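/- **Setting.** All functions are complex valued unless said otherwise; $g$ is a formal variable, $\mathcal S$ denotes Schwartz space, and $\mathcal O_M(\mathbb R^n)$ the space of smooth functions on $\mathbb R^n$ all of whose derivatives are polynomially bounded. Let $\omega_0:\mathbb R^3\to\mathbb R$ be even, with $\omega_0\ge M>0$ for some constant $M$, and with $\omega_0,\,1/\omega_0\in\mathcal O_M(\mathbb R^3)$. Let $F_{(l',l)}(p'_1,\dots,p'_{l'};p_1,\dots,p_l)$, $l,l'\ge 0$, be functions of momenta in $\mathbb R^3$, only finitely many of them non-zero, smooth with polynomially bounded derivatives, symmetric in the $p'$ and in the $p$, with $F_{(l',l)}(p';p)=\overline{F_{(l,l')}(p;p')}$, and such that $F_{(l',l)}(p';p)\,s\big(\sum_j p'_j-\sum_j p_j\big)$ is a Schwartz function of $(p',p)$ for every $s\in\mathcal S(\mathbb R^3)$. Let $a_+(p)$, $a_-(p)$ be the creation and annihilation operators on the bosonic Fock space over $L^2(\mathbb R^3)$, $[a_-(p),a_+(p')]=\delta^3(p-p')$, and let $\Omega_0$ be the vacuum. The free field parts and the interaction density are the operator-valued distributions $$\phi_{0\pm}(k|t)=\frac{a_\pm(\pm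 k)\,e^{\pm i\omega_0(k)t}}{\sqrt{(2\pi)^3\,2\omega_0(k)}},$$ $$h_I(x|t)=\sum_{l',l}\int \frac{F_{(l',l)}(p';p)}{l'!\,l!}\;e^{\,i(\sum_j\omega_0(p'_j)-\sum_j\omega_0(p_j))t\,-\,i(\sum_j p'_j-\sum_j p_j)\cdot x}\;\prod_j a_+(p'_j)\prod_j a_-(p_j)\;d^{3l'}p'\,d^{3l}p .$$ For a cut-off $\tilde\lambda\in\mathcal S(\mathbb R^4)$ (time and momentum) put $\lambda(t,x)=\int\tilde\lambda(t,k)e^{ik\cdot x}\,d^3k$ and $H_I(t)=g\int\lambda(t,x)\,h_I(x|t)\,d^3x$. Let $U(b,a)$, $a,b\in[-\infty,+\infty]$, be the formal power series solution of $U(b,a)=1-i\int_a^bH_I(s)\,U(s,a)\,ds$. Put $S=U(+\infty,-\infty)$ and $\phi_\pm(\cdot|t)=U(-\infty,t)\,\phi_{0\pm}(\cdot|t)\,U(t,-\infty)$. For $n\ge0$, $\alpha_1,\dots,\alpha_n\in\{+,-\}$, $f\in\mathcal S(\mathbb R^{3n})$ and $t=(t_1,\dots,t_n)\in\mathbb R^n$,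 the unnormalized and the normalized restricted Wightman function with cut-off are the formal power series in $g$ $$PW(t)[f]=\big(\Omega_0,\,S\,\phi_{\alpha_1}(\cdot|t_1)\cdots\phi_{\alpha_n}(\cdot|t_n)\,\Omega_0\big)[f],\qquad W(t)[f]=\frac{PW(t)[f]}{(\Omega_0,S\Omega_0)} ,$$ where $f$ is a function of the momentum arguments of the $n$ field parts. **Coefficients.** Put $t_0=+\infty$, $t_{n+1}=-\infty$. For $v=(v_0,\dots,v_n)\in\mathbb N_0^{n+1}$ and $\Phi\in\mathcal S(\mathbb R^{3n+4\sum v_i})$, a function of $k_1,\dots,k_n\in\mathbb R^3$ and of pairs $(\tau_{i,j},q_{i,j})\in\mathbb R\times\mathbb R^3$ ($0\le i\le n$, $1\le j\le v_i$), let $PW_v(t)[\Phi]$ be $$\int d\tau\; C_t(\tau)\,\Big(\Omega_0,\Big[\prod_{j=1}^{v_0}\hat h(\tau_{0,j})\Big]\,\phi_{0\alpha_1}(\cdot|t_1)\Big[\prod_{j=1}^{v_1}\hat h(\tau_{1,j})\Big]\cdots\phi_{0\alpha_n}(\cdot|t_n)\Big[\prod_{j=1}^{v_n}\hat h(\tau_{n,j})\Big]\Omega_0\Big)[\Phi(\tau,\cdot)],$$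 with products in increasing order of $j$ from left to right, $\hat h(q|\tau)=-i\int h_I(x|\tau)e^{iq\cdot x}d^3x$, and with $C_t(\tau)=\prod_iC^{(i)}$, where $C^{(i)}$ is the kernel of the iterated oriented integral $\int_{t_{i+1}}^{t_i}d\tau_{i,1}\int_{t_{i+1}}^{\tau_{i,1}}d\tau_{i,2}\cdots\int_{t_{i+1}}^{\tau_{i,v_i-1}}d\tau_{i,v_i}$. So $C^{(i)}$ is the indicator of $t_i>\tau_{i,1}>\dots>\tau_{i,v_i}>t_{i+1}$ if $t_{i+1}<t_i$, it is $(-1)^{v_i}$ times the indicator of $t_i<\tau_{i,1}<\dots<\tau_{i,v_i}<t_{i+1}$ if $t_i<t_{i+1}$, and for $t_i=t_{i+1}$ it is $1$ if $v_i=0$ and $0$ otherwise. **Feynman rules.** A (totally ordered) graph has $n$ external vertices $1,\dots,n$ and $\sum_iv_i$ internal vertices $(i,j)$, enumerated and ordered as in the word $$(0,1),\dots,(0,v_0),\;1,\;(1,1),\dots,(1,v_1),\;2,\;\dots,\;n,\;(n,1),\dots,(n,v_n),$$ where vertices further to the right are earlier. Any number of lines may join two vertices; each line is directed from the earlier to the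 later of its two (distinct) end points; each external vertex belongs to exactly one line. Graphs are taken up to isomorphisms that fix the vertices, so that the automorphism group $\mathrm{Aut}(\Gamma)$ consists of the permutations of parallel lines. A momentum $p_e\in\mathbb R^3$ is assigned to each line $e$. The factors are: * an internal vertex $(i,j)$ with outgoing momenta $p'_1,\dots,p'_{l'}$ and incoming momenta $p_1,\dots,p_l$: $\;-i(2\pi)^3F_{(l',l)}(p';p)\,e^{i(\sum\omega_0(p'_a)-\sum\omega_0(p_b))\tau_{i,j}}\,\delta^3\big(\sum p'_a-\sum p_b-q_{i,j}\big)$; * an external vertex $i$ whose line has momentum $p$: $\;\delta^3(k_i-p)\,e^{i\omega_0(p)t_i}/\sqrt{(2\pi)^3\,2\omega_0(p)}$ if $\alpha_i=+$ and the line starts at $i$; $\;\delta^3(k_i+p)\,e^{-i\omega_0(p)t_i}/\sqrt{(2\pi)^3\,2\omega_0(p)}$ if $\alpha_i=-$ and the line ends at $i$; $\;0$ otherwise; * a line: $1$; the whole graph: the time factor $C_t(\tau)$ and the symmetry factor $1/|\mathrm{Aut}(\Gamma)|$. The contribution $\Gamma(t)[\Phi]$ of a graph is the product of its factors and of $\Phi$,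 integrated over all $k_i$, $(\tau_{i,j},q_{i,j})$ and $p_e$ (the delta functions remove the integrals over $k$ and $q$). A vacuum component of a graph is a connected component without external vertices. Let $W_v(t)[\Phi]$ be the sum of the contributions of the graphs without vacuum components, and let $N_v(t)[\Psi]$, $\Psi\in\mathcal S(\mathbb R^{4\sum v_i})$, be the sum of the contributions of all graphs that have the same internal vertices and no external vertices, with the same time factor $C_t(\tau)$. **Statement.** For all $n\ge 0$ and all $\alpha_1,\dots,\alpha_n$: 1. For every $v$, only finitely many graphs give a non-zero contribution, the integrals over times and line momenta that remain after the delta functions are resolved converge absolutely, and $$PW_v(t)[\Phi]=\sum_\Gamma\Gamma(t)[\Phi]\qquad(\Phi\in\mathcal S(\mathbb R^{3n+4\sum v_i}),\ t\in\mathbb R^n).$$ For fixed $t$ this is a tempered distribution in $\Phi$, and for fixed $\Phi$ a function of $t$ in $\mathcal O_M(\mathbb R^n)$. 2. For all $\tilde\lambda\in\mathcal S(\mathbb R^4)$, $f\in\mathcal S(\mathbb R^{3n})$ and $t\in\mathbb R^n$, $$PW(t)[f]=\sum_{V\ge0}g^V\sum_{v_0+\dots+v_n=V}PW_v(t)\big[f\otimes\tilde\lambda^{\otimes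 V}\big].$$ 3. For every $v$, only finitely many graphs contribute to $N_v$ and their integrals converge absolutely; $N_v$ and $W_v$ are tempered distributions for fixed $t$, and depend on $t$ as functions in $\mathcal O_M(\mathbb R^n)$ for a fixed test function. For all $\tilde\lambda\in\mathcal S(\mathbb R^4)$ and $t\in\mathbb R^n$, $$(\Omega_0,S\Omega_0)=\sum_{V\ge0}g^V\sum_{v_0+\dots+v_n=V}N_v(t)\big[\tilde\lambda^{\otimes V}\big],$$ and this series has constant term $1$. 4. For all $\tilde\lambda$, $f$ and $t$ as above, $$\Big(\sum_{v'}g^{\sum v'_i}\,W_{v'}(t)\big[f\otimes\tilde\lambda^{\otimes\sum v'_i}\big]\Big)\Big(\sum_{v''}g^{\sum v''_i}\,N_{v''}(t)\big[\tilde\lambda^{\otimes\sum v''_i}\big]\Big)=\sum_{v}g^{\sum v_i}\,PW_v(t)\big[f\otimes\tilde\lambda^{\otimes\sum v_i}\big]$$ as formal power series in $g$, and therefore $$W(t)[f]=\sum_{V\ge0}g^V\sum_{v_0+\dots+v_n=V}W_v(t)\big[f\otimes\tilde\lambda^{\otimes V}\big].$$ That is, division by $(\Omega_0,S\Omega_0)$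 amounts to dropping all graphs with vacuum components. -/

import Mathlib

open scoped SchwartzMap Nat
open MeasureTheory

noncomputable section

namespace HpQFT

/-! ### Basic data: dispersion function and admissible interaction -/

/-- Momentum space. -/
abbrev Mom : Type := EuclideanSpace ℝ (Fin 3)

/-- A massive (even) dispersion function: it and its inverse are multipliers of Schwartz space. -/
structure DispersionFunction where
  toFun : Mom → ℝ
  temperate : Function.HasTemperateGrowth toFun
  temperate_inv : Function.HasTemperateGrowth (fun k => (toFun k)⁻¹)
  massive : ∃ M : ℝ, 0 < M ∧ ∀ k, M ≤ toFun k
  even : ∀ k, toFun (-k) = toFun k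

/-- The kernels `F_{(l',l)}(p'_1,…,p'_{l'}; p_1,…,p_l)` of an admissible interaction density
(`p'` : created momenta, `p` : annihilated momenta). Only finitely many kernels are non-zero. -/
structure AdmissibleInteraction where
  kernel : (l' l : ℕ) → (Fin l' → Mom) → (Fin l → Mom) → ℂ
  bound : ℕ
  finite : ∀ l' l, bound < l' + l → kernel l' l = 0
  temperate : ∀ l' l, Function.HasTemperateGrowth
    (fun x : (Fin l' → Mom) × (Fin l → Mom) => kernel l' l x.1 x.2)
  decay : ∀ (l' l : ℕ) (s : 𝓢(Mom, ℂ)), ∃ G : 𝓢((Fin l' → Mom) × (Fin l → Mom), ℂ),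
    ∀ p' p, G (p', p) = kernel l' l p' p * s (∑ j, p' j - ∑ j, p j)
  symm : ∀ (l' l : ℕ) (σ' : Equiv.Perm (Fin l')) (σ : Equiv.Perm (Fin l)) p' p,
    kernel l' l (p' ∘ σ') (p ∘ σ) = kernel l' l p' p
  hermitian : ∀ l' l p' p, kernel l' l p' p = (starRingEnd ℂ) (kernel l l' p p')

/-- The two parts of the field: `plus` contains the creation operator, `minus` the annihilation
operator. -/
inductive FieldPart where
  | plus : FieldPart
  | minus : FieldPart

/-! ### Fock vectors with distributional slots, and second quantization -/

/-- `l`-particle amplitudes which depend in addition on momentum arguments (`slots`) indexed by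
`X`; the slots carry the arguments of the test function that are still to be consumed. -/
abbrev Amp (X : Type) (l : ℕ) : Type := (Fin l → Mom) → (X → Mom) → ℂ

/-- Fock vectors (families of `l`-particle amplitudes) with slots indexed by `X`. -/
abbrev Fock (X : Type) : Type := (l : ℕ) → Amp X l

/-- The vector `Ω₀ ⊗ f` for a function `f` of the slots. -/
def vac {X : Type} (f : (X → Mom) → ℂ) : Fock X
  | 0 => fun _ κ => f κ
  | _ + 1 => fun _ _ => 0

/-- The pairing `(Ω₀, Ψ)`, for a vector all of whose slots have been consumed. -/
def vacPairing {X : Type} (Ψ : Fock X) : ℂ := Ψ 0 Fin.elim0 0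

/-- Second quantization of `A`, which takes `l`-particle to `l'`-particle amplitudes: on the
`N`-particle component, `N = l + r`, it is `√(N! (r + l')!) / r! • Sym ∘ (A ⊗ 1)`. -/
def secondQuant {X : Type} {l l' : ℕ} (A : Amp X l → Amp X l') (Ψ : Fock X) : Fock X :=
  fun m p κ =>
    if h : l' ≤ m then
      ((Real.sqrt (((l + (m - l'))! : ℝ) * (m ! : ℝ)) / ((m - l')! : ℝ) : ℝ) : ℂ) *
        ((m ! : ℂ)⁻¹ * ∑ σ : Equiv.Perm (Fin m),
          A (fun y κ' => Ψ (l + (m - l'))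
              (Fin.append y (fun j : Fin (m - l') => p (σ ⟨l' + j, by omega⟩))) κ')
            (fun j => p (σ (Fin.castLE h j))) κ)
    else 0

/-! ### Free field -/

/-- `e^{± i ω(p) t} / √((2π)³ 2 ω(p))`. -/
def fieldAmplitude (ω : DispersionFunction) (a : FieldPart) (t : ℝ) (p : Mom) : ℂ :=
  (match a with
    | .plus => Complex.exp (Complex.I * (ω.toFun p * t : ℝ))
    | .minus => Complex.exp (-(Complex.I * (ω.toFun p * t : ℝ)))) /
  (Real.sqrt ((2 * Real.pi) ^ 3 * (2 * ω.toFun p)) : ℝ)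

/-- The free field part `φ_{0±}(k | t) = a_±(±k) e^{± i ω(k) t} / √((2π)³ 2 ω(k))`, smeared in `k`
against the slot `x`. -/
def freeField {X : Type} [DecidableEq X] (ω : DispersionFunction) (a : FieldPart) (t : ℝ) (x : X) :
    Fock X → Fock X :=
  match a with
  | .plus => secondQuant (l := 0) (l' := 1) fun f p κ =>
      fieldAmplitude ω .plus t (p 0) * f Fin.elim0 (Function.update κ x (p 0))
  | .minus => secondQuant (l := 1) (l' := 0) fun f _ κ =>
      ∫ y : Mom, fieldAmplitude ω .minus t y * f (fun _ => y) (Function.update κ x (-y))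

/-! ### Interaction density and Hamiltonian -/

/-- `∫ e^{i η x·k} f(x) dx` with `η = ±1`. -/
def momFourier (η : ℝ) (f : Mom → ℂ) (k : Mom) : ℂ :=
  ∫ x : Mom, Complex.exp (Complex.I * (η * inner ℝ k x : ℝ)) * f x

/-- The energy difference `∑ ω(p'_j) - ∑ ω(p_j)`. -/
def energyDefect (ω : DispersionFunction) {ι' ι : Type} [Fintype ι'] [Fintype ι]
    (p' : ι' → Mom) (p : ι → Mom) : ℝ :=
  ∑ j, ω.toFun (p' j) - ∑ j, ω.toFun (p j)

/-- The `(l', l)` component of the interaction density at time `t`; the slot `x` is the argument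
of the test function on position space. The integral kernel is `F_{(l',l)} / (l'! l!)`. -/
def densityKernelOp {X : Type} [DecidableEq X] (ω : DispersionFunction) (hI : AdmissibleInteraction)
    (t : ℝ) (x : X) (l' l : ℕ) (f : Amp X l) : Amp X l' := fun p' κ =>
  ∫ p : Fin l → Mom,
    (hI.kernel l' l p' p / ((l' ! : ℂ) * (l ! : ℂ))) *
      momFourier (-1) (fun y => f p (Function.update κ x y)) (∑ j, p' j - ∑ j, p j) *
      Complex.exp (Complex.I * (energyDefect ω p' p * t : ℝ))

/-- The (second quantized) interaction density `h_I(x | t)`, smeared in position space. -/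
def density {X : Type} [DecidableEq X] (ω : DispersionFunction) (hI : AdmissibleInteraction)
    (t : ℝ) (x : X) (Ψ : Fock X) : Fock X :=
  ∑ l' ∈ Finset.range (hI.bound + 1), ∑ l ∈ Finset.range (hI.bound + 1),
    secondQuant (densityKernelOp ω hI t x l' l) Ψ

/-- The momentum space density `h_I ∘ 𝓕₊`, smeared in momentum space against the slot `x`. -/
def momDensity {X : Type} [DecidableEq X] (ω : DispersionFunction) (hI : AdmissibleInteraction)
    (t : ℝ) (x : X) (Ψ : Fock X) : Fock X :=
  density ω hI t x fun l p κ => momFourier 1 (fun k => Ψ l p (Function.update κ x k)) (κ x)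

/-- The interaction Hamiltonian (without the factor `g`) with cut-off `lam (t, k)`:
`h_I ∘ 𝓕₊` applied to `Ψ ⊗ lam`, the two time arguments being put equal to `t`. -/
def hamiltonian {X : Type} [DecidableEq X] (ω : DispersionFunction) (hI : AdmissibleInteraction)
    (lam : 𝓢(ℝ × Mom, ℂ)) (t : ℝ) (Ψ : Fock X) : Fock X := fun l p κ =>
  momDensity (X := Option X) ω hI t none
    (fun l' q κ' => Ψ l' q (fun x => κ' (some x)) * lam (t, κ' none)) l p
    (fun o => o.elim 0 κ)

/-! ### Time integrals -/

/-- The kernel `J(τ | a, b)` of the oriented integral `∫_a^b`; the end points may be infinite. -/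
def stepKernel (τ : ℝ) (a b : EReal) : ℝ :=
  if a < τ ∧ (τ : EReal) < b then 1 else if b < τ ∧ (τ : EReal) < a then -1 else 0

/-- The ordering indicator: `1` if `i ≺ j` implies `η (τ_i - τ_j) < 0` for all `i`, `j`, and `0`
otherwise. -/
def orderIndicator {ι : Type} (r : ι → ι → Prop) (η : ℝ) (τ : ι → ℝ) : ℝ :=
  open Classical in if ∀ i j, r i j → η * (τ i - τ j) < 0 then 1 else 0

/-- The sign of `b - a`. -/
def orientation (a b : EReal) : ℝ := if a < b then 1 else if b < a then -1 else 0

/-- The kernel of the iterated integral `∫_a^b dτ_1 ∫_a^{τ_1} dτ_2 ⋯ ∫_a^{τ_{v-1}} dτ_v`. -/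
def simplexKernel {v : ℕ} (a b : EReal) (τ : Fin v → ℝ) : ℝ :=
  (∏ j, stepKernel (τ j) a b) * orderIndicator (fun i j : Fin v => i < j) (-orientation a b) τ

/-- The times `t_0 = +∞, t_1, …, t_n, t_{n+1} = -∞`. -/
def boundaryTime {n : ℕ} (t : Fin n → ℝ) : Fin (n + 2) → EReal :=
  Fin.cons (α := fun _ => EReal) ⊤ (Fin.snoc (α := fun _ => EReal) (fun i => (t i : EReal)) ⊥)

/-! ### Evolution operators, interacting field and correlators as formal power series in `g` -/

/-- The coefficient of `g^m` in the evolution operator `U(b, a)`, from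
`U(b, a) = 1 - i g ∫_a^b H(s) U(s, a) ds`; infinite end points are allowed. -/
def evolution {X : Type} [DecidableEq X] (ω : DispersionFunction) (hI : AdmissibleInteraction)
    (lam : 𝓢(ℝ × Mom, ℂ)) : ℕ → EReal → EReal → Fock X → Fock X
  | 0, _, _, Ψ => Ψ
  | m + 1, b, a, Ψ => fun l p κ =>
      -Complex.I * ∫ s : ℝ, (stepKernel s a b : ℂ) *
        hamiltonian ω hI lam s (evolution ω hI lam m s a Ψ) l p κ

/-- Formal power series in `g` of operators on Fock vectors. -/
abbrev OpSeries (X : Type) : Type := ℕ → Fock X → Fock X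

/-- Product of formal power series of operators. -/
def OpSeries.comp {X : Type} (A B : OpSeries X) : OpSeries X := fun V Ψ =>
  ∑ ab ∈ Finset.HasAntidiagonal.antidiagonal V, A ab.1 (B ab.2 Ψ)

/-- The series concentrated in order zero. -/
def OpSeries.const {X : Type} (A : Fock X → Fock X) : OpSeries X := fun V Ψ =>
  if V = 0 then A Ψ else 0

/-- The scattering operator `S = U(+∞, -∞)`. -/
def scattering {X : Type} [DecidableEq X] (ω : DispersionFunction) (hI : AdmissibleInteraction)
    (lam : 𝓢(ℝ × Mom, ℂ)) : OpSeries X :=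
  fun V => evolution ω hI lam V ⊤ ⊥

/-- The interacting field part `U_R(t)⁻¹ φ_{0,a}(t) U_R(t)`, where `U_R(t) = U(t, -∞)` and
`U_R(t)⁻¹ = U(-∞, t)` (which is also `U_R(t)†` if the cut-off is real in position space). -/
def interactingField {X : Type} [DecidableEq X] (ω : DispersionFunction)
    (hI : AdmissibleInteraction) (lam : 𝓢(ℝ × Mom, ℂ)) (a : FieldPart) (t : ℝ) (x : X) :
    OpSeries X :=
  OpSeries.comp (fun V => evolution ω hI lam V ⊥ t)
    (OpSeries.comp (OpSeries.const (freeField ω a t x)) (fun V => evolution ω hI lam V t ⊥))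

/-- The vacuum expectation value `(Ω₀, S Ω₀)` of the scattering operator. -/
def scatteringVac (ω : DispersionFunction) (hI : AdmissibleInteraction)
    (lam : 𝓢(ℝ × Mom, ℂ)) : PowerSeries ℂ :=
  PowerSeries.mk fun V => vacPairing (X := Empty) (scattering ω hI lam V (vac fun _ => 1))

/-- The unnormalized restricted Wightman function
`(Ω₀, S φ_{α_1}(·|t_1) ⋯ φ_{α_n}(·|t_n) Ω₀)[f]` with cut-off. -/
def wightmanUnnorm (ω : DispersionFunction) (hI : AdmissibleInteraction)
    (lam : 𝓢(ℝ × Mom, ℂ)) {n : ℕ} (α : Fin n → FieldPart) (f : (Fin n → Mom) → ℂ)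
    (t : Fin n → ℝ) : PowerSeries ℂ :=
  PowerSeries.mk fun V => vacPairing
    (OpSeries.comp (scattering ω hI lam)
      ((List.ofFn fun i : Fin n => interactingField ω hI lam (α i) (t i) i).foldr
        OpSeries.comp (OpSeries.const id)) V (vac f))

/-- The normalized restricted Wightman function with cut-off. -/
def wightman (ω : DispersionFunction) (hI : AdmissibleInteraction)
    (lam : 𝓢(ℝ × Mom, ℂ)) {n : ℕ} (α : Fin n → FieldPart) (f : (Fin n → Mom) → ℂ)
    (t : Fin n → ℝ) : PowerSeries ℂ :=
  wightmanUnnorm ω hI lam α f t * (scatteringVac ω hI lam)⁻¹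

/-! ### Coefficient distributions -/

/-- Internal vertices `(i, j)`, `0 ≤ i ≤ n`, `1 ≤ j ≤ v_i` (here `j` is counted from `0`). -/
abbrev Inner {n : ℕ} (v : Fin (n + 1) → ℕ) : Type := (i : Fin (n + 1)) × Fin (v i)

/-- Vertices: `m` external ones and the internal ones. -/
abbrev Vertex (m : ℕ) {n : ℕ} (v : Fin (n + 1) → ℕ) : Type := Fin m ⊕ Inner v

/-- The arguments `(k_1, …, k_m, (τ_{i,j}, q_{i,j}))` of the test functions. -/
abbrev Args (m : ℕ) {n : ℕ} (v : Fin (n + 1) → ℕ) : Type :=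
  (Fin m → Mom) × (Inner v → ℝ × Mom)

/-- The product of the kernels of the time-simplex integrals: the times `τ_{i,1}, …, τ_{i,v_i}`
run over the (oriented) simplex between `t_{i+1}` and `t_i`. -/
def timeFactor {n : ℕ} {v : Fin (n + 1) → ℕ} (t : Fin n → ℝ) (τ : Inner v → ℝ) : ℝ :=
  ∏ i : Fin (n + 1),
    simplexKernel (boundaryTime t i.succ) (boundaryTime t i.castSucc) (fun j => τ ⟨i, j⟩)

/-- The order of the operators in the vacuum expectation value, from left to right:
`(0,1), …, (0,v_0), 1, (1,1), …, (1,v_1), 2, …, n, (n,1), …, (n,v_n)`. -/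
def operatorWord {n : ℕ} (v : Fin (n + 1) → ℕ) : List (Vertex n v) :=
  (List.ofFn fun j : Fin (v 0) => (Sum.inr ⟨0, j⟩ : Vertex n v)) ++
    (List.ofFn fun i : Fin n => (Sum.inl i : Vertex n v) ::
      List.ofFn fun j : Fin (v i.succ) => (Sum.inr ⟨i.succ, j⟩ : Vertex n v)).flatten

/-- The operator at a vertex: a free field at an external vertex, `-i` times the interaction
density in momentum space at an internal one; each one is smeared against its own slot. -/
def vertexOp (ω : DispersionFunction) (hI : AdmissibleInteraction) {n : ℕ}
    {v : Fin (n + 1) → ℕ} (α : Fin n → FieldPart) (t : Fin n → ℝ) (τ : Inner v → ℝ) :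
    Vertex n v → Fock (Vertex n v) → Fock (Vertex n v)
  | .inl i => freeField ω (α i) (t i) (Sum.inl i)
  | .inr x => fun Ψ => -Complex.I • momDensity ω hI (τ x) (Sum.inr x) Ψ

/-- The coefficient distribution for the numbers `v_0, …, v_n` of interaction insertions,
evaluated on the test function `Φ` at the times `t`. -/
def coefficient (ω : DispersionFunction) (hI : AdmissibleInteraction) {n : ℕ}
    (α : Fin n → FieldPart) (v : Fin (n + 1) → ℕ) (Φ : Args n v → ℂ) (t : Fin n → ℝ) : ℂ :=
  ∫ τ : Inner v → ℝ, (timeFactor t τ : ℂ) *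
    vacPairing ((operatorWord v).foldr (vertexOp ω hI α t τ)
      (vac fun κ => Φ (fun i => κ (Sum.inl i), fun x => (τ x, κ (Sum.inr x)))))

/-! ### Feynman graphs and Feynman rules -/

/-- The position of a vertex, counted from left to right in the operator product. -/
def Vertex.key {m n : ℕ} {v : Fin (n + 1) → ℕ} : Vertex m v → ℕ ×ₗ ℕ
  | .inl i => toLex ((i : ℕ) + 1, 0)
  | .inr x => toLex ((x.1 : ℕ), (x.2 : ℕ) + 1)

/-- The total order of the vertices: earlier vertices stand to the right. -/
def Vertex.Precedes {m n : ℕ} {v : Fin (n + 1) → ℕ} (a b : Vertex m v) : Prop :=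
  Vertex.key b < Vertex.key a

/-- Totally ordered Feynman graphs with enumerated vertices (up to isomorphism): `mult a b` is
the number of lines from the earlier vertex `a` to the later vertex `b`. Each external vertex
belongs to exactly one line. -/
@[ext]
structure FeynmanGraph (m : ℕ) {n : ℕ} (v : Fin (n + 1) → ℕ) where
  mult : Vertex m v → Vertex m v → ℕ
  ordered : ∀ a b, mult a b ≠ 0 → Vertex.Precedes a b
  external : ∀ i : Fin m, ∑ b, (mult (Sum.inl i) b + mult b (Sum.inl i)) = 1

namespace FeynmanGraph

variable {m n : ℕ} {v : Fin (n + 1) → ℕ}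

/-- The lines of the graph. -/
abbrev Line (Γ : FeynmanGraph m v) : Type :=
  (ab : Vertex m v × Vertex m v) × Fin (Γ.mult ab.1 ab.2)

/-- Lines leaving a vertex (towards later vertices). -/
abbrev Out (Γ : FeynmanGraph m v) (a : Vertex m v) : Type := {e : Γ.Line // e.1.1 = a}

/-- Lines entering a vertex (from earlier vertices). -/
abbrev In (Γ : FeynmanGraph m v) (a : Vertex m v) : Type := {e : Γ.Line // e.1.2 = a}

/-- Automorphisms: they fix the (enumerated) vertices and permute parallel lines. -/
abbrev Aut (Γ : FeynmanGraph m v) : Type := {σ : Equiv.Perm Γ.Line // ∀ e, (σ e).1 = e.1}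

/-- Two vertices are adjacent if some line joins them. -/
def graph (Γ : FeynmanGraph m v) : SimpleGraph (Vertex m v) :=
  SimpleGraph.fromRel fun a b => Γ.mult a b ≠ 0

/-- A connected component is a vacuum component if it contains no external vertex. -/
def IsVacuumComponent (Γ : FeynmanGraph m v) (c : Γ.graph.ConnectedComponent) : Prop :=
  ∀ i : Fin m, Γ.graph.connectedComponentMk (Sum.inl i) ≠ c

/-- The graph has no vacuum components. -/
def NoVacuum (Γ : FeynmanGraph m v) : Prop := ∀ c, ¬ Γ.IsVacuumComponent c

/-- Outgoing minus incoming momentum at a vertex. -/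
def momDefect (Γ : FeynmanGraph m v) (p : Γ.Line → Mom) (a : Vertex m v) : Mom :=
  ∑ e : Γ.Out a, p e - ∑ e : Γ.In a, p e

/-- The factor of an internal vertex at time `τ`, without the momentum delta function:
`-i (2π)³ F_{(l',l)}(p', p) exp(i (∑ ω(p'_j) - ∑ ω(p_j)) τ)`, where `p'` are the outgoing and `p`
the incoming momenta. As the kernels are symmetric, their enumeration plays no role. -/
def vertexFactor (Γ : FeynmanGraph m v) (ω : DispersionFunction) (hI : AdmissibleInteraction)
    (p : Γ.Line → Mom) (x : Inner v) (τ : ℝ) : ℂ :=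
  -Complex.I * (2 * Real.pi : ℂ) ^ 3 *
    hI.kernel (Fintype.card (Γ.Out (Sum.inr x))) (Fintype.card (Γ.In (Sum.inr x)))
      (fun j => p ((Fintype.equivFin (Γ.Out (Sum.inr x))).symm j))
      (fun j => p ((Fintype.equivFin (Γ.In (Sum.inr x))).symm j)) *
    Complex.exp (Complex.I * (energyDefect ω (fun e : Γ.Out (Sum.inr x) => p e)
      (fun e : Γ.In (Sum.inr x) => p e) * τ : ℝ))

/-- The factor of an external vertex, without the momentum delta function: a line that starts
(ends) there requires the sign `+` (`-`). -/
def externalFactor (Γ : FeynmanGraph m v) (ω : DispersionFunction) (α : Fin m → FieldPart)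
    (s : Fin m → ℝ) (p : Γ.Line → Mom) (i : Fin m) : ℂ :=
  match α i with
  | .plus => (∏ e : Γ.Out (Sum.inl i), fieldAmplitude ω .plus (s i) (p e)) *
      ∏ _e : Γ.In (Sum.inl i), (0 : ℂ)
  | .minus => (∏ _e : Γ.Out (Sum.inl i), (0 : ℂ)) *
      ∏ e : Γ.In (Sum.inl i), fieldAmplitude ω .minus (s i) (p e)

/-- The integrand in the times of the internal vertices and the momenta of the lines. The delta
functions identify `k_i` with `p` (line starting at the external vertex `i`) or `-p` (line ending
there), and `q_{i,j}` with the momentum defect of the internal vertex. Here `s` are the times of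
the external vertices and `t` those that bound the time simplices. -/
def integrand (Γ : FeynmanGraph m v) (ω : DispersionFunction) (hI : AdmissibleInteraction)
    (α : Fin m → FieldPart) (s : Fin m → ℝ) (t : Fin n → ℝ) (Φ : Args m v → ℂ)
    (x : (Inner v → ℝ) × (Γ.Line → Mom)) : ℂ :=
  (timeFactor t x.1 : ℂ) * (∏ y : Inner v, Γ.vertexFactor ω hI x.2 y (x.1 y)) *
    (∏ i : Fin m, Γ.externalFactor ω α s x.2 i) *
    Φ (fun i => Γ.momDefect x.2 (Sum.inl i), fun y => (x.1 y, Γ.momDefect x.2 (Sum.inr y)))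

/-- The contribution of a graph, with its symmetry factor. -/
def contribution (Γ : FeynmanGraph m v) (ω : DispersionFunction) (hI : AdmissibleInteraction)
    (α : Fin m → FieldPart) (s : Fin m → ℝ) (t : Fin n → ℝ) (Φ : Args m v → ℂ) : ℂ :=
  (Nat.card Γ.Aut : ℂ)⁻¹ * ∫ x, Γ.integrand ω hI α s t Φ x

end FeynmanGraph

/-- The sum over all totally ordered graphs. -/
def feynmanSum (ω : DispersionFunction) (hI : AdmissibleInteraction) {n : ℕ}
    (α : Fin n → FieldPart) (v : Fin (n + 1) → ℕ) (Φ : Args n v → ℂ) (t : Fin n → ℝ) : ℂ :=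
  ∑ᶠ Γ : FeynmanGraph n v, Γ.contribution ω hI α t t Φ

/-- The sum over all totally ordered graphs without vacuum components. -/
def feynmanSumNoVacuum (ω : DispersionFunction) (hI : AdmissibleInteraction) {n : ℕ}
    (α : Fin n → FieldPart) (v : Fin (n + 1) → ℕ) (Φ : Args n v → ℂ) (t : Fin n → ℝ) : ℂ :=
  ∑ᶠ Γ : {Γ : FeynmanGraph n v // Γ.NoVacuum}, Γ.1.contribution ω hI α t t Φ

/-- The sum over all totally ordered graphs without external vertices, with the same time simplices
(bounded by `t_1, …, t_n`). -/
def feynmanSumVacuum (ω : DispersionFunction) (hI : AdmissibleInteraction) {n : ℕ}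
    (v : Fin (n + 1) → ℕ) (Φ : Args 0 v → ℂ) (t : Fin n → ℝ) : ℂ :=
  ∑ᶠ Γ : FeynmanGraph 0 v, Γ.contribution ω hI Fin.elim0 Fin.elim0 t Φ

/-- The test function `f ⊗ lam ⊗ ⋯ ⊗ lam`. -/
def tensorTest {m n : ℕ} (v : Fin (n + 1) → ℕ) (f : (Fin m → Mom) → ℂ) (lam : 𝓢(ℝ × Mom, ℂ)) :
    Args m v → ℂ := fun x => f x.1 * ∏ y, lam (x.2 y)

/-- The formal power series whose coefficient of order `g^V` is the sum of `c v` over all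
`v = (v_0, …, v_n)` with `v_0 + ⋯ + v_n = V`. -/
def blockSeries (n : ℕ) (c : (Fin (n + 1) → ℕ) → ℂ) : PowerSeries ℂ :=
  PowerSeries.mk fun V => ∑ v ∈ Finset.Nat.antidiagonalTuple (n + 1) V, c v

/-- `W` is a tempered distribution which depends on the parameters `t ∈ ℝⁿ` smoothly and with
polynomially bounded derivatives (a parameter-dependent distribution of multiplier class). -/
def IsParamDistribution {D : Type} [NormedAddCommGroup D] [NormedSpace ℝ D] {n : ℕ}
    (W : (D → ℂ) → (Fin n → ℝ) → ℂ) : Prop :=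
  (∀ t, ∃ T : 𝓢(D, ℂ) →L[ℂ] ℂ, ∀ Φ : 𝓢(D, ℂ), T Φ = W Φ t) ∧
    ∀ Φ : 𝓢(D, ℂ), Function.HasTemperateGrowth (W Φ)

end HpQFT

end

/-!
# Feynman rules for restricted Wightman functions

*Wick's theorem.* All operators involved are integral operators on Fock vectors which depend on
slots: momentum arguments of the test function that are not yet consumed by an operator. An
interaction density or a free field consumes one slot; for the interaction density this turns the
integral over positions into a momentum delta function, by Fourier inversion
(`momDensity_eq_kernelOp`). Applying the operators of a word one after the other to the vacuum gives
a sum over graphs with open lines, because the next operator connects some of the open lines to the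
new vertex and adds new ones (`kernelOp_graphSum`, `foldr_kernelOp`). Only the multiplicities of
lines between pairs of vertices matter, and counting the assignments of lines with given
multiplicities (`sum_functions_by_fibers`) gives the symmetry factors. Pairing with the vacuum
leaves the graphs without open lines.

*Absolute convergence.* Every line starts at some vertex. The kernel of a vertex is a Schwartz
function after multiplication by any Schwartz function of the momentum transfer; testing with
Schwartz functions that decrease as slowly as one likes (`exists_schwartz_lower_bound`) shows that it
decays rapidly in the line momenta, up to powers of the momentum transfer (`exists_polynomial_bound`,
`vertexWeight_decay`). The momentum transfers are arguments of the test function, which absorbs their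
powers.

*Dependence on the external times.* An affine change of variables in every block of internal times
maps the time simplices, including those that reach to `±∞`, to fixed ones (`simplexKernel_affine`,
`timeFactor_affineTimes`). The orientation sign of the simplex removes the absolute value from the
Jacobian, so that the integrand is smooth in the external times, also where these coincide, with
derivatives of at most polynomial growth (`hasTemperateGrowth_integral`).

*Evolution operators.* The coefficients satisfy `U(c,b) U(b,a) = U(c,a)` order by order
(`sum_evolution_evolution`), so that the products of evolution operators between neighbouring fields
combine to a single one (`act_foldr_interacting`), which is an integral of products of Hamiltonians
over a time simplex (`evolution_eq_integral`, `orderedEvolution_eq_integral`). For test functions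
`f ⊗ lam ⊗ ⋯ ⊗ lam` these are the words treated above (`wightmanUnnorm_eq_blockSeries`,
`scatteringVac_eq_blockSeries`). The bounds collected in `Nice` and `GoodOp` justify all
interchanges of integrals.

*Vacuum components.* At fixed times the amplitude of a disjoint union of graphs factorizes for these
test functions (`graphAmplitude_glueMult`), and the product of the time factors is the sum of the
time factors of all shuffles of the internal vertices (`timeFactor_shuffle`). Every graph arises
exactly once from a graph without vacuum components, a graph without external vertices, and a shuffle
(`bijective_glue`). Hence the series of all graphs is the product of the series of the graphs without
vacuum components and of the series of the vacuum graphs (`finsum_contribution_eq_sum_blockPairs`,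
`blockSeries_mul`); the latter is the normalization, which has constant term `1` and can be divided
out.
-/

noncomputable section

namespace HpQFT

set_option linter.unusedSectionVars false

open Filter Topology

section Analysis

open scoped ContDiff

/-! ### Bounds for functions that become bounded after multiplication with Schwartz functions -/

/-- A slowly decreasing Schwartz function: for radii `2 ≤ r j` there is a Schwartz function which
is at least `r j ^ (-j)` on the ball of radius `r j`, for every `j`. -/
lemma exists_schwartz_lower_bound {E : Type*} [NormedAddCommGroup E] [InnerProductSpace ℝ E]
    [FiniteDimensional ℝ E] (r : ℕ → ℝ) (hr : ∀ j, 2 ≤ r j) :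
    ∃ s : 𝓢(E, ℂ), ∀ j x, ‖x‖ ≤ r j → ((r j) ^ j)⁻¹ ≤ ‖s x‖ := by
  have hr0 : ∀ j, 0 < r j := fun j => by linarith [hr j]
  let b : ContDiffBump (0 : E) := ⟨1, 2, one_pos, one_lt_two⟩
  let g : 𝓢(E, ℝ) := b.hasCompactSupport.toSchwartzMap b.contDiff
  have hg1 : ∀ x, ‖x‖ ≤ 1 → g x = 1 := fun x hx => b.one_of_mem_closedBall (by simpa using hx)
  have hg0 : ∀ x, 0 ≤ g x := fun x => b.nonneg
  -- a superposition of bumps of radius `r j` with weights `r j ^ (-j)`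
  let F : ℕ → E → ℝ := fun j y => ((r j) ^ j)⁻¹ * g ((r j)⁻¹ • y)
  have hF0 : ∀ j y, 0 ≤ F j y := fun j y =>
    mul_nonneg (inv_nonneg.2 (pow_nonneg (hr0 j).le _)) (hg0 _)
  have hFs : ∀ j, ContDiff ℝ ∞ (F j) := fun j =>
    contDiff_const.mul ((g.smooth ⊤).comp (contDiff_const.smul contDiff_id))
  have hFd : ∀ (m k : ℕ), ∃ C : ℝ, 0 ≤ C ∧ ∀ (j : ℕ) (y : E),
      ‖y‖ ^ m * ‖iteratedFDeriv ℝ k (F j) y‖ ≤ C * (r j ^ m * ((r j) ^ j)⁻¹) := by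
    intro m k
    obtain ⟨C, hC0, hC⟩ := g.decay m k
    refine ⟨C, hC0.le, fun j y => ?_⟩
    have h1 : iteratedFDeriv ℝ k (F j) y =
        ((r j) ^ j)⁻¹ • ((r j)⁻¹ ^ k • iteratedFDeriv ℝ k g ((r j)⁻¹ • y)) := by
      have : F j = ((r j) ^ j)⁻¹ • fun y => g ((r j)⁻¹ • y) := by
        ext y; simp [F]
      rw [this, iteratedFDeriv_const_smul_apply, iteratedFDeriv_comp_const_smul _ (g.smooth k)]
      exact ((g.smooth k).comp (contDiff_const.smul contDiff_id)).contDiffAt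
    have h2 := hC ((r j)⁻¹ • y)
    rw [norm_smul, mul_pow, norm_inv, Real.norm_of_nonneg (hr0 j).le] at h2
    rw [h1, norm_smul, norm_smul, norm_inv, norm_pow, norm_pow, norm_inv,
      Real.norm_of_nonneg (hr0 j).le]
    have h3 : ((r j)⁻¹) ^ k ≤ 1 := pow_le_one₀ (inv_nonneg.2 (hr0 j).le)
      (inv_le_one_of_one_le₀ (by linarith [hr j]))
    have h4 : ‖y‖ ^ m * ‖iteratedFDeriv ℝ k g ((r j)⁻¹ • y)‖ ≤ C * r j ^ m := by
      have h5 := mul_le_mul_of_nonneg_left h2 (pow_nonneg (hr0 j).le m)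
      rw [inv_pow, ← mul_assoc, ← mul_assoc, mul_inv_cancel₀ (pow_ne_zero _ (hr0 j).ne'),
        one_mul] at h5
      linarith
    calc ‖y‖ ^ m * (((r j) ^ j)⁻¹ * ((r j)⁻¹ ^ k * ‖iteratedFDeriv ℝ k g ((r j)⁻¹ • y)‖))
        = ((r j) ^ j)⁻¹ * ((r j)⁻¹ ^ k * (‖y‖ ^ m * ‖iteratedFDeriv ℝ k g ((r j)⁻¹ • y)‖)) := by
          ring
      _ ≤ ((r j) ^ j)⁻¹ * (1 * (C * r j ^ m)) := by
          have := (hr0 j).le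
          gcongr
      _ = C * (r j ^ m * ((r j) ^ j)⁻¹) := by ring
  -- the terms with `j ≥ m` are dominated by a geometric series, as `2 ≤ r j`
  have hsum : ∀ m : ℕ, Summable fun j : ℕ => r j ^ m * ((r j) ^ j)⁻¹ := by
    intro m
    refine Summable.of_norm_bounded_eventually_nat (g := fun j : ℕ => 2 ^ m * ((1 : ℝ) / 2) ^ j)
      ((summable_geometric_of_lt_one (by norm_num) (by norm_num)).mul_left _) ?_
    filter_upwards [eventually_ge_atTop m] with j hj
    obtain ⟨i, rfl⟩ := Nat.exists_eq_add_of_le hj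
    have e1 : r (m + i) ^ m * ((r (m + i)) ^ (m + i))⁻¹ = ((r (m + i)) ^ i)⁻¹ := by
      have := (hr0 (m + i)).ne'
      rw [pow_add]; field_simp
    have e2 : (2 : ℝ) ^ m * ((1 : ℝ) / 2) ^ (m + i) = (2 ^ i)⁻¹ := by
      rw [pow_add, one_div, inv_pow, inv_pow]; field_simp
    rw [e1, e2, Real.norm_of_nonneg (inv_nonneg.2 (pow_nonneg (hr0 _).le _))]
    gcongr
    exact hr _
  choose C hC0 hC using hFd
  have hv : ∀ k : ℕ, (k : ℕ∞) ≤ ⊤ → Summable fun j : ℕ => C 0 k * (r j ^ 0 * ((r j) ^ j)⁻¹) :=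
    fun k _ => (hsum 0).mul_left _
  have hb : ∀ (k j : ℕ) (y : E), (k : ℕ∞) ≤ ⊤ →
      ‖iteratedFDeriv ℝ k (F j) y‖ ≤ C 0 k * (r j ^ 0 * ((r j) ^ j)⁻¹) := fun k j y _ => by
    simpa using hC 0 k j y
  let s : 𝓢(E, ℝ) :=
    { toFun := fun y => ∑' j, F j y
      smooth' := contDiff_tsum hFs hv hb
      decay' := fun m k => by
        refine ⟨∑' j, C m k * (r j ^ m * ((r j) ^ j)⁻¹), fun y => ?_⟩
        rw [iteratedFDeriv_tsum_apply hFs hv hb le_top]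
        have hs1 : Summable fun j => ‖iteratedFDeriv ℝ k (F j) y‖ :=
          Summable.of_nonneg_of_le (fun _ => norm_nonneg _) (fun j => hb k j y le_top) (hv k le_top)
        calc _ ≤ ‖y‖ ^ m * ∑' j, ‖iteratedFDeriv ℝ k (F j) y‖ := by
              gcongr
              exact norm_tsum_le_tsum_norm hs1
          _ = ∑' j, ‖y‖ ^ m * ‖iteratedFDeriv ℝ k (F j) y‖ := tsum_mul_left.symm
          _ ≤ _ := (hs1.mul_left _).tsum_le_tsum (hC m k · y) ((hsum m).mul_left _) }
  refine ⟨s.postcompCLM (𝕜 := ℝ) Complex.ofRealCLM, fun j x hx => ?_⟩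
  rw [SchwartzMap.postcompCLM_apply, Complex.ofRealCLM_apply, Complex.norm_real]
  refine le_trans ?_ (le_abs_self _)
  have hs1 : Summable fun j => F j x :=
    Summable.of_norm_bounded (hv 0 le_top) (fun j => by simpa using hb 0 j x le_top)
  refine le_trans ?_ (hs1.le_tsum j fun i _ => hF0 i x)
  have : g ((r j)⁻¹ • x) = 1 := hg1 _ (by
    rw [norm_smul, norm_inv, Real.norm_of_nonneg (hr0 j).le, inv_mul_le_iff₀ (hr0 j)]
    simpa using hx)
  simp [F, this]

/-- A function `G` such that `G * (s ∘ Q)` is bounded for every Schwartz function `s` is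
polynomially bounded in `Q`. -/
lemma exists_polynomial_bound {E X : Type*} [NormedAddCommGroup E] [InnerProductSpace ℝ E]
    [FiniteDimensional ℝ E] (G : X → ℝ) (Q : X → E)
    (h : ∀ s : 𝓢(E, ℂ), ∃ C, ∀ x, G x * ‖s (Q x)‖ ≤ C) :
    ∃ (C : ℝ) (M : ℕ), 0 ≤ C ∧ ∀ x, G x ≤ C * (1 + ‖Q x‖) ^ M := by
  -- otherwise there are points `x j` at which `G` exceeds `j 2 ^ j (1 + ‖Q (x j)‖) ^ j`; a Schwartz
  -- function with `r j = 2 (1 + ‖Q (x j)‖)` then contradicts the boundedness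
  by_contra! hcon
  have : ∀ j : ℕ, ∃ x, (j * 2 ^ j : ℝ) * (1 + ‖Q x‖) ^ j < G x := fun j => hcon _ j (by positivity)
  choose x hx using this
  obtain ⟨s, hs⟩ := exists_schwartz_lower_bound (E := E) (fun j => 2 * (1 + ‖Q (x j)‖))
    (fun j => by linarith [norm_nonneg (Q (x j))])
  obtain ⟨C, hC⟩ := h s
  obtain ⟨j, hj⟩ := exists_nat_gt C
  have h1 := hs j (Q (x j)) (by linarith [norm_nonneg (Q (x j))])
  have h2 := hC (x j)
  have hpos : (0 : ℝ) < (2 * (1 + ‖Q (x j)‖)) ^ j := by positivity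
  have h3 : (j : ℝ) * (2 * (1 + ‖Q (x j)‖)) ^ j < G (x j) := by
    rw [mul_pow, ← mul_assoc]; exact hx j
  have h4 : (j : ℝ) ≤ G (x j) * ‖s (Q (x j))‖ := by
    calc (j : ℝ) = (j * (2 * (1 + ‖Q (x j)‖)) ^ j) * ((2 * (1 + ‖Q (x j)‖)) ^ j)⁻¹ := by
          field_simp
      _ ≤ G (x j) * ‖s (Q (x j))‖ := by
          refine mul_le_mul h3.le h1 (by positivity) (le_trans (by positivity) h3.le)
  linarith

/-- The decay of a Schwartz function in terms of `1 + ‖x‖`, with a bound that is uniform in the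
order of the derivative up to `n`, and given by a seminorm. -/
lemma schwartz_decay {E F : Type*} [NormedAddCommGroup E] [NormedSpace ℝ E]
    [NormedAddCommGroup F] [NormedSpace ℝ F] [NormedSpace ℂ F] [SMulCommClass ℝ ℂ F]
    (f : 𝓢(E, F)) (N n k : ℕ) (hk : k ≤ n) (x : E) :
    (1 + ‖x‖) ^ N * ‖iteratedFDeriv ℝ k f x‖ ≤
      2 ^ N * ((Finset.Iic (N, n)).sup (schwartzSeminormFamily ℂ E F)) f :=
  SchwartzMap.one_add_le_sup_seminorm_apply (m := (N, n)) le_rfl hk f x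

/-- The kernels of an admissible interaction decay rapidly, up to powers of the total momentum. -/
lemma AdmissibleInteraction.kernel_bound (hI : AdmissibleInteraction) (l' l N : ℕ) :
    ∃ (C : ℝ) (M : ℕ), 0 ≤ C ∧ ∀ (p' : Fin l' → Mom) (p : Fin l → Mom),
      (1 + ‖(p', p)‖) ^ N * ‖hI.kernel l' l p' p‖ ≤ C * (1 + ‖∑ j, p' j - ∑ j, p j‖) ^ M := by
  obtain ⟨C, M, h0, h⟩ := exists_polynomial_bound
    (fun x : (Fin l' → Mom) × (Fin l → Mom) => (1 + ‖x‖) ^ N * ‖hI.kernel l' l x.1 x.2‖)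
    (fun x => ∑ j, x.1 j - ∑ j, x.2 j) (fun s => by
      obtain ⟨G, hG⟩ := hI.decay l' l s
      refine ⟨2 ^ N * ((Finset.Iic (N, 0)).sup (schwartzSeminormFamily ℂ _ ℂ)) G, fun x => ?_⟩
      have := schwartz_decay G N 0 0 le_rfl x
      rw [norm_iteratedFDeriv_zero, hG x.1 x.2, norm_mul, ← mul_assoc] at this
      exact this)
  exact ⟨C, M, h0, fun p' p => h (p', p)⟩

/-! ### Derivatives of compositions with Schwartz functions -/

section Composition

variable {E F : Type*} [NormedAddCommGroup E] [NormedSpace ℝ E] [NormedAddCommGroup F]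
  [NormedSpace ℝ F]

/-- The derivatives of `A * (Φ ∘ ζ)`, with `A` and `ζ` of temperate growth, decay rapidly in `ζ`
up to a power of the argument which does not depend on the rate of decay. -/
lemma exists_bound_mul_comp_schwartz {A : E → ℂ} {ζ : E → F} (hA : A.HasTemperateGrowth)
    (hζ : ζ.HasTemperateGrowth) (k : ℕ) :
    ∃ M : ℕ, ∀ (Φ : 𝓢(F, ℂ)) (N : ℕ), ∃ C : ℝ, 0 ≤ C ∧ ∀ x,
      (1 + ‖ζ x‖) ^ N * ‖iteratedFDeriv ℝ k (fun x => A x * Φ (ζ x)) x‖ ≤ C * (1 + ‖x‖) ^ M := by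
  obtain ⟨a, Ca, hCa, ha⟩ := hA.norm_iteratedFDeriv_le_uniform k
  obtain ⟨b, Cb, hCb, hb⟩ := hζ.norm_iteratedFDeriv_le_uniform k
  refine ⟨a + b * k, fun Φ N => ?_⟩
  set S := 2 ^ N * ((Finset.Iic (N, k)).sup (schwartzSeminormFamily ℂ F ℂ)) Φ with hS
  have hS0 : 0 ≤ S := by positivity
  -- the formula of Faà di Bruno for the derivatives of `Φ ∘ ζ`
  have hcomp : ∀ i ≤ k, ∀ x, (1 + ‖ζ x‖) ^ N * ‖iteratedFDeriv ℝ i (fun x => Φ (ζ x)) x‖ ≤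
      i ! * S * ((1 + Cb) * (1 + ‖x‖) ^ b) ^ i := by
    intro i hi x
    have hp : 0 < (1 + ‖ζ x‖) ^ N := by positivity
    have := norm_iteratedFDeriv_comp_le (g := Φ) (f := ζ) (n := i) (N := ∞) (Φ.smooth ⊤) hζ.1
      (mod_cast le_top) x (C := ((1 + ‖ζ x‖) ^ N)⁻¹ * S) (D := (1 + Cb) * (1 + ‖x‖) ^ b)
      (fun j hj => by
        rw [← div_eq_inv_mul, le_div_iff₀' hp]
        exact schwartz_decay Φ N k j (hj.trans hi) (ζ x))
      (fun j hj hj' => by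
        calc _ ≤ Cb * (1 + ‖x‖) ^ b := hb j (hj'.trans hi) x
          _ ≤ (1 + Cb) * (1 + ‖x‖) ^ b := by gcongr; linarith
          _ ≤ _ := le_self_pow₀ (one_le_mul_of_one_le_of_one_le (by linarith)
            (one_le_pow₀ (by linarith [norm_nonneg x]))) (by omega))
    calc _ ≤ (1 + ‖ζ x‖) ^ N * (i ! * (((1 + ‖ζ x‖) ^ N)⁻¹ * S) *
          ((1 + Cb) * (1 + ‖x‖) ^ b) ^ i) := by gcongr; exact this
      _ = _ := by field_simp
  refine ⟨∑ i ∈ Finset.range (k + 1), (k.choose i : ℝ) * Ca * ((k - i)! * S * (1 + Cb) ^ k),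
    Finset.sum_nonneg fun i _ => by positivity, fun x => ?_⟩
  -- the Leibniz rule
  have h1 := norm_iteratedFDeriv_mul_le (n := k) hA.1 ((Φ.smooth ⊤).comp hζ.1) x (mod_cast le_top)
  have h1x : 1 ≤ 1 + ‖x‖ := by linarith [norm_nonneg x]
  calc _ ≤ (1 + ‖ζ x‖) ^ N * ∑ i ∈ Finset.range (k + 1), (k.choose i : ℝ) *
        ‖iteratedFDeriv ℝ i A x‖ * ‖iteratedFDeriv ℝ (k - i) (fun x => Φ (ζ x)) x‖ := by
        gcongr; exact h1
    _ = ∑ i ∈ Finset.range (k + 1), (k.choose i : ℝ) * ‖iteratedFDeriv ℝ i A x‖ *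
        ((1 + ‖ζ x‖) ^ N * ‖iteratedFDeriv ℝ (k - i) (fun x => Φ (ζ x)) x‖) := by
        rw [Finset.mul_sum]; refine Finset.sum_congr rfl fun i _ => by ring
    _ ≤ ∑ i ∈ Finset.range (k + 1), (k.choose i : ℝ) * (Ca * (1 + ‖x‖) ^ a) *
        ((k - i)! * S * ((1 + Cb) * (1 + ‖x‖) ^ b) ^ k) := by
        refine Finset.sum_le_sum fun i hi => ?_
        have hi' : i ≤ k := Nat.lt_succ_iff.1 (Finset.mem_range.1 hi)
        have h5 : ((1 + Cb) * (1 + ‖x‖) ^ b) ^ (k - i) ≤ ((1 + Cb) * (1 + ‖x‖) ^ b) ^ k :=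
          pow_le_pow_right₀ (one_le_mul_of_one_le_of_one_le (by linarith) (one_le_pow₀ h1x))
            (by omega)
        have h6 := hcomp (k - i) (by omega) x
        have h7 := ha i hi' x
        calc _ ≤ (k.choose i : ℝ) * (Ca * (1 + ‖x‖) ^ a) *
              ((k - i)! * S * ((1 + Cb) * (1 + ‖x‖) ^ b) ^ (k - i)) := by gcongr
          _ ≤ _ := by gcongr
    _ = _ := by
        rw [Finset.sum_mul]
        refine Finset.sum_congr rfl fun i _ => ?_
        rw [mul_pow, ← pow_mul, pow_add]; ring

end Composition

/-! ### Smoothness of integrals that depend on parameters -/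

section Parametric

variable {E Y : Type} [NormedAddCommGroup E] [NormedSpace ℝ E] [NormedAddCommGroup Y]
  [NormedSpace ℝ Y]

/-- The partial derivative in the first variable of a function on a product. -/
def partialFDeriv {V : Type} [NormedAddCommGroup V] [NormedSpace ℝ V] (Θ : E × Y → V) :
    E × Y → (E →L[ℝ] V) :=
  fun z => (fderiv ℝ Θ z).comp (ContinuousLinearMap.inl ℝ E Y)

lemma contDiff_partialFDeriv {V : Type} [NormedAddCommGroup V] [NormedSpace ℝ V]
    {Θ : E × Y → V} (hΘ : ContDiff ℝ ∞ Θ) : ContDiff ℝ ∞ (partialFDeriv Θ) :=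
  (hΘ.fderiv_right (m := ∞) (by simp)).clm_comp contDiff_const

lemma norm_iteratedFDeriv_partialFDeriv_le {V : Type} [NormedAddCommGroup V] [NormedSpace ℝ V]
    {Θ : E × Y → V} (hΘ : ContDiff ℝ ∞ Θ) (k : ℕ) (z : E × Y) :
    ‖iteratedFDeriv ℝ k (partialFDeriv Θ) z‖ ≤ ‖iteratedFDeriv ℝ (k + 1) Θ z‖ := by
  have h1 : partialFDeriv Θ = (ContinuousLinearMap.compL ℝ E (E × Y) V).flip
      (ContinuousLinearMap.inl ℝ E Y) ∘ fderiv ℝ Θ := rfl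
  have hf : ContDiff ℝ ∞ (fderiv ℝ Θ) := hΘ.fderiv_right (m := ∞) (by simp)
  rw [h1]
  refine (ContinuousLinearMap.norm_iteratedFDeriv_comp_left _ hf.contDiffAt
    (mod_cast le_top)).trans ?_
  rw [norm_iteratedFDeriv_fderiv]
  refine mul_le_of_le_one_left (norm_nonneg _) ?_
  refine ContinuousLinearMap.opNorm_le_bound _ zero_le_one fun T => ?_
  rw [one_mul]
  refine ContinuousLinearMap.opNorm_le_bound _ (norm_nonneg _) fun e => ?_
  simpa using T.le_opNorm (e, (0 : Y))

variable [MeasurableSpace Y] [BorelSpace Y] [SecondCountableTopology Y] {μ : Measure Y}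

/-- Differentiation under the integral sign, with bounds on all derivatives of the integrand of the
form in which they are available for the partial derivative as well. -/
lemma integral_smooth_aux (w : Y → ℂ) (hw : AEStronglyMeasurable w μ)
    {V : Type} [NormedAddCommGroup V] [NormedSpace ℝ V] [NormedSpace ℂ V] [SMulCommClass ℝ ℂ V]
    [CompleteSpace V] {Θ : E × Y → V}
    (hΘ : ContDiff ℝ ∞ Θ) (g : ℕ → E → ℝ) (hg : ∀ k, Continuous (g k)) (h : ℕ → Y → ℝ)
    (hh : ∀ k, Integrable (h k) μ) (hh0 : ∀ k y, 0 ≤ h k y)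
    (hb : ∀ k e y, ‖w y‖ * ‖iteratedFDeriv ℝ k Θ (e, y)‖ ≤ g k e * h k y) (e : E) :
    HasFDerivAt (fun e => ∫ y, w y • Θ (e, y) ∂μ) (∫ y, w y • partialFDeriv Θ (e, y) ∂μ) e := by
  have hmeas : ∀ e, AEStronglyMeasurable (fun y => w y • Θ (e, y)) μ := fun e =>
    hw.smul (hΘ.continuous.comp (by fun_prop : Continuous fun y => (e, y))).aestronglyMeasurable
  obtain ⟨s, hs, B, hB⟩ : ∃ s : Set E, s ∈ 𝓝 e ∧ ∃ B : ℝ, ∀ x ∈ s, g 1 x ≤ B := by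
    refine ⟨g 1 ⁻¹' Set.Iio (g 1 e + 1), ?_, g 1 e + 1, fun x hx => le_of_lt hx⟩
    exact (hg 1).continuousAt.preimage_mem_nhds (Iio_mem_nhds (by linarith))
  refine hasFDerivAt_integral_of_dominated_of_fderiv_le (𝕜 := ℝ)
    (F' := fun e y => w y • partialFDeriv Θ (e, y)) (bound := fun y => B * h 1 y) hs
    (Eventually.of_forall hmeas) ?_ ?_ (Eventually.of_forall fun y x hx => ?_)
    ((hh 1).const_mul B) (Eventually.of_forall fun y x _ => ?_)
  · refine ((hh 0).const_mul (g 0 e)).mono' (hmeas e) (Eventually.of_forall fun y => ?_)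
    rw [norm_smul]
    simpa using hb 0 e y
  · exact hw.smul ((contDiff_partialFDeriv hΘ).continuous.comp
      (by fun_prop : Continuous fun y => (e, y))).aestronglyMeasurable
  · rw [norm_smul]
    have h1 := norm_iteratedFDeriv_partialFDeriv_le hΘ 0 (x, y)
    rw [norm_iteratedFDeriv_zero] at h1
    calc _ ≤ ‖w y‖ * ‖iteratedFDeriv ℝ 1 Θ (x, y)‖ := by gcongr
      _ ≤ g 1 x * h 1 y := hb 1 x y
      _ ≤ B * h 1 y := by gcongr; exacts [hh0 1 y, hB x hx]
  · have h1 : HasFDerivAt Θ (fderiv ℝ Θ (x, y)) (x, y) :=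
      (hΘ.differentiable (by simp)).differentiableAt.hasFDerivAt
    have h2 : HasFDerivAt (𝕜 := ℝ) (fun x : E => (x, y)) (ContinuousLinearMap.inl ℝ E Y) x :=
      hasFDerivAt_prodMk_left x y
    exact (h1.comp x h2).const_smul (w y)

/-- Differentiation under the integral sign, to all orders. -/
lemma integral_contDiff_and_bound (w : Y → ℂ) (hw : AEStronglyMeasurable w μ)
    (n : ℕ) : ∀ {V : Type} [NormedAddCommGroup V] [NormedSpace ℝ V] [NormedSpace ℂ V]
    [SMulCommClass ℝ ℂ V] [CompleteSpace V]
    {Θ : E × Y → V} (_ : ContDiff ℝ ∞ Θ) (g : ℕ → E → ℝ) (_ : ∀ k, Continuous (g k))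
    (h : ℕ → Y → ℝ) (_ : ∀ k, Integrable (h k) μ) (_ : ∀ k y, 0 ≤ h k y)
    (_ : ∀ k e y, ‖w y‖ * ‖iteratedFDeriv ℝ k Θ (e, y)‖ ≤ g k e * h k y),
    ContDiff ℝ n (fun e => ∫ y, w y • Θ (e, y) ∂μ) ∧
      ∀ e, ‖iteratedFDeriv ℝ n (fun e => ∫ y, w y • Θ (e, y) ∂μ) e‖ ≤ g n e * ∫ y, h n y ∂μ := by
  induction n with
  | zero =>
    intro V _ _ _ _ _ Θ hΘ g hg h hh hh0 hb
    constructor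
    · refine contDiff_zero.2 (continuous_iff_continuousAt.2 fun e => ?_)
      exact (integral_smooth_aux w hw hΘ g hg h hh hh0 hb e).continuousAt
    · intro e
      rw [norm_iteratedFDeriv_zero, ← integral_const_mul]
      refine norm_integral_le_of_norm_le ((hh 0).const_mul _) (Eventually.of_forall fun y => ?_)
      rw [norm_smul]
      simpa using hb 0 e y
  | succ n IH =>
    intro V _ _ _ _ _ Θ hΘ g hg h hh hh0 hb
    have hd := integral_smooth_aux w hw hΘ g hg h hh hh0 hb
    obtain ⟨h1, h2⟩ := IH (contDiff_partialFDeriv hΘ) (fun k => g (k + 1)) (fun k => hg (k + 1))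
      (fun k => h (k + 1)) (fun k => hh (k + 1)) (fun k => hh0 (k + 1)) (fun k e y =>
        (mul_le_mul_of_nonneg_left (norm_iteratedFDeriv_partialFDeriv_le hΘ k (e, y))
          (norm_nonneg _)).trans (hb (k + 1) e y))
    have hfd : fderiv ℝ (fun e => ∫ y, w y • Θ (e, y) ∂μ) =
        fun e => ∫ y, w y • partialFDeriv Θ (e, y) ∂μ := funext fun e => (hd e).fderiv
    constructor
    · rw [show ((n + 1 : ℕ) : WithTop ℕ∞) = (n : WithTop ℕ∞) + 1 by norm_cast]
      refine contDiff_succ_iff_fderiv.2 ⟨fun e => (hd e).differentiableAt, by simp, ?_⟩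
      rw [hfd]; exact h1
    · intro e
      rw [← norm_iteratedFDeriv_fderiv, hfd]
      exact h2 e

end Parametric

/-! ### Fourier inversion -/

lemma momFourier_one_eq (f : Mom → ℂ) (y : Mom) :
    momFourier 1 f y = FourierTransformInv.fourierInv f ((2 * Real.pi)⁻¹ • y) := by
  rw [Real.fourierInv_eq', momFourier]
  refine integral_congr_ae (Eventually.of_forall fun x => ?_)
  simp only [smul_eq_mul]
  congr 2
  rw [inner_smul_right, real_inner_comm, mul_comm]
  congr 2
  have := Real.pi_ne_zero
  field_simp

/-- The Fourier transformations of the momentum space density cancel, up to `(2π)³`. -/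
lemma momFourier_inversion (f : 𝓢(Mom, ℂ)) (q : Mom) :
    momFourier (-1) (fun y => momFourier 1 f y) q = (2 * Real.pi : ℂ) ^ 3 * f q := by
  have h2 := Measure.integral_comp_smul (volume : Measure Mom)
    (fun y => Complex.exp (Complex.I * ((-1 : ℝ) * inner ℝ q y : ℝ)) * momFourier 1 f y)
    (2 * Real.pi)
  have hpi := Real.pi_pos
  have h3 : (FourierTransform.fourier (FourierTransformInv.fourierInv (f : Mom → ℂ))) q = f q := by
    have := congrArg (fun g : 𝓢(Mom, ℂ) => g q)
      (FourierTransform.fourier_fourierInv_eq (E := 𝓢(Mom, ℂ)) (F := 𝓢(Mom, ℂ)) f)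
    simpa only [SchwartzMap.fourier_coe, SchwartzMap.fourierInv_coe] using this
  have h4 : (∫ x : Mom, Complex.exp (Complex.I * ((-1 : ℝ) * inner ℝ q ((2 * Real.pi) • x) : ℝ)) *
      momFourier 1 f ((2 * Real.pi) • x)) = f q := by
    rw [← h3, Real.fourier_eq']
    refine integral_congr_ae (Eventually.of_forall fun x => ?_)
    simp only [smul_eq_mul]
    rw [momFourier_one_eq, smul_smul, inv_mul_cancel₀ (by positivity), one_smul, inner_smul_right,
      real_inner_comm q x]
    congr 2
    push_cast; ring
  rw [h4] at h2
  rw [momFourier, h2]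
  have hfin : Module.finrank ℝ Mom = 3 := by simp
  rw [hfin, abs_of_nonneg (by positivity), Complex.real_smul]
  push_cast
  rw [← mul_assoc, mul_inv_cancel₀ (by simp [hpi.ne']), one_mul]

/-! ### Temperate growth of maps into products -/

section Temperate

variable {E F G : Type*} [NormedAddCommGroup E] [NormedSpace ℝ E] [NormedAddCommGroup F]
  [NormedSpace ℝ F] [NormedAddCommGroup G] [NormedSpace ℝ G]

lemma hasTemperateGrowth_pi {ι : Type*} [Fintype ι] {f : ι → E → F}
    (h : ∀ i, (f i).HasTemperateGrowth) : (fun x i => f i x).HasTemperateGrowth := by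
  classical
  have : (fun x i => f i x) = fun x => ∑ i, (ContinuousLinearMap.single ℝ (fun _ : ι => F) i)
      (f i x) := by
    ext x i
    simp [Finset.sum_apply, Pi.single_apply]
  rw [this]
  exact Function.HasTemperateGrowth.sum fun i _ =>
    (ContinuousLinearMap.single ℝ (fun _ : ι => F) i).hasTemperateGrowth.comp (h i)

lemma hasTemperateGrowth_prodMk {f : E → F} {g : E → G} (hf : f.HasTemperateGrowth)
    (hg : g.HasTemperateGrowth) : (fun x => (f x, g x)).HasTemperateGrowth := by
  have : (fun x => (f x, g x)) = fun x => ContinuousLinearMap.inl ℝ F G (f x) +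
      ContinuousLinearMap.inr ℝ F G (g x) := by
    ext x <;> simp
  rw [this]
  exact ((ContinuousLinearMap.inl ℝ F G).hasTemperateGrowth.comp hf).fun_add
    ((ContinuousLinearMap.inr ℝ F G).hasTemperateGrowth.comp hg)

lemma hasTemperateGrowth_fst : (Prod.fst : E × F → E).HasTemperateGrowth :=
  (ContinuousLinearMap.fst ℝ E F).hasTemperateGrowth

lemma hasTemperateGrowth_snd : (Prod.snd : E × F → F).HasTemperateGrowth :=
  (ContinuousLinearMap.snd ℝ E F).hasTemperateGrowth

lemma hasTemperateGrowth_apply {ι : Type*} [Fintype ι] (i : ι) :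
    (fun x : ι → E => x i).HasTemperateGrowth :=
  (ContinuousLinearMap.proj i : (ι → E) →L[ℝ] E).hasTemperateGrowth

end Temperate

/-! ### Integration over line momenta -/

/-- The weight `(1 + ‖x‖)⁻⁴`, which is integrable on momentum space. -/
lemma integrable_mom_weight : Integrable fun x : Mom => ((1 + ‖x‖) ^ 4)⁻¹ := by
  have h := integrable_one_add_norm (E := Mom) (μ := volume) (r := 4) (by simp; norm_num)
  refine h.congr (Eventually.of_forall fun x => ?_)
  simp only
  rw [Real.rpow_neg (by positivity)]
  norm_cast

lemma integrable_prod_mom_weight (E : Type) [Fintype E] :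
    Integrable fun p : E → Mom => ∏ e, ((1 + ‖p e‖) ^ 4)⁻¹ :=
  Integrable.fintype_prod (f := fun _ (x : Mom) => ((1 + ‖x‖) ^ 4)⁻¹) fun _ =>
    integrable_mom_weight

lemma integral_pi_equiv {E E' D : Type} [Fintype E] [Fintype E'] [MeasureSpace D]
    [SigmaFinite (volume : Measure D)] (e : E ≃ E') (f : (E' → D) → ℂ) :
    ∫ p, f p = ∫ p : E → D, f (p ∘ e.symm) := by
  have h := (volume_measurePreserving_piCongrLeft (fun _ : E' => D) e).integral_comp'
    (f := MeasurableEquiv.piCongrLeft (fun _ : E' => D) e) f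
  rw [← h]
  refine integral_congr_ae (Eventually.of_forall fun p => ?_)
  refine congrArg f (funext fun x => ?_)
  obtain ⟨y, rfl⟩ := e.surjective x
  simp [MeasurableEquiv.coe_piCongrLeft, Equiv.piCongrLeft_apply_apply]

lemma one_le_prod_one_add {E : Type} [Fintype E] (p : E → Mom) : 1 ≤ ∏ e, (1 + ‖p e‖) :=
  Finset.one_le_prod (s := Finset.univ) (f := fun e => 1 + ‖p e‖) fun e _ => by simp

lemma one_add_norm_le_prod {E : Type} [Fintype E] (p : E → Mom) :
    1 + ‖p‖ ≤ ∏ e, (1 + ‖p e‖) := by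
  classical
  have h1 := one_le_prod_one_add p
  suffices ‖p‖ ≤ ∏ e, (1 + ‖p e‖) - 1 by linarith
  refine (pi_norm_le_iff_of_nonneg (by linarith)).2 fun e => ?_
  have : 1 + ‖p e‖ ≤ ∏ e, (1 + ‖p e‖) := by
    rw [← Finset.mul_prod_erase _ _ (Finset.mem_univ e)]
    exact le_mul_of_one_le_right (by positivity)
      (Finset.one_le_prod (f := fun e => 1 + ‖p e‖) fun e _ => by simp)
  linarith

/-! ### Vertex kernels -/

/-- The momentum space kernels of the operator at a vertex, for all numbers `l'` of created and `l`
of annihilated particles. They are symmetric, and decay rapidly in the created momenta up to powers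
of the transferred momentum. -/
structure VertexKernel where
  toFun : (l' l : ℕ) → (Fin l' → Mom) → (Fin l → Mom) → ℂ
  bound : ℕ
  finite : ∀ l' l, bound < l' + l → toFun l' l = 0
  continuous : ∀ l' l, Continuous fun x : (Fin l' → Mom) × (Fin l → Mom) => toFun l' l x.1 x.2
  symm : ∀ (l' l : ℕ) (σ' : Equiv.Perm (Fin l')) (σ : Equiv.Perm (Fin l)) p' p,
    toFun l' l (p' ∘ σ') (p ∘ σ) = toFun l' l p' p
  decay : ∀ l' l N, ∃ (C : ℝ) (M : ℕ), 0 ≤ C ∧ ∀ p' p,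
    (∏ j, (1 + ‖p' j‖)) ^ N * ‖toFun l' l p' p‖ ≤ C * (1 + ‖∑ j, p' j - ∑ j, p j‖) ^ M

namespace VertexKernel

/-- The value of a vertex kernel on momenta indexed by arbitrary finite types. -/
def eval (K : VertexKernel) {O I : Type} [Fintype O] [Fintype I] (p' : O → Mom) (p : I → Mom) : ℂ :=
  K.toFun (Fintype.card O) (Fintype.card I) (fun j => p' ((Fintype.equivFin O).symm j))
    (fun j => p ((Fintype.equivFin I).symm j))

variable (K : VertexKernel) {O I : Type} [Fintype O] [Fintype I]

lemma eval_eq {l' l : ℕ} (f' : Fin l' ≃ O) (f : Fin l ≃ I) (p' : O → Mom) (p : I → Mom) :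
    K.eval p' p = K.toFun l' l (p' ∘ f') (p ∘ f) := by
  obtain rfl : l' = Fintype.card O := by simpa using Fintype.card_congr f'
  obtain rfl : l = Fintype.card I := by simpa using Fintype.card_congr f
  rw [eval, ← K.symm _ _ (f'.trans (Fintype.equivFin O)) (f.trans (Fintype.equivFin I))]
  congr 1 <;> ext j : 1 <;> simp

lemma eval_equiv {O' I' : Type} [Fintype O'] [Fintype I'] (e' : O' ≃ O) (e : I' ≃ I)
    (p' : O → Mom) (p : I → Mom) :
    K.eval (fun o => p' (e' o)) (fun i => p (e i)) = K.eval p' p := by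
  rw [K.eval_eq (((Fintype.equivFin O').symm).trans e') (((Fintype.equivFin I').symm).trans e)]
  rfl

lemma eval_eq_zero (h : K.bound < Fintype.card O + Fintype.card I) (p' : O → Mom) (p : I → Mom) :
    K.eval p' p = 0 := by
  rw [eval, K.finite _ _ h]; rfl

lemma continuous_eval {T : Type*} [TopologicalSpace T] {f' : T → O → Mom} {f : T → I → Mom}
    (hf' : Continuous f') (hf : Continuous f) : Continuous fun t => K.eval (f' t) (f t) :=
  (K.continuous _ _).comp (Continuous.prodMk
    (continuous_pi fun j => (continuous_pi_iff.1 hf') ((Fintype.equivFin O).symm j))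
    (continuous_pi fun j => (continuous_pi_iff.1 hf) ((Fintype.equivFin I).symm j)))

lemma eval_decay (O I : Type) [Fintype O] [Fintype I] (N : ℕ) :
    ∃ (C : ℝ) (M : ℕ), 0 ≤ C ∧ ∀ (p' : O → Mom) (p : I → Mom),
      (∏ j, (1 + ‖p' j‖)) ^ N * ‖K.eval p' p‖ ≤ C * (1 + ‖∑ j, p' j - ∑ j, p j‖) ^ M := by
  obtain ⟨C, M, h0, h⟩ := K.decay (Fintype.card O) (Fintype.card I) N
  refine ⟨C, M, h0, fun p' p => ?_⟩
  have := h (fun j => p' ((Fintype.equivFin O).symm j)) (fun j => p ((Fintype.equivFin I).symm j))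
  rw [Equiv.sum_comp (Fintype.equivFin O).symm p', Equiv.sum_comp (Fintype.equivFin I).symm p,
    Equiv.prod_comp (Fintype.equivFin O).symm (fun o => 1 + ‖p' o‖)] at this
  exact this

end VertexKernel

/-! ### Amplitudes of graphs with open lines -/

section Amplitude

variable {V E I : Type} [Fintype V] [DecidableEq V] [Fintype E] [Fintype I]

/-- Outgoing minus incoming momentum at the vertex `a`, for internal lines `E` with sources `src`
and targets `tgt` and open lines `I` with sources `src`. -/
def lineDefect (src : E ⊕ I → V) (tgt : E → V) (P : I → Mom) (p : E → Mom) (a : V) : Mom :=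
  ∑ e : {e // src e = a}, Sum.elim p P e - ∑ e : {e // tgt e = a}, p e

/-- The product of the vertex kernels of the vertices in `w`. -/
def vertexWeight (K : V → VertexKernel) (w : Finset V) (src : E ⊕ I → V) (tgt : E → V)
    (P : I → Mom) (p : E → Mom) : ℂ :=
  ∏ a ∈ w, (K a).eval (fun e : {e // src e = a} => Sum.elim p P e) (fun e : {e // tgt e = a} => p e)

/-- The slots: those of the vertices in `w` are the momentum defects, the others are free. -/
def slotArgs (w : Finset V) (src : E ⊕ I → V) (tgt : E → V) (P : I → Mom) (κ : V → Mom)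
    (p : E → Mom) : V → Mom :=
  fun a => if a ∈ w then lineDefect src tgt P p a else κ a

/-- The amplitude of a graph with vertices `w`, internal lines `E`, and open lines `I` with
momenta `P`. -/
def amplitude (K : V → VertexKernel) (w : Finset V) (Φ : (V → Mom) → ℂ) (src : E ⊕ I → V)
    (tgt : E → V) (P : I → Mom) (κ : V → Mom) : ℂ :=
  ∫ p : E → Mom, vertexWeight K w src tgt P p * Φ (slotArgs w src tgt P κ p)

/-- Amplitudes are invariant under relabelling of the internal and of the open lines. -/
lemma amplitude_congr_equiv {E' I' : Type} [Fintype E'] [Fintype I'] (K : V → VertexKernel)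
    (w : Finset V) (Φ : (V → Mom) → ℂ) (e : E ≃ E') (f : I ≃ I') (src : E ⊕ I → V) (tgt : E → V)
    (src' : E' ⊕ I' → V) (tgt' : E' → V)
    (hl : ∀ x, src (.inl x) = src' (.inl (e x))) (hr : ∀ x, src (.inr x) = src' (.inr (f x)))
    (ht : ∀ x, tgt x = tgt' (e x)) (P : I' → Mom) (κ : V → Mom) :
    amplitude K w Φ src tgt (P ∘ f) κ = amplitude K w Φ src' tgt' P κ := by
  unfold amplitude
  rw [integral_pi_equiv e]
  refine integral_congr_ae (Eventually.of_forall fun p => ?_)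
  have hs : ∀ (x : E ⊕ I) (a : V), src x = a ↔ src' (Equiv.sumCongr e f x) = a := by
    rintro (x | x) a <;> simp [hl, hr]
  have ht' : ∀ (x : E) (a : V), tgt x = a ↔ tgt' (e x) = a := fun x a => by rw [ht]
  have hel : ∀ x : E ⊕ I, Sum.elim (p ∘ e.symm) P (Equiv.sumCongr e f x) = Sum.elim p (P ∘ f) x := by
    rintro (x | x) <;> simp
  have hO : ∀ (a : V), (fun x : {x // src x = a} => Sum.elim p (P ∘ f) x) =
      fun x => (fun y : {y // src' y = a} => Sum.elim (p ∘ e.symm) P y)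
        ((Equiv.sumCongr e f).subtypeEquiv (fun x => hs x a) x) := fun a => by
    ext1 x; exact (hel x).symm
  have hI : ∀ (a : V), (fun x : {x // tgt x = a} => p x) =
      fun x => (fun y : {y // tgt' y = a} => (p ∘ e.symm) y)
        (e.subtypeEquiv (fun x => ht' x a) x) := fun a => by
    ext1 x; simp
  simp only
  congr 1
  · unfold vertexWeight
    refine Finset.prod_congr rfl fun a _ => ?_
    rw [hO, hI]
    exact (K a).eval_equiv ((Equiv.sumCongr e f).subtypeEquiv fun x => hs x a)
      (e.subtypeEquiv fun x => ht' x a) (fun y : {y // src' y = a} => Sum.elim (p ∘ e.symm) P y)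
      (fun y : {y // tgt' y = a} => (p ∘ e.symm) y)
  · congr 1
    ext1 a
    unfold slotArgs lineDefect
    split_ifs
    · congr 1
      · have := congrArg (fun g => ∑ x, g x) (hO a)
        simp only at this
        rw [this]
        exact Equiv.sum_comp ((Equiv.sumCongr e f).subtypeEquiv fun x => hs x a)
          (fun y : {y // src' y = a} => Sum.elim (p ∘ e.symm) P y)
      · have := congrArg (fun g => ∑ x, g x) (hI a)
        simp only at this
        rw [this]
        exact Equiv.sum_comp (e.subtypeEquiv fun x => ht' x a)
          (fun y : {y // tgt' y = a} => (p ∘ e.symm) y)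
    · rfl

/-- Two families of lines with the same number of lines between any two vertices have the same
amplitude. -/
lemma amplitude_congr_card {E' : Type} [Fintype E'] (K : V → VertexKernel) (w : Finset V)
    (Φ : (V → Mom) → ℂ) (src : E → V) (tgt : E → V) (src' : E' → V) (tgt' : E' → V) (s : I → V)
    (h : ∀ a b, Fintype.card {e // src e = a ∧ tgt e = b} =
      Fintype.card {e // src' e = a ∧ tgt' e = b}) (P : I → Mom) (κ : V → Mom) :
    amplitude K w Φ (Sum.elim src s) tgt P κ = amplitude K w Φ (Sum.elim src' s) tgt' P κ := by
  have he : ∀ ab : V × V, Nonempty ({e // (src e, tgt e) = ab} ≃ {e // (src' e, tgt' e) = ab}) :=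
    fun ab => by
      refine Fintype.card_eq.1 ?_
      simpa only [Prod.ext_iff] using h ab.1 ab.2
  let e : E ≃ E' := (Equiv.sigmaFiberEquiv fun e => (src e, tgt e)).symm.trans
    ((Equiv.sigmaCongrRight fun ab => (he ab).some).trans
      (Equiv.sigmaFiberEquiv fun e => (src' e, tgt' e)))
  have hee : ∀ x, (src' (e x), tgt' (e x)) = (src x, tgt x) := fun x =>
    ((he (src x, tgt x)).some ⟨x, rfl⟩).2
  refine amplitude_congr_equiv K w Φ e (Equiv.refl I) _ _ _ _ (fun x => ?_) (fun x => rfl)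
    (fun x => ?_) P κ
  · exact (congrArg Prod.fst (hee x)).symm
  · exact (congrArg Prod.snd (hee x)).symm

lemma continuous_vertexWeight (K : V → VertexKernel) (w : Finset V) (src : E ⊕ I → V) (tgt : E → V) :
    Continuous fun x : (I → Mom) × (E → Mom) => vertexWeight K w src tgt x.1 x.2 := by
  unfold vertexWeight
  refine continuous_finsetProd _ fun a _ => (K a).continuous_eval ?_ ?_
  · refine continuous_pi fun e => ?_
    rcases e with ⟨e | e, he⟩ <;> simp only [Sum.elim_inl, Sum.elim_inr] <;> fun_prop
  · fun_prop

lemma continuous_slotArgs (w : Finset V) (src : E ⊕ I → V) (tgt : E → V) :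
    Continuous fun x : (I → Mom) × (V → Mom) × (E → Mom) => slotArgs w src tgt x.1 x.2.1 x.2.2 := by
  refine continuous_pi fun a => ?_
  unfold slotArgs lineDefect
  split_ifs
  · refine Continuous.sub (continuous_finsetSum _ fun e _ => ?_) (by fun_prop)
    rcases e with ⟨e | e, he⟩ <;> simp only [Sum.elim_inl, Sum.elim_inr] <;> fun_prop
  · fun_prop

/-- The vertex weights decay in all line momenta, up to powers of the momentum defects: every line
leaves some vertex, and the kernel of that vertex decays in its outgoing momenta. -/
lemma vertexWeight_decay (K : V → VertexKernel) (w : Finset V) (src : E ⊕ I → V) (tgt : E → V)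
    (hsrc : ∀ e, src e ∈ w) (N : ℕ) :
    ∃ (C : ℝ) (M : ℕ), 0 ≤ C ∧ ∀ P κ p, (∏ e, (1 + ‖p e‖)) ^ N * ‖vertexWeight K w src tgt P p‖ ≤
      C * (1 + ‖slotArgs w src tgt P κ p‖) ^ M := by
  choose C M h0 h using fun a => (K a).eval_decay {e // src e = a} {e // tgt e = a} N
  refine ⟨∏ a ∈ w, C a, ∑ a ∈ w, M a, Finset.prod_nonneg fun a _ => h0 a, fun P κ p => ?_⟩
  -- every line is counted at its source
  have h1 : ∏ e, (1 + ‖p e‖) ≤ ∏ a ∈ w, ∏ e : {e // src e = a}, (1 + ‖Sum.elim p P e‖) := by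
    have e1 : ∏ a ∈ w, ∏ e : {e // src e = a}, (1 + ‖Sum.elim p P (e : E ⊕ I)‖) =
        ∏ e : E ⊕ I, (1 + ‖Sum.elim p P e‖) := by
      rw [← Finset.prod_fiberwise_of_maps_to (s := Finset.univ) (t := w) (g := src)
        (fun e _ => hsrc e)]
      refine Finset.prod_congr rfl fun a _ => ?_
      rw [Finset.prod_subtype (Finset.univ.filter fun e => src e = a) (p := fun e => src e = a)
        (fun e => by simp) (fun e => 1 + ‖Sum.elim p P e‖)]
    rw [e1, Fintype.prod_sum_type]
    simp only [Sum.elim_inl, Sum.elim_inr]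
    exact le_mul_of_one_le_right (Finset.prod_nonneg fun e _ => by positivity)
      (one_le_prod_one_add P)
  calc _ ≤ (∏ a ∈ w, ∏ e : {e // src e = a}, (1 + ‖Sum.elim p P (e : E ⊕ I)‖)) ^ N *
        ‖vertexWeight K w src tgt P p‖ := by
        gcongr
    _ = ∏ a ∈ w, ((∏ e : {e // src e = a}, (1 + ‖Sum.elim p P (e : E ⊕ I)‖)) ^ N *
        ‖(K a).eval (fun e : {e // src e = a} => Sum.elim p P e)
          (fun e : {e // tgt e = a} => p e)‖) := by
        rw [vertexWeight, norm_prod, ← Finset.prod_pow, Finset.prod_mul_distrib]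
    _ ≤ ∏ a ∈ w, (C a * (1 + ‖slotArgs w src tgt P κ p‖) ^ M a) := by
        refine Finset.prod_le_prod (fun a _ => mul_nonneg (pow_nonneg
          (Finset.prod_nonneg fun e _ => by positivity) _) (norm_nonneg _)) fun a ha => ?_
        refine (h a _ _).trans ?_
        have hd : ‖∑ e : {e // src e = a}, Sum.elim p P (e : E ⊕ I) - ∑ e : {e // tgt e = a}, p e‖ ≤
            ‖slotArgs w src tgt P κ p‖ := by
          have := norm_le_pi_norm (slotArgs w src tgt P κ p) a
          simpa only [slotArgs, ha, if_true, lineDefect] using this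
        have := h0 a
        gcongr
    _ = _ := by rw [Finset.prod_mul_distrib, Finset.prod_pow_eq_pow_sum]

lemma amplitude_integrand_bound (K : V → VertexKernel) (w : Finset V) (Φ : 𝓢(V → Mom, ℂ))
    (src : E ⊕ I → V) (tgt : E → V) (hsrc : ∀ e, src e ∈ w) :
    ∃ C : ℝ, ∀ P κ p, ‖vertexWeight K w src tgt P p * Φ (slotArgs w src tgt P κ p)‖ ≤
      C * ∏ e, ((1 + ‖p e‖) ^ 4)⁻¹ := by
  obtain ⟨C, M, h0, h⟩ := vertexWeight_decay K w src tgt hsrc 4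
  set S := 2 ^ M * ((Finset.Iic (M, 0)).sup (schwartzSeminormFamily ℂ (V → Mom) ℂ)) Φ
  refine ⟨C * S, fun P κ p => ?_⟩
  have h1 := h P κ p
  have h2 := schwartz_decay Φ M 0 0 le_rfl (slotArgs w src tgt P κ p)
  rw [norm_iteratedFDeriv_zero] at h2
  have hp : 0 < (∏ e, (1 + ‖p e‖)) ^ 4 := by
    have := one_le_prod_one_add p; positivity
  rw [Finset.prod_inv_distrib, Finset.prod_pow, ← div_eq_mul_inv, le_div_iff₀' hp, norm_mul,
    ← mul_assoc]
  calc _ ≤ C * (1 + ‖slotArgs w src tgt P κ p‖) ^ M * ‖Φ (slotArgs w src tgt P κ p)‖ := by gcongr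
    _ = C * ((1 + ‖slotArgs w src tgt P κ p‖) ^ M * ‖Φ (slotArgs w src tgt P κ p)‖) := by ring
    _ ≤ _ := by gcongr

lemma amplitude_integrable (K : V → VertexKernel) (w : Finset V) (Φ : 𝓢(V → Mom, ℂ))
    (src : E ⊕ I → V) (tgt : E → V) (hsrc : ∀ e, src e ∈ w) (P : I → Mom) (κ : V → Mom) :
    Integrable fun p => vertexWeight K w src tgt P p * Φ (slotArgs w src tgt P κ p) := by
  obtain ⟨C, hC⟩ := amplitude_integrand_bound K w Φ src tgt hsrc
  refine ((integrable_prod_mom_weight E).const_mul C).mono' ?_ (Eventually.of_forall (hC P κ))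
  exact (((continuous_vertexWeight K w src tgt).comp (by fun_prop : Continuous fun p => (P, p))).mul
    (Φ.continuous.comp ((continuous_slotArgs w src tgt).comp
      (by fun_prop : Continuous fun p => (P, κ, p))))).aestronglyMeasurable

/-- As a function of a free slot, an amplitude is a Schwartz function. -/
lemma amplitude_slot_schwartz (K : V → VertexKernel) (w : Finset V) (Φ : 𝓢(V → Mom, ℂ))
    (src : E ⊕ I → V) (tgt : E → V) (hsrc : ∀ e, src e ∈ w) (P : I → Mom) (κ : V → Mom) (x : V)
    (hx : x ∉ w) :
    ∃ G : 𝓢(Mom, ℂ), ∀ k, amplitude K w Φ src tgt P (Function.update κ x k) = G k := by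
  let ζ : Mom × (E → Mom) → V → Mom := fun z =>
    slotArgs w src tgt P (Function.update κ x z.1) z.2
  have hζ : ζ.HasTemperateGrowth := by
    have hE : ∀ e : E, (fun z : Mom × (E → Mom) => z.2 e).HasTemperateGrowth := fun e =>
      (hasTemperateGrowth_apply e).comp hasTemperateGrowth_snd
    refine hasTemperateGrowth_pi fun a => ?_
    unfold slotArgs lineDefect
    split_ifs with ha
    · refine Function.HasTemperateGrowth.fun_sub (Function.HasTemperateGrowth.sum fun e _ => ?_)
        (Function.HasTemperateGrowth.sum fun e _ => hE e)
      rcases e with ⟨e | e, he⟩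
      · exact hE e
      · exact Function.HasTemperateGrowth.const _
    · by_cases hax : a = x
      · subst hax; simpa using hasTemperateGrowth_fst
      · simpa only [Function.update_of_ne hax] using Function.HasTemperateGrowth.const _
  -- The vertex weight decays with the power `M + 4` of the line momenta: `M` powers compensate the
  -- growth of the derivatives of `ζ`, the others make the bound integrable. The powers of the
  -- momentum defects are absorbed by `Φ`, whose argument also contains the free slot `q`.
  have hb : ∀ N k, ∃ C : ℝ, 0 ≤ C ∧ ∀ q p, ‖vertexWeight K w src tgt P p‖ *
      ‖iteratedFDeriv ℝ k (fun z => Φ (ζ z)) (q, p)‖ ≤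
        ((1 + ‖q‖) ^ N)⁻¹ * (C * ∏ e, ((1 + ‖p e‖) ^ 4)⁻¹) := by
    intro N k
    obtain ⟨M, hM⟩ := exists_bound_mul_comp_schwartz (Function.HasTemperateGrowth.const (1 : ℂ)) hζ k
    obtain ⟨C, M', hC0, hC⟩ := vertexWeight_decay K w src tgt hsrc (M + 4)
    obtain ⟨C', hC'0, hC'⟩ := hM Φ (M + M' + N)
    refine ⟨C * C', mul_nonneg hC0 hC'0, fun q p => ?_⟩
    have h1 := hC P (Function.update κ x q) p
    have h2 := hC' (q, p)
    simp only [one_mul] at h2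
    set W := ‖vertexWeight K w src tgt P p‖
    set T := ‖iteratedFDeriv ℝ k (fun z => Φ (ζ z)) (q, p)‖
    set R := ∏ e, (1 + ‖p e‖) with hR
    have hR1 : 1 ≤ R := one_le_prod_one_add p
    change R ^ (M + 4) * W ≤ C * (1 + ‖ζ (q, p)‖) ^ M' at h1
    set X := 1 + ‖ζ (q, p)‖
    have hX1 : 1 ≤ X := by simp [X]
    have hqX : 1 + ‖q‖ ≤ X := by
      have := norm_le_pi_norm (ζ (q, p)) x
      simp only [ζ, slotArgs, hx, if_false, Function.update_self] at this
      simpa [X, ζ] using this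
    have hqp : 1 + ‖(q, p)‖ ≤ X * R := by
      have h3 := one_add_norm_le_prod p
      rw [← hR] at h3
      rw [Prod.norm_def]
      rcases max_cases ‖q‖ ‖p‖ with ⟨h, _⟩ | ⟨h, _⟩ <;> rw [h]
      · exact hqX.trans (le_mul_of_one_le_right (by positivity) hR1)
      · exact h3.trans (le_mul_of_one_le_left (by positivity) hX1)
    have hW : 0 ≤ W := norm_nonneg _
    have hT : 0 ≤ T := norm_nonneg _
    -- the product of the two bounds, divided by `R ^ M * X ^ (M + M')`
    have h4 : W * T * (R ^ 4 * X ^ N) ≤ C * C' := by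
      have h5 : (R ^ (M + 4) * W) * (X ^ (M + M' + N) * T) ≤
          (C * X ^ M') * (C' * (X * R) ^ M) := by
        refine mul_le_mul h1 (h2.trans ?_) (by positivity) (by positivity)
        gcongr
      have h6 : 0 < R ^ M * X ^ (M + M') := by positivity
      refine le_of_mul_le_mul_right ?_ h6
      calc _ = (R ^ (M + 4) * W) * (X ^ (M + M' + N) * T) := by ring
        _ ≤ _ := h5
        _ = C * C' * (R ^ M * X ^ (M + M')) := by rw [mul_pow, pow_add]; ring
    have hq0 : 0 < 1 + ‖q‖ := by positivity
    rw [Finset.prod_inv_distrib, Finset.prod_pow, ← hR, ← div_eq_inv_mul, le_div_iff₀ (by positivity),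
      ← div_eq_mul_inv, le_div_iff₀ (by positivity)]
    refine le_trans ?_ h4
    calc W * T * (1 + ‖q‖) ^ N * R ^ 4 ≤ W * T * X ^ N * R ^ 4 := by gcongr
      _ = _ := by ring
  have hw : AEStronglyMeasurable (fun p => vertexWeight K w src tgt P p) volume :=
    ((continuous_vertexWeight K w src tgt).comp
      (by fun_prop : Continuous fun p => (P, p))).aestronglyMeasurable
  have hΘ : ContDiff ℝ ∞ fun z => Φ (ζ z) := (Φ.smooth ⊤).comp hζ.1
  have hmain : ∀ N n : ℕ, ContDiff ℝ n (fun k => amplitude K w Φ src tgt P (Function.update κ x k)) ∧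
      ∃ C : ℝ, ∀ q, ‖iteratedFDeriv ℝ n (fun k => amplitude K w Φ src tgt P
        (Function.update κ x k)) q‖ ≤ ((1 + ‖q‖) ^ N)⁻¹ * C := by
    intro N n
    choose C hC0 hC using hb N
    have h := integral_contDiff_and_bound (μ := volume) (fun p => vertexWeight K w src tgt P p) hw n hΘ
      (fun _ q => ((1 + ‖q‖) ^ N)⁻¹)
      (fun _ => Continuous.inv₀ (by fun_prop) fun q => by positivity)
      (fun k p => C k * ∏ e, ((1 + ‖p e‖) ^ 4)⁻¹)
      (fun k => (integrable_prod_mom_weight E).const_mul _)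
      (fun k p => mul_nonneg (hC0 k) (Finset.prod_nonneg fun e _ => by positivity))
      (fun k q p => hC k q p)
    exact ⟨h.1, _, h.2⟩
  refine ⟨{ toFun := fun k => amplitude K w Φ src tgt P (Function.update κ x k),
            smooth' := contDiff_infty.2 fun n => (hmain 0 n).1,
            decay' := fun N n => ?_ }, fun k => rfl⟩
  obtain ⟨C, hC⟩ := (hmain N n).2
  refine ⟨C, fun q => ?_⟩
  have h := hC q
  rw [← div_eq_inv_mul, le_div_iff₀' (by positivity)] at h
  refine le_trans ?_ h
  have hle : ‖q‖ ^ N ≤ (1 + ‖q‖) ^ N := by gcongr; linarith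
  exact mul_le_mul_of_nonneg_right hle (norm_nonneg _)

end Amplitude

/-! ### Counting permutations and functions with prescribed fibres -/

/-- The permutations which carry `f` to a function `g` with fibres of the same size form a torsor
under the stabilizer of `f`. -/
lemma card_perm_comp_eq {A ι : Type*} [Fintype A] [DecidableEq A] [Fintype ι] [DecidableEq ι]
    (f g : A → ι) (h : ∀ i, Fintype.card {a // f a = i} = Fintype.card {a // g a = i}) :
    Fintype.card {σ : Equiv.Perm A // f ∘ σ = g} = ∏ i, (Fintype.card {a // f a = i})! := by
  have he : ∀ i, Nonempty ({a // g a = i} ≃ {a // f a = i}) := fun i => Fintype.card_eq.1 (h i).symm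
  let σ : Equiv.Perm A := (Equiv.sigmaFiberEquiv g).symm.trans
    ((Equiv.sigmaCongrRight fun i => (he i).some).trans (Equiv.sigmaFiberEquiv f))
  have hσ : ∀ a, f (σ a) = g a := fun a => ((he (g a)).some ⟨a, rfl⟩).2
  rw [← DomMulAct.stabilizer_card f]
  refine Fintype.card_congr ⟨fun τ => ⟨σ.symm.trans τ.1, ?_⟩, fun τ => ⟨σ.trans τ.1, ?_⟩,
    fun τ => ?_, fun τ => ?_⟩
  · ext a
    have := congrFun τ.2 (σ.symm a)
    simp only [Function.comp_apply] at this
    simp [this, ← hσ]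
  · ext a
    have := congrFun τ.2 (σ a)
    simp only [Function.comp_apply] at this
    simp [this, hσ]
  · ext a; simp
  · ext a; simp

lemma nat_card_perm_comp_eq {A ι : Type*} [Fintype A] [DecidableEq A] [Fintype ι] [DecidableEq ι]
    (f g : A → ι) (h : ∀ i, Fintype.card {a // f a = i} = Fintype.card {a // g a = i}) :
    Nat.card {σ : Equiv.Perm A // f ∘ σ = g} = ∏ i, (Fintype.card {a // f a = i})! := by
  rw [← card_perm_comp_eq f g h, Nat.card_eq_fintype_card]

/-- The number of functions with prescribed sizes `m b` of the fibres is a multinomial coefficient.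
-/
lemma card_fun_fibers {V : Type*} [Fintype V] [DecidableEq V] (m : V → ℕ) (k : ℕ)
    (hk : ∑ b, m b = k) :
    (Finset.univ.filter fun s : Fin k → V => (fun b => Fintype.card {j // s j = b}) = m).card *
      ∏ b, (m b)! = k ! := by
  have e : Fin k ≃ Σ b, Fin (m b) := Fintype.equivOfCardEq (by simp [hk])
  -- all such functions arise from one of them by permutations
  let s0 : Fin k → V := fun j => (e j).1
  have hs0 : ∀ b, Fintype.card {j // s0 j = b} = m b := fun b => by
    rw [Fintype.card_congr ((e.subtypeEquiv (p := fun j => s0 j = b) (q := fun x => x.1 = b)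
      fun j => Iff.rfl).trans (Equiv.sigmaSubtype b)), Fintype.card_fin]
  have h1 : k ! = (Finset.univ : Finset (Equiv.Perm (Fin k))).card := by
    rw [Finset.card_univ, Fintype.card_perm, Fintype.card_fin]
  rw [h1, Finset.card_eq_sum_card_fiberwise (f := fun σ : Equiv.Perm (Fin k) => s0 ∘ σ)
    (t := Finset.univ.filter fun s : Fin k → V => (fun b => Fintype.card {j // s j = b}) = m)]
  · rw [← smul_eq_mul, ← Finset.sum_const]
    refine Finset.sum_congr rfl fun s hs => ?_
    have hs' := congrFun (Finset.mem_filter.1 hs).2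
    rw [← Fintype.card_subtype, card_perm_comp_eq s0 s (fun b => by rw [hs0]; exact (hs' b).symm)]
    simp only [hs0]
  · intro σ _
    refine Finset.mem_coe.2 (Finset.mem_filter.2 ⟨Finset.mem_univ _, ?_⟩)
    ext b
    simp only
    rw [← hs0 b]
    exact Fintype.card_congr (σ.subtypeEquiv fun j => Iff.rfl)

lemma sum_card_fibers {V : Type*} [Fintype V] [DecidableEq V] {k : ℕ} (s : Fin k → V) :
    ∑ b, Fintype.card {j // s j = b} = k := by
  rw [← Fintype.card_sigma, Fintype.card_congr (Equiv.sigmaFiberEquiv s), Fintype.card_fin]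

/-- Summation over enumerated families of `k` elements of `w`, weighted by `1 / k!`, amounts to
summation over multiplicities, weighted by the inverse product of their factorials. -/
lemma sum_functions_by_fibers {V : Type*} [Fintype V] [DecidableEq V] (w : Finset V) (B : ℕ)
    (f : (V → ℕ) → ℂ) (hf : ∀ m, B < ∑ b, m b → f m = 0) :
    ∑ k ∈ Finset.range (B + 1), (k ! : ℂ)⁻¹ * ∑ s ∈ Fintype.piFinset (fun _ : Fin k => w),
      f (fun b => Fintype.card {j // s j = b}) =
    ∑ m ∈ Fintype.piFinset (fun b => if b ∈ w then Finset.range (B + 1) else {0}),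
      (∏ b, ((m b)! : ℂ))⁻¹ * f m := by
  set T := Fintype.piFinset (fun b => if b ∈ w then Finset.range (B + 1) else {0}) with hT
  have hmemT : ∀ m, m ∈ T ↔ (∀ b ∈ w, m b ≤ B) ∧ ∀ b ∉ w, m b = 0 := by
    intro m
    rw [hT, Fintype.mem_piFinset]
    refine ⟨fun h => ⟨fun b hb => ?_, fun b hb => ?_⟩, fun h b => ?_⟩
    · have := h b; rw [if_pos hb, Finset.mem_range] at this; omega
    · have := h b; rwa [if_neg hb, Finset.mem_singleton] at this
    · split_ifs with hb
      · exact Finset.mem_range.2 (Nat.lt_succ_of_le (h.1 b hb))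
      · exact Finset.mem_singleton.2 (h.2 b hb)
  -- for a fixed `k` this is the count of the families with given multiplicities
  have hmain : ∀ k ∈ Finset.range (B + 1), (k ! : ℂ)⁻¹ *
      ∑ s ∈ Fintype.piFinset (fun _ : Fin k => w), f (fun b => Fintype.card {j // s j = b}) =
      ∑ m ∈ T.filter (fun m => ∑ b, m b = k), (∏ b, ((m b)! : ℂ))⁻¹ * f m := by
    intro k hk
    have hk' := Finset.mem_range.1 hk
    rw [← Finset.sum_fiberwise_of_maps_to (t := T.filter (fun m => ∑ b, m b = k))
      (g := fun s : Fin k → V => fun b => Fintype.card {j // s j = b}), Finset.mul_sum]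
    · refine Finset.sum_congr rfl fun m hm => ?_
      obtain ⟨hmT, hmk⟩ := Finset.mem_filter.1 hm
      have hset : (Fintype.piFinset (fun _ : Fin k => w)).filter
          (fun s => (fun b => Fintype.card {j // s j = b}) = m) =
          Finset.univ.filter fun s : Fin k → V => (fun b => Fintype.card {j // s j = b}) = m := by
        ext s
        simp only [Finset.mem_filter, Fintype.mem_piFinset, Finset.mem_univ, true_and,
          and_iff_right_iff_imp]
        intro hs j
        by_contra hj
        have h1 := ((hmemT m).1 hmT).2 _ hj
        rw [← hs] at h1
        exact (Fintype.card_eq_zero_iff.1 h1).false ⟨j, rfl⟩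
      rw [hset]
      have h2 : ∑ s ∈ Finset.univ.filter
          (fun s : Fin k → V => (fun b => Fintype.card {j // s j = b}) = m),
          f (fun b => Fintype.card {j // s j = b}) = (Finset.univ.filter
            fun s : Fin k → V => (fun b => Fintype.card {j // s j = b}) = m).card * f m := by
        rw [← nsmul_eq_mul, ← Finset.sum_const]
        exact Finset.sum_congr rfl fun s hs => by rw [(Finset.mem_filter.1 hs).2]
      have h3 := congrArg (fun n : ℕ => (n : ℂ)) (card_fun_fibers m k hmk)
      push_cast at h3
      have h4 : (∏ b, ((m b)! : ℂ)) ≠ 0 :=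
        Finset.prod_ne_zero_iff.2 fun b _ => Nat.cast_ne_zero.2 (Nat.factorial_ne_zero _)
      have h5 : (k ! : ℂ) ≠ 0 := Nat.cast_ne_zero.2 (Nat.factorial_ne_zero _)
      rw [h2, ← h3]
      rw [← h3] at h5
      have h6 := left_ne_zero_of_mul h5
      field_simp
    · intro s hs
      have hs' := Fintype.mem_piFinset.1 hs
      refine Finset.mem_filter.2 ⟨(hmemT _).2 ⟨fun b _ => ?_, fun b hb => ?_⟩, sum_card_fibers s⟩
      · have := Fintype.card_subtype_le (fun j => s j = b)
        rw [Fintype.card_fin] at this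
        omega
      · exact Fintype.card_eq_zero_iff.2 ⟨fun j => hb (j.2 ▸ hs' j.1)⟩
  rw [Finset.sum_congr rfl hmain]
  -- multiplicities with more than `B` elements do not contribute
  have h7 : ∑ m ∈ T.filter (fun m => ∑ b, m b ∈ Finset.range (B + 1)),
      (∏ b, ((m b)! : ℂ))⁻¹ * f m = ∑ m ∈ T, (∏ b, ((m b)! : ℂ))⁻¹ * f m := by
    refine Finset.sum_subset (Finset.filter_subset _ _) fun m hm hm' => ?_
    rw [hf m, mul_zero]
    by_contra hcon
    exact hm' (Finset.mem_filter.2 ⟨hm, Finset.mem_range.2 (by omega)⟩)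
  rw [← h7]
  refine Eq.trans ?_ (Finset.sum_fiberwise_of_maps_to (t := Finset.range (B + 1))
    (s := T.filter (fun m => ∑ b, m b ∈ Finset.range (B + 1))) (g := fun m => ∑ b, m b)
    (fun m hm => (Finset.mem_filter.1 hm).2) _)
  refine Finset.sum_congr rfl fun k hk => Finset.sum_congr ?_ fun _ _ => rfl
  ext m
  simp only [Finset.mem_filter]
  constructor
  · rintro ⟨h1, h2⟩; exact ⟨⟨h1, h2 ▸ hk⟩, h2⟩
  · rintro ⟨⟨h1, _⟩, h2⟩; exact ⟨h1, h2⟩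

/-- The set of the first `l'` elements of `Fin m`, moved by a permutation. -/
def movedInitial {m : ℕ} (l' : ℕ) (σ : Equiv.Perm (Fin m)) : Finset (Fin m) :=
  Finset.univ.filter fun i => ((σ.symm i : Fin m) : ℕ) < l'

/-- Summation over permutations of a function that depends only on the image of the first `l'`
elements. -/
lemma sum_perm_movedInitial {m l' : ℕ} (hl : l' ≤ m) (T : Finset (Fin m) → ℂ) :
    ∑ σ : Equiv.Perm (Fin m), T (movedInitial l' σ) =
      (l' ! * (m - l')! : ℂ) * ∑ B ∈ Finset.univ.powersetCard l', T B := by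
  have hcardlt : Fintype.card {i : Fin m // (i : ℕ) < l'} = l' := by
    have e : {i : Fin m // (i : ℕ) < l'} ≃ Fin l' := ⟨fun i => ⟨i.1, i.2⟩,
      fun j => ⟨⟨j, by omega⟩, j.2⟩, fun _ => rfl, fun _ => rfl⟩
    rw [Fintype.card_congr e, Fintype.card_fin]
  rw [← Finset.sum_fiberwise_of_maps_to (t := Finset.univ.powersetCard l')
    (g := fun σ : Equiv.Perm (Fin m) => movedInitial l' σ), Finset.mul_sum]
  · refine Finset.sum_congr rfl fun B hB => ?_
    have hBc := (Finset.mem_powersetCard.1 hB).2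
    have h1 : ∑ σ ∈ Finset.univ.filter (fun σ : Equiv.Perm (Fin m) => movedInitial l' σ = B),
        T (movedInitial l' σ) = (Finset.univ.filter
          (fun σ : Equiv.Perm (Fin m) => movedInitial l' σ = B)).card * T B := by
      rw [← nsmul_eq_mul, ← Finset.sum_const]
      exact Finset.sum_congr rfl fun σ hσ => by rw [(Finset.mem_filter.1 hσ).2]
    rw [h1]
    congr 1
    -- the permutations that move the initial segment to `B` carry one indicator function to another
    let f : Fin m → Bool := fun i => decide (i ∈ B)
    let g : Fin m → Bool := fun i => decide ((i : ℕ) < l')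
    have hft : Fintype.card {i // f i = true} = l' := by
      rw [← hBc, ← Fintype.card_coe]
      exact Fintype.card_congr (Equiv.subtypeEquivRight fun i => by simp [f])
    have hgt : Fintype.card {i // g i = true} = l' := by
      rw [← hcardlt]
      exact Fintype.card_congr (Equiv.subtypeEquivRight fun i => by simp [g])
    have hcompl : ∀ h : Fin m → Bool, Fintype.card {i // h i = true} = l' →
        Fintype.card {i // h i = false} = m - l' := fun h hh => by
      have := Fintype.card_subtype_compl (fun i => h i = true)
      rw [hh, Fintype.card_fin] at this
      rw [← this]
      exact Fintype.card_congr (Equiv.subtypeEquivRight fun i => by simp)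
    have h2 := card_perm_comp_eq f g (fun b => by
      cases b
      · rw [hcompl f hft, hcompl g hgt]
      · rw [hft, hgt])
    rw [Fintype.prod_bool, hft, hcompl f hft] at h2
    rw [← Fintype.card_subtype]
    have h3 : Fintype.card {σ : Equiv.Perm (Fin m) // movedInitial l' σ = B} =
        Fintype.card {σ : Equiv.Perm (Fin m) // f ∘ σ = g} := by
      refine Fintype.card_congr (Equiv.subtypeEquivRight fun σ => ?_)
      simp only [Finset.ext_iff, movedInitial, Finset.mem_filter, Finset.mem_univ, true_and,
        funext_iff, Function.comp_apply, f, g, decide_eq_decide]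
      refine ⟨fun h i => by rw [← h, Equiv.symm_apply_apply], fun h i => ?_⟩
      rw [← h, Equiv.apply_symm_apply]
    rw [h3, h2]
    push_cast
    rfl
  · intro σ _
    refine Finset.mem_powersetCard.2 ⟨Finset.subset_univ _, ?_⟩
    rw [movedInitial, ← Fintype.card_subtype]
    refine Eq.trans ?_ hcardlt
    exact Fintype.card_congr (σ.symm.subtypeEquiv fun i => Iff.rfl)

/-! ### Joining a vertex to the open lines of a graph -/

section Insert

variable {V E : Type} [Fintype V] [DecidableEq V] [Fintype E]
variable {I : Type} [Fintype I] [DecidableEq I]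

/-- The sources of the lines after the vertex `a` has absorbed the open lines `Fin k` and emitted
the open lines `B`. -/
def joinSrc {k : ℕ} (a : V) (B : Finset I) (src : E ⊕ (Fin k ⊕ {i // i ∉ B}) → V) :
    (Fin k ⊕ E) ⊕ I → V
  | .inl (.inl j) => src (.inr (.inl j))
  | .inl (.inr e) => src (.inl e)
  | .inr i => if h : i ∈ B then a else src (.inr (.inr ⟨i, h⟩))

/-- The lines of a graph, regarded as lines of the graph with the additional vertex. -/
def joinLine {k : ℕ} (B : Finset I) : E ⊕ (Fin k ⊕ {i // i ∉ B}) → (Fin k ⊕ E) ⊕ I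
  | .inl e => .inl (.inr e)
  | .inr (.inl j) => .inl (.inl j)
  | .inr (.inr i) => .inr i.1

lemma joinLine_injective {k : ℕ} (B : Finset I) :
    Function.Injective (joinLine (E := E) (k := k) B) := by
  rintro (e | j | i) (e' | j' | i') h <;> simp_all [joinLine, Subtype.ext_iff]

lemma joinSrc_joinLine {k : ℕ} (a : V) (B : Finset I) (src : E ⊕ (Fin k ⊕ {i // i ∉ B}) → V) (x) :
    joinSrc a B src (joinLine B x) = src x := by
  rcases x with e | j | i
  · rfl
  · rfl
  · simp [joinLine, joinSrc, i.2]

/-- The lines that leave an old vertex. -/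
def joinFiberEquiv {k : ℕ} (a b : V) (hab : b ≠ a) (B : Finset I)
    (src : E ⊕ (Fin k ⊕ {i // i ∉ B}) → V) :
    {x // src x = b} ≃ {x // joinSrc a B src x = b} :=
  Equiv.ofBijective (fun x => ⟨joinLine B x.1, by rw [joinSrc_joinLine]; exact x.2⟩) (by
    constructor
    · intro x y h
      exact Subtype.ext (joinLine_injective B (congrArg Subtype.val h))
    · rintro ⟨(j | e) | i, h⟩
      · exact ⟨⟨.inr (.inl j), h⟩, rfl⟩
      · exact ⟨⟨.inl e, h⟩, rfl⟩
      · by_cases hi : i ∈ B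
        · simp only [joinSrc, hi, dif_pos] at h
          exact absurd h.symm hab
        · simp only [joinSrc, hi, dif_neg, not_false_iff] at h
          exact ⟨⟨.inr (.inr ⟨i, hi⟩), h⟩, rfl⟩)

/-- The lines that leave the new vertex. -/
def joinFiberEquivSelf {k : ℕ} (a : V) (B : Finset I)
    (src : E ⊕ (Fin k ⊕ {i // i ∉ B}) → V) (hsrc : ∀ x, src x ≠ a) :
    {i // i ∈ B} ≃ {x // joinSrc a B src x = a} :=
  Equiv.ofBijective (fun i => ⟨.inr i.1, by simp [joinSrc, i.2]⟩) (by
    constructor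
    · intro x y h
      exact Subtype.ext (Sum.inr_injective (congrArg Subtype.val h))
    · rintro ⟨(j | e) | i, h⟩
      · exact absurd h (hsrc _)
      · exact absurd h (hsrc _)
      · by_cases hi : i ∈ B
        · exact ⟨⟨i, hi⟩, rfl⟩
        · simp only [joinSrc, hi, dif_neg, not_false_iff] at h
          exact absurd h (hsrc _))

/-- The amplitude of a graph with an additional vertex `a`, which absorbs the open lines `Fin k`
and emits the open lines `B`. -/
lemma amplitude_insert (K : V → VertexKernel) (w : Finset V) (Φ : 𝓢(V → Mom, ℂ)) (a : V)
    (ha : a ∉ w) (B : Finset I) {k : ℕ} (src : E ⊕ (Fin k ⊕ {i // i ∉ B}) → V) (tgt : E → V)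
    (hsrc : ∀ x, src x ∈ w) (htgt : ∀ e, tgt e ≠ a) (P : I → Mom) (κ : V → Mom) :
    Integrable (fun y : Fin k → Mom => (K a).eval (fun i : {i // i ∈ B} => P i) y *
        amplitude K w Φ src tgt (Sum.elim y fun i => P i)
          (Function.update κ a (∑ i : {i // i ∈ B}, P i - ∑ j, y j))) ∧
    amplitude K (insert a w) Φ (joinSrc a B src) (Sum.elim (fun _ => a) tgt) P κ =
      ∫ y : Fin k → Mom, (K a).eval (fun i : {i // i ∈ B} => P i) y *
        amplitude K w Φ src tgt (Sum.elim y fun i => P i)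
          (Function.update κ a (∑ i : {i // i ∈ B}, P i - ∑ j, y j)) := by
  have hsa : ∀ x, src x ≠ a := fun x h => ha (h ▸ hsrc x)
  have hsrc' : ∀ x, joinSrc a B src x ∈ insert a w := by
    rintro ((j | e) | i)
    · exact Finset.mem_insert_of_mem (hsrc _)
    · exact Finset.mem_insert_of_mem (hsrc _)
    · by_cases hi : i ∈ B
      · simp [joinSrc, hi]
      · simp only [joinSrc, hi, dif_neg, not_false_iff]
        exact Finset.mem_insert_of_mem (hsrc _)
  have hint := amplitude_integrable K (insert a w) Φ (joinSrc a B src) (Sum.elim (fun _ => a) tgt)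
    hsrc' P κ
  set f : (Fin k ⊕ E → Mom) → ℂ := fun p => vertexWeight K (insert a w) (joinSrc a B src)
    (Sum.elim (fun _ => a) tgt) P p * Φ (slotArgs (insert a w) (joinSrc a B src)
      (Sum.elim (fun _ => a) tgt) P κ p) with hf
  have hmp := (volume_measurePreserving_sumPiEquivProdPi_symm (fun _ : Fin k ⊕ E => Mom))
  have hemb := (MeasurableEquiv.sumPiEquivProdPi (fun _ : Fin k ⊕ E => Mom)).symm.measurableEmbedding
  have hint2 : Integrable fun z => f ((MeasurableEquiv.sumPiEquivProdPi
      (fun _ : Fin k ⊕ E => Mom)).symm z) := (hmp.integrable_comp_emb hemb).2 hint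
  -- the integrand factorizes at the vertex `a`, whose slot becomes its momentum defect
  have hval : ∀ (y : Fin k → Mom) (p : E → Mom),
      f ((MeasurableEquiv.sumPiEquivProdPi (fun _ : Fin k ⊕ E => Mom)).symm (y, p)) =
      (K a).eval (fun i : {i // i ∈ B} => P i) y *
        (vertexWeight K w src tgt (Sum.elim y fun i => P i) p *
          Φ (slotArgs w src tgt (Sum.elim y fun i => P i)
            (Function.update κ a (∑ i : {i // i ∈ B}, P i - ∑ j, y j)) p)) := by
    intro y p
    have hyp : (MeasurableEquiv.sumPiEquivProdPi (fun _ : Fin k ⊕ E => Mom)).symm (y, p) =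
        Sum.elim y p := by
      ext1 x; rcases x with j | e <;> rfl
    have hmom : ∀ x, Sum.elim (Sum.elim y p) P (joinLine B x) =
        Sum.elim p (Sum.elim y fun i : {i // i ∉ B} => P i) x := by
      rintro (e | j | i) <;> rfl
    -- momenta at an old vertex
    have hO : ∀ b (hb : b ≠ a), (fun x : {x // src x = b} =>
        Sum.elim p (Sum.elim y fun i : {i // i ∉ B} => P i) x) = fun x =>
        (fun z : {z // joinSrc a B src z = b} => Sum.elim (Sum.elim y p) P z)
          (joinFiberEquiv a b hb B src x) := fun b hb => by
      ext1 x; exact (hmom x).symm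
    let eI : ∀ b, b ≠ a → ({e // tgt e = b} ≃
        {x : Fin k ⊕ E // Sum.elim (fun _ => a) tgt x = b}) := fun b hb =>
      Equiv.ofBijective (fun e => ⟨.inr e.1, e.2⟩) (by
        constructor
        · intro x y h
          exact Subtype.ext (Sum.inr_injective (congrArg Subtype.val h))
        · rintro ⟨j | e, h⟩
          · exact absurd h.symm hb
          · exact ⟨⟨e, h⟩, rfl⟩)
    have hI : ∀ b (hb : b ≠ a), (fun x : {x // tgt x = b} => p x) = fun x =>
        (fun z : {z : Fin k ⊕ E // Sum.elim (fun _ => a) tgt z = b} => Sum.elim y p z)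
          (eI b hb x) := fun b hb => rfl
    -- momenta at the new vertex
    have hOa : (fun i : {i // i ∈ B} => P i) = fun i =>
        (fun z : {z // joinSrc a B src z = a} => Sum.elim (Sum.elim y p) P z)
          (joinFiberEquivSelf a B src hsa i) := rfl
    let eIa : Fin k ≃ {x : Fin k ⊕ E // Sum.elim (fun _ => a) tgt x = a} :=
      Equiv.ofBijective (fun j => ⟨.inl j, rfl⟩) (by
        constructor
        · intro x y h
          exact Sum.inl_injective (congrArg Subtype.val h)
        · rintro ⟨j | e, h⟩
          · exact ⟨j, rfl⟩
          · exact absurd h (htgt e))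
    have hIa : y = fun j => (fun z : {z : Fin k ⊕ E // Sum.elim (fun _ => a) tgt z = a} =>
        Sum.elim y p z) (eIa j) := rfl
    rw [hyp, hf]
    simp only
    rw [vertexWeight, Finset.prod_insert ha, mul_assoc]
    congr 1
    · rw [hOa, hIa]
      exact ((K a).eval_equiv (joinFiberEquivSelf a B src hsa) eIa _ _).symm
    · congr 1
      · unfold vertexWeight
        refine Finset.prod_congr rfl fun b hb => ?_
        have hba : b ≠ a := fun h => ha (h ▸ hb)
        rw [hO b hba, hI b hba]
        exact ((K b).eval_equiv (joinFiberEquiv a b hba B src) (eI b hba) _ _).symm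
      · congr 1
        ext1 b
        unfold slotArgs lineDefect
        by_cases hba : b = a
        · subst hba
          simp only [Finset.mem_insert_self, if_true, ha, if_false, Function.update_self]
          congr 1
          · have := congrArg (fun g => ∑ x, g x) hOa
            simp only at this
            rw [this]
            exact (Equiv.sum_comp (joinFiberEquivSelf b B src hsa) _).symm
          · rw [hIa]
            exact (Equiv.sum_comp eIa _).symm
        · by_cases hbw : b ∈ w
          · simp only [Finset.mem_insert_of_mem hbw, hbw, if_true]
            congr 1
            · have := congrArg (fun g => ∑ x, g x) (hO b hba)
              simp only at this
              rw [this]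
              exact (Equiv.sum_comp (joinFiberEquiv a b hba B src)
                (fun z : {z // joinSrc a B src z = b} => Sum.elim (Sum.elim y p) P z)).symm
            · exact (Equiv.sum_comp (eI b hba)
                (fun z : {z : Fin k ⊕ E // Sum.elim (fun _ => a) tgt z = b} =>
                  Sum.elim y p z)).symm
          · simp [hba, hbw]
  have hprod : ∀ y, (∫ p : E → Mom, f ((MeasurableEquiv.sumPiEquivProdPi
      (fun _ : Fin k ⊕ E => Mom)).symm (y, p))) = (K a).eval (fun i : {i // i ∈ B} => P i) y *
        amplitude K w Φ src tgt (Sum.elim y fun i => P i)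
          (Function.update κ a (∑ i : {i // i ∈ B}, P i - ∑ j, y j)) := fun y => by
    simp only [hval]
    rw [integral_const_mul]; rfl
  constructor
  · have := hint2.integral_prod_left
    simp only [hprod] at this
    exact this
  · have h1 := hmp.integral_comp hemb f
    unfold amplitude at hprod ⊢
    rw [← h1, Measure.volume_eq_prod, integral_prod _ hint2]
    exact integral_congr_ae (Eventually.of_forall hprod)

end Insert

/-! ### Sums over graphs with open lines -/

section GraphSum

variable {V : Type} [Fintype V] [DecidableEq V]

/-- The lines of a graph with `μ a b` lines from `a` to `b`. -/
abbrev MultLine (μ : V → V → ℕ) : Type := (ab : V × V) × Fin (μ ab.1 ab.2)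

lemma card_multLine (μ : V → V → ℕ) (a b : V) :
    Fintype.card {e : MultLine μ // e.1.1 = a ∧ e.1.2 = b} = μ a b := by
  rw [Fintype.card_congr ((Equiv.subtypeEquivRight (q := fun e : MultLine μ => e.1 = (a, b))
    fun e => by rw [Prod.ext_iff]).trans (Equiv.sigmaSubtype (a, b))), Fintype.card_fin]

lemma card_multLine_target (μ : V → V → ℕ) (b : V) :
    Fintype.card {e : MultLine μ // e.1.2 = b} = ∑ a, μ a b := by
  have e : {e : MultLine μ // e.1.2 = b} ≃ Σ a, {e : MultLine μ // e.1.1 = a ∧ e.1.2 = b} :=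
    ⟨fun e => ⟨e.1.1.1, e.1, rfl, e.2⟩, fun x => ⟨x.2.1, x.2.2.2⟩, fun _ => rfl, by
      rintro ⟨a, e, rfl, h⟩; rfl⟩
  rw [Fintype.card_congr e, Fintype.card_sigma]
  simp only [card_multLine]

variable (r : V → V → Prop) [DecidableRel r]

/-- The admissible numbers of lines between the vertices in `w`: at most `B` lines from `b` to `a`
if `r b a`, and none otherwise. -/
def multSet (B : ℕ) (w : Finset V) : Finset (V → V → ℕ) :=
  Fintype.piFinset fun b => Fintype.piFinset fun a =>
    if b ∈ w ∧ a ∈ w ∧ r b a then Finset.range (B + 1) else {0}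

variable {r} in
lemma mem_multSet {B : ℕ} {w : Finset V} {μ : V → V → ℕ} : μ ∈ multSet r B w ↔
    ∀ b a, μ b a ≤ B ∧ (μ b a ≠ 0 → b ∈ w ∧ a ∈ w ∧ r b a) := by
  unfold multSet
  simp only [Fintype.mem_piFinset]
  refine forall₂_congr fun b a => ?_
  split_ifs with h
  · simp [h]
  · simp only [Finset.mem_singleton, h, imp_false, not_not]
    exact ⟨fun h => ⟨by omega, h⟩, fun h => h.2⟩

/-- The sum over all graphs with vertices `w` and open lines `I`, with inverse symmetry factors. -/
def graphSum (K : V → VertexKernel) (B : ℕ) (w : Finset V) (Φ : (V → Mom) → ℂ) {I : Type}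
    [Fintype I] [DecidableEq I] (P : I → Mom) (κ : V → Mom) : ℂ :=
  ∑ μ ∈ multSet r B w, ∑ s ∈ Fintype.piFinset (fun _ : I => w),
    (∏ b, ∏ a, ((μ b a)! : ℂ))⁻¹ *
      amplitude K w Φ (Sum.elim (fun e : MultLine μ => e.1.1) s) (fun e => e.1.2) P κ

lemma graphSum_equiv (K : V → VertexKernel) (B : ℕ) (w : Finset V) (Φ : (V → Mom) → ℂ)
    {I I' : Type} [Fintype I] [DecidableEq I] [Fintype I'] [DecidableEq I'] (f : I ≃ I')
    (P : I' → Mom) (κ : V → Mom) :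
    graphSum r K B w Φ (P ∘ f) κ = graphSum r K B w Φ P κ := by
  unfold graphSum
  refine Finset.sum_congr rfl fun μ _ => ?_
  refine Finset.sum_nbij' (fun s => s ∘ f.symm) (fun s => s ∘ f) (fun s hs => ?_) (fun s hs => ?_)
    (fun s _ => ?_) (fun s _ => ?_) fun s _ => ?_
  · exact Fintype.mem_piFinset.2 fun i => Fintype.mem_piFinset.1 hs _
  · exact Fintype.mem_piFinset.2 fun i => Fintype.mem_piFinset.1 hs _
  · ext i; simp
  · ext i; simp
  · congr 1
    exact amplitude_congr_equiv K w Φ (Equiv.refl _) f _ _ _ _ (fun x => rfl) (fun x => by simp)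
      (fun x => rfl) P κ

/-- The numbers of lines of a graph with an additional vertex `a`, at which `m b` lines from `b`
end. -/
def joinMult (a : V) (μ : V → V → ℕ) (m : V → ℕ) : V → V → ℕ :=
  fun b c => if c = a then m b else μ b c

lemma prod_joinMult (a : V) (μ : V → V → ℕ) (m : V → ℕ) (hμ : ∀ b, μ b a = 0) :
    ∏ b, ∏ c, ((joinMult a μ m b c)! : ℂ) = (∏ b, ((m b)! : ℂ)) * ∏ b, ∏ c, ((μ b c)! : ℂ) := by
  rw [← Finset.prod_mul_distrib]
  refine Finset.prod_congr rfl fun b _ => ?_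
  rw [← Finset.mul_prod_erase _ _ (Finset.mem_univ a),
    ← Finset.mul_prod_erase Finset.univ (fun c => ((μ b c)! : ℂ)) (Finset.mem_univ a), hμ b]
  simp only [joinMult, if_true, Nat.factorial_zero, Nat.cast_one, one_mul]
  congr 1
  refine Finset.prod_congr rfl fun c hc => ?_
  rw [if_neg (Finset.ne_of_mem_erase hc)]

/-- Multiplicities on `insert a w`, where no lines leave `a`, consist of multiplicities on `w` and
of the numbers of lines that run to `a`. -/
lemma sum_multSet_insert (B : ℕ) (w : Finset V) (a : V) (ha : a ∉ w) (hr : ∀ b ∈ w, r b a)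
    (hr' : ∀ b ∈ insert a w, ¬ r a b) (G : (V → V → ℕ) → ℂ) :
    ∑ μ' ∈ multSet r B (insert a w), G μ' = ∑ μ ∈ multSet r B w,
      ∑ m ∈ Fintype.piFinset (fun b => if b ∈ w then Finset.range (B + 1) else {0}),
        G (joinMult a μ m) := by
  have hT : ∀ m, m ∈ Fintype.piFinset (fun b => if b ∈ w then Finset.range (B + 1) else {0}) ↔
      ∀ b, m b ≤ B ∧ (m b ≠ 0 → b ∈ w) := by
    intro m
    rw [Fintype.mem_piFinset]
    refine forall_congr' fun b => ?_
    split_ifs with h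
    · simp [h]
    · simp only [Finset.mem_singleton, h, imp_false, not_not]
      exact ⟨fun h => ⟨by omega, h⟩, fun h => h.2⟩
  rw [← Finset.sum_product']
  refine (Finset.sum_nbij' (fun x => joinMult a x.1 x.2)
    (fun μ' => (fun b c => if c = a then 0 else μ' b c, fun b => μ' b a)) ?_ ?_ ?_ ?_ ?_).symm
  · rintro ⟨μ, m⟩ h
    obtain ⟨h1, h2⟩ := Finset.mem_product.1 h
    have h1 := mem_multSet.1 h1
    have h2 := (hT _).1 h2
    refine mem_multSet.2 fun b c => ?_
    unfold joinMult
    dsimp only at h1 h2 ⊢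
    split_ifs with hc
    · subst hc
      refine ⟨(h2 b).1, fun h => ?_⟩
      have := (h2 b).2 h
      exact ⟨Finset.mem_insert_of_mem this, Finset.mem_insert_self _ _, hr b this⟩
    · refine ⟨(h1 b c).1, fun h => ?_⟩
      obtain ⟨h3, h4, h5⟩ := (h1 b c).2 h
      exact ⟨Finset.mem_insert_of_mem h3, Finset.mem_insert_of_mem h4, h5⟩
  · intro μ' h
    have h := mem_multSet.1 h
    have hb : ∀ b c, μ' b c ≠ 0 → b ∈ w := fun b c h0 => by
      obtain ⟨h3, h4, h5⟩ := (h b c).2 h0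
      rcases Finset.mem_insert.1 h3 with rfl | h3
      · exact absurd h5 (hr' c h4)
      · exact h3
    refine Finset.mem_product.2 ⟨mem_multSet.2 fun b c => ?_, (hT _).2 fun b => ?_⟩
    · dsimp only
      split_ifs with hc
      · simp
      · refine ⟨(h b c).1, fun h0 => ⟨hb b c h0, ?_, ((h b c).2 h0).2.2⟩⟩
        exact (Finset.mem_insert.1 ((h b c).2 h0).2.1).resolve_left hc
    · exact ⟨(h b a).1, hb b a⟩
  · rintro ⟨μ, m⟩ h
    have h1 := mem_multSet.1 (Finset.mem_product.1 h).1
    ext b c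
    · simp only [joinMult]
      split_ifs with hc
      · subst hc
        by_contra h0
        exact ha ((h1 b c).2 (Ne.symm h0)).2.1
      · rfl
    · simp [joinMult]
  · intro μ' _
    ext b c
    simp only [joinMult]
    split_ifs with hc
    · rw [hc]
    · rfl
  · rintro _ _; rfl

/-- A function on the complement of `S`, extended by the value `a`. -/
def extendBy {I : Type} [DecidableEq I] (a : V) (S : Finset I) (s : {i // i ∉ S} → V) : I → V :=
  fun i => if h : i ∈ S then a else s ⟨i, h⟩

/-- Open lines are distributed over the vertices by choosing the set `S` of those that `a` emits. -/
lemma sum_extendBy {I : Type} [Fintype I] [DecidableEq I] (w : Finset V) (a : V) (ha : a ∉ w)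
    (G : (I → V) → ℂ) :
    ∑ s ∈ Fintype.piFinset (fun _ : I => insert a w), G s = ∑ S : Finset I,
      ∑ s ∈ Fintype.piFinset (fun _ : {i // i ∉ S} => w), G (extendBy a S s) := by
  rw [← Finset.sum_fiberwise (g := fun s : I → V => Finset.univ.filter fun i => s i = a)]
  refine Finset.sum_congr rfl fun S _ => ?_
  refine (Finset.sum_nbij' (fun s => extendBy a S s) (fun s i => s i.1) ?_ ?_ ?_ ?_ ?_).symm
  · intro s hs
    have hs := Fintype.mem_piFinset.1 hs
    refine Finset.mem_filter.2 ⟨Fintype.mem_piFinset.2 fun i => ?_, ?_⟩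
    · unfold extendBy
      split_ifs with h
      · exact Finset.mem_insert_self _ _
      · exact Finset.mem_insert_of_mem (hs _)
    · ext i
      refine Finset.mem_filter.trans ?_
      simp only [Finset.mem_univ, true_and, extendBy]
      split_ifs with h
      · simp [h]
      · simp only [h, iff_false]
        exact fun h' => ha (h' ▸ hs _)
  · intro s hs
    obtain ⟨h1, rfl⟩ := Finset.mem_filter.1 hs
    refine Fintype.mem_piFinset.2 fun i => ?_
    have h2 := i.2
    simp only [Finset.mem_filter, Finset.mem_univ, true_and] at h2
    exact (Finset.mem_insert.1 (Fintype.mem_piFinset.1 h1 i.1)).resolve_left h2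
  · intro s _
    ext i
    simp [extendBy, i.2]
  · intro s hs
    obtain ⟨h1, rfl⟩ := Finset.mem_filter.1 hs
    ext i
    simp only [extendBy, Finset.mem_filter, Finset.mem_univ, true_and]
    split_ifs with h
    · exact h.symm
    · rfl
  · intro s _; rfl

lemma sum_piFinset_sum {A C : Type} [Fintype A] [DecidableEq A] [Fintype C] [DecidableEq C]
    (w : Finset V) (G : (A ⊕ C → V) → ℂ) :
    ∑ s ∈ Fintype.piFinset (fun _ : A ⊕ C => w), G s =
      ∑ s₁ ∈ Fintype.piFinset (fun _ : A => w), ∑ s₂ ∈ Fintype.piFinset (fun _ : C => w),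
        G (Sum.elim s₁ s₂) := by
  rw [← Finset.sum_product']
  refine Finset.sum_nbij' (fun s => (s ∘ Sum.inl, s ∘ Sum.inr)) (fun x => Sum.elim x.1 x.2)
    ?_ ?_ ?_ ?_ ?_
  · intro s hs
    have hs := Fintype.mem_piFinset.1 hs
    exact Finset.mem_product.2 ⟨Fintype.mem_piFinset.2 fun i => hs _,
      Fintype.mem_piFinset.2 fun i => hs _⟩
  · rintro ⟨s₁, s₂⟩ h
    obtain ⟨h1, h2⟩ := Finset.mem_product.1 h
    refine Fintype.mem_piFinset.2 ?_
    rintro (i | i)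
    · exact Fintype.mem_piFinset.1 h1 i
    · exact Fintype.mem_piFinset.1 h2 i
  · intro s _; exact Sum.elim_comp_inl_inr s
  · rintro ⟨s₁, s₂⟩ _; rfl
  · intro s _; rw [Sum.elim_comp_inl_inr]

/-- The recursion for graph sums: the additional vertex `a`, which is later than all the others,
emits the open lines `S` and absorbs `k` of the open lines of the remaining graph. -/
lemma graphSum_insert (K : V → VertexKernel) (B : ℕ) (w : Finset V) (Φ : 𝓢(V → Mom, ℂ)) (a : V)
    (ha : a ∉ w) (hr : ∀ b ∈ w, r b a) (hr' : ∀ b ∈ insert a w, ¬ r a b) (hB : (K a).bound ≤ B)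
    {I : Type} [Fintype I] [DecidableEq I] (P : I → Mom) (κ : V → Mom) :
    graphSum r K B (insert a w) Φ P κ = ∑ S : Finset I, ∑ k ∈ Finset.range (B + 1),
      (k ! : ℂ)⁻¹ * ∫ y : Fin k → Mom, (K a).eval (fun i : {i // i ∈ S} => P i) y *
        graphSum r K B w Φ (Sum.elim y fun i : {i // i ∉ S} => P i)
          (Function.update κ a (∑ i : {i // i ∈ S}, P i - ∑ j, y j)) := by
  -- left side: the lines into `a` and the open lines emitted by `a` are split off
  have hL : graphSum r K B (insert a w) Φ P κ = ∑ μ ∈ multSet r B w,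
      ∑ m ∈ Fintype.piFinset (fun b => if b ∈ w then Finset.range (B + 1) else {0}),
        ∑ S : Finset I, ∑ s ∈ Fintype.piFinset (fun _ : {i // i ∉ S} => w),
          (∏ b, ∏ c, ((joinMult a μ m b c)! : ℂ))⁻¹ * amplitude K (insert a w) Φ
            (Sum.elim (fun e : MultLine (joinMult a μ m) => e.1.1) (extendBy a S s))
            (fun e => e.1.2) P κ := by
    unfold graphSum
    rw [sum_multSet_insert r B w a ha hr hr']
    refine Finset.sum_congr rfl fun μ _ => Finset.sum_congr rfl fun m _ => ?_
    rw [sum_extendBy w a ha]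
  -- right side: the absorbed lines are integrated, which joins their sources to `a`
  have hR : ∀ (S : Finset I) (k : ℕ), (∫ y : Fin k → Mom,
      (K a).eval (fun i : {i // i ∈ S} => P i) y *
        graphSum r K B w Φ (Sum.elim y fun i : {i // i ∉ S} => P i)
          (Function.update κ a (∑ i : {i // i ∈ S}, P i - ∑ j, y j))) =
      ∑ μ ∈ multSet r B w, ∑ s₁ ∈ Fintype.piFinset (fun _ : Fin k => w),
        ∑ s ∈ Fintype.piFinset (fun _ : {i // i ∉ S} => w), (∏ b, ∏ c, ((μ b c)! : ℂ))⁻¹ *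
          amplitude K (insert a w) Φ (Sum.elim (fun e : MultLine (joinMult a μ
            (fun b => Fintype.card {j // s₁ j = b})) => e.1.1) (extendBy a S s))
            (fun e => e.1.2) P κ := by
    intro S k
    have hμa : ∀ μ ∈ multSet r B w, ∀ b, μ b a = 0 := fun μ hμ b => by
      by_contra h0
      exact ha ((mem_multSet.1 hμ b a).2 h0).2.1
    have hins : ∀ μ ∈ multSet r B w, ∀ s ∈ Fintype.piFinset (fun _ : Fin k ⊕ {i // i ∉ S} => w),
        _ := fun μ hμ s hs => amplitude_insert K w Φ a ha S
          (Sum.elim (fun e : MultLine μ => e.1.1) s) (fun e => e.1.2) (by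
            rintro (e | i)
            · exact ((mem_multSet.1 hμ e.1.1 e.1.2).2 (Fin.pos e.2).ne').1
            · exact Fintype.mem_piFinset.1 hs i) (fun e h => by
            exact absurd (hμa μ hμ e.1.1) (h ▸ (Fin.pos e.2).ne')) P κ
    have h1 : ∀ y : Fin k → Mom, (K a).eval (fun i : {i // i ∈ S} => P i) y *
        graphSum r K B w Φ (Sum.elim y fun i : {i // i ∉ S} => P i)
          (Function.update κ a (∑ i : {i // i ∈ S}, P i - ∑ j, y j)) =
        ∑ μ ∈ multSet r B w, ∑ s ∈ Fintype.piFinset (fun _ : Fin k ⊕ {i // i ∉ S} => w),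
          (∏ b, ∏ c, ((μ b c)! : ℂ))⁻¹ * ((K a).eval (fun i : {i // i ∈ S} => P i) y *
            amplitude K w Φ (Sum.elim (fun e : MultLine μ => e.1.1) s) (fun e => e.1.2)
              (Sum.elim y fun i : {i // i ∉ S} => P i)
              (Function.update κ a (∑ i : {i // i ∈ S}, P i - ∑ j, y j))) := by
      intro y
      unfold graphSum
      rw [Finset.mul_sum]
      refine Finset.sum_congr rfl fun μ _ => ?_
      rw [Finset.mul_sum]
      exact Finset.sum_congr rfl fun s _ => by ring
    simp only [h1]
    rw [integral_finsetSum _ fun μ hμ => integrable_finsetSum _ fun s hs =>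
      (hins μ hμ s hs).1.const_mul _]
    refine Finset.sum_congr rfl fun μ hμ => ?_
    rw [integral_finsetSum _ fun s hs => (hins μ hμ s hs).1.const_mul _]
    rw [Finset.sum_congr rfl fun s hs => by rw [integral_const_mul, ← (hins μ hμ s hs).2]]
    rw [sum_piFinset_sum]
    refine Finset.sum_congr rfl fun s₁ _ => Finset.sum_congr rfl fun s _ => ?_
    congr 1
    have hsrc : joinSrc a S (Sum.elim (fun e : MultLine μ => e.1.1) (Sum.elim s₁ s)) =
        Sum.elim (Sum.elim s₁ fun e : MultLine μ => e.1.1) (extendBy a S s) := by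
      ext1 x
      rcases x with (j | e) | i
      · rfl
      · rfl
      · rfl
    rw [hsrc]
    refine amplitude_congr_card K (insert a w) Φ _ _ _ _ _ (fun b c => ?_) P κ
    rw [card_multLine]
    have e : {e : Fin k ⊕ MultLine μ // Sum.elim s₁ (fun e => e.1.1) e = b ∧
        Sum.elim (fun _ => a) (fun e => e.1.2) e = c} ≃
        {j // s₁ j = b ∧ a = c} ⊕ {e : MultLine μ // e.1.1 = b ∧ e.1.2 = c} := by
      exact Equiv.subtypeSum
    rw [Fintype.card_congr e, Fintype.card_sum, card_multLine]
    unfold joinMult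
    split_ifs with hc
    · subst hc
      rw [hμa μ hμ b, add_zero]
      exact Fintype.card_congr (Equiv.subtypeEquivRight fun j => by simp)
    · rw [Fintype.card_eq_zero_iff.2 ⟨fun j => hc j.2.2.symm⟩, zero_add]
  -- absorbed lines are counted by their sources
  have hsum : ∀ (S : Finset I), ∑ k ∈ Finset.range (B + 1),
      (k ! : ℂ)⁻¹ * ∫ y : Fin k → Mom, (K a).eval (fun i : {i // i ∈ S} => P i) y *
        graphSum r K B w Φ (Sum.elim y fun i : {i // i ∉ S} => P i)
          (Function.update κ a (∑ i : {i // i ∈ S}, P i - ∑ j, y j)) =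
      ∑ μ ∈ multSet r B w,
        ∑ m ∈ Fintype.piFinset (fun b => if b ∈ w then Finset.range (B + 1) else {0}),
        ∑ s ∈ Fintype.piFinset (fun _ : {i // i ∉ S} => w),
          (∏ b, ∏ c, ((joinMult a μ m b c)! : ℂ))⁻¹ * amplitude K (insert a w) Φ
            (Sum.elim (fun e : MultLine (joinMult a μ m) => e.1.1) (extendBy a S s))
            (fun e => e.1.2) P κ := by
    intro S
    simp only [hR, Finset.mul_sum]
    rw [Finset.sum_comm]
    refine Finset.sum_congr rfl fun μ hμ => ?_
    have h2 := sum_functions_by_fibers w B (fun m => ∑ s ∈ Fintype.piFinset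
      (fun _ : {i // i ∉ S} => w), (∏ b, ∏ c, ((μ b c)! : ℂ))⁻¹ * amplitude K (insert a w) Φ
        (Sum.elim (fun e : MultLine (joinMult a μ m) => e.1.1) (extendBy a S s))
          (fun e => e.1.2) P κ) (fun m hm => by
        refine Finset.sum_eq_zero fun s _ => ?_
        rw [amplitude]
        refine mul_eq_zero_of_right _ (integral_eq_zero_of_ae (Eventually.of_forall fun p => ?_))
        simp only [Pi.zero_apply]
        rw [vertexWeight, Finset.prod_insert ha, VertexKernel.eval_eq_zero]
        · simp
        · rw [card_multLine_target]
          simp only [joinMult, if_true]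
          omega)
    simp only [Finset.mul_sum] at h2
    rw [h2]
    refine Finset.sum_congr rfl fun m _ => Finset.sum_congr rfl fun s _ => ?_
    rw [prod_joinMult a μ m, mul_inv, mul_assoc]
    intro b
    by_contra h0
    exact ha ((mem_multSet.1 hμ b a).2 h0).2.1
  simp only [hsum]
  rw [hL, Finset.sum_comm (s := Finset.univ)]
  refine Finset.sum_congr rfl fun μ _ => ?_
  rw [Finset.sum_comm]

end GraphSum

/-! ### Fock space operators with vertex kernels, and Wick's theorem -/

section Wick

/-- The operator on Fock vectors with a given vertex kernel, the slot `x` being the transferred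
momentum. -/
def kernelOp {X : Type} [DecidableEq X] (K : VertexKernel) (B : ℕ) (x : X) (Ψ : Fock X) : Fock X :=
  ∑ l' ∈ Finset.range (B + 1), ∑ l ∈ Finset.range (B + 1),
    secondQuant (fun f p' κ => ∫ p : Fin l → Mom, K.toFun l' l p' p / ((l' ! : ℂ) * (l ! : ℂ)) *
      f p (Function.update κ x (∑ j, p' j - ∑ j, p j))) Ψ

variable {V : Type} [Fintype V] [DecidableEq V] (r : V → V → Prop) [DecidableRel r]

/-- The enumeration of the first `l'` entries of a permutation. -/
def movedInitialEquiv {m l' : ℕ} (h : l' ≤ m) (σ : Equiv.Perm (Fin m)) :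
    Fin l' ≃ {i // i ∈ movedInitial l' σ} :=
  Equiv.ofBijective (fun j => ⟨σ (Fin.castLE h j), by simp [movedInitial]⟩) (by
    constructor
    · intro i j hij
      simpa using congrArg Subtype.val hij
    · rintro ⟨i, hi⟩
      simp only [movedInitial, Finset.mem_filter, Finset.mem_univ, true_and] at hi
      exact ⟨⟨σ.symm i, hi⟩, Subtype.ext (by simp)⟩)

/-- The enumeration of the remaining entries of a permutation. -/
def movedRestEquiv {m l' : ℕ} (h : l' ≤ m) (σ : Equiv.Perm (Fin m)) :
    Fin (m - l') ≃ {i // i ∉ movedInitial l' σ} :=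
  Equiv.ofBijective (fun j => ⟨σ ⟨l' + j, by omega⟩, by simp [movedInitial]⟩) (by
    constructor
    · intro i j hij
      have := congrArg Subtype.val hij
      simp only [EmbeddingLike.apply_eq_iff_eq, Fin.mk.injEq] at this
      ext; omega
    · rintro ⟨i, hi⟩
      simp only [movedInitial, Finset.mem_filter, Finset.mem_univ, true_and, not_lt] at hi
      refine ⟨⟨σ.symm i - l', by omega⟩, Subtype.ext ?_⟩
      have : (⟨l' + ((σ.symm i : ℕ) - l'), by omega⟩ : Fin m) = σ.symm i := by
        ext; simp only; omega
      simp [this])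

/-- A single term of a vertex operator, applied to a sum over graphs: the `l'` emitted lines form a
subset of the open lines, and the square roots in the definition of the Fock space operators combine
to the normalization of the new vector. -/
lemma secondQuant_graphSum (K : V → VertexKernel) (B : ℕ) (w : Finset V) (Φ : 𝓢(V → Mom, ℂ)) (a : V)
    (l' l m : ℕ) (h : l' ≤ m) (P : Fin m → Mom) (κ : V → Mom) :
    secondQuant (fun f p' κ => ∫ p : Fin l → Mom, (K a).toFun l' l p' p / ((l' ! : ℂ) * (l ! : ℂ)) *
      f p (Function.update κ a (∑ j, p' j - ∑ j, p j)))
        (fun l P κ => ((Real.sqrt (l ! : ℝ) : ℝ) : ℂ)⁻¹ * graphSum r K B w Φ P κ) m P κ =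
    ((Real.sqrt (m ! : ℝ) : ℝ) : ℂ)⁻¹ * ∑ S ∈ (Finset.univ : Finset (Fin m)).powersetCard l', (l ! : ℂ)⁻¹ *
      ∫ y : Fin l → Mom, (K a).eval (fun i : {i // i ∈ S} => P i) y *
        graphSum r K B w Φ (Sum.elim y fun i : {i // i ∉ S} => P i)
          (Function.update κ a (∑ i : {i // i ∈ S}, P i - ∑ j, y j)) := by
  unfold secondQuant
  rw [dif_pos h]
  let T : Finset (Fin m) → ℂ := fun S =>
    ∫ y : Fin l → Mom, (K a).eval (fun i : {i // i ∈ S} => P i) y *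
        graphSum r K B w Φ (Sum.elim y fun i : {i // i ∉ S} => P i)
          (Function.update κ a (∑ i : {i // i ∈ S}, P i - ∑ j, y j))
  -- a permutation contributes only through the image of the first `l'` elements
  have hterm : ∀ σ : Equiv.Perm (Fin m), (∫ p : Fin l → Mom,
      (K a).toFun l' l (fun j => P (σ (Fin.castLE h j))) p / ((l' ! : ℂ) * (l ! : ℂ)) *
      (((Real.sqrt ((l + (m - l'))! : ℝ) : ℝ) : ℂ)⁻¹ * graphSum r K B w Φ
        (Fin.append p fun j : Fin (m - l') => P (σ ⟨l' + j, by omega⟩))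
          (Function.update κ a (∑ j, P (σ (Fin.castLE h j)) - ∑ j, p j)))) =
      ((l' ! : ℂ) * (l ! : ℂ))⁻¹ * ((Real.sqrt ((l + (m - l'))! : ℝ) : ℝ) : ℂ)⁻¹ *
        T (movedInitial l' σ) := by
    intro σ
    rw [← integral_const_mul]
    refine integral_congr_ae (Eventually.of_forall fun y => ?_)
    have h1 := (K a).eval_eq (movedInitialEquiv h σ) (Equiv.refl (Fin l))
      (fun i : {i // i ∈ movedInitial l' σ} => P i) y
    have h2 := graphSum_equiv r K B w Φ ((finSumFinEquiv (m := l) (n := m - l')).symm.trans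
      (Equiv.sumCongr (Equiv.refl (Fin l)) (movedRestEquiv h σ)))
      (Sum.elim y fun i : {i // i ∉ movedInitial l' σ} => P i)
      (Function.update κ a (∑ i : {i // i ∈ movedInitial l' σ}, P i - ∑ j, y j))
    have h3 : Fin.append y (fun j : Fin (m - l') => P (σ ⟨l' + j, by omega⟩)) =
        (Sum.elim y fun i : {i // i ∉ movedInitial l' σ} => P i) ∘
          ((finSumFinEquiv (m := l) (n := m - l')).symm.trans
      (Equiv.sumCongr (Equiv.refl (Fin l)) (movedRestEquiv h σ))) := by
      ext1 j
      refine Fin.addCases (fun j => ?_) (fun j => ?_) j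
      · simp
      · simp [movedRestEquiv]
        rfl
    have h4 : ∑ i : {i // i ∈ movedInitial l' σ}, P i = ∑ j, P (σ (Fin.castLE h j)) :=
      (Equiv.sum_comp (movedInitialEquiv h σ) (fun i : {i // i ∈ movedInitial l' σ} => P i)).symm
    have h5 : (fun i : {i // i ∈ movedInitial l' σ} => P i) ∘ movedInitialEquiv h σ =
        fun j => P (σ (Fin.castLE h j)) := rfl
    rw [h4] at h2
    simp only [h1, h2, h3, h4, h5, div_eq_mul_inv, Equiv.coe_refl, Function.comp_id]
    ring
  simp only [hterm]
  rw [← Finset.mul_sum, sum_perm_movedInitial h T, ← Finset.mul_sum]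
  have hsq : ((Real.sqrt (((l + (m - l'))! : ℝ) * (m ! : ℝ)) / ((m - l')! : ℝ) : ℝ) : ℂ) =
      ((Real.sqrt ((l + (m - l'))! : ℝ) : ℝ) : ℂ) * ((Real.sqrt (m ! : ℝ) : ℝ) : ℂ) /
        ((m - l')! : ℂ) := by
    rw [Real.sqrt_mul (by positivity)]
    push_cast
    rfl
  have hm : ((m ! : ℕ) : ℂ) = ((Real.sqrt (m ! : ℝ) : ℝ) : ℂ) * ((Real.sqrt (m ! : ℝ) : ℝ) : ℂ) := by
    rw [← Complex.ofReal_mul, Real.mul_self_sqrt (by positivity)]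
    push_cast
    rfl
  have e1 : ((Real.sqrt (m ! : ℝ) : ℝ) : ℂ) ≠ 0 := by
    rw [Complex.ofReal_ne_zero]; positivity
  have e2 : ((Real.sqrt ((l + (m - l'))! : ℝ) : ℝ) : ℂ) ≠ 0 := by
    rw [Complex.ofReal_ne_zero]; positivity
  have e3 : ((m - l')! : ℂ) ≠ 0 := Nat.cast_ne_zero.2 (Nat.factorial_ne_zero _)
  have e4 : (l' ! : ℂ) ≠ 0 := Nat.cast_ne_zero.2 (Nat.factorial_ne_zero _)
  have e5 : (l ! : ℂ) ≠ 0 := Nat.cast_ne_zero.2 (Nat.factorial_ne_zero _)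
  rw [hsq, hm]
  change _ = _ * ((l ! : ℂ)⁻¹ * ∑ S ∈ Finset.univ.powersetCard l', T S)
  field_simp

lemma secondQuant_of_lt {X : Type} {l l' : ℕ} (A : Amp X l → Amp X l') (Ψ : Fock X) {m : ℕ}
    (h : m < l') : secondQuant A Ψ m = 0 := by
  ext P κ
  rw [secondQuant, dif_neg (by omega)]
  rfl

/-- A vertex operator, applied to a sum over graphs, adds a vertex to the graphs. -/
lemma kernelOp_graphSum (K : V → VertexKernel) (B : ℕ) (w : Finset V) (Φ : 𝓢(V → Mom, ℂ)) (a : V)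
    (ha : a ∉ w) (hr : ∀ b ∈ w, r b a) (hr' : ∀ b ∈ insert a w, ¬ r a b) (hB : (K a).bound ≤ B) :
    kernelOp (K a) B a
      (fun l P κ => ((Real.sqrt (l ! : ℝ) : ℝ) : ℂ)⁻¹ * graphSum r K B w Φ P κ) =
    fun m P κ => ((Real.sqrt (m ! : ℝ) : ℝ) : ℂ)⁻¹ * graphSum r K B (insert a w) Φ P κ := by
  ext m P κ
  rw [graphSum_insert r K B w Φ a ha hr hr' hB, kernelOp]
  simp only [Finset.sum_apply]
  set T : Finset (Fin m) → ℂ := fun S => ∑ l ∈ Finset.range (B + 1), (l ! : ℂ)⁻¹ *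
      ∫ y : Fin l → Mom, (K a).eval (fun i : {i // i ∈ S} => P i) y *
        graphSum r K B w Φ (Sum.elim y fun i : {i // i ∉ S} => P i)
          (Function.update κ a (∑ i : {i // i ∈ S}, P i - ∑ j, y j)) with hT
  -- the terms with `l'` creation operators yield the sets of `l'` emitted lines
  have h1 : ∀ l' ∈ Finset.range (B + 1), (∑ l ∈ Finset.range (B + 1),
      secondQuant (fun f p' κ => ∫ p : Fin l → Mom,
        (K a).toFun l' l p' p / ((l' ! : ℂ) * (l ! : ℂ)) *
        f p (Function.update κ a (∑ j, p' j - ∑ j, p j)))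
        (fun l P κ => ((Real.sqrt (l ! : ℝ) : ℝ) : ℂ)⁻¹ * graphSum r K B w Φ P κ) m P κ) =
      ((Real.sqrt (m ! : ℝ) : ℝ) : ℂ)⁻¹ * ∑ S ∈ Finset.univ.filter (fun S => S.card = l'), T S := by
    intro l' _
    rcases le_or_gt l' m with h | h
    · simp only [secondQuant_graphSum r K B w Φ a l' _ m h P κ, hT]
      rw [← Finset.mul_sum, Finset.sum_comm]
      congr 2
      ext S
      simp [Finset.mem_powersetCard]
    · simp only [secondQuant_of_lt _ _ h, Pi.zero_apply, Finset.sum_const_zero]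
      rw [Finset.sum_eq_zero, mul_zero]
      intro S hS
      have := Finset.card_le_univ S
      rw [(Finset.mem_filter.1 hS).2, Fintype.card_fin] at this
      omega
  rw [Finset.sum_congr rfl h1, ← Finset.mul_sum]
  congr 1
  -- the vertex cannot emit more lines than its bound allows
  have h2 : ∑ S ∈ Finset.univ.filter (fun S : Finset (Fin m) => S.card ∈ Finset.range (B + 1)), T S =
      ∑ S, T S := by
    refine Finset.sum_subset (Finset.filter_subset _ _) fun S _ hS => ?_
    rw [hT]
    refine Finset.sum_eq_zero fun l _ => ?_
    rw [integral_eq_zero_of_ae, mul_zero]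
    refine Eventually.of_forall fun y => ?_
    simp only [Finset.mem_filter, Finset.mem_univ, true_and, Finset.mem_range] at hS
    simp only [Pi.zero_apply]
    rw [VertexKernel.eval_eq_zero, zero_mul]
    rw [Fintype.card_coe]
    omega
  change _ = ∑ S, T S
  rw [← h2]
  refine Eq.trans ?_ (Finset.sum_fiberwise_of_maps_to (t := Finset.range (B + 1))
    (s := Finset.univ.filter (fun S : Finset (Fin m) => S.card ∈ Finset.range (B + 1)))
    (g := fun S => S.card) (fun S hS => (Finset.mem_filter.1 hS).2) _)
  refine Finset.sum_congr rfl fun l' hl' => Finset.sum_congr ?_ fun _ _ => rfl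
  ext S
  simp only [Finset.mem_filter, Finset.mem_univ, true_and]
  exact ⟨fun h => ⟨h ▸ hl', h⟩, fun h => h.2⟩

/-- The only graph without vertices has no lines; it represents the vacuum. -/
lemma graphSum_empty (K : V → VertexKernel) (B : ℕ) (Φ : (V → Mom) → ℂ) :
    (fun l (P : Fin l → Mom) κ => ((Real.sqrt (l ! : ℝ) : ℝ) : ℂ)⁻¹ * graphSum r K B ∅ Φ P κ) =
      vac Φ := by
  have h0 : multSet r B (∅ : Finset V) = {0} := by
    ext μ
    simp only [mem_multSet, Finset.notMem_empty, false_and, imp_false, not_not,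
      Finset.mem_singleton]
    exact ⟨fun h => by ext b a; exact (h b a).2, fun h => by simp [h]⟩
  ext l P κ
  rcases l with _ | l
  · have hE : IsEmpty (MultLine (0 : V → V → ℕ)) := ⟨fun e => Fin.elim0 e.2⟩
    have hs : Fintype.piFinset (fun _ : Fin 0 => (∅ : Finset V)) = {Fin.elim0} := by
      ext s; simp [Subsingleton.elim s Fin.elim0, Subsingleton.elim Fin.elim0 (default : Fin 0 → V)]
    simp only [graphSum, h0, hs, Finset.sum_singleton, vac]
    rw [amplitude, integral_unique]
    have hsl : ∀ p, slotArgs ∅ (Sum.elim (fun e : MultLine (0 : V → V → ℕ) => e.1.1) Fin.elim0)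
        (fun e => e.1.2) P κ p = κ := fun p => by ext1 a; simp [slotArgs]
    rw [hsl]
    simp [vertexWeight, Measure.real, volume_pi]
  · have hs : Fintype.piFinset (fun _ : Fin (l + 1) => (∅ : Finset V)) = ∅ := by
      ext s
      simp only [Fintype.mem_piFinset, Finset.notMem_empty, iff_false, not_forall]
      exact ⟨0, fun h => h⟩
    simp only [graphSum, hs, Finset.sum_empty, Finset.sum_const_zero, mul_zero, vac]

/-- Wick's theorem: the vertex operators of an ordered word, applied to the vacuum, yield the sum
over all graphs whose lines are directed from earlier (right) to later (left) vertices. -/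
lemma foldr_kernelOp (K : V → VertexKernel) (B : ℕ) (hB : ∀ a, (K a).bound ≤ B)
    (Φ : 𝓢(V → Mom, ℂ)) (W : List V) (hW : W.Pairwise fun a b => r b a ∧ ¬ r a b)
    (hir : ∀ a, ¬ r a a) :
    W.foldr (fun a => kernelOp (K a) B a) (vac Φ) =
      fun l P κ => ((Real.sqrt (l ! : ℝ) : ℝ) : ℂ)⁻¹ * graphSum r K B W.toFinset Φ P κ := by
  induction W with
  | nil => rw [List.foldr_nil, List.toFinset_nil, graphSum_empty]
  | cons a W ih =>
    obtain ⟨h1, h2⟩ := List.pairwise_cons.1 hW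
    rw [List.foldr_cons, ih h2, List.toFinset_cons]
    refine kernelOp_graphSum r K B W.toFinset Φ a (fun h => hir a ?_) (fun b hb => ?_)
      (fun b hb => ?_) (hB a)
    · exact (h1 a (List.mem_toFinset.1 h)).1
    · exact (h1 b (List.mem_toFinset.1 hb)).1
    · rcases Finset.mem_insert.1 hb with rfl | hb
      · exact hir b
      · exact (h1 b (List.mem_toFinset.1 hb)).2

section NoOpen

variable (K : V → VertexKernel) {E : Type} [Fintype E] (src tgt : E → V)

/-- The lines leaving a vertex of a graph without open lines. -/
def noOpenEquiv (a : V) : {e : E // src e = a} ≃ {x : E ⊕ Fin 0 // Sum.elim src Fin.elim0 x = a} :=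
  Equiv.subtypeEquiv (Equiv.sumEmpty E (Fin 0)).symm fun _ => Iff.rfl

lemma vertexWeight_no_open (P : Fin 0 → Mom) (p : E → Mom) :
    vertexWeight K Finset.univ (Sum.elim src Fin.elim0) tgt P p =
      ∏ a, (K a).eval (fun e : {e // src e = a} => p e) (fun e : {e // tgt e = a} => p e) := by
  unfold vertexWeight
  exact Finset.prod_congr rfl fun a _ => ((K a).eval_equiv (noOpenEquiv src a)
    (Equiv.refl {e // tgt e = a}) (fun x => Sum.elim p P x) (fun x => p x.1)).symm

lemma slotArgs_no_open (P : Fin 0 → Mom) (κ : V → Mom) (p : E → Mom) :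
    slotArgs Finset.univ (Sum.elim src Fin.elim0) tgt P κ p =
      fun a => ∑ e : {e // src e = a}, p e - ∑ e : {e // tgt e = a}, p e := by
  ext1 a
  unfold slotArgs lineDefect
  rw [if_pos (Finset.mem_univ a)]
  congr 1
  exact (Equiv.sum_comp (noOpenEquiv src a) (fun x => Sum.elim p P x)).symm

end NoOpen

lemma graphSum_no_open (K : V → VertexKernel) (B : ℕ) (Φ : (V → Mom) → ℂ) (P : Fin 0 → Mom)
    (κ : V → Mom) : graphSum r K B Finset.univ Φ P κ = ∑ μ ∈ multSet r B Finset.univ,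
      (∏ b, ∏ a, ((μ b a)! : ℂ))⁻¹ * ∫ p : MultLine μ → Mom,
        (∏ a, (K a).eval (fun e : {e : MultLine μ // e.1.1 = a} => p e)
          (fun e : {e : MultLine μ // e.1.2 = a} => p e)) *
        Φ (fun a => ∑ e : {e : MultLine μ // e.1.1 = a}, p e -
          ∑ e : {e : MultLine μ // e.1.2 = a}, p e) := by
  have hs : Fintype.piFinset (fun _ : Fin 0 => (Finset.univ : Finset V)) = {Fin.elim0} := by
    ext s; simp [Subsingleton.elim s Fin.elim0, Subsingleton.elim Fin.elim0 (default : Fin 0 → V)]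
  unfold graphSum
  refine Finset.sum_congr rfl fun μ _ => ?_
  rw [hs, Finset.sum_singleton, amplitude]
  simp only [vertexWeight_no_open, slotArgs_no_open]

end Wick

end Analysis

/-! ### The vertex kernels of the interaction density and of the free field -/

lemma norm_exp_I_mul (x : ℝ) : ‖Complex.exp (Complex.I * (x : ℂ))‖ = 1 := by
  rw [mul_comm, Complex.norm_exp_ofReal_mul_I]

lemma DispersionFunction.pos (ω : DispersionFunction) (p : Mom) : 0 < ω.toFun p := by
  obtain ⟨M, h0, h⟩ := ω.massive
  exact h0.trans_le (h p)

lemma DispersionFunction.continuous (ω : DispersionFunction) : Continuous ω.toFun :=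
  ω.temperate.1.continuous

lemma norm_fieldAmplitude (ω : DispersionFunction) (a : FieldPart) (t : ℝ) (p : Mom) :
    ‖fieldAmplitude ω a t p‖ = (Real.sqrt ((2 * Real.pi) ^ 3 * (2 * ω.toFun p)))⁻¹ := by
  have h : ∀ x : ℝ, ‖Complex.exp (-(Complex.I * (x : ℂ)))‖ = 1 := fun x => by
    rw [← norm_exp_I_mul (-x)]; congr 2; push_cast; ring
  unfold fieldAmplitude
  cases a <;> simp only [norm_div, norm_exp_I_mul, h, Complex.norm_real, Real.norm_eq_abs,
    abs_of_nonneg (Real.sqrt_nonneg _), one_div]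

lemma exists_fieldAmplitude_bound (ω : DispersionFunction) :
    ∃ C : ℝ, 0 ≤ C ∧ ∀ a t p, ‖fieldAmplitude ω a t p‖ ≤ C := by
  obtain ⟨M, h0, h⟩ := ω.massive
  refine ⟨(Real.sqrt ((2 * Real.pi) ^ 3 * (2 * M)))⁻¹, by positivity, fun a t p => ?_⟩
  rw [norm_fieldAmplitude]
  have := h p
  have := Real.pi_pos
  gcongr

lemma continuous_fieldAmplitude (ω : DispersionFunction) (a : FieldPart) :
    Continuous fun x : ℝ × Mom => fieldAmplitude ω a x.1 x.2 := by
  unfold fieldAmplitude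
  have hω : Continuous fun x : ℝ × Mom => ω.toFun x.2 := ω.continuous.comp continuous_snd
  have hs : Continuous fun x : ℝ × Mom =>
      ((Real.sqrt ((2 * Real.pi) ^ 3 * (2 * ω.toFun x.2)) : ℝ) : ℂ) := by fun_prop
  refine Continuous.div ?_ hs fun x => ?_
  · cases a <;> simp only <;> fun_prop
  · have := ω.pos x.2
    have := Real.pi_pos
    rw [Complex.ofReal_ne_zero]
    positivity

/-- The vertex kernel of `-i` times the interaction density in momentum space. -/
def internalKernel (ω : DispersionFunction) (hI : AdmissibleInteraction) (t : ℝ) : VertexKernel where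
  toFun l' l p' p := -Complex.I * (2 * Real.pi : ℂ) ^ 3 * hI.kernel l' l p' p *
    Complex.exp (Complex.I * (energyDefect ω p' p * t : ℝ))
  bound := hI.bound
  finite l' l h := by
    ext p' p
    simp [hI.finite l' l h]
  continuous l' l := by
    have h1 : Continuous fun x : (Fin l' → Mom) × (Fin l → Mom) => hI.kernel l' l x.1 x.2 :=
      (hI.temperate l' l).1.continuous
    have h2 : Continuous fun x : (Fin l' → Mom) × (Fin l → Mom) => energyDefect ω x.1 x.2 := by
      unfold energyDefect
      refine Continuous.sub (continuous_finsetSum _ fun j _ => ω.continuous.comp (by fun_prop))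
        (continuous_finsetSum _ fun j _ => ω.continuous.comp (by fun_prop))
    fun_prop
  symm l' l σ' σ p' p := by
    rw [hI.symm]
    unfold energyDefect
    simp only [Function.comp_apply]
    rw [Equiv.sum_comp σ' (fun j => ω.toFun (p' j)), Equiv.sum_comp σ (fun j => ω.toFun (p j))]
  decay l' l N := by
    obtain ⟨C, M, h0, h⟩ := hI.kernel_bound l' l (l' * N)
    refine ⟨(2 * Real.pi) ^ 3 * C, M, by have := Real.pi_pos; positivity, fun p' p => ?_⟩
    have hpi := Real.pi_pos
    have h1 : ∏ j, (1 + ‖p' j‖) ≤ (1 + ‖(p', p)‖) ^ l' := by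
      calc ∏ j, (1 + ‖p' j‖) ≤ ∏ _j : Fin l', (1 + ‖(p', p)‖) :=
            Finset.prod_le_prod (fun j _ => by positivity) fun j _ => by
              gcongr
              exact (norm_le_pi_norm p' j).trans (norm_fst_le (p', p))
        _ = _ := by simp
    have h2 : ‖-Complex.I * (2 * Real.pi : ℂ) ^ 3 * hI.kernel l' l p' p *
        Complex.exp (Complex.I * (energyDefect ω p' p * t : ℝ))‖ =
        (2 * Real.pi) ^ 3 * ‖hI.kernel l' l p' p‖ := by
      rw [norm_mul, norm_exp_I_mul]
      simp [abs_of_pos hpi]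
    rw [h2]
    calc _ ≤ ((1 + ‖(p', p)‖) ^ l') ^ N * ((2 * Real.pi) ^ 3 * ‖hI.kernel l' l p' p‖) := by
          gcongr
      _ = (2 * Real.pi) ^ 3 * ((1 + ‖(p', p)‖) ^ (l' * N) * ‖hI.kernel l' l p' p‖) := by
          rw [pow_mul]; ring
      _ ≤ _ := by rw [mul_assoc]; exact mul_le_mul_of_nonneg_left (h p' p) (by positivity)

/-- The vertex kernel of a free field part: it creates or annihilates one particle. -/
def externalKernel (ω : DispersionFunction) (a : FieldPart) (t : ℝ) : VertexKernel where
  toFun l' l p' p := match a with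
    | .plus => if l' = 1 ∧ l = 0 then ∏ j, fieldAmplitude ω .plus t (p' j) else 0
    | .minus => if l' = 0 ∧ l = 1 then ∏ j, fieldAmplitude ω .minus t (p j) else 0
  bound := 1
  finite l' l h := by
    ext p' p
    cases a <;> simp only [Pi.zero_apply] <;> rw [if_neg (by omega)]
  continuous l' l := by
    have h : ∀ a, Continuous fun p : Mom => fieldAmplitude ω a t p := fun a =>
      (continuous_fieldAmplitude ω a).comp (by fun_prop : Continuous fun p : Mom => (t, p))
    cases a <;> simp only
    · split_ifs
      · exact continuous_finsetProd _ fun j _ =>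
          (h .plus).comp ((continuous_apply j).comp continuous_fst)
      · exact continuous_const
    · split_ifs
      · exact continuous_finsetProd _ fun j _ =>
          (h .minus).comp ((continuous_apply j).comp continuous_snd)
      · exact continuous_const
  symm l' l σ' σ p' p := by
    cases a <;> simp only [Function.comp_apply]
    · rw [Equiv.prod_comp σ' (fun j => fieldAmplitude ω .plus t (p' j))]
    · rw [Equiv.prod_comp σ (fun j => fieldAmplitude ω .minus t (p j))]
  decay l' l N := by
    obtain ⟨C, h0, hC⟩ := exists_fieldAmplitude_bound ω
    refine ⟨C, N, h0, fun p' p => ?_⟩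
    cases a <;> simp only
    · split_ifs with h
      · obtain ⟨rfl, rfl⟩ := h
        simp only [Fin.prod_univ_one, Fin.sum_univ_one, Finset.univ_eq_empty, Finset.sum_empty,
          sub_zero]
        rw [mul_comm]
        gcongr
        exact hC _ _ _
      · rw [norm_zero, mul_zero]; positivity
    · split_ifs with h
      · obtain ⟨rfl, rfl⟩ := h
        simp only [Fin.prod_univ_one, Finset.univ_eq_empty, Finset.prod_empty, one_pow, one_mul]
        exact (hC _ _ _).trans (le_mul_of_one_le_right h0 (one_le_pow₀ (by simp)))
      · rw [norm_zero, mul_zero]; positivity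

lemma secondQuant_zero {X : Type} {l l' : ℕ} (Ψ : Fock X) :
    secondQuant (fun (_ : Amp X l) (_ : Fin l' → Mom) _ => (0 : ℂ)) Ψ = 0 := by
  ext m P κ
  simp [secondQuant]

section

variable {X : Type} [DecidableEq X]

lemma kernelOp_term_eq_zero (K : VertexKernel) (x : X) (Ψ : Fock X) {l' l : ℕ}
    (h : K.toFun l' l = 0) : secondQuant (fun f p' κ => ∫ p : Fin l → Mom,
      K.toFun l' l p' p / ((l' ! : ℂ) * (l ! : ℂ)) *
        f p (Function.update κ x (∑ j, p' j - ∑ j, p j))) Ψ = 0 := by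
  simp only [h, Pi.zero_apply, zero_div, zero_mul, integral_zero]
  exact secondQuant_zero Ψ

/-- The range of summation in `kernelOp` is immaterial once it contains all particle numbers. -/
lemma kernelOp_eq_bound (K : VertexKernel) {B : ℕ} (hB : K.bound ≤ B) (x : X) (Ψ : Fock X) :
    kernelOp K B x Ψ = kernelOp K K.bound x Ψ := by
  have hsub : Finset.range (K.bound + 1) ⊆ Finset.range (B + 1) :=
    Finset.range_mono (by omega)
  unfold kernelOp
  refine (Finset.sum_subset hsub fun l' _ hl' => ?_).symm.trans ?_
  · refine Finset.sum_eq_zero fun l _ => kernelOp_term_eq_zero K x Ψ (K.finite _ _ ?_)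
    rw [Finset.mem_range] at hl'; omega
  · refine Finset.sum_congr rfl fun l' _ => (Finset.sum_subset hsub fun l _ hl => ?_).symm
    refine kernelOp_term_eq_zero K x Ψ (K.finite _ _ ?_)
    rw [Finset.mem_range] at hl; omega

/-- A field part is the operator of a kernel with a single creation or annihilation operator. -/
lemma freeField_eq_kernelOp (ω : DispersionFunction) (a : FieldPart) (t : ℝ) (x : X) {B : ℕ}
    (hB : 1 ≤ B) (Ψ : Fock X) :
    freeField ω a t x Ψ = kernelOp (externalKernel ω a t) B x Ψ := by
  rw [kernelOp_eq_bound _ (show (externalKernel ω a t).bound ≤ B from hB)]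
  have hb : (externalKernel ω a t).bound = 1 := rfl
  rw [kernelOp, hb]
  simp only [Finset.sum_range_succ, Finset.sum_range_zero, zero_add]
  cases a
  · rw [kernelOp_term_eq_zero (l' := 0) (l := 0) _ _ _ (by ext; simp [externalKernel]),
      kernelOp_term_eq_zero (l' := 0) (l := 1) _ _ _ (by ext; simp [externalKernel]),
      kernelOp_term_eq_zero (l' := 1) (l := 1) _ _ _ (by ext; simp [externalKernel]),
      zero_add, zero_add, add_zero]
    unfold freeField
    simp only
    congr 1
    ext f p' κ
    rw [integral_unique]
    simp [externalKernel, Measure.real, volume_pi, Subsingleton.elim default Fin.elim0]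
  · rw [kernelOp_term_eq_zero (l' := 0) (l := 0) _ _ _ (by ext; simp [externalKernel]),
      kernelOp_term_eq_zero (l' := 1) (l := 0) _ _ _ (by ext; simp [externalKernel]),
      kernelOp_term_eq_zero (l' := 1) (l := 1) _ _ _ (by ext; simp [externalKernel]),
      zero_add, add_zero, add_zero]
    unfold freeField
    simp only
    congr 1
    ext f p' κ
    have h := ((volume_preserving_funUnique (Fin 1) Mom).symm _).integral_comp'
      (f := (MeasurableEquiv.funUnique (Fin 1) Mom).symm) (fun p : Fin 1 → Mom =>
        (externalKernel ω .minus t).toFun 0 1 p' p / (((0)! : ℂ) * ((1)! : ℂ)) *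
          f p (Function.update κ x (∑ j, p' j - ∑ j, p j)))
    refine Eq.trans ?_ h
    refine integral_congr_ae (Eventually.of_forall fun y => ?_)
    have hy : (MeasurableEquiv.funUnique (Fin 1) Mom).symm y = fun _ => y := rfl
    simp [externalKernel, hy]

/-- The interaction density in momentum space has the expected kernel on vectors which depend on
the slot as Schwartz functions; this is Fourier inversion. -/
lemma momDensity_eq_kernelOp (ω : DispersionFunction) (hI : AdmissibleInteraction) (t : ℝ) (x : X)
    {B : ℕ} (hB : hI.bound ≤ B) (Ψ : Fock X)
    (hΨ : ∀ l p κ, ∃ G : 𝓢(Mom, ℂ), ∀ k, Ψ l p (Function.update κ x k) = G k) :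
    -Complex.I • momDensity ω hI t x Ψ = kernelOp (internalKernel ω hI t) B x Ψ := by
  rw [kernelOp_eq_bound _ (show (internalKernel ω hI t).bound ≤ B from hB)]
  have hb : (internalKernel ω hI t).bound = hI.bound := rfl
  rw [kernelOp, hb, momDensity, density, Finset.smul_sum]
  refine Finset.sum_congr rfl fun l' _ => ?_
  rw [Finset.smul_sum]
  refine Finset.sum_congr rfl fun l _ => ?_
  ext m P κ
  simp only [Pi.smul_apply, smul_eq_mul, secondQuant]
  split_ifs with hm
  · rw [← mul_assoc, mul_comm (-Complex.I), mul_assoc, ← mul_assoc (-Complex.I),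
      mul_comm (-Complex.I), mul_assoc, Finset.mul_sum]
    congr 2
    refine Finset.sum_congr rfl fun σ _ => ?_
    unfold densityKernelOp
    rw [← integral_const_mul]
    refine integral_congr_ae (Eventually.of_forall fun p => ?_)
    simp only [Function.update_self, Function.update_idem]
    obtain ⟨G, hG⟩ := hΨ (l + (m - l'))
      (Fin.append p fun j : Fin (m - l') => P (σ ⟨l' + j, by omega⟩)) κ
    simp only [hG]
    rw [momFourier_inversion]
    simp only [internalKernel]
    ring
  · rw [mul_zero]

end

/-! ### Words of operators -/

section Word

variable {m n : ℕ}

/-- The external vertices in front of the `(i + 1)`-st block of internal vertices: the vertex `i`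
if there are more than `i` external vertices. -/
def externalAt (m i : ℕ) : List (Fin m) := if h : i < m then [⟨i, h⟩] else []

/-- The word of operators with only the first `m` of the external vertices `1, …, n`. -/
def partialWord (m : ℕ) (v : Fin (n + 1) → ℕ) : List (Vertex m v) :=
  (List.ofFn fun j : Fin (v 0) => (Sum.inr ⟨0, j⟩ : Vertex m v)) ++
    (List.ofFn fun i : Fin n => (externalAt m i).map Sum.inl ++
      List.ofFn fun j : Fin (v i.succ) => (Sum.inr ⟨i.succ, j⟩ : Vertex m v)).flatten

lemma partialWord_eq_operatorWord (v : Fin (n + 1) → ℕ) : partialWord n v = operatorWord v := by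
  simp [partialWord, operatorWord, externalAt]

lemma mem_partialWord (hmn : m ≤ n) (v : Fin (n + 1) → ℕ) (a : Vertex m v) : a ∈ partialWord m v := by
  unfold partialWord
  rw [List.mem_append, List.mem_flatten]
  rcases a with i | ⟨i, j⟩
  · right
    refine ⟨_, List.mem_ofFn.2 ⟨⟨i, by omega⟩, rfl⟩, List.mem_append.2 (Or.inl ?_)⟩
    exact List.mem_map.2 ⟨i, by simp [externalAt], rfl⟩
  · refine Fin.cases (fun j => ?_) (fun i j => ?_) i j
    · left
      exact List.mem_ofFn.2 ⟨j, rfl⟩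
    · right
      exact ⟨_, List.mem_ofFn.2 ⟨i, rfl⟩, List.mem_append.2 (Or.inr (List.mem_ofFn.2 ⟨j, rfl⟩))⟩

lemma pairwise_partialWord (v : Fin (n + 1) → ℕ) :
    (partialWord m v).Pairwise fun a b => Vertex.key a < Vertex.key b := by
  -- within a block the keys are ordered by the second component
  have hblock : ∀ i : Fin (n + 1), (List.ofFn fun j : Fin (v i) => (Sum.inr ⟨i, j⟩ :
      Vertex m v)).Pairwise fun a b => Vertex.key a < Vertex.key b := fun i => by
    rw [List.pairwise_ofFn]
    intro j j' hj
    simp only [Vertex.key, Prod.Lex.toLex_lt_toLex]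
    right
    simpa using hj
  -- between the blocks they are ordered by the first component
  have hkey : ∀ (i : Fin n) (a : Vertex m v), a ∈ (externalAt m i).map Sum.inl ++
      List.ofFn (fun j : Fin (v i.succ) => (Sum.inr ⟨i.succ, j⟩ : Vertex m v)) →
      (ofLex (Vertex.key a)).1 = (i : ℕ) + 1 := by
    intro i a ha
    rcases List.mem_append.1 ha with h | h
    · obtain ⟨e, he, rfl⟩ := List.mem_map.1 h
      unfold externalAt at he
      split_ifs at he with him
      · rw [List.mem_singleton.1 he]; rfl
      · simp at he
    · obtain ⟨j, rfl⟩ := List.mem_ofFn.1 h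
      simp [Vertex.key]
  have hlt : ∀ a b : Vertex m v, (ofLex (Vertex.key a)).1 < (ofLex (Vertex.key b)).1 →
      Vertex.key a < Vertex.key b := fun a b h => by
    rw [Prod.Lex.lt_iff]; exact Or.inl h
  unfold partialWord
  rw [List.pairwise_append]
  refine ⟨hblock 0, ?_, ?_⟩
  · rw [List.pairwise_flatten]
    constructor
    · intro l hl
      obtain ⟨i, rfl⟩ := List.mem_ofFn.1 hl
      rw [List.pairwise_append]
      refine ⟨?_, hblock _, ?_⟩
      · unfold externalAt
        split_ifs <;> simp
      · intro a ha b hb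
        obtain ⟨e, he, rfl⟩ := List.mem_map.1 ha
        obtain ⟨j, rfl⟩ := List.mem_ofFn.1 hb
        unfold externalAt at he
        split_ifs at he with him
        · rw [List.mem_singleton.1 he]
          simp [Vertex.key, Prod.Lex.toLex_lt_toLex]
        · simp at he
    · rw [List.pairwise_ofFn]
      intro i i' hi a ha b hb
      refine hlt a b ?_
      rw [hkey i a ha, hkey i' b hb]
      simpa using hi
  · intro a ha b hb
    obtain ⟨j, rfl⟩ := List.mem_ofFn.1 ha
    obtain ⟨l, hl, hb⟩ := List.mem_flatten.1 hb
    obtain ⟨i, rfl⟩ := List.mem_ofFn.1 hl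
    refine hlt _ b ?_
    rw [hkey i b hb]
    simp [Vertex.key]

end Word

/-! ### Wick's theorem for words of vertex operators -/

section WickWord

variable (ω : DispersionFunction) (hI : AdmissibleInteraction) {m n : ℕ} {v : Fin (n + 1) → ℕ}

instance : DecidableRel (Vertex.Precedes (m := m) (v := v)) := fun a b =>
  inferInstanceAs (Decidable (Vertex.key b < Vertex.key a))

/-- The operator at a vertex, for `m` external vertices at the times `s`. -/
def vertexOperator (α : Fin m → FieldPart) (s : Fin m → ℝ) (τ : Inner v → ℝ) :
    Vertex m v → Fock (Vertex m v) → Fock (Vertex m v)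
  | .inl i => freeField ω (α i) (s i) (Sum.inl i)
  | .inr x => fun Ψ => -Complex.I • momDensity ω hI (τ x) (Sum.inr x) Ψ

lemma vertexOp_eq_vertexOperator (α : Fin n → FieldPart) (t : Fin n → ℝ) (τ : Inner v → ℝ) :
    vertexOp ω hI α t τ = vertexOperator ω hI α t τ := by
  ext1 a
  cases a <;> rfl

/-- The vertex kernels of the Feynman rules. -/
def feynmanKernel (α : Fin m → FieldPart) (s : Fin m → ℝ) (τ : Inner v → ℝ) :
    Vertex m v → VertexKernel
  | .inl i => externalKernel ω (α i) (s i)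
  | .inr x => internalKernel ω hI (τ x)

lemma feynmanKernel_bound_le (α : Fin m → FieldPart) (s : Fin m → ℝ) (τ : Inner v → ℝ)
    (a : Vertex m v) : (feynmanKernel ω hI α s τ a).bound ≤ hI.bound + 1 := by
  cases a
  · exact Nat.le_add_left 1 _
  · exact Nat.le_succ hI.bound

/-- A test function at fixed internal times, as a function of all the momentum slots. -/
def slotTest (Φ : 𝓢(Args m v, ℂ)) (τ : Inner v → ℝ) : 𝓢(Vertex m v → Mom, ℂ) :=
  SchwartzMap.compCLM ℂ (D := Vertex m v → Mom) (E := Args m v) (F := ℂ)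
    (g := fun κ => (fun i => κ (Sum.inl i), fun x => (τ x, κ (Sum.inr x))))
    (hasTemperateGrowth_prodMk (hasTemperateGrowth_pi fun i => hasTemperateGrowth_apply _)
      (hasTemperateGrowth_pi fun x => hasTemperateGrowth_prodMk
        (Function.HasTemperateGrowth.const _) (hasTemperateGrowth_apply _)))
    ⟨1, 1, fun κ => by
      rw [one_mul, pow_one]
      refine (pi_norm_le_iff_of_nonneg (by positivity)).2 fun a => ?_
      refine le_trans ?_ (le_add_of_nonneg_left zero_le_one)
      rcases a with i | x
      · exact (norm_le_pi_norm (fun i : Fin m => κ (Sum.inl i)) i).trans (norm_fst_le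
          ((fun i => κ (Sum.inl i), fun x => (τ x, κ (Sum.inr x))) : Args m v))
      · refine le_trans ?_ (norm_snd_le
          ((fun i => κ (Sum.inl i), fun x => (τ x, κ (Sum.inr x))) : Args m v))
        refine le_trans ?_ (norm_le_pi_norm _ x)
        exact norm_snd_le (τ x, κ (Sum.inr x))⟩ Φ

lemma slotTest_apply (Φ : 𝓢(Args m v, ℂ)) (τ : Inner v → ℝ) (κ : Vertex m v → Mom) :
    slotTest Φ τ κ = Φ (fun i => κ (Sum.inl i), fun x => (τ x, κ (Sum.inr x))) := by
  unfold slotTest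
  rw [SchwartzMap.compCLM_apply]
  rfl

/-- Graph sums are Schwartz functions of each free slot. -/
lemma graphSum_slot_schwartz {V : Type} [Fintype V] [DecidableEq V] (r : V → V → Prop)
    [DecidableRel r] (K : V → VertexKernel) (B : ℕ) (w : Finset V) (Φ : 𝓢(V → Mom, ℂ)) (x : V)
    (hx : x ∉ w) {I : Type} [Fintype I] [DecidableEq I] (P : I → Mom) (κ : V → Mom) (c : ℂ) :
    ∃ G : 𝓢(Mom, ℂ), ∀ k, c * graphSum r K B w Φ P (Function.update κ x k) = G k := by
  have h : ∀ μ ∈ multSet r B w, ∀ s ∈ Fintype.piFinset (fun _ : I => w), ∃ G : 𝓢(Mom, ℂ), ∀ k,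
      amplitude K w Φ (Sum.elim (fun e : MultLine μ => e.1.1) s) (fun e => e.1.2) P
        (Function.update κ x k) = G k := fun μ hμ s hs =>
    amplitude_slot_schwartz K w Φ _ _ (by
      rintro (e | i)
      · exact ((mem_multSet.1 hμ e.1.1 e.1.2).2 (Fin.pos e.2).ne').1
      · exact Fintype.mem_piFinset.1 hs i) P κ x hx
  choose! G hG using h
  refine ⟨c • ∑ μ ∈ multSet r B w, ∑ s ∈ Fintype.piFinset (fun _ : I => w),
    (∏ b, ∏ a, ((μ b a)! : ℂ))⁻¹ • G μ s, fun k => ?_⟩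
  simp only [graphSum, smul_apply, sum_apply, smul_eq_mul]
  congr 1
  exact Finset.sum_congr rfl fun μ hμ => Finset.sum_congr rfl fun s hs => by rw [hG μ hμ s hs]

/-- Free fields and interaction densities act on the vectors generated from the vacuum as operators
with vertex kernels. -/
lemma foldr_vertexOperator (α : Fin m → FieldPart) (s : Fin m → ℝ) (τ : Inner v → ℝ)
    (Φ : 𝓢(Vertex m v → Mom, ℂ)) (W : List (Vertex m v))
    (hW : W.Pairwise fun a b => Vertex.key a < Vertex.key b) :
    W.foldr (vertexOperator ω hI α s τ) (vac Φ) = fun l P κ =>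
      ((Real.sqrt (l ! : ℝ) : ℝ) : ℂ)⁻¹ * graphSum Vertex.Precedes (feynmanKernel ω hI α s τ)
        (hI.bound + 1) W.toFinset Φ P κ := by
  have hW' : ∀ W' : List (Vertex m v), W'.Pairwise (fun a b => Vertex.key a < Vertex.key b) →
      W'.foldr (fun a => kernelOp (feynmanKernel ω hI α s τ a) (hI.bound + 1) a) (vac Φ) =
      fun l P κ => ((Real.sqrt (l ! : ℝ) : ℝ) : ℂ)⁻¹ * graphSum Vertex.Precedes
        (feynmanKernel ω hI α s τ) (hI.bound + 1) W'.toFinset Φ P κ := fun W' h =>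
    foldr_kernelOp Vertex.Precedes _ _ (feynmanKernel_bound_le ω hI α s τ) Φ W'
      (h.imp fun hab => ⟨hab, lt_asymm hab⟩) (fun a => lt_irrefl (Vertex.key a))
  rw [← hW' W hW]
  induction W with
  | nil => rfl
  | cons a W ih =>
    obtain ⟨h1, h2⟩ := List.pairwise_cons.1 hW
    rw [List.foldr_cons, List.foldr_cons, ih h2]
    rcases a with i | x
    · exact freeField_eq_kernelOp ω (α i) (s i) _ (Nat.le_add_left 1 _) _
    · refine momDensity_eq_kernelOp ω hI (τ x) _ (Nat.le_succ _) _ fun l p κ => ?_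
      rw [hW' W h2]
      refine graphSum_slot_schwartz _ _ _ _ Φ _ (fun h => ?_) p κ _
      exact lt_irrefl _ (h1 _ (List.mem_toFinset.1 h))

/-- The integrand of the graph with multiplicities `μ`, at fixed internal times. -/
def wickTerm (α : Fin m → FieldPart) (s : Fin m → ℝ) (Φ : Args m v → ℂ)
    (μ : Vertex m v → Vertex m v → ℕ) (τ : Inner v → ℝ) (p : MultLine μ → Mom) : ℂ :=
  (∏ a, (feynmanKernel ω hI α s τ a).eval (fun e : {e : MultLine μ // e.1.1 = a} => p e)
    (fun e : {e : MultLine μ // e.1.2 = a} => p e)) *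
  Φ (fun i => ∑ e : {e : MultLine μ // e.1.1 = Sum.inl i}, p e -
      ∑ e : {e : MultLine μ // e.1.2 = Sum.inl i}, p e,
    fun x => (τ x, ∑ e : {e : MultLine μ // e.1.1 = Sum.inr x}, p e -
      ∑ e : {e : MultLine μ // e.1.2 = Sum.inr x}, p e))

/-- The vacuum expectation value of the operator word is the sum over the graphs without open lines,
that is, over the multiplicities of the lines between any two vertices. -/
lemma vacPairing_word (hmn : m ≤ n) (α : Fin m → FieldPart) (s : Fin m → ℝ) (Φ : 𝓢(Args m v, ℂ))
    (τ : Inner v → ℝ) :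
    vacPairing ((partialWord m v).foldr (vertexOperator ω hI α s τ)
      (vac fun κ => Φ (fun i => κ (Sum.inl i), fun x => (τ x, κ (Sum.inr x))))) =
    ∑ μ ∈ multSet Vertex.Precedes (hI.bound + 1) Finset.univ,
      (∏ b, ∏ a, ((μ b a)! : ℂ))⁻¹ * ∫ p, wickTerm ω hI α s Φ μ τ p := by
  have h1 : (fun κ => Φ (fun i => κ (Sum.inl i), fun x => (τ x, κ (Sum.inr x)))) =
      ⇑(slotTest Φ τ) := by
    ext κ; rw [slotTest_apply]
  have h2 : (partialWord m v).toFinset = Finset.univ := by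
    ext a; simp [mem_partialWord hmn v a]
  rw [h1, foldr_vertexOperator ω hI α s τ _ _ (pairwise_partialWord v), h2, vacPairing]
  simp only [Nat.factorial_zero, Nat.cast_one, Real.sqrt_one, Complex.ofReal_one, inv_one, one_mul]
  rw [graphSum_no_open]
  refine Finset.sum_congr rfl fun μ _ => ?_
  simp only [slotTest_apply]
  rfl

end WickWord

/-! ### Kernels of the time integrals -/

lemma abs_stepKernel_le_one (τ : ℝ) (a b : EReal) : |stepKernel τ a b| ≤ 1 := by
  unfold stepKernel
  split_ifs <;> simp

lemma measurable_stepKernel :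
    Measurable fun x : ℝ × EReal × EReal => stepKernel x.1 x.2.1 x.2.2 := by
  unfold stepKernel
  have h : Measurable fun x : ℝ × EReal × EReal => (x.1 : EReal) :=
    measurable_coe_real_ereal.comp measurable_fst
  have ha : Measurable fun x : ℝ × EReal × EReal => x.2.1 := by fun_prop
  have hb : Measurable fun x : ℝ × EReal × EReal => x.2.2 := by fun_prop
  refine Measurable.ite ((measurableSet_lt ha h).inter (measurableSet_lt h hb)) measurable_const ?_
  exact Measurable.ite ((measurableSet_lt hb h).inter (measurableSet_lt h ha)) measurable_const
    measurable_const

lemma measurable_orientation : Measurable fun x : EReal × EReal => orientation x.1 x.2 := by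
  unfold orientation
  exact Measurable.ite (measurableSet_lt measurable_fst measurable_snd) measurable_const
    (Measurable.ite (measurableSet_lt measurable_snd measurable_fst) measurable_const
      measurable_const)

lemma abs_simplexKernel_le_one {v : ℕ} (a b : EReal) (τ : Fin v → ℝ) :
    |simplexKernel a b τ| ≤ 1 := by
  unfold simplexKernel
  rw [abs_mul, Finset.abs_prod]
  refine mul_le_one₀ (Finset.prod_le_one (fun j _ => abs_nonneg _)
    fun j _ => abs_stepKernel_le_one _ _ _) (abs_nonneg _) ?_
  unfold orderIndicator
  split_ifs <;> simp

lemma measurable_simplexKernel (v : ℕ) :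
    Measurable fun x : EReal × EReal × (Fin v → ℝ) => simplexKernel x.1 x.2.1 x.2.2 := by
  unfold simplexKernel
  refine Measurable.mul (Finset.measurable_prod _ fun j _ => ?_) ?_
  · exact measurable_stepKernel.comp (by fun_prop : Measurable
      fun x : EReal × EReal × (Fin v → ℝ) => (x.2.2 j, x.1, x.2.1))
  · unfold orderIndicator
    have ho : Measurable fun x : EReal × EReal × (Fin v → ℝ) => orientation x.1 x.2.1 :=
      measurable_orientation.comp (by fun_prop : Measurable
        fun x : EReal × EReal × (Fin v → ℝ) => (x.1, x.2.1))
    refine Measurable.ite ?_ measurable_const measurable_const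
    simp only [Set.ofPred_forall]
    refine MeasurableSet.iInter fun i => MeasurableSet.iInter fun j => MeasurableSet.iInter fun _ =>
      ?_
    exact measurableSet_lt (by fun_prop) measurable_const

section TimeFactor

variable {n : ℕ} {v : Fin (n + 1) → ℕ}

lemma abs_timeFactor_le_one (t : Fin n → ℝ) (τ : Inner v → ℝ) : |timeFactor t τ| ≤ 1 := by
  unfold timeFactor
  rw [Finset.abs_prod]
  exact Finset.prod_le_one (fun j _ => abs_nonneg _) fun j _ => abs_simplexKernel_le_one _ _ _

lemma measurable_timeFactor (t : Fin n → ℝ) :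
    Measurable fun τ : Inner v → ℝ => timeFactor t τ := by
  unfold timeFactor
  refine Finset.measurable_prod _ fun i _ => ?_
  exact (measurable_simplexKernel (v i)).comp (by fun_prop : Measurable
    fun τ : Inner v → ℝ => (boundaryTime t i.succ, boundaryTime t i.castSucc, fun j => τ ⟨i, j⟩))

end TimeFactor

/-! ### Absolute convergence -/

/-- The weight `∏ (1 + |τ|)⁻²` on times. -/
def timeWeight {ι : Type} [Fintype ι] (τ : ι → ℝ) : ℝ := ∏ x, ((1 + |τ x|) ^ 2)⁻¹

/-- The weight `∏ (1 + ‖p‖)⁻⁴` on momenta. -/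
def momWeight {ι : Type} [Fintype ι] (p : ι → Mom) : ℝ := ∏ x, ((1 + ‖p x‖) ^ 4)⁻¹

lemma integrable_one_add_abs : Integrable fun x : ℝ => ((1 + |x|) ^ 2)⁻¹ := by
  have h := integrable_one_add_norm (E := ℝ) (μ := volume) (r := 2) (by simp)
  refine h.congr (Eventually.of_forall fun x => ?_)
  simp only
  rw [Real.rpow_neg (by positivity), Real.norm_eq_abs]
  norm_cast

lemma integrable_timeWeight (ι : Type) [Fintype ι] : Integrable fun τ : ι → ℝ => timeWeight τ :=
  Integrable.fintype_prod (f := fun _ (x : ℝ) => ((1 + |x|) ^ 2)⁻¹) fun _ => integrable_one_add_abs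

lemma integrable_momWeight (ι : Type) [Fintype ι] : Integrable fun p : ι → Mom => momWeight p :=
  integrable_prod_mom_weight ι

lemma timeWeight_nonneg {ι : Type} [Fintype ι] (τ : ι → ℝ) : 0 ≤ timeWeight τ :=
  Finset.prod_nonneg fun x _ => by positivity

lemma momWeight_nonneg {ι : Type} [Fintype ι] (p : ι → Mom) : 0 ≤ momWeight p :=
  Finset.prod_nonneg fun x _ => by positivity

lemma integrable_timeWeight_mul_momWeight (ι E : Type) [Fintype ι] [Fintype E] :
    Integrable fun x : (ι → ℝ) × (E → Mom) => timeWeight x.1 * momWeight x.2 :=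
  (integrable_timeWeight ι).mul_prod (integrable_momWeight E)

section Wick

variable (ω : DispersionFunction) (hI : AdmissibleInteraction) {m n : ℕ} {v : Fin (n + 1) → ℕ}

lemma norm_feynmanKernel_eval (α : Fin m → FieldPart) (s : Fin m → ℝ) (τ : Inner v → ℝ)
    (a : Vertex m v) {O I : Type} [Fintype O] [Fintype I] (p' : O → Mom) (p : I → Mom) :
    ‖(feynmanKernel ω hI α s τ a).eval p' p‖ = ‖(feynmanKernel ω hI α 0 0 a).eval p' p‖ := by
  unfold VertexKernel.eval
  rcases a with i | x
  · simp only [feynmanKernel, externalKernel]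
    cases α i <;> simp only <;> split_ifs <;> simp only [norm_prod, norm_fieldAmplitude]
  · simp only [feynmanKernel, internalKernel, norm_mul, norm_exp_I_mul]

lemma continuous_feynmanKernel_eval {T : Type*} [TopologicalSpace T] (α : Fin m → FieldPart)
    {s : T → Fin m → ℝ} (hs : Continuous s) {τ : T → Inner v → ℝ} (hτ : Continuous τ)
    (a : Vertex m v) {O I : Type} [Fintype O] [Fintype I] {p' : T → O → Mom} (hp' : Continuous p')
    {p : T → I → Mom} (hp : Continuous p) :
    Continuous fun z => (feynmanKernel ω hI α (s z) (τ z) a).eval (p' z) (p z) := by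
  have hp'j : ∀ j, Continuous fun z => p' z j := fun j => (continuous_apply j).comp hp'
  have hpj : ∀ j, Continuous fun z => p z j := fun j => (continuous_apply j).comp hp
  unfold VertexKernel.eval
  rcases a with i | x
  · have hsi : Continuous fun z => s z i := (continuous_apply i).comp hs
    simp only [feynmanKernel, externalKernel]
    cases α i <;> simp only <;> split_ifs
    · exact continuous_finsetProd _ fun j _ => (continuous_fieldAmplitude ω .plus).comp
        (hsi.prodMk (hp'j _))
    · exact continuous_const
    · exact continuous_finsetProd _ fun j _ => (continuous_fieldAmplitude ω .minus).comp
        (hsi.prodMk (hpj _))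
    · exact continuous_const
  · have hτx : Continuous fun z => τ z x := (continuous_apply x).comp hτ
    simp only [feynmanKernel, internalKernel]
    have h1 : Continuous fun z => hI.kernel (Fintype.card O) (Fintype.card I)
        (fun j => p' z ((Fintype.equivFin O).symm j)) (fun j => p z ((Fintype.equivFin I).symm j)) :=
      (hI.temperate _ _).1.continuous.comp
        ((continuous_pi fun j => hp'j _).prodMk (continuous_pi fun j => hpj _))
    have h2 : Continuous fun z => energyDefect ω
        (fun j => p' z ((Fintype.equivFin O).symm j)) (fun j => p z ((Fintype.equivFin I).symm j)) := by
      unfold energyDefect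
      exact Continuous.sub (continuous_finsetSum _ fun j _ => ω.continuous.comp (hp'j _))
        (continuous_finsetSum _ fun j _ => ω.continuous.comp (hpj _))
    fun_prop

/-- The seminorms of Schwartz space that control the values of a function. -/
def schwartzNorm {E : Type*} [NormedAddCommGroup E] [NormedSpace ℝ E] (N : ℕ) (Φ : 𝓢(E, ℂ)) : ℝ :=
  2 ^ N * ((Finset.Iic (N, 0)).sup (schwartzSeminormFamily ℂ E ℂ)) Φ

/-- The momentum defects of the vertices of a graph with multiplicities `μ`. -/
def multDefect (μ : Vertex m v → Vertex m v → ℕ) (p : MultLine μ → Mom) (a : Vertex m v) : Mom :=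
  ∑ e : {e : MultLine μ // e.1.1 = a}, p e - ∑ e : {e : MultLine μ // e.1.2 = a}, p e

/-- The weight of a graph at fixed times decays in all line momenta, up to powers of the momentum
defects. -/
lemma prod_feynmanKernel_decay (α : Fin m → FieldPart) (μ : Vertex m v → Vertex m v → ℕ) (N : ℕ) :
    ∃ (C : ℝ) (M : ℕ), 0 ≤ C ∧ ∀ (s : Fin m → ℝ) (τ : Inner v → ℝ) (p : MultLine μ → Mom),
      (∏ e, (1 + ‖p e‖)) ^ N * ‖∏ a, (feynmanKernel ω hI α s τ a).eval
        (fun e : {e : MultLine μ // e.1.1 = a} => p e)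
        (fun e : {e : MultLine μ // e.1.2 = a} => p e)‖ ≤ C * (1 + ‖multDefect μ p‖) ^ M := by
  obtain ⟨C, M, h0, h⟩ := vertexWeight_decay (feynmanKernel ω hI α (0 : Fin m → ℝ)
    (0 : Inner v → ℝ)) Finset.univ
    (Sum.elim (fun e : MultLine μ => e.1.1) (Fin.elim0 : Fin 0 → Vertex m v))
    (fun e => e.1.2) (fun e => Finset.mem_univ _) N
  refine ⟨C, M, h0, fun s τ p => ?_⟩
  have h1 := h Fin.elim0 0 p
  rw [vertexWeight_no_open, slotArgs_no_open, norm_prod] at h1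
  rw [norm_prod]
  simp only [norm_feynmanKernel_eval ω hI α s τ]
  exact h1

/-- The weights at the arguments of the test function dominate those of the times. -/
lemma one_add_norm_args_ge {τ : Inner v → ℝ} {κ : Vertex m v → Mom} :
    1 + ‖κ‖ ≤ 1 + ‖(((fun i => κ (Sum.inl i), fun x => (τ x, κ (Sum.inr x))) : Args m v))‖ ∧
      ∀ x, 1 + |τ x| ≤
        1 + ‖(((fun i => κ (Sum.inl i), fun x => (τ x, κ (Sum.inr x))) : Args m v))‖ := by
  set A : Args m v := (fun i => κ (Sum.inl i), fun x => (τ x, κ (Sum.inr x))) with hA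
  have h2 : ∀ x, ‖A.2 x‖ ≤ ‖A‖ := fun x => (norm_le_pi_norm A.2 x).trans (norm_snd_le A)
  refine ⟨by
    gcongr
    refine (pi_norm_le_iff_of_nonneg (norm_nonneg _)).2 fun a => ?_
    rcases a with i | x
    · exact (norm_le_pi_norm A.1 i).trans (norm_fst_le A)
    · exact (norm_snd_le (A.2 x)).trans (h2 x), fun x => ?_⟩
  gcongr
  exact (norm_fst_le (A.2 x)).trans (h2 x)

/-- The integrand of a graph is bounded by an integrable function of times and line momenta,
uniformly in the external times. The decay in the times and the powers of the momentum defects come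
from the test function. -/
lemma exists_wickTerm_bound (α : Fin m → FieldPart) (μ : Vertex m v → Vertex m v → ℕ) :
    ∃ (C : ℝ) (N : ℕ), 0 ≤ C ∧ ∀ (s : Fin m → ℝ) (Φ : 𝓢(Args m v, ℂ)) τ p,
      ‖wickTerm ω hI α s Φ μ τ p‖ ≤ C * schwartzNorm N Φ * (timeWeight τ * momWeight p) := by
  obtain ⟨C, M, h0, h⟩ := prod_feynmanKernel_decay ω hI α μ 4
  refine ⟨C, M + Fintype.card (Inner v) * 2, h0, fun s Φ τ p => ?_⟩
  set N := M + Fintype.card (Inner v) * 2 with hN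
  have h1 := h s τ p
  set A : Args m v := (fun i => multDefect μ p (Sum.inl i), fun x => (τ x, multDefect μ p (Sum.inr x)))
    with hA
  have h2 := schwartz_decay Φ N 0 0 le_rfl A
  rw [norm_iteratedFDeriv_zero] at h2
  change _ ≤ schwartzNorm N Φ at h2
  obtain ⟨hκ, hτ⟩ := one_add_norm_args_ge (τ := τ) (κ := multDefect μ p)
  rw [← hA] at hκ
  have hτ' : ∏ x : Inner v, (1 + |τ x|) ^ 2 ≤ (1 + ‖A‖) ^ (Fintype.card (Inner v) * 2) := by
    calc _ ≤ ∏ _x : Inner v, (1 + ‖A‖) ^ 2 :=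
          Finset.prod_le_prod (fun x _ => by positivity) fun x _ => by
            have := hτ x
            gcongr
      _ = _ := by rw [Finset.prod_const, Finset.card_univ, ← pow_mul, mul_comm 2]
  have hp1 := one_le_prod_one_add p
  have hτ1 : 0 < ∏ x : Inner v, (1 + |τ x|) ^ 2 := Finset.prod_pos fun x _ => by positivity
  have hp : 0 < (∏ e, (1 + ‖p e‖)) ^ 4 := by positivity
  unfold wickTerm timeWeight momWeight
  rw [Finset.prod_inv_distrib, Finset.prod_inv_distrib, Finset.prod_pow _ 4, ← mul_inv,
    ← div_eq_mul_inv, le_div_iff₀ (by positivity), norm_mul]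
  change ‖_‖ * ‖Φ A‖ * _ ≤ _
  set W := ‖∏ a, (feynmanKernel ω hI α s τ a).eval
        (fun e : {e : MultLine μ // e.1.1 = a} => p e)
        (fun e : {e : MultLine μ // e.1.2 = a} => p e)‖
  calc W * ‖Φ A‖ * ((∏ x : Inner v, (1 + |τ x|) ^ 2) * (∏ e, (1 + ‖p e‖)) ^ 4)
      = ((∏ e, (1 + ‖p e‖)) ^ 4 * W) * ((∏ x : Inner v, (1 + |τ x|) ^ 2) * ‖Φ A‖) := by ring
    _ ≤ (C * (1 + ‖A‖) ^ M) * ((1 + ‖A‖) ^ (Fintype.card (Inner v) * 2) * ‖Φ A‖) := by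
        have h1' : (∏ e, (1 + ‖p e‖)) ^ 4 * W ≤ C * (1 + ‖A‖) ^ M := h1.trans (by gcongr)
        gcongr
    _ = C * ((1 + ‖A‖) ^ N * ‖Φ A‖) := by rw [hN, pow_add]; ring
    _ ≤ C * schwartzNorm N Φ := by gcongr

lemma continuous_wickTerm (α : Fin m → FieldPart) (s : Fin m → ℝ) (Φ : 𝓢(Args m v, ℂ))
    (μ : Vertex m v → Vertex m v → ℕ) :
    Continuous fun x : (Inner v → ℝ) × (MultLine μ → Mom) => wickTerm ω hI α s Φ μ x.1 x.2 := by
  unfold wickTerm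
  refine Continuous.mul (continuous_finsetProd _ fun a _ => ?_) (Φ.continuous.comp (by fun_prop))
  exact continuous_feynmanKernel_eval ω hI α continuous_const continuous_fst a (by fun_prop)
    (by fun_prop)

lemma integrable_timeFactor_mul_wickTerm (α : Fin m → FieldPart) (s : Fin m → ℝ)
    (t : Fin n → ℝ) (Φ : 𝓢(Args m v, ℂ)) (μ : Vertex m v → Vertex m v → ℕ) :
    Integrable fun x : (Inner v → ℝ) × (MultLine μ → Mom) =>
      (timeFactor t x.1 : ℂ) * wickTerm ω hI α s Φ μ x.1 x.2 := by
  obtain ⟨C, N, h0, h⟩ := exists_wickTerm_bound ω hI α μ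
  refine ((integrable_timeWeight_mul_momWeight _ _).const_mul (C * schwartzNorm N Φ)).mono'
    ?_ (Eventually.of_forall fun x => ?_)
  · refine AEStronglyMeasurable.mul ?_ (continuous_wickTerm ω hI α s Φ μ).aestronglyMeasurable
    exact (Complex.measurable_ofReal.comp
      ((measurable_timeFactor t).comp measurable_fst)).aestronglyMeasurable
  · rw [norm_mul, Complex.norm_real, Real.norm_eq_abs]
    exact (mul_le_of_le_one_left (norm_nonneg _) (abs_timeFactor_le_one _ _)).trans (h s Φ _ _)

end Wick

namespace FeynmanGraph

variable (ω : DispersionFunction) (hI : AdmissibleInteraction) {m n : ℕ} {v : Fin (n + 1) → ℕ}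

lemma card_out (Γ : FeynmanGraph m v) (a : Vertex m v) :
    Fintype.card (Γ.Out a) = ∑ b, Γ.mult a b := by
  have e : Γ.Out a ≃ Σ b, {e : Γ.Line // e.1.1 = a ∧ e.1.2 = b} :=
    ⟨fun e => ⟨e.1.1.2, e.1, e.2, rfl⟩, fun x => ⟨x.2.1, x.2.2.1⟩, fun _ => rfl, by
      rintro ⟨a, e, h, rfl⟩; rfl⟩
  rw [Fintype.card_congr e, Fintype.card_sigma]
  exact Finset.sum_congr rfl fun b _ => card_multLine Γ.mult a b

lemma card_in (Γ : FeynmanGraph m v) (b : Vertex m v) :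
    Fintype.card (Γ.In b) = ∑ a, Γ.mult a b := card_multLine_target Γ.mult b

/-- The automorphisms of a graph are the permutations of parallel lines. -/
lemma card_aut (Γ : FeynmanGraph m v) : Nat.card Γ.Aut = ∏ b, ∏ a, (Γ.mult b a)! := by
  have e : Γ.Aut ≃ {σ : Equiv.Perm Γ.Line // (fun e : Γ.Line => e.1) ∘ σ = fun e => e.1} :=
    Equiv.subtypeEquivRight fun σ => by rw [funext_iff]; rfl
  rw [Nat.card_congr e, nat_card_perm_comp_eq _ _ fun _ => rfl, Fintype.prod_prod_type]
  refine Finset.prod_congr rfl fun b _ => Finset.prod_congr rfl fun a _ => ?_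
  rw [Fintype.card_congr (Equiv.sigmaSubtype (b, a)), Fintype.card_fin]

/-- The integrand of the Feynman rules is the integrand of Wick's theorem. -/
lemma integrand_eq (Γ : FeynmanGraph m v) (α : Fin m → FieldPart) (s : Fin m → ℝ) (t : Fin n → ℝ)
    (Φ : Args m v → ℂ) (x : (Inner v → ℝ) × (Γ.Line → Mom)) :
    Γ.integrand ω hI α s t Φ x = (timeFactor t x.1 : ℂ) * wickTerm ω hI α s Φ Γ.mult x.1 x.2 := by
  obtain ⟨τ, p⟩ := x
  unfold integrand wickTerm
  rw [mul_assoc, mul_assoc, ← mul_assoc (∏ y, _)]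
  congr 2
  rw [Fintype.prod_sum_type, mul_comm]
  congr 1
  · refine Finset.prod_congr rfl fun i _ => ?_
    -- exactly one line meets an external vertex, so the powers of zero in the external factor, over
    -- the incoming or outgoing lines, decide whether it has the right direction
    have hdeg : Fintype.card (Γ.Out (Sum.inl i)) + Fintype.card (Γ.In (Sum.inl i)) = 1 := by
      rw [card_out, card_in, ← Finset.sum_add_distrib, Γ.external i]
    unfold externalFactor VertexKernel.eval
    simp only [feynmanKernel, externalKernel]
    cases α i <;> simp only
    · by_cases h : Fintype.card (Γ.In (Sum.inl i)) = 0
      · have h1 : Fintype.card (Γ.Out (Sum.inl i)) = 1 := by omega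
        rw [if_pos ⟨h1, h⟩, Finset.prod_const, Finset.card_univ, h, pow_zero, mul_one]
        exact (Equiv.prod_comp (Fintype.equivFin (Γ.Out (Sum.inl i))).symm
          (fun e => fieldAmplitude ω .plus (s i) (p e))).symm
      · rw [if_neg fun h' => h h'.2, Finset.prod_const, Finset.card_univ, zero_pow h, mul_zero]
    · by_cases h : Fintype.card (Γ.Out (Sum.inl i)) = 0
      · have h1 : Fintype.card (Γ.In (Sum.inl i)) = 1 := by omega
        rw [if_pos ⟨h, h1⟩, Finset.prod_const, Finset.card_univ, h, pow_zero, one_mul]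
        exact (Equiv.prod_comp (Fintype.equivFin (Γ.In (Sum.inl i))).symm
          (fun e => fieldAmplitude ω .minus (s i) (p e))).symm
      · rw [if_neg fun h' => h h'.1, Finset.prod_const, Finset.card_univ, zero_pow h, zero_mul]
  · refine Finset.prod_congr rfl fun y _ => ?_
    unfold vertexFactor VertexKernel.eval
    simp only [feynmanKernel, internalKernel]
    congr 4
    unfold energyDefect
    rw [Equiv.sum_comp (Fintype.equivFin (Γ.Out (Sum.inr y))).symm (fun e => ω.toFun (p e)),
      Equiv.sum_comp (Fintype.equivFin (Γ.In (Sum.inr y))).symm (fun e => ω.toFun (p e))]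

lemma integrable_integrand (Γ : FeynmanGraph m v) (α : Fin m → FieldPart) (s : Fin m → ℝ)
    (t : Fin n → ℝ) (Φ : 𝓢(Args m v, ℂ)) : Integrable (Γ.integrand ω hI α s t Φ) :=
  (integrable_timeFactor_mul_wickTerm ω hI α s t Φ Γ.mult).congr
    (Eventually.of_forall fun x => (Γ.integrand_eq ω hI α s t Φ x).symm)

lemma contribution_eq (Γ : FeynmanGraph m v) (α : Fin m → FieldPart) (s : Fin m → ℝ)
    (t : Fin n → ℝ) (Φ : Args m v → ℂ) : Γ.contribution ω hI α s t Φ =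
      (∏ b, ∏ a, ((Γ.mult b a)! : ℂ))⁻¹ * ∫ x : (Inner v → ℝ) × (Γ.Line → Mom),
        (timeFactor t x.1 : ℂ) * wickTerm ω hI α s Φ Γ.mult x.1 x.2 := by
  unfold contribution
  rw [card_aut]
  push_cast
  simp only [integrand_eq]

end FeynmanGraph

section Sum

variable (ω : DispersionFunction) (hI : AdmissibleInteraction) {m n : ℕ} {v : Fin (n + 1) → ℕ}

/-- Only graphs whose vertices have bounded degrees contribute. -/
lemma wickTerm_eq_zero_of_degree (α : Fin m → FieldPart) (s : Fin m → ℝ) (Φ : Args m v → ℂ)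
    (μ : Vertex m v → Vertex m v → ℕ) (τ : Inner v → ℝ) (p : MultLine μ → Mom) (a : Vertex m v)
    (h : (feynmanKernel ω hI α s τ a).bound < ∑ b, (μ a b + μ b a)) :
    wickTerm ω hI α s Φ μ τ p = 0 := by
  unfold wickTerm
  refine mul_eq_zero_of_left (Finset.prod_eq_zero (Finset.mem_univ a)
    (VertexKernel.eval_eq_zero _ ?_ _ _)) _
  refine h.trans_eq ?_
  rw [Finset.sum_add_distrib, card_multLine_target]
  congr 1
  have e : {e : MultLine μ // e.1.1 = a} ≃ Σ b, {e : MultLine μ // e.1.1 = a ∧ e.1.2 = b} :=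
    ⟨fun e => ⟨e.1.1.2, e.1, e.2, rfl⟩, fun x => ⟨x.2.1, x.2.2.1⟩, fun _ => rfl, by
      rintro ⟨a, e, h, rfl⟩; rfl⟩
  rw [Fintype.card_congr e, Fintype.card_sigma]
  exact Finset.sum_congr rfl fun b _ => (card_multLine μ a b).symm

/-- External vertices belong to exactly one line. -/
lemma wickTerm_eq_zero_of_external (α : Fin m → FieldPart) (s : Fin m → ℝ) (Φ : Args m v → ℂ)
    (μ : Vertex m v → Vertex m v → ℕ) (τ : Inner v → ℝ) (p : MultLine μ → Mom) (i : Fin m)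
    (h : ∑ b, (μ (Sum.inl i) b + μ b (Sum.inl i)) ≠ 1) : wickTerm ω hI α s Φ μ τ p = 0 := by
  rcases lt_or_gt_of_ne h with h | h
  · have h0 : ∀ b, μ (Sum.inl i) b = 0 ∧ μ b (Sum.inl i) = 0 := fun b => by
      have := Finset.single_le_sum (f := fun b => μ (Sum.inl i) b + μ b (Sum.inl i))
        (fun _ _ => Nat.zero_le _) (Finset.mem_univ b)
      omega
    have hO : Fintype.card {e : MultLine μ // e.1.1 = Sum.inl i} = 0 :=
      Fintype.card_eq_zero_iff.2 ⟨by
        rintro ⟨⟨⟨a, b⟩, j⟩, h1⟩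
        obtain rfl : a = Sum.inl i := h1
        exact (Fin.pos j).ne' (h0 b).1⟩
    have hN : Fintype.card {e : MultLine μ // e.1.2 = Sum.inl i} = 0 :=
      Fintype.card_eq_zero_iff.2 ⟨by
        rintro ⟨⟨⟨a, b⟩, j⟩, h1⟩
        obtain rfl : b = Sum.inl i := h1
        exact (Fin.pos j).ne' (h0 a).2⟩
    unfold wickTerm
    refine mul_eq_zero_of_left (Finset.prod_eq_zero (Finset.mem_univ (Sum.inl i)) ?_) _
    unfold VertexKernel.eval
    simp only [feynmanKernel, externalKernel]
    cases α i <;> simp only <;> rw [if_neg (by omega)]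
  · exact wickTerm_eq_zero_of_degree ω hI α s Φ μ τ p (Sum.inl i) h

/-- The graphs with at most `B` lines between any two vertices. -/
lemma finite_mult_le (m : ℕ) (v : Fin (n + 1) → ℕ) (B : ℕ) :
    {Γ : FeynmanGraph m v | ∀ a b, Γ.mult a b ≤ B}.Finite := by
  refine Set.Finite.of_finite_image (f := FeynmanGraph.mult) ?_ fun Γ _ Γ' _ h =>
    FeynmanGraph.ext h
  refine (multSet (fun _ _ : Vertex m v => True) B Finset.univ).finite_toSet.subset ?_
  rintro _ ⟨Γ, hΓ, rfl⟩
  exact Finset.mem_coe.2 (mem_multSet.2 fun b a => ⟨hΓ b a, fun _ => by simp⟩)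

lemma mult_le_of_contribution_ne_zero (Γ : FeynmanGraph m v) (α : Fin m → FieldPart)
    (s : Fin m → ℝ) (t : Fin n → ℝ) (Φ : Args m v → ℂ) (h : Γ.contribution ω hI α s t Φ ≠ 0)
    (a b : Vertex m v) : Γ.mult a b ≤ hI.bound + 1 := by
  by_contra hcon
  refine h ?_
  rw [FeynmanGraph.contribution_eq]
  refine mul_eq_zero_of_right _ (integral_eq_zero_of_ae (Eventually.of_forall fun x => ?_))
  refine mul_eq_zero_of_right _ (wickTerm_eq_zero_of_degree ω hI α s Φ Γ.mult x.1 x.2 a ?_)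
  have h1 := feynmanKernel_bound_le ω hI α s x.1 a
  have h2 := Finset.single_le_sum (f := fun b => Γ.mult a b + Γ.mult b a)
    (fun _ _ => Nat.zero_le _) (Finset.mem_univ b)
  omega

lemma finite_contribution_ne_zero (m : ℕ) (v : Fin (n + 1) → ℕ) (α : Fin m → FieldPart) :
    {Γ : FeynmanGraph m v | ∃ s t Φ, Γ.contribution ω hI α s t Φ ≠ 0}.Finite :=
  (finite_mult_le m v (hI.bound + 1)).subset fun Γ ⟨s, t, Φ, h⟩ a b =>
    mult_le_of_contribution_ne_zero ω hI Γ α s t Φ h a b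

/-- The coefficient distributions with only the first `m` external vertices. -/
def partialCoefficient (α : Fin m → FieldPart) (s : Fin m → ℝ) (v : Fin (n + 1) → ℕ)
    (Φ : Args m v → ℂ) (t : Fin n → ℝ) : ℂ :=
  ∫ τ : Inner v → ℝ, (timeFactor t τ : ℂ) *
    vacPairing ((partialWord m v).foldr (vertexOperator ω hI α s τ)
      (vac fun κ => Φ (fun i => κ (Sum.inl i), fun x => (τ x, κ (Sum.inr x)))))

lemma partialCoefficient_self (α : Fin n → FieldPart) (v : Fin (n + 1) → ℕ) (Φ : Args n v → ℂ)
    (t : Fin n → ℝ) : partialCoefficient ω hI α t v Φ t = coefficient ω hI α v Φ t := by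
  unfold partialCoefficient coefficient
  simp only [partialWord_eq_operatorWord, vertexOp_eq_vertexOperator]

/-- The sum over graphs is a finite sum over the multiplicities of lines. Multiplicities which are
not those of a graph, because the number of lines at an external vertex differs from one, contribute
zero. -/
lemma finsum_contribution_eq_sum (α : Fin m → FieldPart) (s : Fin m → ℝ) (Φ : Args m v → ℂ)
    (t : Fin n → ℝ) : ∑ᶠ Γ : FeynmanGraph m v, Γ.contribution ω hI α s t Φ =
      ∑ μ ∈ multSet Vertex.Precedes (hI.bound + 1) Finset.univ, (∏ b, ∏ a, ((μ b a)! : ℂ))⁻¹ *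
        ∫ x : (Inner v → ℝ) × (MultLine μ → Mom),
          (timeFactor t x.1 : ℂ) * wickTerm ω hI α s Φ μ x.1 x.2 := by
  rw [finsum_eq_sum_of_support_subset (s := (finite_mult_le m v (hI.bound + 1)).toFinset) _
    fun Γ h => by
      rw [Set.Finite.coe_toFinset]
      exact fun a b => mult_le_of_contribution_ne_zero ω hI Γ α s t Φ h a b]
  refine Finset.sum_of_injOn FeynmanGraph.mult (fun Γ _ Γ' _ h => FeynmanGraph.ext h) ?_ ?_ ?_
  · intro Γ hΓ
    rw [Set.Finite.coe_toFinset] at hΓ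
    exact Finset.mem_coe.2 (mem_multSet.2 fun b a => ⟨hΓ b a, fun h => ⟨by simp, by simp,
      Γ.ordered b a h⟩⟩)
  · intro μ hμ hμ'
    have hμ := mem_multSet.1 hμ
    have hex : ∃ i : Fin m, ∑ b, (μ (Sum.inl i) b + μ b (Sum.inl i)) ≠ 1 := by
      by_contra hcon
      push Not at hcon
      refine hμ' ⟨⟨μ, fun a b h => ((hμ a b).2 h).2.2, hcon⟩, ?_, rfl⟩
      rw [Set.Finite.coe_toFinset]
      exact fun a b => (hμ a b).1
    obtain ⟨i, hi⟩ := hex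
    refine mul_eq_zero_of_right _ (integral_eq_zero_of_ae (Eventually.of_forall fun x => ?_))
    exact mul_eq_zero_of_right _ (wickTerm_eq_zero_of_external ω hI α s Φ μ x.1 x.2 i hi)
  · intro Γ _
    exact Γ.contribution_eq ω hI α s t Φ

/-- The Feynman rules for the coefficient distributions. -/
lemma partialCoefficient_eq_finsum (hmn : m ≤ n) (α : Fin m → FieldPart) (s : Fin m → ℝ)
    (Φ : 𝓢(Args m v, ℂ)) (t : Fin n → ℝ) : partialCoefficient ω hI α s v Φ t =
      ∑ᶠ Γ : FeynmanGraph m v, Γ.contribution ω hI α s t Φ := by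
  rw [finsum_contribution_eq_sum]
  unfold partialCoefficient
  simp only [vacPairing_word ω hI hmn α s Φ, Finset.mul_sum]
  have hint := integrable_timeFactor_mul_wickTerm ω hI α s t Φ
  have h1 : ∀ (μ : Vertex m v → Vertex m v → ℕ) (τ : Inner v → ℝ),
      (timeFactor t τ : ℂ) * ((∏ b, ∏ a, ((μ b a)! : ℂ))⁻¹ * ∫ p, wickTerm ω hI α s Φ μ τ p) =
      (∏ b, ∏ a, ((μ b a)! : ℂ))⁻¹ * ∫ p, (timeFactor t τ : ℂ) * wickTerm ω hI α s Φ μ τ p := by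
    intro μ τ
    rw [integral_const_mul]; ring
  simp only [h1]
  rw [integral_finsetSum _ fun μ _ => ((hint μ).integral_prod_left).const_mul _]
  refine Finset.sum_congr rfl fun μ _ => ?_
  rw [integral_const_mul, Measure.volume_eq_prod, integral_prod _ (hint μ)]

end Sum

/-! ### Rescaling the time simplices to fixed ones -/

lemma stepKernel_self (τ : ℝ) (a : EReal) : stepKernel τ a a = 0 := by
  unfold stepKernel
  rw [if_neg fun h => (lt_asymm h.1 h.2).elim, if_neg fun h => (lt_asymm h.1 h.2).elim]

lemma stepKernel_of_lt {a b : EReal} (h : a < b) (τ : ℝ) :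
    stepKernel τ a b = if a < τ ∧ (τ : EReal) < b then 1 else 0 := by
  unfold stepKernel
  rw [if_neg (c := b < τ ∧ (τ : EReal) < a) fun h' => (h'.1.trans h'.2).not_gt h]

lemma stepKernel_swap (τ : ℝ) (a b : EReal) : stepKernel τ b a = -stepKernel τ a b := by
  rcases lt_trichotomy a b with h | rfl | h
  · rw [stepKernel_of_lt h]
    unfold stepKernel
    rw [if_neg (c := b < τ ∧ (τ : EReal) < a) fun h' => (h'.1.trans h'.2).not_gt h]
    split_ifs <;> simp
  · simp [stepKernel_self]
  · rw [stepKernel_of_lt h]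
    unfold stepKernel
    rw [if_neg (c := a < τ ∧ (τ : EReal) < b) fun h' => (h'.1.trans h'.2).not_gt h]
    split_ifs <;> simp

lemma simplexKernel_of_lt {v : ℕ} {a b : EReal} (h : a < b) (τ : Fin v → ℝ) :
    simplexKernel a b τ = (∏ j, stepKernel (τ j) a b) *
      orderIndicator (fun i j : Fin v => i < j) (-1) τ := by
  simp [simplexKernel, orientation, h]

lemma simplexKernel_of_gt {v : ℕ} {a b : EReal} (h : b < a) (τ : Fin v → ℝ) :
    simplexKernel a b τ = (∏ j, stepKernel (τ j) a b) *
      orderIndicator (fun i j : Fin v => i < j) 1 τ := by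
  simp [simplexKernel, orientation, h, h.not_gt]

lemma simplexKernel_zero (a b : EReal) (τ : Fin 0 → ℝ) : simplexKernel a b τ = 1 := by
  simp [simplexKernel, orderIndicator]

lemma simplexKernel_self {v : ℕ} (a : EReal) (τ : Fin (v + 1) → ℝ) : simplexKernel a a τ = 0 := by
  simp [simplexKernel, stepKernel_self]

lemma orderIndicator_scale {v : ℕ} {η η' : ℝ} {c : ℝ} (b : ℝ) (h : 0 < η * c / η') (hη : η' ≠ 0)
    (u : Fin v → ℝ) : orderIndicator (fun i j : Fin v => i < j) η (fun j => b + c * u j) =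
      orderIndicator (fun i j : Fin v => i < j) η' u := by
  unfold orderIndicator
  congr 1
  refine propext (forall₂_congr fun i j => imp_congr_right fun _ => ?_)
  have : η * (b + c * u i - (b + c * u j)) = (η * c / η') * (η' * (u i - u j)) := by
    field_simp
    ring
  rw [this, mul_neg_iff]
  constructor
  · rintro (h' | h')
    · exact h'.2
    · exact absurd h'.1 (by linarith)
  · exact fun h' => Or.inl ⟨h, h'⟩

/-- An increasing affine substitution in the kernel of a simplex integral. -/
lemma simplexKernel_affine_pos {v : ℕ} {a b lo hi : EReal} (hab : a < b) (hlh : lo < hi) {x c : ℝ}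
    (hc : 0 < c) (h1 : ∀ u : ℝ, a < ((x + c * u : ℝ) : EReal) ↔ lo < u)
    (h2 : ∀ u : ℝ, ((x + c * u : ℝ) : EReal) < b ↔ (u : EReal) < hi) (u : Fin v → ℝ) :
    simplexKernel a b (fun j => x + c * u j) = simplexKernel lo hi u := by
  rw [simplexKernel_of_lt hab, simplexKernel_of_lt hlh]
  congr 1
  · refine Finset.prod_congr rfl fun j _ => ?_
    rw [stepKernel_of_lt hab, stepKernel_of_lt hlh]
    simp only [h1, h2]
  · exact orderIndicator_scale x (by linarith) (by norm_num) u

lemma coe_lt_affine_iff {c : ℝ} (hc : 0 < c) (x y u : ℝ) :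
    ((x + c * y : ℝ) : EReal) < ((x + c * u : ℝ) : EReal) ↔ (y : EReal) < u := by
  rw [EReal.coe_lt_coe_iff, EReal.coe_lt_coe_iff, add_lt_add_iff_left, mul_lt_mul_iff_right₀ hc]

/-- A bounded oriented simplex is the affine image of the standard one. -/
lemma simplexKernel_affine {v : ℕ} (a b : ℝ) (u : Fin v → ℝ) :
    simplexKernel a b (fun j => a + (b - a) * u j) * |b - a| ^ v =
      (b - a) ^ v * simplexKernel 0 1 u := by
  have h01 : (0 : EReal) < 1 := zero_lt_one
  rcases lt_trichotomy a b with h | rfl | h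
  · rw [simplexKernel_affine_pos (lo := 0) (hi := 1) (EReal.coe_lt_coe_iff.2 h) h01
      (sub_pos.2 h) (fun u => ?_) (fun u => ?_), abs_of_pos (sub_pos.2 h), mul_comm]
    · have := coe_lt_affine_iff (sub_pos.2 h) a 0 u
      simpa using this
    · have := coe_lt_affine_iff (sub_pos.2 h) a u 1
      simpa using this
  · rcases v with _ | v
    · simp [simplexKernel_zero]
    · rw [simplexKernel_self, sub_self, zero_pow (Nat.succ_ne_zero v)]; simp
  · have hc : 0 < a - b := sub_pos.2 h
    rw [simplexKernel_of_gt (EReal.coe_lt_coe_iff.2 h), simplexKernel_of_lt h01,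
      orderIndicator_scale (η' := -1) a (by linarith) (by norm_num) u]
    -- each of the `v` step kernels changes sign, which compensates the sign of `(b - a) ^ v`
    have hs : ∀ j, stepKernel (a + (b - a) * u j) a b = -1 * stepKernel (u j) 0 1 := fun j => by
      rw [stepKernel_swap, stepKernel_of_lt (EReal.coe_lt_coe_iff.2 h), stepKernel_of_lt h01,
        neg_one_mul]
      congr 1
      have e1 : ((b : EReal) < ((a + (b - a) * u j : ℝ) : EReal)) ↔ ((u j : ℝ) : EReal) < 1 := by
        rw [EReal.coe_lt_coe_iff, ← EReal.coe_one, EReal.coe_lt_coe_iff]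
        constructor <;> intro h' <;> nlinarith
      have e2 : (((a + (b - a) * u j : ℝ) : EReal) < a) ↔ (0 : EReal) < ((u j : ℝ) : EReal) := by
        rw [EReal.coe_lt_coe_iff, ← EReal.coe_zero, EReal.coe_lt_coe_iff]
        constructor <;> intro h' <;> nlinarith
      simp only [e1, e2]
      exact if_congr and_comm rfl rfl
    simp only [hs, Finset.prod_mul_distrib, Finset.prod_const, Finset.card_univ, Fintype.card_fin]
    rw [abs_of_neg (by linarith), ← neg_one_mul (b - a), mul_pow]
    have : ((-1 : ℝ) ^ v) * (-1) ^ v = 1 := by rw [← mul_pow]; norm_num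
    linear_combination ((b - a) ^ v * (∏ j, stepKernel (u j) 0 1) *
      orderIndicator (fun i j : Fin v => i < j) (-1) u) * this

section Rescale

variable {n : ℕ} {v : Fin (n + 1) → ℕ}

/-- The origin of the affine coordinate in the `i`-th time simplex. -/
def affineBase (t : Fin n → ℝ) (i : Fin (n + 1)) : ℝ :=
  if h : (i : ℕ) < n then t ⟨i, h⟩ else if h : 0 < n then t ⟨n - 1, by omega⟩ else 0

/-- The scale of the affine coordinate in the `i`-th time simplex: the length of a bounded simplex,
and `1` for an unbounded one. -/
def affineScale (t : Fin n → ℝ) (i : Fin (n + 1)) : ℝ :=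
  if h : 0 < (i : ℕ) ∧ (i : ℕ) < n then t ⟨i - 1, by omega⟩ - t ⟨i, h.2⟩ else 1

/-- The lower end of the `i`-th time simplex in the affine coordinate. -/
def refLower (n : ℕ) (i : Fin (n + 1)) : EReal := if (i : ℕ) < n then 0 else ⊥

/-- The upper end of the `i`-th time simplex in the affine coordinate. -/
def refUpper (n : ℕ) (i : Fin (n + 1)) : EReal :=
  if (i : ℕ) = 0 then ⊤ else if (i : ℕ) < n then 1 else 0

/-- The kernel of the time integrals in the affine coordinates. It does not depend on the times. -/
def refFactor (v : Fin (n + 1) → ℕ) (u : Inner v → ℝ) : ℝ :=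
  ∏ i, simplexKernel (refLower n i) (refUpper n i) fun j => u ⟨i, j⟩

lemma boundaryTime_succ (t : Fin n → ℝ) (i : Fin (n + 1)) :
    boundaryTime t i.succ = if h : (i : ℕ) < n then (t ⟨i, h⟩ : EReal) else ⊥ := by
  unfold boundaryTime
  rw [Fin.cons_succ, Fin.snoc]
  split_ifs with h
  · rfl
  · rfl

lemma boundaryTime_castSucc (t : Fin n → ℝ) (i : Fin (n + 1)) :
    boundaryTime t i.castSucc =
      if h : 0 < (i : ℕ) then (t ⟨i - 1, by omega⟩ : EReal) else ⊤ := by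
  refine Fin.cases ?_ (fun j => ?_) i
  · rfl
  · rw [dif_pos (by simp), ← Fin.succ_castSucc]
    unfold boundaryTime
    rw [Fin.cons_succ, Fin.snoc_castSucc]
    rfl

/-- In the affine coordinate the `i`-th time simplex becomes independent of the times; the sign of
the oriented simplex turns the absolute value of the Jacobian into the Jacobian itself, which is
polynomial in the times. -/
lemma simplexKernel_boundaryTime_affine (t : Fin n → ℝ) (i : Fin (n + 1)) {k : ℕ} (u : Fin k → ℝ) :
    simplexKernel (boundaryTime t i.succ) (boundaryTime t i.castSucc)
      (fun j => affineBase t i + affineScale t i * u j) * |affineScale t i| ^ k =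
    affineScale t i ^ k * simplexKernel (refLower n i) (refUpper n i) u := by
  rw [boundaryTime_succ, boundaryTime_castSucc]
  unfold affineBase affineScale refLower refUpper
  by_cases h1 : 0 < (i : ℕ) <;> by_cases h2 : (i : ℕ) < n
  · simp only [h1, h2, h1.ne', and_self, dif_pos, if_true, if_false]
    exact simplexKernel_affine _ _ u
  · have h3 : (i : ℕ) = n := by omega
    have h4 : 0 < n := by omega
    simp only [h1, h2, h4, h1.ne', and_false, dif_pos, dif_neg, if_false, not_false_iff, one_pow,
      abs_one, mul_one, one_mul]
    have h5 : (⟨(i : ℕ) - 1, by omega⟩ : Fin n) = ⟨n - 1, by omega⟩ := by ext; simp [h3]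
    rw [h5]
    have := simplexKernel_affine_pos (v := k) (a := ⊥) (b := (t ⟨n - 1, by omega⟩ : EReal))
      (lo := ⊥) (hi := 0) (x := t ⟨n - 1, by omega⟩) (EReal.bot_lt_coe _) EReal.bot_lt_zero
      one_pos (fun u => by simp only [EReal.bot_lt_coe]) (fun u => by
        have := coe_lt_affine_iff one_pos (t ⟨n - 1, by omega⟩) u 0
        simpa using this) u
    simpa only [one_mul] using this
  · simp only [h1, h2, false_and, dif_pos, dif_neg, if_true, not_false_iff, one_pow,
      abs_one, mul_one, one_mul]
    have h3 : (i : ℕ) = 0 := by omega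
    rw [if_pos h3]
    have := simplexKernel_affine_pos (v := k) (a := (t ⟨i, h2⟩ : EReal)) (b := ⊤)
      (lo := 0) (hi := ⊤) (x := t ⟨i, h2⟩) (EReal.coe_lt_top _) EReal.zero_lt_top
      one_pos (fun u => by
        have := coe_lt_affine_iff one_pos (t ⟨i, h2⟩) 0 u
        simpa using this) (fun u => by simp only [EReal.coe_lt_top]) u
    simpa only [one_mul] using this
  · have h3 : (i : ℕ) = 0 := by omega
    have h4 : ¬ 0 < n := by omega
    simp only [h1, h2, h4, false_and, dif_neg, if_false, not_false_iff, one_pow,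
      abs_one, mul_one, one_mul, zero_add]
    rw [if_pos h3]

/-- The affine coordinates on the time simplices. -/
def affineTimes (t : Fin n → ℝ) (u : Inner v → ℝ) : Inner v → ℝ :=
  fun x => affineBase t x.1 + affineScale t x.1 * u x

/-- The time factor in affine coordinates; the oriented simplices replace the absolute value of the
Jacobian by the Jacobian. -/
lemma timeFactor_affineTimes (t : Fin n → ℝ) (u : Inner v → ℝ) :
    timeFactor t (affineTimes t u) * |∏ x : Inner v, affineScale t x.1| =
      (∏ x : Inner v, affineScale t x.1) * refFactor v u := by
  have h : ∀ f : Fin (n + 1) → ℝ, ∏ x : Inner v, f x.1 = ∏ i, f i ^ v i := fun f => by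
    rw [Fintype.prod_sigma]
    simp
  rw [Finset.abs_prod, h, h (fun i => |affineScale t i|), timeFactor, refFactor,
    ← Finset.prod_mul_distrib, ← Finset.prod_mul_distrib]
  exact Finset.prod_congr rfl fun i _ => simplexKernel_boundaryTime_affine t i _

/-- A nonempty time simplex between coinciding times vanishes. -/
lemma timeFactor_eq_zero (t : Fin n → ℝ) (x : Inner v) (hx : affineScale t x.1 = 0)
    (τ : Inner v → ℝ) : timeFactor t τ = 0 := by
  obtain ⟨i, j⟩ := x
  refine Finset.prod_eq_zero (Finset.mem_univ i) ?_
  unfold affineScale at hx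
  split_ifs at hx with h
  · rw [boundaryTime_succ, boundaryTime_castSucc, dif_pos h.2, dif_pos h.1, sub_eq_zero.1 hx]
    refine mul_eq_zero_of_left (Finset.prod_eq_zero (Finset.mem_univ j) ?_) _
    exact stepKernel_self _ _
  · exact absurd hx one_ne_zero

/-- In the bounded simplices the affine coordinates are bounded. -/
lemma abs_le_one_of_refFactor_ne_zero {u : Inner v → ℝ} (hu : refFactor v u ≠ 0) (x : Inner v)
    (hx : 0 < (x.1 : ℕ) ∧ (x.1 : ℕ) < n) : |u x| ≤ 1 := by
  obtain ⟨i, j⟩ := x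
  have h1 := Finset.prod_ne_zero_iff.1 hu i (Finset.mem_univ i)
  have h2 := Finset.prod_ne_zero_iff.1 (left_ne_zero_of_mul h1) j (Finset.mem_univ j)
  simp only [refLower, refUpper] at hx h2
  rw [if_pos hx.2, if_neg hx.1.ne', if_pos hx.2, stepKernel_of_lt zero_lt_one] at h2
  have h3 := (ite_ne_right_iff.1 h2).1
  rw [← EReal.coe_zero, ← EReal.coe_one, EReal.coe_lt_coe_iff, EReal.coe_lt_coe_iff] at h3
  rw [abs_le]
  constructor <;> linarith [h3.1, h3.2]

lemma abs_refFactor_le_one (u : Inner v → ℝ) : |refFactor v u| ≤ 1 := by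
  unfold refFactor
  rw [Finset.abs_prod]
  exact Finset.prod_le_one (fun j _ => abs_nonneg _) fun j _ => abs_simplexKernel_le_one _ _ _

lemma measurable_refFactor : Measurable fun u : Inner v → ℝ => refFactor v u := by
  unfold refFactor
  refine Finset.measurable_prod _ fun i _ => ?_
  exact (measurable_simplexKernel (v i)).comp (by fun_prop : Measurable
    fun τ : Inner v → ℝ => (refLower n i, refUpper n i, fun j => τ ⟨i, j⟩))

end Rescale

/-- An affine change of variables that acts on each coordinate separately. -/
lemma integral_affine {ι Y : Type} [Fintype ι] [MeasureSpace Y] [SigmaFinite (volume : Measure Y)]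
    (c b : ι → ℝ) (hc : ∀ x, c x ≠ 0) (f : (ι → ℝ) × Y → ℂ) :
    ∫ z, f z = ((|∏ x, c x| : ℝ) : ℂ) * ∫ z : (ι → ℝ) × Y, f (fun x => b x + c x * z.1 x, z.2) := by
  classical
  let e : (ι → ℝ) ≃ᵐ (ι → ℝ) :=
    { toFun := fun u x => b x + c x * u x
      invFun := fun τ x => (τ x - b x) / c x
      left_inv := fun u => by ext x; have := hc x; field_simp; ring
      right_inv := fun u => by ext x; have := hc x; field_simp; ring
      measurable_toFun := by simp only [Equiv.coe_fn_mk]; fun_prop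
      measurable_invFun := by simp only [Equiv.coe_fn_symm_mk]; fun_prop }
  have hdet : (Matrix.diagonal c).det ≠ 0 := by
    rw [Matrix.det_diagonal]; exact Finset.prod_ne_zero_iff.2 fun x _ => hc x
  have h1 := Real.smul_map_diagonal_volume_pi hdet
  rw [Matrix.det_diagonal] at h1
  have h2 : (ENNReal.ofReal |∏ x, c x|) • Measure.map e volume = volume := by
    have h3 : (e : (ι → ℝ) → ι → ℝ) = (fun u => b + u) ∘ Matrix.toLin' (Matrix.diagonal c) := by
      ext u x
      simp [e, Matrix.mulVec_diagonal]
    have h4 : Measurable (Matrix.toLin' (Matrix.diagonal c)) :=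
      (LinearMap.continuous_on_pi _).measurable
    rw [h3, ← Measure.map_map (measurable_const_add b) h4, ← Measure.map_smul, h1]
    exact map_add_left_eq_self volume b
  let e' : (ι → ℝ) × Y ≃ᵐ (ι → ℝ) × Y := e.prodCongr (MeasurableEquiv.refl Y)
  have h5 : (ENNReal.ofReal |∏ x, c x|) • Measure.map e' volume = volume := by
    have h6 : Measure.map e' (volume : Measure ((ι → ℝ) × Y)) =
        (Measure.map e volume).prod volume := by
      have h7 := Measure.map_prod_map (volume : Measure (ι → ℝ)) (volume : Measure Y) e.measurable
        measurable_id
      rw [Measure.map_id] at h7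
      exact h7.symm
    rw [h6, ← Measure.prod_smul_left, h2]
    rfl
  conv_lhs => rw [← h5]
  rw [integral_smul_measure, integral_map_equiv, ENNReal.toReal_ofReal (abs_nonneg _),
    Complex.real_smul]
  rfl

/-! ### Dependence of the graph contributions on the times -/

lemma hasTemperateGrowth_exp_I :
    (fun x : ℝ => Complex.exp (Complex.I * (x : ℂ))).HasTemperateGrowth := by
  have hd : ∀ x : ℝ, HasDerivAt (fun x : ℝ => Complex.exp (Complex.I * (x : ℂ)))
      (Complex.I * Complex.exp (Complex.I * (x : ℂ))) x := fun x => by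
    have h1 : HasDerivAt (fun x : ℝ => Complex.I * (x : ℂ)) Complex.I x := by
      simpa using (Complex.ofRealCLM.hasDerivAt (x := x)).const_mul Complex.I
    have := h1.cexp
    rwa [mul_comm] at this
  have hit : ∀ n, iteratedDeriv n (fun x : ℝ => Complex.exp (Complex.I * (x : ℂ))) =
      fun x : ℝ => Complex.I ^ n * Complex.exp (Complex.I * (x : ℂ)) := by
    intro n
    induction n with
    | zero => simp
    | succ n ih =>
      rw [iteratedDeriv_succ, ih]
      ext x
      rw [((hd x).const_mul (Complex.I ^ n)).deriv, pow_succ, mul_assoc]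
  refine ⟨?_, fun n => ⟨0, 1, fun x => ?_⟩⟩
  · exact Complex.contDiff_exp.comp (contDiff_const.mul Complex.ofRealCLM.contDiff)
  · rw [norm_iteratedFDeriv_eq_norm_iteratedDeriv, hit]
    simp only [norm_mul, norm_pow, Complex.norm_I, one_pow, norm_exp_I_mul, pow_zero, mul_one,
      le_refl]

lemma hasTemperateGrowth_prod {E ι : Type*} [NormedAddCommGroup E] [NormedSpace ℝ E] {R : Type*}
    [NormedCommRing R] [NormedAlgebra ℝ R] {f : ι → E → R}
    (s : Finset ι) (h : ∀ i ∈ s, (f i).HasTemperateGrowth) :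
    (fun x => ∏ i ∈ s, f i x).HasTemperateGrowth := by
  classical
  induction s using Finset.induction_on with
  | empty =>
    simp only [Finset.prod_empty]
    exact Function.HasTemperateGrowth.const _
  | insert a s ha ih =>
    simp only [Finset.prod_insert ha]
    exact (h a (Finset.mem_insert_self _ _)).fun_mul
      (ih fun i hi => h i (Finset.mem_insert_of_mem hi))

section Phase

variable (ω : DispersionFunction) (hI : AdmissibleInteraction) {m n : ℕ} {v : Fin (n + 1) → ℕ}

/-- The time of a vertex. -/
def vertexTime (s : Fin m → ℝ) (τ : Inner v → ℝ) : Vertex m v → ℝ := Sum.elim s τ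

lemma fieldAmplitude_plus_eq (t : ℝ) (p : Mom) : fieldAmplitude ω .plus t p =
    fieldAmplitude ω .plus 0 p * Complex.exp (Complex.I * (ω.toFun p * t : ℝ)) := by
  simp [fieldAmplitude]; ring

lemma fieldAmplitude_minus_eq (t : ℝ) (p : Mom) : fieldAmplitude ω .minus t p =
    fieldAmplitude ω .minus 0 p * Complex.exp (-(Complex.I * (ω.toFun p * t : ℝ))) := by
  simp [fieldAmplitude]; ring

/-- The times enter the vertex kernels through phases only. -/
lemma feynmanKernel_eval_eq_phase (α : Fin m → FieldPart) (s : Fin m → ℝ) (τ : Inner v → ℝ)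
    (a : Vertex m v) {O I : Type} [Fintype O] [Fintype I] (p' : O → Mom) (p : I → Mom) :
    (feynmanKernel ω hI α s τ a).eval p' p = (feynmanKernel ω hI α 0 0 a).eval p' p *
      Complex.exp (Complex.I * (energyDefect ω p' p * vertexTime s τ a : ℝ)) := by
  have hO : ∀ f : O → ℝ, ∑ j, f ((Fintype.equivFin O).symm j) = ∑ o, f o := fun f =>
    Equiv.sum_comp _ _
  have hN : ∀ f : I → ℝ, ∑ j, f ((Fintype.equivFin I).symm j) = ∑ o, f o := fun f =>
    Equiv.sum_comp _ _
  unfold VertexKernel.eval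
  rcases a with i | x
  · simp only [feynmanKernel, externalKernel, vertexTime, Sum.elim_inl, energyDefect, Pi.zero_apply]
    cases α i <;> simp only
    · split_ifs with h
      · have : IsEmpty I := Fintype.card_eq_zero_iff.1 h.2
        simp only [fieldAmplitude_plus_eq ω (s i), Finset.prod_mul_distrib, Finset.univ_eq_empty,
          Finset.sum_empty, sub_zero]
        rw [← Complex.exp_sum, ← Finset.mul_sum, ← hO (fun o => ω.toFun (p' o)), Finset.sum_mul]
        push_cast
        rfl
      · rw [zero_mul]
    · split_ifs with h
      · have : IsEmpty O := Fintype.card_eq_zero_iff.1 h.1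
        simp only [fieldAmplitude_minus_eq ω (s i), Finset.prod_mul_distrib, Finset.univ_eq_empty,
          Finset.sum_empty, zero_sub]
        rw [← Complex.exp_sum, Finset.sum_neg_distrib, ← Finset.mul_sum,
          ← hN (fun o => ω.toFun (p o)), neg_mul, Finset.sum_mul]
        push_cast
        rw [mul_neg]
      · rw [zero_mul]
  · simp only [feynmanKernel, internalKernel, vertexTime, Sum.elim_inr, energyDefect, Pi.zero_apply,
      mul_zero, Complex.ofReal_zero, Complex.exp_zero, mul_one]
    rw [hO (fun o => ω.toFun (p' o)), hN (fun o => ω.toFun (p o))]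

/-- The energy defect of a vertex. -/
def multEnergy (μ : Vertex m v → Vertex m v → ℕ) (p : MultLine μ → Mom) (a : Vertex m v) : ℝ :=
  energyDefect ω (fun e : {e : MultLine μ // e.1.1 = a} => p e)
    (fun e : {e : MultLine μ // e.1.2 = a} => p e)

/-- The weight of a graph at time zero. -/
def multWeight (α : Fin m → FieldPart) (μ : Vertex m v → Vertex m v → ℕ) (p : MultLine μ → Mom) : ℂ :=
  ∏ a, (feynmanKernel ω hI α (0 : Fin m → ℝ) (0 : Inner v → ℝ) a).eval
    (fun e : {e : MultLine μ // e.1.1 = a} => p e) (fun e : {e : MultLine μ // e.1.2 = a} => p e)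

/-- The integrand of a graph consists of its weight at time zero, which does not depend on the
times, of phases, and of the test function. -/
lemma wickTerm_eq_phase (α : Fin m → FieldPart) (s : Fin m → ℝ) (Φ : Args m v → ℂ)
    (μ : Vertex m v → Vertex m v → ℕ) (τ : Inner v → ℝ) (p : MultLine μ → Mom) :
    wickTerm ω hI α s Φ μ τ p = multWeight ω hI α μ p *
      ((∏ a, Complex.exp (Complex.I * (multEnergy ω μ p a * vertexTime s τ a : ℝ))) *
        Φ (fun i => multDefect μ p (Sum.inl i), fun x => (τ x, multDefect μ p (Sum.inr x)))) := by
  unfold wickTerm multWeight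
  rw [← mul_assoc, ← Finset.prod_mul_distrib]
  congr 1
  exact Finset.prod_congr rfl fun a _ => feynmanKernel_eval_eq_phase ω hI α s τ a _ _

lemma continuous_multWeight (α : Fin m → FieldPart) (μ : Vertex m v → Vertex m v → ℕ) :
    Continuous (multWeight ω hI α μ) :=
  continuous_finsetProd _ fun a _ => continuous_feynmanKernel_eval ω hI α continuous_const
    continuous_const a (by fun_prop) (by fun_prop)

lemma hasTemperateGrowth_multEnergy (μ : Vertex m v → Vertex m v → ℕ) (a : Vertex m v) :
    (fun p : MultLine μ → Mom => multEnergy ω μ p a).HasTemperateGrowth := by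
  unfold multEnergy energyDefect
  exact (Function.HasTemperateGrowth.sum fun e _ =>
      ω.temperate.comp (hasTemperateGrowth_apply e.1)).fun_sub
    (Function.HasTemperateGrowth.sum fun e _ => ω.temperate.comp (hasTemperateGrowth_apply e.1))

lemma hasTemperateGrowth_multDefect (μ : Vertex m v → Vertex m v → ℕ) (a : Vertex m v) :
    (fun p : MultLine μ → Mom => multDefect μ p a).HasTemperateGrowth := by
  unfold multDefect
  exact (Function.HasTemperateGrowth.sum fun e _ => hasTemperateGrowth_apply e.1).fun_sub
    (Function.HasTemperateGrowth.sum fun e _ => hasTemperateGrowth_apply e.1)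

lemma hasTemperateGrowth_affineBase (i : Fin (n + 1)) :
    (fun t : Fin n → ℝ => affineBase t i).HasTemperateGrowth := by
  unfold affineBase
  split_ifs
  · exact hasTemperateGrowth_apply _
  · exact hasTemperateGrowth_apply _
  · exact Function.HasTemperateGrowth.const _

lemma hasTemperateGrowth_affineScale (i : Fin (n + 1)) :
    (fun t : Fin n → ℝ => affineScale t i).HasTemperateGrowth := by
  unfold affineScale
  split_ifs
  · exact (hasTemperateGrowth_apply _).fun_sub (hasTemperateGrowth_apply _)
  · exact Function.HasTemperateGrowth.const _

lemma abs_affineBase_le (t : Fin n → ℝ) (i : Fin (n + 1)) : |affineBase t i| ≤ ‖t‖ := by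
  unfold affineBase
  split_ifs
  · exact norm_le_pi_norm t _
  · exact norm_le_pi_norm t _
  · simp

/-- On the support of the time kernel, the affine coordinates are bounded by the times. -/
lemma one_add_abs_le_of_refFactor_ne_zero (t : Fin n → ℝ) {u : Inner v → ℝ}
    (hu : refFactor v u ≠ 0) (x : Inner v) :
    1 + |u x| ≤ 2 * ((1 + ‖t‖) * (1 + |affineTimes t u x|)) := by
  have h0 : 0 ≤ ‖t‖ := norm_nonneg t
  have h1 : 0 ≤ |affineTimes t u x| := abs_nonneg _
  by_cases hx : 0 < (x.1 : ℕ) ∧ (x.1 : ℕ) < n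
  · have := abs_le_one_of_refFactor_ne_zero hu x hx
    nlinarith
  · have h2 : u x = affineTimes t u x - affineBase t x.1 := by
      simp only [affineTimes, affineScale, dif_neg hx]; ring
    have h3 := abs_affineBase_le t x.1
    have h4 : |u x| ≤ |affineTimes t u x| + |affineBase t x.1| := by
      rw [h2]; exact abs_sub _ _
    nlinarith

end Phase

section Parameters

variable (ω : DispersionFunction) (hI : AdmissibleInteraction) {m n : ℕ} {v : Fin (n + 1) → ℕ}

/-- The integrals of the Feynman rules in affine time coordinates. -/
lemma integral_timeFactor_mul_wickTerm (α : Fin m → FieldPart) (s : Fin m → ℝ) (t : Fin n → ℝ)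
    (Φ : Args m v → ℂ) (μ : Vertex m v → Vertex m v → ℕ) :
    ∫ x : (Inner v → ℝ) × (MultLine μ → Mom),
        (timeFactor t x.1 : ℂ) * wickTerm ω hI α s Φ μ x.1 x.2 =
      ∫ y : (Inner v → ℝ) × (MultLine μ → Mom), ((refFactor v y.1 : ℂ) * multWeight ω hI α μ y.2) •
        ((((∏ x : Inner v, affineScale t x.1 : ℝ) : ℂ) * ∏ a, Complex.exp (Complex.I *
          (multEnergy ω μ y.2 a * vertexTime s (affineTimes t y.1) a : ℝ))) *
        Φ (fun i => multDefect μ y.2 (Sum.inl i),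
          fun x => (affineTimes t y.1 x, multDefect μ y.2 (Sum.inr x)))) := by
  by_cases h0 : ∃ x : Inner v, affineScale t x.1 = 0
  · obtain ⟨x, hx⟩ := h0
    have h1 : ∏ x : Inner v, affineScale t x.1 = 0 := Finset.prod_eq_zero (Finset.mem_univ x) hx
    simp [timeFactor_eq_zero t x hx, h1]
  · push Not at h0
    rw [integral_affine (fun x : Inner v => affineScale t x.1) (fun x => affineBase t x.1) h0,
      ← integral_const_mul]
    refine integral_congr_ae (Eventually.of_forall fun y => ?_)
    have h2 := congrArg (fun x : ℝ => (x : ℂ)) (timeFactor_affineTimes t y.1)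
    push_cast at h2
    simp only
    rw [wickTerm_eq_phase]
    change _ * ((timeFactor t (affineTimes t y.1) : ℂ) * _) = _
    change _ * (_ * (_ * (_ * Φ (_, fun x => (affineTimes t y.1 x, _))))) = _
    rw [smul_eq_mul, Complex.ofReal_prod]
    have h3 : ((|∏ x : Inner v, affineScale t x.1| : ℝ) : ℂ) *
        (timeFactor t (affineTimes t y.1) : ℂ) =
        (∏ x : Inner v, (affineScale t x.1 : ℂ)) * (refFactor v y.1 : ℂ) := by
      rw [mul_comm]; exact h2
    rw [← mul_assoc, h3]
    change _ * (_ * ((∏ a, Complex.exp (Complex.I *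
      (multEnergy ω μ y.2 a * vertexTime s (affineTimes t y.1) a : ℝ))) * _)) = _
    ring

/-- The contribution of a graph depends on the times as a function of temperate growth. -/
lemma hasTemperateGrowth_integral (α : Fin m → FieldPart) {s : (Fin n → ℝ) → Fin m → ℝ}
    (hs : s.HasTemperateGrowth) (Φ : 𝓢(Args m v, ℂ)) (μ : Vertex m v → Vertex m v → ℕ) :
    (fun t => ∫ x : (Inner v → ℝ) × (MultLine μ → Mom),
      (timeFactor t x.1 : ℂ) * wickTerm ω hI α (s t) Φ μ x.1 x.2).HasTemperateGrowth := by
  simp only [integral_timeFactor_mul_wickTerm]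
  -- the factors of temperate growth, and the argument of the test function
  let A : (Fin n → ℝ) × ((Inner v → ℝ) × (MultLine μ → Mom)) → ℂ := fun z =>
    ((∏ x : Inner v, affineScale z.1 x.1 : ℝ) : ℂ) * ∏ a, Complex.exp (Complex.I *
      (multEnergy ω μ z.2.2 a * vertexTime (s z.1) (affineTimes z.1 z.2.1) a : ℝ))
  let ζ : (Fin n → ℝ) × ((Inner v → ℝ) × (MultLine μ → Mom)) → Args m v := fun z =>
    (fun i => multDefect μ z.2.2 (Sum.inl i),
      fun x => (affineTimes z.1 z.2.1 x, multDefect μ z.2.2 (Sum.inr x)))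
  have hp : (fun z : (Fin n → ℝ) × ((Inner v → ℝ) × (MultLine μ → Mom)) =>
      z.2.2).HasTemperateGrowth := hasTemperateGrowth_snd.comp hasTemperateGrowth_snd
  have hu : (fun z : (Fin n → ℝ) × ((Inner v → ℝ) × (MultLine μ → Mom)) =>
      z.2.1).HasTemperateGrowth := hasTemperateGrowth_fst.comp hasTemperateGrowth_snd
  have hτ : ∀ x, (fun z : (Fin n → ℝ) × ((Inner v → ℝ) × (MultLine μ → Mom)) =>
      affineTimes z.1 z.2.1 x).HasTemperateGrowth := fun x =>
    ((hasTemperateGrowth_affineBase x.1).comp hasTemperateGrowth_fst).fun_add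
      (((hasTemperateGrowth_affineScale x.1).comp hasTemperateGrowth_fst).fun_mul
        ((hasTemperateGrowth_apply x).comp hu))
  have hT : ∀ a, (fun z : (Fin n → ℝ) × ((Inner v → ℝ) × (MultLine μ → Mom)) =>
      vertexTime (s z.1) (affineTimes z.1 z.2.1) a).HasTemperateGrowth := by
    rintro (i | x)
    · exact (hasTemperateGrowth_apply i).comp (hs.comp hasTemperateGrowth_fst)
    · exact hτ x
  have hA : A.HasTemperateGrowth := by
    refine Function.HasTemperateGrowth.fun_mul ?_ (hasTemperateGrowth_prod _ fun a _ => ?_)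
    · exact Function.Complex.hasTemperateGrowth_ofReal.comp (hasTemperateGrowth_prod _ fun x _ =>
        (hasTemperateGrowth_affineScale x.1).comp hasTemperateGrowth_fst)
    · exact hasTemperateGrowth_exp_I.comp
        (((hasTemperateGrowth_multEnergy ω μ a).comp hp).fun_mul (hT a))
  have hζ : ζ.HasTemperateGrowth :=
    hasTemperateGrowth_prodMk
      (hasTemperateGrowth_pi fun i => (hasTemperateGrowth_multDefect μ _).comp hp)
      (hasTemperateGrowth_pi fun x => hasTemperateGrowth_prodMk (hτ x)
        ((hasTemperateGrowth_multDefect μ _).comp hp))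
  have hΘ : ContDiff ℝ (⊤ : ℕ∞) fun z => A z * Φ (ζ z) := hA.1.mul ((Φ.smooth ⊤).comp hζ.1)
  have hw : AEStronglyMeasurable (fun y : (Inner v → ℝ) × (MultLine μ → Mom) =>
      (refFactor v y.1 : ℂ) * multWeight ω hI α μ y.2) volume :=
    (Complex.measurable_ofReal.comp
      (measurable_refFactor.comp measurable_fst)).aestronglyMeasurable.mul
      ((continuous_multWeight ω hI α μ).comp continuous_snd).aestronglyMeasurable
  -- The derivatives of `A * (Φ ∘ ζ)` grow with at most `M` powers of all variables. In the line
  -- momenta these are compensated by the decay of the weight of the graph; the remaining variables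
  -- are bounded by the times and by `ζ`, in which the test function decays.
  have hb : ∀ k : ℕ, ∃ (C : ℝ) (L : ℕ), ∀ (t : Fin n → ℝ)
      (y : (Inner v → ℝ) × (MultLine μ → Mom)),
      ‖(refFactor v y.1 : ℂ) * multWeight ω hI α μ y.2‖ *
        ‖iteratedFDeriv ℝ k (fun z => A z * Φ (ζ z)) (t, y)‖ ≤
      (C * (1 + ‖t‖) ^ L) * (timeWeight y.1 * momWeight y.2) := by
    intro k
    obtain ⟨M, hM⟩ := exists_bound_mul_comp_schwartz hA hζ k
    obtain ⟨C, M', hC0, hC⟩ := prod_feynmanKernel_decay ω hI α μ (M + 4)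
    set q := Fintype.card (Inner v) * 2 with hq
    obtain ⟨C', hC'0, hC'⟩ := hM Φ (M + M' + q)
    refine ⟨C * C' * 2 ^ (M + q), 2 * M + q, ?_⟩
    rintro t ⟨u, p⟩
    rw [norm_mul, Complex.norm_real, Real.norm_eq_abs]
    by_cases hr : refFactor v u = 0
    · simp only [hr, abs_zero, zero_mul]
      have := timeWeight_nonneg u
      have := momWeight_nonneg p
      positivity
    have h1 := hC 0 0 p
    change (∏ e, (1 + ‖p e‖)) ^ (M + 4) * ‖multWeight ω hI α μ p‖ ≤ _ at h1
    have h2 := hC' (t, u, p)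
    set W := ‖multWeight ω hI α μ p‖
    set D := ‖iteratedFDeriv ℝ k (fun z => A z * Φ (ζ z)) (t, u, p)‖
    set R := ∏ e, (1 + ‖p e‖) with hR
    have hR1 : 1 ≤ R := one_le_prod_one_add p
    obtain ⟨hκ, hτX⟩ := one_add_norm_args_ge (τ := affineTimes t u) (κ := multDefect μ p)
    set X := 1 + ‖ζ (t, u, p)‖ with hX
    change 1 + ‖multDefect μ p‖ ≤ X at hκ
    change ∀ x, 1 + |affineTimes t u x| ≤ X at hτX
    have hX1 : 1 ≤ X := by simp [X]
    set T := 1 + ‖t‖ with hT'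
    have hT1 : 1 ≤ T := by simp [T]
    have hux : ∀ x, 1 + |u x| ≤ 2 * (T * X) := fun x => by
      refine (one_add_abs_le_of_refFactor_ne_zero t hr x).trans ?_
      have := hτX x
      gcongr
    have hTX : 1 ≤ T * X := one_le_mul_of_one_le_of_one_le hT1 hX1
    have hu1 : 1 + ‖u‖ ≤ 2 * (T * X) := by
      have : ‖u‖ ≤ 2 * (T * X) - 1 := (pi_norm_le_iff_of_nonneg (by linarith)).2 fun x => by
        have := hux x
        rw [Real.norm_eq_abs]
        linarith
      linarith
    have hz : 1 + ‖(t, u, p)‖ ≤ T * (2 * (T * X)) * R := by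
      have h3 := one_add_norm_le_prod p
      rw [← hR] at h3
      have hA1 : T ≤ T * (2 * (T * X)) * R := by
        rw [mul_assoc]
        exact le_mul_of_one_le_right (by positivity)
          (one_le_mul_of_one_le_of_one_le (by linarith) hR1)
      have hA2 : 2 * (T * X) ≤ T * (2 * (T * X)) * R := by
        calc 2 * (T * X) ≤ T * (2 * (T * X)) := le_mul_of_one_le_left (by positivity) hT1
          _ ≤ _ := le_mul_of_one_le_right (by positivity) hR1
      have hA3 : R ≤ T * (2 * (T * X)) * R := le_mul_of_one_le_left (by positivity)
        (one_le_mul_of_one_le_of_one_le hT1 (by linarith))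
      rw [Prod.norm_def, Prod.norm_def]
      simp only
      rcases max_cases ‖t‖ (max ‖u‖ ‖p‖) with ⟨h, _⟩ | ⟨h, _⟩ <;> rw [h]
      · exact hA1
      · rcases max_cases ‖u‖ ‖p‖ with ⟨h, _⟩ | ⟨h, _⟩ <;> rw [h]
        · exact hu1.trans hA2
        · exact h3.trans hA3
    have hτ2 : ∏ x : Inner v, (1 + |u x|) ^ 2 ≤ (2 * (T * X)) ^ q := by
      calc _ ≤ ∏ _x : Inner v, (2 * (T * X)) ^ 2 :=
            Finset.prod_le_prod (fun x _ => by positivity) fun x _ => by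
              have := hux x
              gcongr
        _ = _ := by rw [Finset.prod_const, Finset.card_univ, ← pow_mul, mul_comm 2 (Fintype.card _)]
    have hW : 0 ≤ W := norm_nonneg _
    have hD : 0 ≤ D := norm_nonneg _
    have hU1 : 0 < ∏ x : Inner v, (1 + |u x|) ^ 2 := Finset.prod_pos fun x _ => by positivity
    unfold timeWeight momWeight
    rw [Finset.prod_inv_distrib, Finset.prod_inv_distrib, Finset.prod_pow _ 4, ← hR, ← mul_inv,
      ← div_eq_mul_inv, le_div_iff₀ (by positivity)]
    have h6 : 0 < R ^ M * X ^ (M + M' + q) := by positivity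
    refine le_of_mul_le_mul_right ?_ h6
    have hr1 := abs_refFactor_le_one u
    calc _ = |refFactor v u| * ((R ^ (M + 4) * W) * (X ^ (M + M' + q) * D) *
            ∏ x : Inner v, (1 + |u x|) ^ 2) := by ring
      _ ≤ 1 * ((R ^ (M + 4) * W) * (X ^ (M + M' + q) * D) * ∏ x : Inner v, (1 + |u x|) ^ 2) := by
          gcongr
      _ ≤ 1 * ((C * X ^ M') * (C' * (T * (2 * (T * X)) * R) ^ M) * (2 * (T * X)) ^ q) := by
          have h1' : R ^ (M + 4) * W ≤ C * X ^ M' := h1.trans (by gcongr)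
          have h2' : X ^ (M + M' + q) * D ≤ C' * (T * (2 * (T * X)) * R) ^ M :=
            h2.trans (by gcongr)
          gcongr
      _ = _ := by rw [one_mul]; simp only [mul_pow, pow_add, two_mul]; ring_nf
  choose C L hCL using hb
  have hmain := fun n' : ℕ => integral_contDiff_and_bound (μ := volume) _ hw n' hΘ
    (fun k t => C k * (1 + ‖t‖) ^ L k) (fun k => by fun_prop)
    (fun k y => timeWeight y.1 * momWeight y.2)
    (fun k => integrable_timeWeight_mul_momWeight _ _)
    (fun k y => mul_nonneg (timeWeight_nonneg _) (momWeight_nonneg _)) hCL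
  refine ⟨contDiff_infty.2 fun k => (hmain k).1, fun k => ⟨L k,
    C k * ∫ y : (Inner v → ℝ) × (MultLine μ → Mom), timeWeight y.1 * momWeight y.2, fun t => ?_⟩⟩
  refine ((hmain k).2 t).trans_eq ?_
  ring

/-- The integral of a graph is a tempered distribution which depends on the times as a function of
temperate growth. -/
lemma isParamDistribution_integral (α : Fin m → FieldPart) {s : (Fin n → ℝ) → Fin m → ℝ}
    (hs : s.HasTemperateGrowth) (μ : Vertex m v → Vertex m v → ℕ) :
    IsParamDistribution fun (Φ : Args m v → ℂ) (t : Fin n → ℝ) =>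
      ∫ x : (Inner v → ℝ) × (MultLine μ → Mom),
        (timeFactor t x.1 : ℂ) * wickTerm ω hI α (s t) Φ μ x.1 x.2 := by
  refine ⟨fun t => ?_, fun Φ => hasTemperateGrowth_integral ω hI α hs Φ μ⟩
  obtain ⟨C, N, h0, h⟩ := exists_wickTerm_bound ω hI α μ
  have hint := fun Φ => integrable_timeFactor_mul_wickTerm ω hI α (s t) t Φ μ
  refine ⟨SchwartzMap.mkCLMtoNormedSpace (𝕜 := ℂ) (σ := RingHom.id ℂ)
    (fun Φ : 𝓢(Args m v, ℂ) => ∫ x : (Inner v → ℝ) × (MultLine μ → Mom),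
        (timeFactor t x.1 : ℂ) * wickTerm ω hI α (s t) Φ μ x.1 x.2) (fun Φ Ψ => ?_)
    (fun c Φ => ?_) ⟨Finset.Iic (N, 0), C * 2 ^ N * ∫ x : (Inner v → ℝ) × (MultLine μ → Mom),
      timeWeight x.1 * momWeight x.2, ?_, fun Φ => ?_⟩, fun Φ => rfl⟩
  · rw [← integral_add (hint Φ) (hint Ψ)]
    refine integral_congr_ae (Eventually.of_forall fun x => ?_)
    simp only [wickTerm, add_apply]
    ring
  · rw [RingHom.id_apply, ← integral_smul]
    refine integral_congr_ae (Eventually.of_forall fun x => ?_)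
    simp only [wickTerm, smul_apply, smul_eq_mul]
    ring
  · have : 0 ≤ ∫ x : (Inner v → ℝ) × (MultLine μ → Mom), timeWeight x.1 * momWeight x.2 :=
      integral_nonneg fun x => mul_nonneg (timeWeight_nonneg _) (momWeight_nonneg _)
    positivity
  · refine (norm_integral_le_of_norm_le
      ((integrable_timeWeight_mul_momWeight _ _).const_mul (C * schwartzNorm N Φ))
      (Eventually.of_forall fun x => ?_)).trans_eq ?_
    · rw [norm_mul, Complex.norm_real, Real.norm_eq_abs]
      exact (mul_le_of_le_one_left (norm_nonneg _) (abs_timeFactor_le_one _ _)).trans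
        (h (s t) Φ _ _)
    · rw [integral_const_mul, schwartzNorm]
      ring

end Parameters

section Sums

variable {D : Type} [NormedAddCommGroup D] [NormedSpace ℝ D] {n : ℕ}

lemma IsParamDistribution.const_mul {W : (D → ℂ) → (Fin n → ℝ) → ℂ} (h : IsParamDistribution W)
    (c : ℂ) : IsParamDistribution fun Φ t => c * W Φ t :=
  ⟨fun t => by
    obtain ⟨T, hT⟩ := h.1 t
    exact ⟨c • T, fun Φ => by rw [smul_apply, hT, smul_eq_mul]⟩,
    fun Φ => (Function.HasTemperateGrowth.const c).fun_mul (h.2 Φ)⟩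

lemma IsParamDistribution.sum {ι : Type*} {W : ι → (D → ℂ) → (Fin n → ℝ) → ℂ} (S : Finset ι)
    (h : ∀ i ∈ S, IsParamDistribution (W i)) : IsParamDistribution fun Φ t => ∑ i ∈ S, W i Φ t := by
  constructor
  · intro t
    choose! T hT using fun i (hi : i ∈ S) => (h i hi).1 t
    refine ⟨∑ i ∈ S, T i, fun Φ => ?_⟩
    rw [sum_apply]
    exact Finset.sum_congr rfl fun i hi => hT i hi Φ
  · exact fun Φ => Function.HasTemperateGrowth.sum fun i hi => (h i hi).2 Φ

end Sums

section GraphDistribution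

variable (ω : DispersionFunction) (hI : AdmissibleInteraction) {m n : ℕ} {v : Fin (n + 1) → ℕ}

lemma FeynmanGraph.isParamDistribution_contribution (Γ : FeynmanGraph m v) (α : Fin m → FieldPart)
    {s : (Fin n → ℝ) → Fin m → ℝ} (hs : s.HasTemperateGrowth) :
    IsParamDistribution fun (Φ : Args m v → ℂ) (t : Fin n → ℝ) =>
      Γ.contribution ω hI α (s t) t Φ := by
  simp only [FeynmanGraph.contribution_eq]
  exact (isParamDistribution_integral ω hI α hs Γ.mult).const_mul _

lemma isParamDistribution_finsum (α : Fin m → FieldPart) {s : (Fin n → ℝ) → Fin m → ℝ}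
    (hs : s.HasTemperateGrowth) (p : FeynmanGraph m v → Prop) :
    IsParamDistribution fun (Φ : Args m v → ℂ) (t : Fin n → ℝ) =>
      ∑ᶠ Γ : {Γ : FeynmanGraph m v // p Γ}, Γ.1.contribution ω hI α (s t) t Φ := by
  have hfin : {Γ : {Γ : FeynmanGraph m v // p Γ} |
      ∃ s t Φ, Γ.1.contribution ω hI α s t Φ ≠ 0}.Finite :=
    ((finite_contribution_ne_zero ω hI m v α).preimage
      (f := fun Γ : {Γ : FeynmanGraph m v // p Γ} => Γ.1) Subtype.val_injective.injOn).subset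
      fun Γ h => h
  have h : ∀ (Φ : Args m v → ℂ) (t : Fin n → ℝ),
      ∑ᶠ Γ : {Γ : FeynmanGraph m v // p Γ}, Γ.1.contribution ω hI α (s t) t Φ =
        ∑ Γ ∈ hfin.toFinset, Γ.1.contribution ω hI α (s t) t Φ := fun Φ t =>
    finsum_eq_sum_of_support_subset _ fun Γ hΓ => by
      rw [Set.Finite.coe_toFinset]
      exact ⟨_, _, _, hΓ⟩
  simp only [h]
  exact IsParamDistribution.sum _ fun Γ _ => Γ.1.isParamDistribution_contribution ω hI α hs

end GraphDistribution

/-! ### Measurable families of Fock vectors with integrable bounds -/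

section Nice

variable {X T S : Type} [MeasurableSpace T] [MeasurableSpace S]

/-- The weight `∏ (1 + ‖κ x‖)⁻⁴` of the slots in `D`. -/
def slotWeight (D : Finset X) (κ : X → Mom) : ℝ := ∏ x ∈ D, ((1 + ‖κ x‖) ^ 4)⁻¹

lemma slotWeight_nonneg (D : Finset X) (κ : X → Mom) : 0 ≤ slotWeight D κ :=
  Finset.prod_nonneg fun x _ => by positivity

/-- Measurable families of Fock vectors, bounded by `G` in the parameter, bounded in the momenta,
and decaying in the slots `D`. -/
structure Nice (D : Finset X) (G : T → ℝ) (Ψ : T → Fock X) : Prop where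
  measurable : ∀ l, Measurable fun z : T × (Fin l → Mom) × (X → Mom) => Ψ z.1 l z.2.1 z.2.2
  bound : ∀ l, ∃ C : ℝ, 0 ≤ C ∧ ∀ τ p κ, ‖Ψ τ l p κ‖ ≤ C * (G τ * slotWeight D κ)

lemma Nice.comp {D : Finset X} {G : T → ℝ} {Ψ : T → Fock X} (h : Nice D G Ψ) {f : S → T}
    (hf : Measurable f) : Nice D (fun s => G (f s)) (fun s => Ψ (f s)) :=
  ⟨fun l => (h.measurable l).comp (by fun_prop : Measurable
    fun z : S × (Fin l → Mom) × (X → Mom) => (f z.1, z.2)), fun l => by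
    obtain ⟨C, h0, hC⟩ := h.bound l
    exact ⟨C, h0, fun τ p κ => hC _ p κ⟩⟩

/-- Operators on Fock vectors with integral kernel `k`, which act on the slots through the
transferred momentum. -/
def slotOp (k : (l' l : ℕ) → (Fin l' → Mom) → (Fin l → Mom) → ℂ) (B : ℕ)
    (ρ : (X → Mom) → Mom → X → Mom) (Ψ : Fock X) : Fock X :=
  ∑ l' ∈ Finset.range (B + 1), ∑ l ∈ Finset.range (B + 1),
    secondQuant (fun f p' κ => ∫ p : Fin l → Mom, k l' l p' p *
      f p (ρ κ (∑ j, p' j - ∑ j, p j))) Ψ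

/-- The momenta that are kept by an operator. -/
def restMomenta {m : ℕ} (l' : ℕ) (P : Fin m → Mom) (σ : Equiv.Perm (Fin m)) (j : Fin (m - l')) : Mom :=
  P (σ ⟨l' + j, by omega⟩)

/-- The momenta that are created by an operator. -/
def newMomenta {m l' : ℕ} (h : l' ≤ m) (P : Fin m → Mom) (σ : Equiv.Perm (Fin m)) (j : Fin l') : Mom :=
  P (σ (Fin.castLE h j))

lemma slotOp_apply (k : (l' l : ℕ) → (Fin l' → Mom) → (Fin l → Mom) → ℂ) (B : ℕ)
    (ρ : (X → Mom) → Mom → X → Mom) (Ψ : Fock X) (m : ℕ) (P : Fin m → Mom) (κ : X → Mom) :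
    slotOp k B ρ Ψ m P κ = ∑ l' ∈ Finset.range (B + 1), ∑ l ∈ Finset.range (B + 1),
      if h : l' ≤ m then
        ((Real.sqrt (((l + (m - l'))! : ℝ) * (m ! : ℝ)) / ((m - l')! : ℝ) : ℝ) : ℂ) *
        ((m ! : ℂ)⁻¹ * ∑ σ : Equiv.Perm (Fin m), ∫ p : Fin l → Mom,
          k l' l (newMomenta h P σ) p * Ψ (l + (m - l')) (Fin.append p (restMomenta l' P σ))
            (ρ κ (∑ j, newMomenta h P σ j - ∑ j, p j)))
      else 0 := by
  unfold slotOp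
  simp only [Finset.sum_apply]
  rfl

/-- Families of integral kernels which map families with decay in the slots `D` to families with
decay in the slots `D'`. -/
structure NiceKernel (D D' : Finset X) (γ : T → ℝ)
    (k : T → (l' l : ℕ) → (Fin l' → Mom) → (Fin l → Mom) → ℂ)
    (ρ : (X → Mom) → Mom → X → Mom) : Prop where
  measurable : ∀ l' l, Measurable fun z : T × (Fin l' → Mom) × (Fin l → Mom) =>
    k z.1 l' l z.2.1 z.2.2
  measurable_slot : Measurable fun z : (X → Mom) × Mom => ρ z.1 z.2
  bound : ∀ l' l, ∃ C : ℝ, 0 ≤ C ∧ ∀ τ p' p κ,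
    ‖k τ l' l p' p‖ * slotWeight D (ρ κ (∑ j, p' j - ∑ j, p j)) ≤
      C * (γ τ * (momWeight p * slotWeight D' κ))

lemma measurable_append (l r : ℕ) : Measurable fun z : (Fin l → Mom) × (Fin r → Mom) =>
    Fin.append z.1 z.2 := by
  refine measurable_pi_iff.2 fun j => ?_
  refine Fin.addCases (fun j => ?_) (fun j => ?_) j
  · simp only [Fin.append_left]; fun_prop
  · simp only [Fin.append_right]; fun_prop

section Op

variable {D D' : Finset X} {γ : T → ℝ}
  {k : T → (l' l : ℕ) → (Fin l' → Mom) → (Fin l → Mom) → ℂ} {ρ : (X → Mom) → Mom → X → Mom}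
  {G : T → ℝ} {Ψ : T → Fock X}

/-- The integrand of an operator is measurable in all variables. -/
lemma NiceKernel.measurable_integrand (hk : NiceKernel D D' γ k ρ) (hΨ : Nice D G Ψ) (l' l r : ℕ) :
    Measurable fun z : (T × (Fin l' → Mom) × (Fin r → Mom) × (X → Mom)) × (Fin l → Mom) =>
      k z.1.1 l' l z.1.2.1 z.2 * Ψ z.1.1 (l + r) (Fin.append z.2 z.1.2.2.1)
        (ρ z.1.2.2.2 (∑ j, z.1.2.1 j - ∑ j, z.2 j)) := by
  refine Measurable.mul ((hk.measurable l' l).comp (by fun_prop : Measurable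
    fun z : (T × (Fin l' → Mom) × (Fin r → Mom) × (X → Mom)) × (Fin l → Mom) =>
      (z.1.1, z.1.2.1, z.2))) ?_
  refine (hΨ.measurable (l + r)).comp (measurable_fst.fst.prodMk (Measurable.prodMk ?_ ?_))
  · exact (measurable_append l r).comp (by fun_prop : Measurable
      fun z : (T × (Fin l' → Mom) × (Fin r → Mom) × (X → Mom)) × (Fin l → Mom) =>
        (z.2, z.1.2.2.1))
  · exact hk.measurable_slot.comp (by fun_prop : Measurable
      fun z : (T × (Fin l' → Mom) × (Fin r → Mom) × (X → Mom)) × (Fin l → Mom) =>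
        (z.1.2.2.2, ∑ j, z.1.2.1 j - ∑ j, z.2 j))

/-- The integrand is dominated by an integrable function of the consumed momenta, uniformly in the
other momenta. -/
lemma NiceKernel.exists_integrand_bound (hk : NiceKernel D D' γ k ρ) (hG : ∀ τ, 0 ≤ G τ)
    (hΨ : Nice D G Ψ) (l' l r : ℕ) :
    ∃ C : ℝ, 0 ≤ C ∧ ∀ τ (p' : Fin l' → Mom) (P : Fin r → Mom) κ (p : Fin l → Mom),
      ‖k τ l' l p' p * Ψ τ (l + r) (Fin.append p P) (ρ κ (∑ j, p' j - ∑ j, p j))‖ ≤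
        C * ((G τ * γ τ) * slotWeight D' κ) * momWeight p := by
  obtain ⟨C, h0, hC⟩ := hk.bound l' l
  obtain ⟨C', h0', hC'⟩ := hΨ.bound (l + r)
  refine ⟨C' * C, by positivity, fun τ p' P κ p => ?_⟩
  rw [norm_mul]
  calc _ ≤ ‖k τ l' l p' p‖ * (C' * (G τ * slotWeight D (ρ κ (∑ j, p' j - ∑ j, p j)))) :=
        mul_le_mul_of_nonneg_left (hC' _ _ _) (norm_nonneg _)
    _ = C' * G τ * (‖k τ l' l p' p‖ * slotWeight D (ρ κ (∑ j, p' j - ∑ j, p j))) := by ring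
    _ ≤ C' * G τ * (C * (γ τ * (momWeight p * slotWeight D' κ))) :=
        mul_le_mul_of_nonneg_left (hC _ _ _ _) (mul_nonneg h0' (hG τ))
    _ = _ := by ring

lemma NiceKernel.integrable_integrand (hk : NiceKernel D D' γ k ρ) (hG : ∀ τ, 0 ≤ G τ)
    (hΨ : Nice D G Ψ) (l' l r : ℕ) (τ : T) (p' : Fin l' → Mom) (P : Fin r → Mom) (κ : X → Mom) :
    Integrable fun p : Fin l → Mom =>
      k τ l' l p' p * Ψ τ (l + r) (Fin.append p P) (ρ κ (∑ j, p' j - ∑ j, p j)) := by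
  obtain ⟨C, h0, hC⟩ := hk.exists_integrand_bound hG hΨ l' l r
  refine ((integrable_momWeight (Fin l)).const_mul (C * ((G τ * γ τ) * slotWeight D' κ))).mono' ?_
    (Eventually.of_forall fun p => hC τ p' P κ p)
  exact ((hk.measurable_integrand hΨ l' l r).comp (by fun_prop : Measurable
    fun p : Fin l → Mom => ((τ, p', P, κ), p))).aestronglyMeasurable

/-- Operators with nice kernels act on nice families. -/
lemma Nice.slotOp (hk : NiceKernel D D' γ k ρ) (hG : ∀ τ, 0 ≤ G τ) (hΨ : Nice D G Ψ) (B : ℕ) :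
    Nice D' (fun τ => G τ * γ τ) fun τ => slotOp (k τ) B ρ (Ψ τ) := by
  constructor
  · intro m
    simp only [slotOp_apply]
    refine Finset.measurable_sum _ fun l' _ => Finset.measurable_sum _ fun l _ => ?_
    split_ifs with h
    · refine Measurable.const_mul (Measurable.const_mul (Finset.measurable_sum _ fun σ _ => ?_) _) _
      have h1 := (hk.measurable_integrand hΨ l' l (m - l')).stronglyMeasurable.integral_prod_right'
        (ν := (volume : Measure (Fin l → Mom)))
      refine h1.measurable.comp (g := fun z : T × (Fin l' → Mom) × (Fin (m - l') → Mom) × (X → Mom) =>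
        ∫ p : Fin l → Mom, k z.1 l' l z.2.1 p * Ψ z.1 (l + (m - l')) (Fin.append p z.2.2.1)
          (ρ z.2.2.2 (∑ j, z.2.1 j - ∑ j, p j))) (f := fun z : T × (Fin m → Mom) × (X → Mom) =>
          (z.1, newMomenta h z.2.1 σ, restMomenta l' z.2.1 σ, z.2.2)) ?_
      unfold newMomenta restMomenta
      fun_prop
    · exact measurable_const
  · intro m
    choose C h0 hC using fun l' l => hk.exists_integrand_bound hG hΨ l' l (m - l')
    refine ⟨∑ l' ∈ Finset.range (B + 1), ∑ l ∈ Finset.range (B + 1),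
      ‖((Real.sqrt (((l + (m - l'))! : ℝ) * (m ! : ℝ)) / ((m - l')! : ℝ) : ℝ) : ℂ)‖ *
      (‖(m ! : ℂ)⁻¹‖ * ∑ σ : Equiv.Perm (Fin m), C l' l * ∫ p : Fin l → Mom, momWeight p),
      ?_, fun τ P κ => ?_⟩
    · refine Finset.sum_nonneg fun l' _ => Finset.sum_nonneg fun l _ => ?_
      have h1 : 0 ≤ ∫ p : Fin l → Mom, momWeight p := integral_nonneg fun p => momWeight_nonneg p
      have h2 := h0 l' l
      exact mul_nonneg (norm_nonneg _) (mul_nonneg (norm_nonneg _)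
        (Finset.sum_nonneg fun σ _ => mul_nonneg h2 h1))
    · rw [slotOp_apply, Finset.sum_mul]
      refine (norm_sum_le _ _).trans (Finset.sum_le_sum fun l' _ => ?_)
      rw [Finset.sum_mul]
      refine (norm_sum_le _ _).trans (Finset.sum_le_sum fun l _ => ?_)
      have hγ : 0 ≤ (C l' l * ∫ p : Fin l → Mom, momWeight p) *
          ((G τ * γ τ) * slotWeight D' κ) := by
        have h2 := (norm_nonneg _).trans (hC l' l τ 0 0 κ 0)
        have h3 : 0 < momWeight (0 : Fin l → Mom) := by simp [momWeight]
        have h4 := nonneg_of_mul_nonneg_left h2 h3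
        have h1 : 0 ≤ ∫ p : Fin l → Mom, momWeight p := integral_nonneg fun p => momWeight_nonneg p
        have := mul_nonneg h4 h1
        linarith
      split_ifs with h
      · rw [norm_mul, norm_mul, mul_assoc, mul_assoc]
        refine mul_le_mul_of_nonneg_left (mul_le_mul_of_nonneg_left ?_ (norm_nonneg _))
          (norm_nonneg _)
        rw [Finset.sum_mul]
        refine (norm_sum_le _ _).trans (Finset.sum_le_sum fun σ _ => ?_)
        refine (norm_integral_le_of_norm_le ((integrable_momWeight (Fin l)).const_mul
          (C l' l * ((G τ * γ τ) * slotWeight D' κ)))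
          (Eventually.of_forall fun p => hC l' l τ _ _ κ p)).trans_eq ?_
        rw [integral_const_mul]; ring
      · rw [norm_zero, mul_assoc, mul_assoc, Finset.sum_mul]
        exact mul_nonneg (norm_nonneg _) (mul_nonneg (norm_nonneg _)
          (Finset.sum_nonneg fun σ _ => hγ))

end Op

/-- Integration of a nice family over part of its parameters. -/
lemma Nice.integral {D : Finset X} {G : T → ℝ} {g : S → ℝ} {Ψ : T × S → Fock X}
    (hΨ : Nice D (fun z : T × S => G z.1 * g z.2) Ψ) (hg0 : ∀ s, 0 ≤ g s)
    {μ : Measure S} [SFinite μ] (hg : Integrable g μ) {w : T × S → ℂ}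
    (hw : Measurable w) (hw1 : ∀ z, ‖w z‖ ≤ 1) :
    Nice D G fun τ l p κ => ∫ s, w (τ, s) * Ψ (τ, s) l p κ ∂μ := by
  constructor
  · intro l
    have h1 : Measurable fun z : (T × (Fin l → Mom) × (X → Mom)) × S =>
        w (z.1.1, z.2) * Ψ (z.1.1, z.2) l z.1.2.1 z.1.2.2 :=
      (hw.comp (by fun_prop : Measurable
        fun z : (T × (Fin l → Mom) × (X → Mom)) × S => (z.1.1, z.2))).mul
      ((hΨ.measurable l).comp (by fun_prop : Measurable
        fun z : (T × (Fin l → Mom) × (X → Mom)) × S => ((z.1.1, z.2), z.1.2)))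
    exact (h1.stronglyMeasurable.integral_prod_right' (ν := μ)).measurable
  · intro l
    obtain ⟨C, h0, hC⟩ := hΨ.bound l
    refine ⟨C * ∫ s, g s ∂μ, mul_nonneg h0 (integral_nonneg hg0), fun τ p κ => ?_⟩
    refine (norm_integral_le_of_norm_le (hg.const_mul (C * (G τ * slotWeight D κ)))
      (Eventually.of_forall fun s => ?_)).trans_eq ?_
    · rw [norm_mul]
      refine (mul_le_of_le_one_left (norm_nonneg _) (hw1 _)).trans ((hC _ _ _).trans_eq ?_)
      ring
    · rw [integral_const_mul]; ring

/-- Operators with nice kernels commute with integrals over nice families. -/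
lemma slotOp_integral {D D' : Finset X} {k : (l' l : ℕ) → (Fin l' → Mom) → (Fin l → Mom) → ℂ}
    {ρ : (X → Mom) → Mom → X → Mom} {c : S → ℝ} (hk : NiceKernel D D' c (fun _ => k) ρ)
    {g : S → ℝ} {Ψ : S → Fock X} (hΨ : Nice D g Ψ) (hg0 : ∀ s, 0 ≤ g s) {μ : Measure S} [SFinite μ]
    (hgc : Integrable (fun s => g s * c s) μ) {w : S → ℂ} (hw : Measurable w)
    (hw1 : ∀ z, ‖w z‖ ≤ 1) (B : ℕ) :
    slotOp k B ρ (fun l p κ => ∫ s, w s * Ψ s l p κ ∂μ) =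
      fun l p κ => ∫ s, w s * slotOp k B ρ (Ψ s) l p κ ∂μ := by
  ext m P κ
  -- the joint integrability that Fubini's theorem needs
  have hint : ∀ (l' l : ℕ) (p' : Fin l' → Mom) (Q : Fin (m - l') → Mom),
      Integrable (fun z : S × (Fin l → Mom) => w z.1 * (k l' l p' z.2 *
        Ψ z.1 (l + (m - l')) (Fin.append z.2 Q) (ρ κ (∑ j, p' j - ∑ j, z.2 j))))
        (μ.prod volume) := by
    intro l' l p' Q
    obtain ⟨C, h0, hC⟩ := hk.exists_integrand_bound hg0 hΨ l' l (m - l')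
    refine ((hgc.mul_prod (integrable_momWeight (Fin l))).const_mul (C * slotWeight D' κ)).mono'
      (Measurable.aestronglyMeasurable ?_) (Eventually.of_forall fun z => ?_)
    · exact (hw.comp measurable_fst).mul ((hk.measurable_integrand hΨ l' l (m - l')).comp
        (by fun_prop : Measurable fun z : S × (Fin l → Mom) => ((z.1, p', Q, κ), z.2)))
    · rw [norm_mul]
      refine (mul_le_of_le_one_left (norm_nonneg _) (hw1 _)).trans
        ((hC z.1 p' Q κ z.2).trans_eq ?_)
      ring
  have hswap : ∀ (l' l : ℕ) (p' : Fin l' → Mom) (Q : Fin (m - l') → Mom),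
      (∫ p : Fin l → Mom, k l' l p' p * (∫ s, w s * Ψ s (l + (m - l')) (Fin.append p Q)
        (ρ κ (∑ j, p' j - ∑ j, p j)) ∂μ)) =
      ∫ s, w s * (∫ p : Fin l → Mom, k l' l p' p * Ψ s (l + (m - l')) (Fin.append p Q)
        (ρ κ (∑ j, p' j - ∑ j, p j))) ∂μ := by
    intro l' l p' Q
    simp only [← integral_const_mul]
    refine Eq.trans ?_ (integral_integral_swap (hint l' l p' Q)).symm
    refine integral_congr_ae (Eventually.of_forall fun p => ?_)
    refine integral_congr_ae (Eventually.of_forall fun s => ?_)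
    simp only
    ring
  have hint' : ∀ (l' l : ℕ) (p' : Fin l' → Mom) (Q : Fin (m - l') → Mom),
      Integrable (fun s => w s * (∫ p : Fin l → Mom, k l' l p' p *
        Ψ s (l + (m - l')) (Fin.append p Q) (ρ κ (∑ j, p' j - ∑ j, p j)))) μ := by
    intro l' l p' Q
    have := (hint l' l p' Q).integral_prod_left
    simpa only [integral_const_mul] using this
  simp only [slotOp_apply]
  have hint2 : ∀ (l' l : ℕ), Integrable (fun s => w s * (if h : l' ≤ m then
        ((Real.sqrt (((l + (m - l'))! : ℝ) * (m ! : ℝ)) / ((m - l')! : ℝ) : ℝ) : ℂ) *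
        ((m ! : ℂ)⁻¹ * ∑ σ : Equiv.Perm (Fin m), ∫ p : Fin l → Mom,
          k l' l (newMomenta h P σ) p * Ψ s (l + (m - l')) (Fin.append p (restMomenta l' P σ))
            (ρ κ (∑ j, newMomenta h P σ j - ∑ j, p j)))
      else 0)) μ := by
    intro l' l
    split_ifs with h
    · have := (integrable_finsetSum Finset.univ fun σ (_ : σ ∈ Finset.univ) =>
        hint' l' l (newMomenta h P σ) (restMomenta l' P σ)).const_mul
        (((Real.sqrt (((l + (m - l'))! : ℝ) * (m ! : ℝ)) / ((m - l')! : ℝ) : ℝ) : ℂ) * (m ! : ℂ)⁻¹)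
      refine this.congr (Eventually.of_forall fun s => ?_)
      simp only [← Finset.mul_sum]
      ring
    · simp
  have hsum : ∀ s, w s * (∑ l' ∈ Finset.range (B + 1), ∑ l ∈ Finset.range (B + 1),
      if h : l' ≤ m then
        ((Real.sqrt (((l + (m - l'))! : ℝ) * (m ! : ℝ)) / ((m - l')! : ℝ) : ℝ) : ℂ) *
        ((m ! : ℂ)⁻¹ * ∑ σ : Equiv.Perm (Fin m), ∫ p : Fin l → Mom,
          k l' l (newMomenta h P σ) p * Ψ s (l + (m - l')) (Fin.append p (restMomenta l' P σ))
            (ρ κ (∑ j, newMomenta h P σ j - ∑ j, p j)))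
      else 0) = ∑ l' ∈ Finset.range (B + 1), ∑ l ∈ Finset.range (B + 1), w s * (if h : l' ≤ m then
        ((Real.sqrt (((l + (m - l'))! : ℝ) * (m ! : ℝ)) / ((m - l')! : ℝ) : ℝ) : ℂ) *
        ((m ! : ℂ)⁻¹ * ∑ σ : Equiv.Perm (Fin m), ∫ p : Fin l → Mom,
          k l' l (newMomenta h P σ) p * Ψ s (l + (m - l')) (Fin.append p (restMomenta l' P σ))
            (ρ κ (∑ j, newMomenta h P σ j - ∑ j, p j)))
      else 0) := fun s => by simp only [Finset.mul_sum]
  simp only [hsum]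
  rw [integral_finsetSum _ fun l' _ => integrable_finsetSum _ fun l _ => hint2 l' l]
  refine Finset.sum_congr rfl fun l' _ => ?_
  rw [integral_finsetSum _ fun l _ => hint2 l' l]
  refine Finset.sum_congr rfl fun l _ => ?_
  split_ifs with h
  · simp only [hswap]
    rw [← integral_finsetSum _ fun σ _ => hint' l' l (newMomenta h P σ) (restMomenta l' P σ),
      ← integral_const_mul, ← integral_const_mul]
    refine integral_congr_ae (Eventually.of_forall fun s => ?_)
    simp only [← Finset.mul_sum]
    ring
  · simp

/-- Operators with nice kernels are additive on nice vectors. Integrability is essential here, as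
the Bochner integral is `0` on functions that are not integrable. -/
lemma slotOp_sum {D D' : Finset X} {k : (l' l : ℕ) → (Fin l' → Mom) → (Fin l → Mom) → ℂ}
    {ρ : (X → Mom) → Mom → X → Mom} {c : ℝ} (hk : NiceKernel D D' (fun _ : Unit => c) (fun _ => k) ρ)
    {ι : Type} (s : Finset ι) {Ψ : ι → Fock X}
    (hΨ : ∀ i ∈ s, Nice D (fun _ : Unit => 1) fun _ => Ψ i) (B : ℕ) :
    slotOp k B ρ (∑ i ∈ s, Ψ i) = ∑ i ∈ s, slotOp k B ρ (Ψ i) := by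
  ext m P κ
  simp only [Finset.sum_apply, slotOp_apply]
  rw [Finset.sum_comm (s := s)]
  refine Finset.sum_congr rfl fun l' _ => ?_
  rw [Finset.sum_comm (s := s)]
  refine Finset.sum_congr rfl fun l _ => ?_
  by_cases h : l' ≤ m
  · simp only [dif_pos h]
    rw [← Finset.mul_sum, ← Finset.mul_sum]
    congr 2
    rw [Finset.sum_comm (s := s)]
    refine Finset.sum_congr rfl fun σ _ => ?_
    rw [← integral_finsetSum s fun i hi => hk.integrable_integrand (fun _ => zero_le_one) (hΨ i hi)
      l' l (m - l') () (newMomenta h P σ) (restMomenta l' P σ) κ]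
    refine integral_congr_ae (Eventually.of_forall fun p => ?_)
    simp only [Finset.mul_sum]
  · simp [h]

end Nice

/-! ### The Hamiltonian and the free field as operators with kernels -/

section Operators

variable {X Y T : Type} [MeasurableSpace T]

/-- Operators with kernels commute with relabellings of the slots and with multiplication by
functions of spectator slots; a function of the slot that is consumed becomes part of the kernel. -/
lemma slotOp_pullback {k k' : (l' l : ℕ) → (Fin l' → Mom) → (Fin l → Mom) → ℂ} (B : ℕ)
    {ρ : (X → Mom) → Mom → X → Mom} {ρ' : (Y → Mom) → Mom → Y → Mom} {r : (X → Mom) → Y → Mom}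
    {g g' : (X → Mom) → ℂ}
    (hk : ∀ l' l p' p κ, k l' l p' p * g (ρ κ (∑ j, p' j - ∑ j, p j)) = g' κ * k' l' l p' p)
    (hr : ∀ κ Q, r (ρ κ Q) = ρ' (r κ) Q) (Ψ : Fock Y) :
    slotOp k B ρ (fun l p κ => g κ * Ψ l p (r κ)) =
      fun l p κ => g' κ * slotOp k' B ρ' Ψ l p (r κ) := by
  ext m P κ
  simp only [slotOp_apply, hr, ← mul_assoc, hk]
  rw [Finset.mul_sum]
  refine Finset.sum_congr rfl fun l' _ => ?_
  rw [Finset.mul_sum]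
  refine Finset.sum_congr rfl fun l _ => ?_
  split_ifs with h
  · simp only [mul_assoc, integral_const_mul, ← Finset.mul_sum]
    ring
  · rw [mul_zero]

/-- The restriction of a Schwartz cut-off to a fixed time. -/
def cutoffSlice (lam : 𝓢(ℝ × Mom, ℂ)) (s : ℝ) : 𝓢(Mom, ℂ) :=
  SchwartzMap.compCLM ℂ (D := Mom) (E := ℝ × Mom) (F := ℂ) (g := fun k => (s, k))
    (hasTemperateGrowth_prodMk (Function.HasTemperateGrowth.const _)
      (ContinuousLinearMap.id ℝ Mom).hasTemperateGrowth)
    ⟨1, 1, fun k => by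
      rw [one_mul, pow_one]
      exact (norm_snd_le (s, k)).trans (le_add_of_nonneg_left zero_le_one)⟩ lam

lemma cutoffSlice_apply (lam : 𝓢(ℝ × Mom, ℂ)) (s : ℝ) (k : Mom) :
    cutoffSlice lam s k = lam (s, k) := by
  unfold cutoffSlice
  rw [SchwartzMap.compCLM_apply]
  rfl

lemma kernelOp_eq_slotOp [DecidableEq X] (K : VertexKernel) (B : ℕ) (x : X) (Ψ : Fock X) :
    kernelOp K B x Ψ = slotOp (fun l' l p' p => K.toFun l' l p' p / ((l' ! : ℂ) * (l ! : ℂ))) B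
      (fun κ Q => Function.update κ x Q) Ψ := rfl

variable (ω : DispersionFunction) (hI : AdmissibleInteraction) (lam : 𝓢(ℝ × Mom, ℂ))

/-- The integral kernels of `-i` times the Hamiltonian. -/
def couplingKernel (s : ℝ) (l' l : ℕ) (p' : Fin l' → Mom) (p : Fin l → Mom) : ℂ :=
  (internalKernel ω hI s).toFun l' l p' p / ((l' ! : ℂ) * (l ! : ℂ)) *
    lam (s, ∑ j, p' j - ∑ j, p j)

/-- `-i` times the Hamiltonian at time `s`. -/
def coupling (s : ℝ) (Ψ : Fock X) : Fock X :=
  slotOp (couplingKernel ω hI lam s) hI.bound (fun κ _ => κ) Ψ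

/-- Consuming the slot `x` of `Ψ ⊗ lam` by the interaction density gives the Hamiltonian. -/
lemma momDensity_mul_cutoff [DecidableEq X] (s : ℝ) (x : X) (Ψ : Fock Y) (r : (X → Mom) → Y → Mom)
    (hr : ∀ κ k, r (Function.update κ x k) = r κ) {g g' : (X → Mom) → ℂ}
    (hg : ∀ κ k, g (Function.update κ x k) = g' κ * lam (s, k)) :
    -Complex.I • momDensity ω hI s x (fun l p κ => g κ * Ψ l p (r κ)) =
      fun l p κ => g' κ * coupling ω hI lam s Ψ l p (r κ) := by
  rw [momDensity_eq_kernelOp ω hI s x le_rfl _ fun l p κ =>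
    ⟨(g' κ * Ψ l p (r κ)) • cutoffSlice lam s, fun k => by
      rw [smul_apply, smul_eq_mul, cutoffSlice_apply, hg, hr]; ring⟩, kernelOp_eq_slotOp]
  refine slotOp_pullback hI.bound (fun l' l p' p κ => ?_) (fun κ Q => hr κ Q) Ψ
  rw [hg, couplingKernel]
  ring

/-- The definition of the Hamiltonian uses an auxiliary slot `none` for the momentum transfer, which
is consumed by the interaction density. -/
lemma smul_hamiltonian [DecidableEq X] (s : ℝ) (Ψ : Fock X) :
    -Complex.I • hamiltonian ω hI lam s Ψ = coupling ω hI lam s Ψ := by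
  have h := momDensity_mul_cutoff ω hI lam s (none : Option X) Ψ (fun κ x => κ (some x))
    (fun κ k => by ext1 x; simp) (g := fun κ => lam (s, κ none)) (g' := fun _ => 1)
    (fun κ k => by simp)
  ext l p κ
  have h1 := congrFun (congrFun (congrFun h l) p) (fun o => o.elim 0 κ)
  simp only [one_mul, Option.elim_some] at h1
  rw [← h1]
  simp only [hamiltonian, Pi.smul_apply, mul_comm]

lemma coupling_pullback (s : ℝ) (r : (X → Mom) → Y → Mom) (Ψ : Fock Y) :
    coupling ω hI lam s (fun l p κ => Ψ l p (r κ)) =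
      fun l p κ => coupling ω hI lam s Ψ l p (r κ) := by
  have := slotOp_pullback (k := couplingKernel ω hI lam s) (k' := couplingKernel ω hI lam s)
    hI.bound (ρ := fun κ _ => κ) (ρ' := fun κ _ => κ) (r := r) (g := fun _ => 1) (g' := fun _ => 1)
    (fun _ _ _ _ _ => by ring) (fun _ _ => rfl) Ψ
  simp only [one_mul] at this
  exact this

/-- The Hamiltonian preserves the decay in the slots, and the cut-off supplies integrable decay in
time. -/
lemma niceKernel_coupling (D : Finset X) :
    NiceKernel D D (fun s : ℝ => ((1 + |s|) ^ 2)⁻¹) (couplingKernel ω hI lam)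
      (fun κ _ => κ) := by
  refine ⟨fun l' l => ?_, measurable_fst, fun l' l => ?_⟩
  · have h1 : Continuous fun z : ℝ × (Fin l' → Mom) × (Fin l → Mom) =>
        hI.kernel l' l z.2.1 z.2.2 := (hI.temperate l' l).1.continuous.comp continuous_snd
    have h2 : Continuous fun z : ℝ × (Fin l' → Mom) × (Fin l → Mom) =>
        energyDefect ω z.2.1 z.2.2 := by
      unfold energyDefect
      refine Continuous.sub (continuous_finsetSum _ fun j _ => ω.continuous.comp (by fun_prop))
        (continuous_finsetSum _ fun j _ => ω.continuous.comp (by fun_prop))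
    -- the cut-off absorbs the powers of `Q` and decays in time
    have h3 : Continuous fun z : ℝ × (Fin l' → Mom) × (Fin l → Mom) =>
        lam (z.1, ∑ j, z.2.1 j - ∑ j, z.2.2 j) := lam.continuous.comp (by fun_prop)
    refine Continuous.measurable ?_
    unfold couplingKernel internalKernel
    simp only
    fun_prop
  · obtain ⟨C, M, h0, hC⟩ := hI.kernel_bound l' l (4 * l)
    have hpi := Real.pi_pos
    have hlam := fun x => schwartz_decay lam (2 + M) 0 0 le_rfl x
    set L := 2 ^ (2 + M) * ((Finset.Iic (2 + M, 0)).sup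
      (schwartzSeminormFamily ℂ (ℝ × Mom) ℂ)) lam
    have hL : 0 ≤ L := by
      refine le_trans ?_ (hlam 0); positivity
    refine ⟨(2 * Real.pi) ^ 3 * C * L, by positivity, fun s p' p κ => ?_⟩
    rw [← mul_assoc, ← mul_assoc]
    refine mul_le_mul_of_nonneg_right ?_ (slotWeight_nonneg _ _)
    set Q := ∑ j, p' j - ∑ j, p j
    -- trades the rapid decay of the kernel at bounded momentum transfer `Q` for an integrable
    -- weight of the consumed momenta
    have h1 : momWeight p * (1 + ‖(p', p)‖) ^ (4 * l) ≥ 1 := by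
      unfold momWeight
      rw [Finset.prod_inv_distrib, Finset.prod_pow, mul_comm, ← div_eq_mul_inv, ge_iff_le,
        one_le_div (by positivity), mul_comm, pow_mul]
      refine pow_le_pow_left₀ (by positivity) ?_ 4
      calc ∏ j, (1 + ‖p j‖) ≤ ∏ _j : Fin l, (1 + ‖(p', p)‖) :=
            Finset.prod_le_prod (fun j _ => by positivity) fun j _ => by
              gcongr
              exact (norm_le_pi_norm p j).trans (norm_snd_le (p', p))
        _ = _ := by simp
    have h2 : ‖hI.kernel l' l p' p‖ ≤ C * (1 + ‖Q‖) ^ M * momWeight p := by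
      calc ‖hI.kernel l' l p' p‖ = 1 * ‖hI.kernel l' l p' p‖ := (one_mul _).symm
        _ ≤ (momWeight p * (1 + ‖(p', p)‖) ^ (4 * l)) * ‖hI.kernel l' l p' p‖ :=
          mul_le_mul_of_nonneg_right h1 (norm_nonneg _)
        _ = momWeight p * ((1 + ‖(p', p)‖) ^ (4 * l) * ‖hI.kernel l' l p' p‖) := mul_assoc _ _ _
        _ ≤ momWeight p * (C * (1 + ‖Q‖) ^ M) :=
          mul_le_mul_of_nonneg_left (hC p' p) (momWeight_nonneg p)
        _ = _ := mul_comm _ _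
    have h3 : (1 + |s|) ^ 2 * ((1 + ‖Q‖) ^ M * ‖lam (s, Q)‖) ≤ L := by
      have := hlam (s, Q)
      rw [norm_iteratedFDeriv_zero] at this
      refine le_trans ?_ this
      rw [pow_add, ← mul_assoc]
      gcongr
      · exact norm_fst_le (s, Q)
      · exact norm_snd_le (s, Q)
    have h4 : (1 + ‖Q‖) ^ M * ‖lam (s, Q)‖ ≤ L * ((1 + |s|) ^ 2)⁻¹ := by
      rw [← div_eq_mul_inv, le_div_iff₀ (by positivity), mul_comm]; exact h3
    have h5 : ‖couplingKernel ω hI lam s l' l p' p‖ ≤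
        (2 * Real.pi) ^ 3 * ‖hI.kernel l' l p' p‖ * ‖lam (s, Q)‖ := by
      unfold couplingKernel internalKernel
      rw [norm_mul, norm_div]
      refine mul_le_mul_of_nonneg_right ?_ (norm_nonneg _)
      simp only [norm_mul, norm_exp_I_mul]
      rw [div_le_iff₀ (by simp [Nat.factorial_pos])]
      have : (1 : ℝ) ≤ ‖(l' ! : ℂ)‖ * ‖(l ! : ℂ)‖ := by
        rw [Complex.norm_natCast, Complex.norm_natCast]
        exact_mod_cast Nat.mul_pos l'.factorial_pos l.factorial_pos
      simp only [norm_neg, Complex.norm_I, one_mul, norm_pow, Complex.norm_ofNat,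
        Complex.norm_real, Real.norm_eq_abs, abs_of_pos hpi, mul_one, norm_mul]
      exact le_mul_of_one_le_right (by positivity) this
    calc _ ≤ (2 * Real.pi) ^ 3 * ‖hI.kernel l' l p' p‖ * ‖lam (s, Q)‖ := h5
      _ ≤ (2 * Real.pi) ^ 3 * (C * (1 + ‖Q‖) ^ M * momWeight p) * ‖lam (s, Q)‖ := by gcongr
      _ = (2 * Real.pi) ^ 3 * C * momWeight p * ((1 + ‖Q‖) ^ M * ‖lam (s, Q)‖) := by ring
      _ ≤ (2 * Real.pi) ^ 3 * C * momWeight p * (L * ((1 + |s|) ^ 2)⁻¹) :=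
        mul_le_mul_of_nonneg_left h4 (by have := momWeight_nonneg p; positivity)
      _ = _ := by ring

variable [DecidableEq X]

/-- The free field consumes the decay in its slot. -/
lemma niceKernel_field (a : FieldPart) (t : ℝ) (D : Finset X) (x : X) (hx : x ∈ D) :
    NiceKernel D (D.erase x) (fun _ : T => 1)
      (fun _ l' l p' p => (externalKernel ω a t).toFun l' l p' p / ((l' ! : ℂ) * (l ! : ℂ)))
      (fun κ Q => Function.update κ x Q) := by
  obtain ⟨C, h0, hC⟩ := exists_fieldAmplitude_bound ω
  have hw : ∀ (κ : X → Mom) Q, slotWeight D (Function.update κ x Q) =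
      ((1 + ‖Q‖) ^ 4)⁻¹ * slotWeight (D.erase x) κ := fun κ Q => by
    unfold slotWeight
    rw [← Finset.mul_prod_erase D _ hx, Function.update_self]
    congr 1
    exact Finset.prod_congr rfl fun y hy => by
      rw [Function.update_of_ne (Finset.ne_of_mem_erase hy)]
  refine ⟨fun l' l => ?_, ?_, fun l' l => ⟨C, h0, fun _ p' p κ => ?_⟩⟩
  · exact (((externalKernel ω a t).continuous l' l).measurable.comp measurable_snd).div_const _
  · refine measurable_pi_iff.2 fun y => ?_
    by_cases h : y = x
    · subst h; simp only [Function.update_self]; fun_prop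
    · simp only [Function.update_of_ne h]; fun_prop
  · rw [hw, one_mul, ← mul_assoc, ← mul_assoc]
    refine mul_le_mul_of_nonneg_right ?_ (slotWeight_nonneg _ _)
    simp only [externalKernel]
    cases a <;> simp only
    · split_ifs with h
      · obtain ⟨rfl, rfl⟩ := h
        simp only [Fin.prod_univ_one, Nat.factorial_one, Nat.factorial_zero, Nat.cast_one, mul_one,
          div_one, momWeight, Finset.univ_eq_empty, Finset.prod_empty]
        refine (mul_le_of_le_one_right (norm_nonneg _) ?_).trans (hC _ _ _)
        exact inv_le_one_of_one_le₀ (one_le_pow₀ (by simp))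
      · simp only [zero_div, norm_zero, zero_mul]
        exact mul_nonneg h0 (momWeight_nonneg _)
    · split_ifs with h
      · obtain ⟨rfl, rfl⟩ := h
        simp only [Fin.prod_univ_one, Nat.factorial_one, Nat.factorial_zero, Nat.cast_one, mul_one,
          div_one, momWeight, Fin.sum_univ_one, Finset.univ_eq_empty, Finset.sum_empty, zero_sub,
          norm_neg]
        exact mul_le_mul_of_nonneg_right (hC _ _ _) (by positivity)
      · simp only [zero_div, norm_zero, zero_mul]
        exact mul_nonneg h0 (momWeight_nonneg _)

end Operators

/-! ### Operators which preserve nice families -/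

section GoodOp

variable {X : Type}

/-- Operators which take nice families with decay in the slots `D` to nice families with decay in
the slots `D'`, and which commute with the integrals and the sums of such families. -/
structure GoodOp (D D' : Finset X) (A : Fock X → Fock X) : Prop where
  nice : ∀ {T : Type} [MeasurableSpace T] {G : T → ℝ} {Ψ : T → Fock X}, (∀ τ, 0 ≤ G τ) →
    Nice D G Ψ → Nice D' G fun τ => A (Ψ τ)
  integral : ∀ {S : Type} [MeasurableSpace S] {g : S → ℝ} {Ψ : S → Fock X}, (∀ s, 0 ≤ g s) →
    Nice D g Ψ → ∀ {μ : Measure S} [SFinite μ], Integrable g μ → ∀ {w : S → ℂ}, Measurable w →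
    (∀ s, ‖w s‖ ≤ 1) → A (fun l p κ => ∫ s, w s * Ψ s l p κ ∂μ) =
      fun l p κ => ∫ s, w s * A (Ψ s) l p κ ∂μ
  sum : ∀ {ι : Type} (s : Finset ι) {Ψ : ι → Fock X},
    (∀ i ∈ s, Nice D (fun _ : Unit => 1) fun _ => Ψ i) → A (∑ i ∈ s, Ψ i) = ∑ i ∈ s, A (Ψ i)

lemma GoodOp.id (D : Finset X) : GoodOp D D id :=
  ⟨fun _ h => h, fun _ _ _ _ _ _ _ _ => rfl, fun _ _ _ => rfl⟩

lemma GoodOp.of_slotOp {D D' : Finset X} {k : (l' l : ℕ) → (Fin l' → Mom) → (Fin l → Mom) → ℂ}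
    {ρ : (X → Mom) → Mom → X → Mom} {B : ℕ} {c : ℝ}
    (hk : ∀ (T : Type) [MeasurableSpace T], NiceKernel D D' (fun _ : T => c) (fun _ => k) ρ) :
    GoodOp D D' (slotOp k B ρ) where
  nice {T} _ G Ψ hG hΨ := by
    have h := hΨ.slotOp (hk T) hG B
    refine ⟨h.measurable, fun l => ?_⟩
    obtain ⟨C, h0, hC⟩ := h.bound l
    refine ⟨C * |c|, by positivity, fun τ p κ => (hC τ p κ).trans ?_⟩
    have := mul_nonneg (mul_nonneg h0 (hG τ)) (slotWeight_nonneg D' κ)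
    nlinarith [le_abs_self c]
  integral hg hΨ μ _ hi w hw hw1 :=
    slotOp_integral (hk _) hΨ hg (hi.mul_const c) hw hw1 B
  sum s Ψ hΨ := slotOp_sum (hk _) s hΨ B

variable (ω : DispersionFunction) (hI : AdmissibleInteraction) (lam : 𝓢(ℝ × Mom, ℂ))

lemma NiceKernel.comp {S T : Type} [MeasurableSpace S] [MeasurableSpace T] {D D' : Finset X}
    {γ : T → ℝ} {k : T → (l' l : ℕ) → (Fin l' → Mom) → (Fin l → Mom) → ℂ}
    {ρ : (X → Mom) → Mom → X → Mom} (hk : NiceKernel D D' γ k ρ) {f : S → T} (hf : Measurable f) :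
    NiceKernel D D' (fun s => γ (f s)) (fun s => k (f s)) ρ where
  measurable l' l := (hk.measurable l' l).comp
    (by fun_prop : Measurable fun z : S × (Fin l' → Mom) × (Fin l → Mom) => (f z.1, z.2))
  measurable_slot := hk.measurable_slot
  bound l' l := by
    obtain ⟨C, h0, hC⟩ := hk.bound l' l
    exact ⟨C, h0, fun s => hC (f s)⟩

lemma goodOp_coupling (D : Finset X) (s : ℝ) : GoodOp D D (coupling (X := X) ω hI lam s) := by
  have h : coupling (X := X) ω hI lam s =
      slotOp (couplingKernel ω hI lam s) hI.bound (fun κ _ => κ) := rfl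
  have hk : ∀ (T : Type) [MeasurableSpace T], NiceKernel D D (fun _ : T => ((1 + |s|) ^ 2)⁻¹)
      (fun _ => couplingKernel ω hI lam s) (fun κ _ => κ) := fun T _ =>
    (niceKernel_coupling ω hI lam D).comp (f := fun _ : T => s) measurable_const
  rw [h]
  exact GoodOp.of_slotOp hk

/-- The Hamiltonian, as a function of the time, preserves nice families and adds decay in time. -/
lemma Nice.coupling_apply {T : Type} [MeasurableSpace T] {D : Finset X} {G : T → ℝ}
    {Ψ : T → Fock X} (hG : ∀ τ, 0 ≤ G τ) (hΨ : Nice D G Ψ) {f : T → ℝ} (hf : Measurable f) :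
    Nice D (fun τ => G τ * ((1 + |f τ|) ^ 2)⁻¹) fun τ => coupling ω hI lam (f τ) (Ψ τ) :=
  hΨ.slotOp ((niceKernel_coupling ω hI lam D).comp hf) hG hI.bound

lemma goodOp_freeField [DecidableEq X] (a : FieldPart) (t : ℝ) (D : Finset X) (x : X)
    (hx : x ∈ D) : GoodOp D (D.erase x) (freeField ω a t x) := by
  have : freeField ω a t x = slotOp (fun l' l p' p => (externalKernel ω a t).toFun l' l p' p /
      ((l' ! : ℂ) * (l ! : ℂ))) 1 (fun κ Q => Function.update κ x Q) := by
    ext1 Ψ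
    rw [freeField_eq_kernelOp ω a t x le_rfl Ψ, kernelOp_eq_slotOp]
  rw [this]
  exact GoodOp.of_slotOp (c := 1) fun T _ => niceKernel_field ω a t D x hx

end GoodOp

/-! ### Recursion for the kernels of the iterated integrals -/

section Kernels

open Classical in
lemma simplexKernel_eq_ite_of_lt {v : ℕ} {a b : EReal} (h : a < b) (τ : Fin v → ℝ) :
    simplexKernel a b τ = if (∀ j, a < τ j ∧ (τ j : EReal) < b) ∧ (∀ i j, i < j → τ j < τ i)
      then 1 else 0 := by
  rw [simplexKernel_of_lt h]
  have h2 : (∀ i j : Fin v, i < j → -1 * (τ i - τ j) < 0) ↔ ∀ i j, i < j → τ j < τ i :=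
    forall₂_congr fun i j => imp_congr_right fun _ => by constructor <;> intro h <;> linarith
  simp only [stepKernel_of_lt h, Finset.prod_ite_zero, orderIndicator, Finset.mem_univ,
    forall_const, Finset.prod_const_one, h2]
  split_ifs <;> first | (exfalso; tauto) | simp

open Classical in
lemma simplexKernel_eq_ite_of_gt {v : ℕ} {a b : EReal} (h : b < a) (τ : Fin v → ℝ) :
    simplexKernel a b τ = if (∀ j, b < τ j ∧ (τ j : EReal) < a) ∧ (∀ i j, i < j → τ i < τ j)
      then (-1) ^ v else 0 := by
  rw [simplexKernel_of_gt h]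
  have h1 : ∀ j, stepKernel (τ j) a b = -1 * if b < τ j ∧ (τ j : EReal) < a then 1 else 0 :=
    fun j => by rw [stepKernel_swap, stepKernel_of_lt h, neg_one_mul]
  have h2 : (∀ i j : Fin v, i < j → 1 * (τ i - τ j) < 0) ↔ ∀ i j, i < j → τ i < τ j :=
    forall₂_congr fun i j => imp_congr_right fun _ => by constructor <;> intro h <;> linarith
  simp only [h1, Finset.prod_mul_distrib, Finset.prod_ite_zero, orderIndicator, Finset.mem_univ,
    forall_const, Finset.prod_const_one, Finset.prod_const, Finset.card_univ, Fintype.card_fin, h2]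
  split_ifs <;> first | (exfalso; tauto) | simp

/-- The outermost time bounds the other ones. -/
lemma simplexKernel_succ {v : ℕ} (a b : EReal) (τ : Fin (v + 1) → ℝ) :
    simplexKernel a b τ = stepKernel (τ 0) a b * simplexKernel a (τ 0) fun j => τ j.succ := by
  classical
  rcases lt_trichotomy a b with h | rfl | h
  · rw [simplexKernel_eq_ite_of_lt h, stepKernel_of_lt h]
    by_cases h0 : a < τ 0 ∧ (τ 0 : EReal) < b
    · rw [if_pos h0, one_mul, simplexKernel_eq_ite_of_lt h0.1]
      refine if_congr ⟨fun ⟨h1, h2⟩ => ⟨fun j => ⟨(h1 j.succ).1, ?_⟩, fun i j hij =>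
        h2 _ _ (Fin.succ_lt_succ_iff.2 hij)⟩, fun ⟨h1, h2⟩ => ⟨fun j => ?_, fun i j => ?_⟩⟩ rfl rfl
      · exact EReal.coe_lt_coe_iff.2 (h2 0 j.succ (Fin.succ_pos j))
      · refine Fin.cases h0 (fun j => ⟨(h1 j).1, (h1 j).2.trans h0.2⟩) j
      · refine Fin.cases ?_ (fun j => ?_) j
        · exact fun hi => absurd hi (Fin.not_lt_zero i)
        · refine Fin.cases (fun _ => EReal.coe_lt_coe_iff.1 (h1 j).2) (fun i hij => ?_) i
          exact h2 i j (Fin.succ_lt_succ_iff.1 hij)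
    · rw [if_neg h0, zero_mul, if_neg fun h1 => h0 (h1.1 0)]
  · rw [simplexKernel_self, stepKernel_self, zero_mul]
  · rw [simplexKernel_eq_ite_of_gt h, stepKernel_swap, stepKernel_of_lt h]
    by_cases h0 : b < τ 0 ∧ (τ 0 : EReal) < a
    · rw [if_pos h0, simplexKernel_eq_ite_of_gt h0.2, pow_succ', mul_ite, mul_zero]
      refine if_congr ⟨fun ⟨h1, h2⟩ => ⟨fun j => ⟨?_, (h1 j.succ).2⟩, fun i j hij =>
        h2 _ _ (Fin.succ_lt_succ_iff.2 hij)⟩, fun ⟨h1, h2⟩ => ⟨fun j => ?_, fun i j => ?_⟩⟩ rfl rfl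
      · exact EReal.coe_lt_coe_iff.2 (h2 0 j.succ (Fin.succ_pos j))
      · refine Fin.cases h0 (fun j => ⟨h0.1.trans (h1 j).1, (h1 j).2⟩) j
      · refine Fin.cases ?_ (fun j => ?_) j
        · exact fun hi => absurd hi (Fin.not_lt_zero i)
        · refine Fin.cases (fun _ => EReal.coe_lt_coe_iff.1 (h1 j).1) (fun i hij => ?_) i
          exact h2 i j (Fin.succ_lt_succ_iff.1 hij)
    · rw [if_neg h0, neg_zero, zero_mul, if_neg fun h1 => h0 (h1.1 0)]

/-- Additivity of oriented integrals. -/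
lemma stepKernel_add {a b c : EReal} {s : ℝ} (ha : (s : EReal) ≠ a) (hb : (s : EReal) ≠ b)
    (hc : (s : EReal) ≠ c) : stepKernel s a b + stepKernel s b c = stepKernel s a c := by
  unfold stepKernel
  rcases lt_or_gt_of_ne ha with h1 | h1 <;> rcases lt_or_gt_of_ne hb with h2 | h2 <;>
    rcases lt_or_gt_of_ne hc with h3 | h3 <;>
    simp [h1, h2, h3, h1.not_gt, h2.not_gt, h3.not_gt]

lemma ae_coe_ne (a : EReal) : ∀ᵐ s : ℝ, (s : EReal) ≠ a := by
  by_cases h : ∃ r : ℝ, (r : EReal) = a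
  · obtain ⟨r, rfl⟩ := h
    filter_upwards [Measure.ae_ne volume r] with s hs
    exact fun h => hs (EReal.coe_injective h)
  · exact Eventually.of_forall fun s hs => h ⟨s, hs⟩

lemma ae_stepKernel_add (a b c : EReal) :
    ∀ᵐ s : ℝ, stepKernel s a b + stepKernel s b c = stepKernel s a c := by
  filter_upwards [ae_coe_ne a, ae_coe_ne b, ae_coe_ne c] with s h1 h2 h3
  exact stepKernel_add h1 h2 h3

lemma norm_stepKernel_le_one (s : ℝ) (a b : EReal) : ‖(stepKernel s a b : ℂ)‖ ≤ 1 := by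
  rw [Complex.norm_real]
  exact abs_stepKernel_le_one s a b

lemma measurable_stepKernel_comp {T : Type} [MeasurableSpace T] {s : T → ℝ} {a b : T → EReal}
    (hs : Measurable s) (ha : Measurable a) (hb : Measurable b) :
    Measurable fun τ => (stepKernel (s τ) (a τ) (b τ) : ℂ) :=
  Complex.measurable_ofReal.comp (measurable_stepKernel.comp (hs.prodMk (ha.prodMk hb)))

lemma norm_simplexKernel_le_one {v : ℕ} (a b : EReal) (τ : Fin v → ℝ) :
    ‖(simplexKernel a b τ : ℂ)‖ ≤ 1 := by
  rw [Complex.norm_real]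
  exact abs_simplexKernel_le_one a b τ

lemma measurable_simplexKernel_comp {T : Type} [MeasurableSpace T] {v : ℕ} {τ : T → Fin v → ℝ}
    {a b : T → EReal} (hs : Measurable τ) (ha : Measurable a) (hb : Measurable b) :
    Measurable fun z => (simplexKernel (a z) (b z) (τ z) : ℂ) :=
  Complex.measurable_ofReal.comp ((measurable_simplexKernel v).comp (ha.prodMk (hb.prodMk hs)))

end Kernels

/-! ### The evolution operators -/

section Evolution

variable {X : Type} {D : Finset X}

lemma Nice.integrable {S : Type} [MeasurableSpace S] {g : S → ℝ} {Ψ : S → Fock X}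
    (hΨ : Nice D g Ψ) {μ : Measure S} (hg : Integrable g μ) {w : S → ℂ}
    (hw : Measurable w) (hw1 : ∀ s, ‖w s‖ ≤ 1) (l : ℕ) (p : Fin l → Mom) (κ : X → Mom) :
    Integrable (fun s => w s * Ψ s l p κ) μ := by
  obtain ⟨C, h0, hC⟩ := hΨ.bound l
  refine (hg.const_mul (C * slotWeight D κ)).mono' (Measurable.aestronglyMeasurable ?_)
    (Eventually.of_forall fun s => ?_)
  · exact hw.mul ((hΨ.measurable l).comp (by fun_prop : Measurable fun s : S => (s, p, κ)))
  · rw [norm_mul]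
    refine (mul_le_of_le_one_left (norm_nonneg _) (hw1 s)).trans ((hC s p κ).trans_eq ?_)
    ring

/-- Vectors that are constant families. -/
abbrev NiceVec (D : Finset X) (Ψ : Fock X) : Prop := Nice D (fun _ : Unit => 1) fun _ => Ψ

lemma NiceVec.family {Ψ : Fock X} (h : NiceVec D Ψ) (T : Type) [MeasurableSpace T] :
    Nice D (fun _ : T => 1) fun _ => Ψ :=
  Nice.comp h (f := fun _ => ()) measurable_const

lemma Nice.eval {T : Type} [MeasurableSpace T] {G : T → ℝ} {Ψ : T → Fock X} (h : Nice D G Ψ)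
    (τ : T) : NiceVec D (Ψ τ) := by
  refine ⟨fun l => (h.measurable l).comp (by fun_prop : Measurable
    fun z : Unit × (Fin l → Mom) × (X → Mom) => (τ, z.2)), fun l => ?_⟩
  obtain ⟨C, h0, hC⟩ := h.bound l
  refine ⟨C * |G τ|, by positivity, fun _ p κ => (hC τ p κ).trans ?_⟩
  rw [one_mul, mul_assoc]
  gcongr
  · exact slotWeight_nonneg _ _
  · exact le_abs_self _

lemma NiceVec.sum {ι : Type} (s : Finset ι) {Ψ : ι → Fock X} (h : ∀ i ∈ s, NiceVec D (Ψ i)) :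
    NiceVec D (∑ i ∈ s, Ψ i) := by
  constructor
  · intro l
    simp only [Finset.sum_apply]
    exact Finset.measurable_sum _ fun i hi => (h i hi).measurable l
  · intro l
    choose! C h0 hC using fun i hi => (h i hi).bound l
    refine ⟨∑ i ∈ s, C i, Finset.sum_nonneg h0, fun τ p κ => ?_⟩
    simp only [Finset.sum_apply]
    rw [Finset.sum_mul]
    exact (norm_sum_le _ _).trans (Finset.sum_le_sum fun i hi => hC i hi τ p κ)

variable [DecidableEq X] (ω : DispersionFunction) (hI : AdmissibleInteraction)
  (lam : 𝓢(ℝ × Mom, ℂ))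

/-- The Dyson equation. -/
lemma evolution_succ (m : ℕ) (b a : EReal) (Ψ : Fock X) :
    evolution ω hI lam (m + 1) b a Ψ = fun l p κ => ∫ s : ℝ, (stepKernel s a b : ℂ) *
      coupling ω hI lam s (evolution ω hI lam m s a Ψ) l p κ := by
  ext l p κ
  simp only [evolution]
  rw [← integral_const_mul]
  refine integral_congr_ae (Eventually.of_forall fun s => ?_)
  simp only [← smul_hamiltonian, Pi.smul_apply, smul_eq_mul]
  ring

/-- Evolution operators with measurable end points preserve nice families. -/
lemma Nice.evolution_apply (m : ℕ) {T : Type} [MeasurableSpace T] {G : T → ℝ} {Ψ : T → Fock X}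
    (hG : ∀ τ, 0 ≤ G τ) (hΨ : Nice D G Ψ) {b a : T → EReal} (hb : Measurable b)
    (ha : Measurable a) : Nice D G fun τ => evolution ω hI lam m (b τ) (a τ) (Ψ τ) := by
  induction m generalizing T with
  | zero => exact hΨ
  | succ m ih =>
    simp only [evolution_succ]
    have h1 : Nice D (fun z : T × ℝ => G z.1) fun z => evolution ω hI lam m z.2 (a z.1) (Ψ z.1) :=
      ih (b := fun z : T × ℝ => (z.2 : EReal)) (a := fun z => a z.1) (fun z => hG z.1)
        (hΨ.comp (f := Prod.fst) measurable_fst) (measurable_coe_real_ereal.comp measurable_snd)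
        (ha.comp measurable_fst)
    have h2 : Nice D (fun z : T × ℝ => G z.1 * ((1 + |z.2|) ^ 2)⁻¹) fun z =>
        coupling ω hI lam z.2 (evolution ω hI lam m z.2 (a z.1) (Ψ z.1)) :=
      Nice.coupling_apply ω hI lam (fun z : T × ℝ => hG z.1) h1 measurable_snd
    have hw : Measurable fun z : T × ℝ => (stepKernel z.2 (a z.1) (b z.1) : ℂ) :=
      measurable_stepKernel_comp measurable_snd (ha.comp measurable_fst) (hb.comp measurable_fst)
    exact Nice.integral (G := G) (g := fun s : ℝ => ((1 + |s|) ^ 2)⁻¹) h2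
      (fun s => by positivity) integrable_one_add_abs hw
      (fun z => norm_stepKernel_le_one _ _ _)

lemma nice_coupling_evolution (m : ℕ) (a : EReal) {Ψ : Fock X} (hΨ : NiceVec D Ψ) :
    Nice D (fun r : ℝ => ((1 + |r|) ^ 2)⁻¹) fun r =>
      coupling ω hI lam r (evolution ω hI lam m r a Ψ) := by
  have h1 := Nice.coupling_apply ω hI lam (f := fun r : ℝ => r) (fun _ => zero_le_one)
    ((NiceVec.family hΨ ℝ).evolution_apply ω hI lam m (b := fun r : ℝ => (r : EReal))
      (a := fun _ => a) (fun _ => zero_le_one) measurable_coe_real_ereal measurable_const)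
    measurable_id
  simpa only [one_mul] using h1

/-- The coefficients of the evolution operators are integrals of good operators with an integrable
decay in time. -/
lemma goodOp_evolution (D : Finset X) (m : ℕ) (b a : EReal) :
    GoodOp D D (evolution (X := X) ω hI lam m b a) where
  nice hG hΨ := hΨ.evolution_apply ω hI lam m hG measurable_const measurable_const
  integral {S} _ g Ψ hg hΨ μ _ hi w hw hw1 := by
    induction m generalizing b with
    | zero => rfl
    | succ m ih =>
      have hn : Nice D (fun z : S × ℝ => g z.1 * ((1 + |z.2|) ^ 2)⁻¹) fun z =>
          coupling ω hI lam z.2 (evolution ω hI lam m z.2 a (Ψ z.1)) :=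
        Nice.coupling_apply ω hI lam (fun z : S × ℝ => hg z.1)
          (Nice.evolution_apply ω hI lam m (b := fun z : S × ℝ => (z.2 : EReal)) (a := fun _ => a)
            (fun z => hg z.1) (hΨ.comp (f := Prod.fst) measurable_fst)
            (measurable_coe_real_ereal.comp measurable_snd) measurable_const) measurable_snd
      have h1 : ∀ s : ℝ, coupling ω hI lam s (evolution ω hI lam m s a
          fun l p κ => ∫ σ, w σ * Ψ σ l p κ ∂μ) = fun l p κ => ∫ σ, w σ *
            coupling ω hI lam s (evolution ω hI lam m s a (Ψ σ)) l p κ ∂μ := fun s => by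
        rw [ih]
        exact (goodOp_coupling ω hI lam D s).integral hg
          (hΨ.evolution_apply ω hI lam m hg measurable_const measurable_const) hi hw hw1
      simp only [evolution_succ, h1]
      ext l p κ
      simp only [← integral_const_mul]
      have h2 := hn.integrable (hi.mul_prod integrable_one_add_abs)
        (w := fun z : S × ℝ => w z.1 * (stepKernel z.2 a b : ℂ))
        ((hw.comp measurable_fst).mul (measurable_stepKernel_comp measurable_snd measurable_const
          measurable_const)) (fun z => by
          rw [norm_mul]
          exact mul_le_one₀ (hw1 _) (norm_nonneg _) (norm_stepKernel_le_one _ _ _)) l p κ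
      refine Eq.trans ?_ ((integral_integral_swap (f := fun σ s => w σ * (stepKernel s a b : ℂ) *
        coupling ω hI lam s (evolution ω hI lam m s a (Ψ σ)) l p κ) h2).symm.trans ?_)
      · refine integral_congr_ae (Eventually.of_forall fun s => ?_)
        refine integral_congr_ae (Eventually.of_forall fun σ => ?_)
        simp only
        ring
      · refine integral_congr_ae (Eventually.of_forall fun s => ?_)
        refine integral_congr_ae (Eventually.of_forall fun σ => ?_)
        simp only
        ring
  sum {ι} s Ψ hΨ := by
    induction m generalizing b with
    | zero => rfl
    | succ m ih =>
      ext l p κ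
      simp only [evolution_succ, Finset.sum_apply]
      have hnice : ∀ i ∈ s, ∀ r : ℝ, NiceVec D (evolution ω hI lam m r a (Ψ i)) := fun i hi r =>
        (hΨ i hi).evolution_apply ω hI lam m (fun _ => zero_le_one) measurable_const measurable_const
      rw [← integral_finsetSum s fun i hi => ?_]
      · refine integral_congr_ae (Eventually.of_forall fun r => ?_)
        simp only
        rw [ih, (goodOp_coupling ω hI lam D r).sum s fun i hi => hnice i hi r]
        simp only [Finset.sum_apply, Finset.mul_sum]
      · exact (nice_coupling_evolution ω hI lam m a (hΨ i hi)).integrable integrable_one_add_abs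
          (measurable_stepKernel_comp measurable_id measurable_const measurable_const)
          (fun z => norm_stepKernel_le_one _ _ _) l p κ

lemma evolution_pullback {Y : Type} [DecidableEq Y] (r : (X → Mom) → Y → Mom) (m : ℕ)
    (b a : EReal) (Ψ : Fock Y) : evolution ω hI lam m b a (fun l p κ => Ψ l p (r κ)) =
      fun l p κ => evolution ω hI lam m b a Ψ l p (r κ) := by
  induction m generalizing b with
  | zero => rfl
  | succ m ih => simp only [evolution_succ, ih, coupling_pullback]

/-- The composition law of the evolution operators, order by order. -/
lemma sum_evolution_evolution (m : ℕ) (c b a : EReal) {Ψ : Fock X} (hΨ : NiceVec D Ψ) :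
    ∑ jk ∈ Finset.HasAntidiagonal.antidiagonal m, evolution ω hI lam jk.1 c b (evolution ω hI lam jk.2 b a Ψ) =
      evolution ω hI lam m c a Ψ := by
  induction m generalizing c with
  | zero => simp [evolution]
  | succ m ih =>
    have hnice := fun k j : ℕ => nice_coupling_evolution ω hI lam j b
      ((goodOp_evolution ω hI lam D k b a).nice (fun _ => zero_le_one) hΨ)
    have hnice' := nice_coupling_evolution ω hI lam m a hΨ
    -- the term in which the left factor has order zero is split off; the other ones have an
    -- outermost Hamiltonian in the left factor
    rw [Finset.Nat.antidiagonal_succ, Finset.sum_cons, Finset.sum_map]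
    ext l p κ
    simp only [Pi.add_apply, Finset.sum_apply, Function.Embedding.coe_prodMap,
      Function.Embedding.coeFn_mk, Prod.map, Function.Embedding.refl_apply]
    have h0 : ∀ x : Fock X, evolution ω hI lam 0 c b x = x := fun _ => rfl
    have hw : ∀ a b : EReal, Measurable fun s : ℝ => (stepKernel s a b : ℂ) := fun a b =>
      measurable_stepKernel_comp measurable_id measurable_const measurable_const
    have hw1 := fun (a b : EReal) (s : ℝ) => norm_stepKernel_le_one s a b
    simp only [h0, evolution_succ, Nat.succ_eq_add_one]
    rw [← integral_finsetSum _ fun jk _ => (hnice jk.2 jk.1).integrable integrable_one_add_abs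
        (hw b c) (hw1 b c) l p κ,
      ← integral_add (hnice'.integrable integrable_one_add_abs (hw a b) (hw1 a b) l p κ)
        (integrable_finsetSum _ fun jk _ => (hnice jk.2 jk.1).integrable integrable_one_add_abs
        (hw b c) (hw1 b c) l p κ)]
    refine integral_congr_ae ?_
    -- the outermost time `s` runs from `a` to `b` or from `b` to `c`
    filter_upwards [ae_stepKernel_add a b c] with s hs
    have h2 : ∑ jk ∈ Finset.HasAntidiagonal.antidiagonal m, coupling ω hI lam s (evolution ω hI lam jk.1 s b
        (evolution ω hI lam jk.2 b a Ψ)) l p κ =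
        coupling ω hI lam s (evolution ω hI lam m s a Ψ) l p κ := by
      rw [← ih s, (goodOp_coupling ω hI lam D s).sum]
      · simp only [Finset.sum_apply]
      · intro jk _
        exact (goodOp_evolution ω hI lam D jk.1 s b).nice (fun _ => zero_le_one)
          ((goodOp_evolution ω hI lam D jk.2 b a).nice (fun _ => zero_le_one) hΨ)
    rw [← Finset.mul_sum, h2, ← add_mul, ← hs]
    push_cast
    ring

end Evolution

/-! ### Evolution operators as integrals over time simplices -/

lemma integral_pi_sum {ι ι' Y D : Type} [Fintype ι] [Fintype ι'] [Fintype Y] [MeasureSpace D]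
    [SigmaFinite (volume : Measure D)] (e : ι ⊕ ι' ≃ Y) (f : (Y → D) → ℂ) :
    ∫ p, f p = ∫ z : (ι → D) × (ι' → D), f (fun y => Sum.elim z.1 z.2 (e.symm y)) := by
  rw [integral_pi_equiv e, ← (volume_measurePreserving_sumPiEquivProdPi_symm
    (fun _ : ι ⊕ ι' => D)).integral_comp' (f := (MeasurableEquiv.sumPiEquivProdPi _).symm)]
  refine integral_congr_ae (Eventually.of_forall fun z => ?_)
  refine congrArg f (funext fun y => ?_)
  simp only [Function.comp_apply]
  cases e.symm y <;> rfl

lemma integral_pi_fin_succ {k : ℕ} (f : (Fin (k + 1) → ℝ) → ℂ) :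
    ∫ τ, f τ = ∫ z : ℝ × (Fin k → ℝ), f (Fin.cons z.1 z.2) := by
  rw [← ((volume_preserving_piFinSuccAbove (fun _ : Fin (k + 1) => ℝ) 0).symm).integral_comp'
    (f := (MeasurableEquiv.piFinSuccAbove (fun _ : Fin (k + 1) => ℝ) 0).symm)]
  refine integral_congr_ae (Eventually.of_forall fun z => ?_)
  refine congrArg f ?_
  simp [MeasurableEquiv.piFinSuccAbove_symm_apply, Fin.insertNthEquiv]

section Words

variable {X : Type} {D : Finset X} (ω : DispersionFunction) (hI : AdmissibleInteraction)
  (lam : 𝓢(ℝ × Mom, ℂ))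

/-- A product of Hamiltonians at the times `τ`. -/
def couplingWord {k : ℕ} (τ : Fin k → ℝ) (Ψ : Fock X) : Fock X :=
  (List.ofFn τ).foldr (coupling ω hI lam) Ψ

lemma couplingWord_succ {k : ℕ} (τ : Fin (k + 1) → ℝ) (Ψ : Fock X) :
    couplingWord ω hI lam τ Ψ =
      coupling ω hI lam (τ 0) (couplingWord ω hI lam (fun j => τ j.succ) Ψ) := by
  rw [couplingWord, List.ofFn_succ, List.foldr_cons, couplingWord]

lemma Nice.couplingWord_apply {T : Type} [MeasurableSpace T] {G : T → ℝ} {Ψ : T → Fock X}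
    (hG : ∀ τ, 0 ≤ G τ) (hΨ : Nice D G Ψ) {k : ℕ} {f : T → Fin k → ℝ} (hf : Measurable f) :
    Nice D (fun z => G z * timeWeight (f z)) fun z => couplingWord ω hI lam (f z) (Ψ z) := by
  induction k with
  | zero => simpa [timeWeight, couplingWord] using hΨ
  | succ k ih =>
    have hf' : Measurable fun z (j : Fin k) => f z j.succ := by fun_prop
    have h1 := Nice.coupling_apply ω hI lam (f := fun z => f z 0)
      (fun z => mul_nonneg (hG z) (timeWeight_nonneg _)) (ih hf') (by fun_prop)
    have h2 : ∀ z, G z * timeWeight (f z) =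
        G z * timeWeight (fun j : Fin k => f z j.succ) * ((1 + |f z 0|) ^ 2)⁻¹ := fun z => by
      unfold timeWeight
      rw [Fin.prod_univ_succ]; ring
    simp only [h2, couplingWord_succ]
    exact h1

/-- The Dyson series: the coefficients of the evolution operators are integrals of products of
Hamiltonians over time simplices. -/
lemma evolution_eq_integral [DecidableEq X] (k : ℕ) (b a : EReal) {Ψ : Fock X}
    (hΨ : NiceVec D Ψ) : evolution ω hI lam k b a Ψ = fun l p κ => ∫ τ : Fin k → ℝ,
      (simplexKernel a b τ : ℂ) * couplingWord ω hI lam τ Ψ l p κ := by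
  induction k generalizing b with
  | zero =>
    ext l p κ
    rw [volume_pi, Measure.pi_of_empty (fun _ : Fin 0 => volume) Fin.elim0, integral_dirac]
    simp [simplexKernel_zero, couplingWord, evolution]
  | succ k ih =>
    ext l p κ
    have hn : Nice D (fun τ : Fin k → ℝ => timeWeight τ)
        fun τ => couplingWord ω hI lam τ Ψ := by
      have := (NiceVec.family hΨ (Fin k → ℝ)).couplingWord_apply ω hI lam
        (fun _ => zero_le_one) (f := fun τ => τ) measurable_id
      simpa only [one_mul] using this
    have hn' : Nice D (fun z : ℝ × (Fin k → ℝ) => ((1 + |z.1|) ^ 2)⁻¹ * timeWeight z.2)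
        fun z => coupling ω hI lam z.1 (couplingWord ω hI lam z.2 Ψ) := by
      have := Nice.coupling_apply ω hI lam (fun z : ℝ × (Fin k → ℝ) => timeWeight_nonneg z.2)
        (hn.comp (f := Prod.snd) measurable_snd) (f := fun z => z.1) measurable_fst
      simpa only [mul_comm] using this
    have hm : ∀ c d : EReal, Measurable fun τ : Fin k → ℝ => (simplexKernel c d τ : ℂ) :=
      fun c d => measurable_simplexKernel_comp measurable_id measurable_const measurable_const
    -- the Hamiltonian commutes with the integral over the inner times
    have h1 : ∀ s : ℝ, coupling ω hI lam s (evolution ω hI lam k s a Ψ) = fun l p κ =>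
        ∫ τ : Fin k → ℝ, (simplexKernel a s τ : ℂ) *
          coupling ω hI lam s (couplingWord ω hI lam τ Ψ) l p κ := fun s => by
      rw [ih]
      exact (goodOp_coupling ω hI lam D s).integral timeWeight_nonneg hn
        (integrable_timeWeight (Fin k)) (hm a s) (fun τ => norm_simplexKernel_le_one a s τ)
    rw [evolution_succ, integral_pi_fin_succ]
    simp only [simplexKernel_succ, couplingWord_succ, Fin.cons_zero, Fin.cons_succ, h1]
    have h2 := hn'.integrable (integrable_one_add_abs.mul_prod (integrable_timeWeight (Fin k)))
      (w := fun z => ((stepKernel z.1 a b * simplexKernel a z.1 z.2 : ℝ) : ℂ))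
      (by
        push_cast
        exact (measurable_stepKernel_comp measurable_fst measurable_const measurable_const).mul
          (measurable_simplexKernel_comp measurable_snd measurable_const
            (measurable_coe_real_ereal.comp measurable_fst)))
      (fun z => by
        push_cast
        rw [norm_mul]
        exact mul_le_one₀ (norm_stepKernel_le_one _ _ _) (norm_nonneg _)
          (norm_simplexKernel_le_one _ _ _)) l p κ
    rw [Measure.volume_eq_prod, integral_prod _ h2]
    refine integral_congr_ae (Eventually.of_forall fun s => ?_)
    simp only [← integral_const_mul]
    refine integral_congr_ae (Eventually.of_forall fun τ => ?_)
    push_cast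
    ring

/-- The internal vertices are those of the first block and those of the other blocks. -/
def innerSucc {n : ℕ} (v : Fin (n + 2) → ℕ) : Fin (v 0) ⊕ Inner (fun i => v i.succ) ≃ Inner v where
  toFun := Sum.elim (fun j => ⟨0, j⟩) (fun x => ⟨x.1.succ, x.2⟩)
  invFun x := Fin.cases (motive := fun i => Fin (v i) → Fin (v 0) ⊕ Inner (fun i => v i.succ))
    (fun j => Sum.inl j) (fun i j => Sum.inr ⟨i, j⟩) x.1 x.2
  left_inv := by rintro (j | ⟨i, j⟩) <;> rfl
  right_inv := by
    rintro ⟨i, j⟩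
    refine Fin.cases (fun j => ?_) (fun i j => ?_) i j <;> rfl

/-- A product of Hamiltonians at the times `τ` and of the operators `A`, in the order of the
operator word. -/
def timeWord : (n : ℕ) → (v : Fin (n + 1) → ℕ) → (Fin n → Fock X → Fock X) → (Inner v → ℝ) →
    Fock X → Fock X
  | 0, _, _, τ, Ψ => couplingWord ω hI lam (fun j => τ ⟨0, j⟩) Ψ
  | n + 1, v, A, τ, Ψ => couplingWord ω hI lam (fun j => τ ⟨0, j⟩)
      (A 0 (timeWord n (fun i => v i.succ) (fun i => A i.succ) (fun x => τ ⟨x.1.succ, x.2⟩) Ψ))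

/-- A product of coefficients of evolution operators between the times `b` and of the operators
`A`. -/
def orderedEvolution [DecidableEq X] : (n : ℕ) → (Fin (n + 1) → ℕ) → (Fin (n + 2) → EReal) →
    (Fin n → Fock X → Fock X) → Fock X → Fock X
  | 0, v, b, _, Ψ => evolution ω hI lam (v 0) (b 0) (b 1) Ψ
  | n + 1, v, b, A, Ψ => evolution ω hI lam (v 0) (b 0) (b 1)
      (A 0 (orderedEvolution n (fun i => v i.succ) (fun i => b i.succ) (fun i => A i.succ) Ψ))

lemma timeWeight_inner_one (v : Fin 1 → ℕ) (τ : Inner v → ℝ) :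
    timeWeight τ = timeWeight fun j : Fin (v 0) => τ ⟨0, j⟩ := by
  unfold timeWeight
  rw [Fintype.prod_sigma, Fin.prod_univ_one]

lemma timeWeight_inner_succ {n : ℕ} (v : Fin (n + 2) → ℕ) (τ : Inner v → ℝ) :
    timeWeight τ = timeWeight (fun x : Inner (fun i => v i.succ) => τ ⟨x.1.succ, x.2⟩) *
      timeWeight fun j : Fin (v 0) => τ ⟨0, j⟩ := by
  unfold timeWeight
  rw [Fintype.prod_sigma, Fin.prod_univ_succ, mul_comm, Fintype.prod_sigma]

lemma Nice.timeWord_apply {T : Type} [MeasurableSpace T] {G : T → ℝ} {Ψ : T → Fock X}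
    (hG : ∀ τ, 0 ≤ G τ) (n : ℕ) (v : Fin (n + 1) → ℕ) (A : Fin n → Fock X → Fock X)
    (D : Fin (n + 1) → Finset X) (hA : ∀ i, GoodOp (D i.succ) (D i.castSucc) (A i))
    (hΨ : Nice (D (Fin.last n)) G Ψ) {f : T → Inner v → ℝ} (hf : Measurable f) :
    Nice (D 0) (fun z => G z * timeWeight (f z)) fun z => timeWord ω hI lam n v A (f z) (Ψ z) := by
  induction n with
  | zero =>
    simp only [timeWeight_inner_one, timeWord]
    exact Nice.couplingWord_apply ω hI lam hG hΨ (by fun_prop)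
  | succ n ih =>
    have h1 := ih (fun i => v i.succ) (fun i => A i.succ) (fun i => D i.succ)
      (fun i => hA i.succ) hΨ (f := fun z x => f z ⟨x.1.succ, x.2⟩) (by fun_prop)
    have h2 := (hA 0).nice (fun z => mul_nonneg (hG z) (timeWeight_nonneg _)) h1
    have h3 := Nice.couplingWord_apply ω hI lam (f := fun z (j : Fin (v 0)) => f z ⟨0, j⟩)
      (fun z => mul_nonneg (hG z) (timeWeight_nonneg _)) h2 (by fun_prop)
    simp only [timeWeight_inner_succ, timeWord, ← mul_assoc]
    exact h3

lemma niceVec_orderedEvolution [DecidableEq X] (n : ℕ) (v : Fin (n + 1) → ℕ)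
    (b : Fin (n + 2) → EReal) (A : Fin n → Fock X → Fock X) (D : Fin (n + 1) → Finset X)
    (hA : ∀ i, GoodOp (D i.succ) (D i.castSucc) (A i)) {Ψ : Fock X}
    (hΨ : NiceVec (D (Fin.last n)) Ψ) :
    NiceVec (D 0) (orderedEvolution ω hI lam n v b A Ψ) := by
  induction n with
  | zero => exact (goodOp_evolution ω hI lam _ _ _ _).nice (fun _ => zero_le_one) hΨ
  | succ n ih =>
    exact (goodOp_evolution ω hI lam _ _ _ _).nice (fun _ => zero_le_one)
      ((hA 0).nice (fun _ => zero_le_one) (ih (fun i => v i.succ) (fun i => b i.succ)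
        (fun i => A i.succ) (fun i => D i.succ) (fun i => hA i.succ) hΨ))

lemma measurable_prod_simplexKernel {n : ℕ} (v : Fin (n + 1) → ℕ) (b : Fin (n + 2) → EReal) :
    Measurable fun τ : Inner v → ℝ =>
      ∏ i, (simplexKernel (b i.succ) (b i.castSucc) (fun j => τ ⟨i, j⟩) : ℂ) :=
  Finset.measurable_prod _ fun i _ => measurable_simplexKernel_comp (by fun_prop)
    measurable_const measurable_const

lemma norm_prod_simplexKernel_le_one {n : ℕ} (v : Fin (n + 1) → ℕ) (b : Fin (n + 2) → EReal)
    (τ : Inner v → ℝ) :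
    ‖∏ i, (simplexKernel (b i.succ) (b i.castSucc) (fun j => τ ⟨i, j⟩) : ℂ)‖ ≤ 1 := by
  rw [norm_prod]
  exact Finset.prod_le_one (fun i _ => norm_nonneg _) fun i _ => norm_simplexKernel_le_one _ _ _

/-- Products of evolution operators and of good operators are integrals over time simplices. -/
lemma orderedEvolution_eq_integral [DecidableEq X] (n : ℕ) (v : Fin (n + 1) → ℕ)
    (b : Fin (n + 2) → EReal) (A : Fin n → Fock X → Fock X) (D : Fin (n + 1) → Finset X)
    (hA : ∀ i, GoodOp (D i.succ) (D i.castSucc) (A i)) {Ψ : Fock X}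
    (hΨ : NiceVec (D (Fin.last n)) Ψ) :
    orderedEvolution ω hI lam n v b A Ψ = fun l p κ => ∫ τ : Inner v → ℝ,
      (∏ i, (simplexKernel (b i.succ) (b i.castSucc) (fun j => τ ⟨i, j⟩) : ℂ)) *
        timeWord ω hI lam n v A τ Ψ l p κ := by
  induction n with
  | zero =>
    ext l p κ
    have : Subsingleton (Fin (0 + 1)) := inferInstanceAs (Subsingleton (Fin 1))
    let e : Fin (v 0) ≃ Inner v :=
      ⟨fun j => ⟨0, j⟩, fun x => Fin.cast (by rw [Subsingleton.elim x.1 0]) x.2, fun _ => rfl, by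
        rintro ⟨i, j⟩
        obtain rfl : i = 0 := Subsingleton.elim i 0
        rfl⟩
    rw [orderedEvolution, evolution_eq_integral ω hI lam (v 0) (b 0) (b 1) hΨ,
      integral_pi_equiv e]
    refine integral_congr_ae (Eventually.of_forall fun τ => ?_)
    simp only [timeWord]
    have h := Fin.prod_univ_one fun i : Fin 1 =>
      (simplexKernel (b i.succ) (b i.castSucc) (fun j => (τ ∘ e.symm) ⟨i, j⟩) : ℂ)
    exact congrArg (fun z : ℂ => z * _) h.symm
  | succ n ih =>
    ext l p κ
    have hΨ' : Nice (D (Fin.last (n + 1))) (fun _ : Inner (fun i => v i.succ) → ℝ => 1)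
        fun _ => Ψ := NiceVec.family hΨ _
    have h1 := Nice.timeWord_apply ω hI lam (fun _ => zero_le_one) n (fun i => v i.succ)
      (fun i => A i.succ) (fun i => D i.succ) (fun i => hA i.succ) hΨ' (f := fun τ => τ)
      measurable_id
    simp only [one_mul] at h1
    have h2 := (hA 0).nice timeWeight_nonneg h1
    have hw := measurable_prod_simplexKernel (fun i => v i.succ) (fun i => b i.succ)
    have hw1 := norm_prod_simplexKernel_le_one (fun i => v i.succ) (fun i => b i.succ)
    have hi := integrable_timeWeight (Inner fun i : Fin (n + 1) => v i.succ)
    rw [orderedEvolution, ih (fun i => v i.succ) (fun i => b i.succ) (fun i => A i.succ)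
      (fun i => D i.succ) (fun i => hA i.succ) hΨ,
      (hA 0).integral timeWeight_nonneg h1 hi hw hw1,
      (goodOp_evolution ω hI lam _ _ _ _).integral timeWeight_nonneg h2 hi hw hw1,
      integral_pi_sum (innerSucc v)]
    have h3 : Nice (D 0) (fun z : (Fin (v 0) → ℝ) × (Inner (fun i => v i.succ) → ℝ) =>
        timeWeight z.1 * timeWeight z.2) fun z => couplingWord ω hI lam z.1 (A 0 (timeWord ω hI lam
          n (fun i => v i.succ) (fun i => A i.succ) z.2 Ψ)) := by
      have := Nice.couplingWord_apply ω hI lam (f := fun z : (Fin (v 0) → ℝ) ×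
        (Inner (fun i => v i.succ) → ℝ) => z.1) (fun z => timeWeight_nonneg z.2)
        (h2.comp (f := Prod.snd) measurable_snd) measurable_fst
      simp only [mul_comm (timeWeight (Prod.snd _))] at this
      exact this
    -- joint integrability in the times of block `0` and of the other blocks
    have h4 := h3.integrable ((integrable_timeWeight (Fin (v 0))).mul_prod hi)
      (w := fun z => (simplexKernel (b 1) (b 0) z.1 : ℂ) *
        ∏ i, (simplexKernel (b i.succ.succ) (b i.castSucc.succ) (fun j => z.2 ⟨i, j⟩) : ℂ))
      ((measurable_simplexKernel_comp measurable_fst measurable_const measurable_const).mul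
        (hw.comp measurable_snd))
      (fun z => by
        rw [norm_mul]
        exact mul_le_one₀ (norm_simplexKernel_le_one _ _ _) (norm_nonneg _) (hw1 z.2)) l p κ
    have h5 : ∀ τ, evolution ω hI lam (v 0) (b 0) (b 1) (A 0 (timeWord ω hI lam
          n (fun i => v i.succ) (fun i => A i.succ) τ Ψ)) l p κ = _ := fun τ =>
      congrFun (congrFun (congrFun (evolution_eq_integral ω hI lam (v 0) (b 0) (b 1)
        (h2.eval τ)) l) p) κ
    simp only [h5, ← integral_const_mul]
    rw [Measure.volume_eq_prod]
    refine Eq.trans ?_ ((integral_prod_symm _ h4).symm.trans ?_)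
    · refine integral_congr_ae (Eventually.of_forall fun τ' => ?_)
      refine integral_congr_ae (Eventually.of_forall fun τ => ?_)
      simp only
      ring
    · refine integral_congr_ae (Eventually.of_forall fun z => ?_)
      simp only [Fin.prod_univ_succ, timeWord]
      rfl

/-- The word of the blocks of internal vertices, separated by the external vertices `ext`. -/
lemma foldr_word {Z : Type} (F : Z → Fock X → Fock X) {n : ℕ} (v : Fin (n + 1) → ℕ)
    (ext : Fin n → List Z) (τ : Inner v → ℝ) (Ψ : Fock X) :
    ((List.ofFn fun j : Fin (v 0) => (Sum.inr ⟨0, j⟩ : Z ⊕ Inner v)) ++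
      (List.ofFn fun i : Fin n => (ext i).map Sum.inl ++
        List.ofFn fun j : Fin (v i.succ) => (Sum.inr ⟨i.succ, j⟩ : Z ⊕ Inner v)).flatten).foldr
      (Sum.elim F fun x => coupling ω hI lam (τ x)) Ψ =
    timeWord ω hI lam n v (fun i => fun Ψ => (ext i).foldr F Ψ) τ Ψ := by
  have hblock : ∀ {n : ℕ} (v : Fin (n + 1) → ℕ) (τ : Inner v → ℝ) (Ψ : Fock X),
      (List.ofFn fun j : Fin (v 0) => (Sum.inr ⟨0, j⟩ : Z ⊕ Inner v)).foldr
        (Sum.elim F fun x => coupling ω hI lam (τ x)) Ψ =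
      couplingWord ω hI lam (fun j => τ ⟨0, j⟩) Ψ := fun v τ Ψ => by
    have : (List.ofFn fun j : Fin (v 0) => τ ⟨0, j⟩) = (List.ofFn fun j : Fin (v 0) =>
        (Sum.inr ⟨0, j⟩ : Z ⊕ Inner v)).map (Sum.elim (fun _ => 0) τ) := by
      rw [List.map_ofFn]; rfl
    rw [couplingWord, this, List.foldr_map]
    refine List.foldr_ext _ _ _ fun a ha Φ => ?_
    obtain ⟨j, rfl⟩ := List.mem_ofFn.1 ha
    rfl
  induction n with
  | zero =>
    simp only [List.ofFn_zero, List.flatten_nil, List.append_nil, timeWord]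
    exact hblock v τ Ψ
  | succ n ih =>
    rw [List.foldr_append, hblock, timeWord, List.ofFn_succ, List.flatten_cons, List.append_assoc,
      List.foldr_append, List.foldr_map]
    refine congrArg (couplingWord ω hI lam fun j => τ ⟨0, j⟩) ?_
    rw [← ih (fun i => v i.succ) (fun i => ext i.succ)]
    -- the remaining word is the word of the shifted block sizes, relabelled
    have hmap : (List.ofFn fun j : Fin (v (Fin.succ 0)) => (Sum.inr ⟨Fin.succ 0, j⟩ : Z ⊕ Inner v)) ++
        (List.ofFn fun i : Fin n => (ext i.succ).map Sum.inl ++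
          List.ofFn fun j : Fin (v i.succ.succ) => (Sum.inr ⟨i.succ.succ, j⟩ : Z ⊕ Inner v)).flatten =
        ((List.ofFn fun j : Fin (v (Fin.succ 0)) =>
          (Sum.inr ⟨0, j⟩ : Z ⊕ Inner (fun i => v i.succ))) ++
        (List.ofFn fun i : Fin n => (ext i.succ).map Sum.inl ++
          List.ofFn fun j : Fin (v i.succ.succ) =>
            (Sum.inr ⟨i.succ, j⟩ : Z ⊕ Inner (fun i => v i.succ))).flatten).map
          (Sum.map id fun x : Inner (fun i => v i.succ) => (⟨x.1.succ, x.2⟩ : Inner v)) := by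
      simp only [List.map_append, List.map_ofFn, List.map_flatten, List.map_map,
        Function.comp_def, Sum.map_inr, Sum.map_inl, id]
    rw [hmap, List.foldr_map]
    refine congrArg ((ext 0).foldr F) (List.foldr_ext _ _ _ fun a _ Φ => ?_)
    cases a <;> rfl

end Words

/-! ### Products of Schwartz functions in separate variables -/

section Tensor

variable {E F : Type*} [NormedAddCommGroup E] [NormedSpace ℝ E] [NormedAddCommGroup F]
  [NormedSpace ℝ F]

/-- A product of functions each of which decays rapidly in its own variable is a Schwartz function
of all the variables. -/
lemma exists_schwartz_prod {ι : Type} [Fintype ι] (h : ι → E → ℂ) (w : ι → E → ℝ)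
    (hsm : ∀ j, ContDiff ℝ (⊤ : ℕ∞) (h j)) (hw : ∀ j x, 0 ≤ w j x)
    (hdec : ∀ j k n, ∃ C : ℝ, ∀ x, w j x ^ k * ‖iteratedFDeriv ℝ n (h j) x‖ ≤ C)
    (hnorm : ∀ x, ‖x‖ ≤ ∏ j, w j x) : ∃ Φ : 𝓢(E, ℂ), ∀ x, Φ x = ∏ j, h j x := by
  classical
  choose C hC using hdec
  refine ⟨⟨fun x => ∏ j, h j x, contDiff_prod fun j _ => hsm j, fun k n => ?_⟩, fun x => rfl⟩
  refine ⟨∑ p ∈ (Finset.univ : Finset ι).sym n, ((p : Multiset ι).countPerms : ℝ) *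
    ∏ j, C j k ((p : Multiset ι).count j), fun x => ?_⟩
  -- the Leibniz rule
  have h1 := norm_iteratedFDeriv_prod_le (𝕜 := ℝ) (u := Finset.univ) (f := h)
    (fun i _ => hsm i) (x := x) (n := n) (by exact_mod_cast le_top)
  calc ‖x‖ ^ k * ‖iteratedFDeriv ℝ n (fun x => ∏ j, h j x) x‖
      ≤ (∏ j, w j x) ^ k * ∑ p ∈ (Finset.univ : Finset ι).sym n,
        ((p : Multiset ι).countPerms : ℝ) *
          ∏ j, ‖iteratedFDeriv ℝ ((p : Multiset ι).count j) (h j) x‖ := by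
        gcongr
        · exact pow_nonneg (Finset.prod_nonneg fun j _ => hw j x) k
        · exact hnorm x
    _ = ∑ p ∈ (Finset.univ : Finset ι).sym n, ((p : Multiset ι).countPerms : ℝ) *
          ∏ j, w j x ^ k * ‖iteratedFDeriv ℝ ((p : Multiset ι).count j) (h j) x‖ := by
        rw [Finset.mul_sum]
        refine Finset.sum_congr rfl fun p _ => ?_
        rw [Finset.prod_mul_distrib, Finset.prod_pow]
        ring
    _ ≤ _ := by
        refine Finset.sum_le_sum fun p _ => mul_le_mul_of_nonneg_left ?_ (Nat.cast_nonneg _)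
        exact Finset.prod_le_prod (fun j _ => mul_nonneg (pow_nonneg (hw j x) _) (norm_nonneg _))
          fun j _ => hC j k _ x

lemma schwartz_comp_decay (g : 𝓢(F, ℂ)) (L : E →L[ℝ] F) (k n : ℕ) :
    ∃ C : ℝ, ∀ x, (1 + ‖L x‖) ^ k * ‖iteratedFDeriv ℝ n (fun x => g (L x)) x‖ ≤ C := by
  refine ⟨2 ^ k * ((Finset.Iic (k, n)).sup (schwartzSeminormFamily ℂ F ℂ)) g * ‖L‖ ^ n,
    fun x => ?_⟩
  have h1 : iteratedFDeriv ℝ n (fun x => g (L x)) x =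
      (iteratedFDeriv ℝ n g (L x)).compContinuousLinearMap fun _ => L :=
    L.iteratedFDeriv_comp_right (g.smooth ⊤) x (by exact_mod_cast le_top)
  rw [h1]
  calc _ ≤ (1 + ‖L x‖) ^ k * (‖iteratedFDeriv ℝ n g (L x)‖ * ∏ _i : Fin n, ‖L‖) := by
        gcongr
        exact ContinuousMultilinearMap.norm_compContinuousLinearMap_le _ _
    _ = (1 + ‖L x‖) ^ k * ‖iteratedFDeriv ℝ n g (L x)‖ * ‖L‖ ^ n := by simp [mul_assoc]
    _ ≤ _ := mul_le_mul_of_nonneg_right (schwartz_decay g k n n le_rfl _) (by positivity)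

/-- The test function `f ⊗ lam ⊗ ⋯ ⊗ lam` is a Schwartz function. -/
lemma exists_schwartz_tensorTest {m n : ℕ} (v : Fin (n + 1) → ℕ) (f : 𝓢(Fin m → Mom, ℂ))
    (lam : 𝓢(ℝ × Mom, ℂ)) : ∃ Φ : 𝓢(Args m v, ℂ), ⇑Φ = tensorTest v f lam := by
  let Lf : Args m v →L[ℝ] (Fin m → Mom) := ContinuousLinearMap.fst ℝ _ _
  let Ly : Inner v → Args m v →L[ℝ] ℝ × Mom := fun y =>
    (ContinuousLinearMap.proj y).comp (ContinuousLinearMap.snd ℝ (Fin m → Mom) (Inner v → ℝ × Mom))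
  let h : Option (Inner v) → Args m v → ℂ := fun o x => o.elim (f (Lf x)) fun y => lam (Ly y x)
  let w : Option (Inner v) → Args m v → ℝ := fun o x => o.elim (1 + ‖Lf x‖) fun y => 1 + ‖Ly y x‖
  have hsm : ∀ o, ContDiff ℝ (⊤ : ℕ∞) (h o) := by
    rintro (_ | y)
    · exact (f.smooth ⊤).comp Lf.contDiff
    · exact (lam.smooth ⊤).comp (Ly y).contDiff
  have hw : ∀ o x, 0 ≤ w o x := by
    rintro (_ | y) x
    · exact add_nonneg zero_le_one (norm_nonneg _)
    · exact add_nonneg zero_le_one (norm_nonneg _)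
  have hdec : ∀ o k n, ∃ C : ℝ, ∀ x, w o x ^ k * ‖iteratedFDeriv ℝ n (h o) x‖ ≤ C := by
    rintro (_ | y) k n
    · exact schwartz_comp_decay f Lf k n
    · exact schwartz_comp_decay lam (Ly y) k n
  have hnorm : ∀ x, ‖x‖ ≤ ∏ o, w o x := by
    intro x
    rw [Fintype.prod_option]
    have h1 : ∀ y : Inner v, 1 ≤ 1 + ‖Ly y x‖ := fun y => by simp
    have h2 : 1 ≤ ∏ y : Inner v, (1 + ‖Ly y x‖) :=
      Finset.one_le_prod (f := fun y => 1 + ‖Ly y x‖) fun y _ => h1 y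
    change ‖x‖ ≤ (1 + ‖Lf x‖) * ∏ y : Inner v, (1 + ‖Ly y x‖)
    refine max_le ?_ ?_
    · calc ‖x.1‖ ≤ (1 + ‖Lf x‖) * 1 := by rw [mul_one]; exact le_add_of_nonneg_left zero_le_one
        _ ≤ _ := by gcongr
    · refine (pi_norm_le_iff_of_nonneg (by positivity)).2 fun y => ?_
      calc ‖x.2 y‖ ≤ 1 * (1 + ‖Ly y x‖) := by
            rw [one_mul]; exact le_add_of_nonneg_left zero_le_one
        _ ≤ (1 + ‖Lf x‖) * ∏ y : Inner v, (1 + ‖Ly y x‖) := by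
            gcongr
            · simp
            · rw [← Finset.mul_prod_erase _ _ (Finset.mem_univ y)]
              exact le_mul_of_one_le_right (by positivity)
                (Finset.one_le_prod (f := fun y => 1 + ‖Ly y x‖) fun y _ => h1 y)
  obtain ⟨Φ, hΦ⟩ := exists_schwartz_prod h w hsm hw hdec hnorm
  refine ⟨Φ, funext fun x => ?_⟩
  rw [hΦ, Fintype.prod_option]
  rfl

/-- The constant `1`, as a Schwartz function on the space of no variables. -/
def schwartzOne : 𝓢(Fin 0 → Mom, ℂ) where
  toFun _ := 1
  smooth' := contDiff_const
  decay' k n := ⟨‖(0 : Fin 0 → Mom)‖ ^ k * ‖iteratedFDeriv ℝ n (fun _ : Fin 0 → Mom => (1 : ℂ)) 0‖,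
    fun x => by rw [Subsingleton.elim x 0]⟩

/-- The vacuum, smeared with a Schwartz function, decays in all slots. -/
lemma niceVec_vac {m : ℕ} (f : 𝓢(Fin m → Mom, ℂ)) :
    NiceVec (Finset.univ : Finset (Fin m)) (vac f) := by
  constructor
  · rintro (_ | l)
    · exact f.continuous.measurable.comp (by fun_prop : Measurable
        fun z : Unit × (Fin 0 → Mom) × (Fin m → Mom) => z.2.2)
    · exact measurable_const
  · rintro (_ | l)
    · refine ⟨2 ^ (4 * m) * ((Finset.Iic (4 * m, 0)).sup
        (schwartzSeminormFamily ℂ (Fin m → Mom) ℂ)) f, by positivity, fun _ p κ => ?_⟩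
      have h1 := schwartz_decay f (4 * m) 0 0 le_rfl κ
      rw [norm_iteratedFDeriv_zero] at h1
      refine le_trans ?_ (mul_le_mul_of_nonneg_right h1 (mul_nonneg zero_le_one
        (slotWeight_nonneg _ _)))
      have h2 : (1 : ℝ) ≤ (1 + ‖κ‖) ^ (4 * m) * slotWeight Finset.univ κ := by
        unfold slotWeight
        rw [Finset.prod_inv_distrib, Finset.prod_pow, ← div_eq_mul_inv,
          one_le_div (by positivity), mul_comm, pow_mul]
        refine pow_le_pow_left₀ (by positivity) ?_ 4
        calc ∏ j, (1 + ‖κ j‖) ≤ ∏ _j : Fin m, (1 + ‖κ‖) :=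
              Finset.prod_le_prod (fun j _ => by positivity) fun j _ => by
                gcongr
                exact norm_le_pi_norm κ j
          _ = _ := by simp
      calc ‖vac (⇑f) 0 p κ‖ = 1 * ‖f κ‖ := (one_mul _).symm
        _ ≤ ((1 + ‖κ‖) ^ (4 * m) * slotWeight Finset.univ κ) * ‖f κ‖ :=
          mul_le_mul_of_nonneg_right h2 (norm_nonneg _)
        _ = _ := by ring
    · refine ⟨0, le_rfl, fun _ p κ => ?_⟩
      simp [vac]

end Tensor

/-! ### Words of Hamiltonians and words of interaction densities -/

section TensorTestFunction

variable (ω : DispersionFunction) (hI : AdmissibleInteraction) (lam : 𝓢(ℝ × Mom, ℂ)) {m n : ℕ}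
  {v : Fin (n + 1) → ℕ} (α : Fin m → FieldPart) (s : Fin m → ℝ)

/-- The field operators in front of the `(i + 1)`-st block of internal vertices. -/
def fieldAt (i : ℕ) (Ψ : Fock (Fin m)) : Fock (Fin m) :=
  (externalAt m i).foldr (fun e => freeField ω (α e) (s e) e) Ψ

open Classical in
/-- For test functions `f ⊗ lam ⊗ ⋯ ⊗ lam`, the words of interaction densities are words of
Hamiltonians; the slots of the internal vertices that do not occur are spectators. -/
lemma foldr_vertexOperator_tensor (f : (Fin m → Mom) → ℂ) (τ : Inner v → ℝ)
    (W : List (Vertex m v)) (hW : W.Nodup) :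
    W.foldr (vertexOperator ω hI α s τ)
      (vac fun κ => f (fun i => κ (Sum.inl i)) * ∏ y, lam (τ y, κ (Sum.inr y))) =
    fun l P κ => (∏ y with Sum.inr y ∉ W, lam (τ y, κ (Sum.inr y))) *
      W.foldr (Sum.elim (fun e => freeField ω (α e) (s e) e) fun x => coupling ω hI lam (τ x))
        (vac f) l P (fun i => κ (Sum.inl i)) := by
  induction W with
  | nil =>
    ext l P κ
    cases l
    · simp [vac, mul_comm]
    · simp [vac]
  | cons a W ih =>
    obtain ⟨ha, hW'⟩ := List.nodup_cons.1 hW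
    rw [List.foldr_cons, ih hW']
    rcases a with i | x
    · simp only [vertexOperator, List.foldr_cons, Sum.elim_inl, List.mem_cons, reduceCtorEq,
        false_or]
      rw [freeField_eq_kernelOp ω _ _ _ le_rfl, kernelOp_eq_slotOp,
        freeField_eq_kernelOp ω _ _ _ le_rfl, kernelOp_eq_slotOp]
      refine slotOp_pullback 1 (g := fun κ => ∏ y with Sum.inr y ∉ W, lam (τ y, κ (Sum.inr y)))
        (r := fun κ i => κ (Sum.inl i)) (fun l' l p' p κ => ?_) (fun κ Q => ?_) _
      · rw [mul_comm]
        simp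
      · ext1 j
        by_cases h : j = i
        · subst h; simp
        · rw [Function.update_of_ne h, Function.update_of_ne (by simpa using h)]
    · simp only [vertexOperator, List.foldr_cons, Sum.elim_inr, List.mem_cons, Sum.inr.injEq,
        not_or]
      refine momDensity_mul_cutoff ω hI lam (τ x) (Sum.inr x) _ (fun κ i => κ (Sum.inl i))
        (fun κ k => by ext1 j; simp) (g := fun κ => ∏ y with Sum.inr y ∉ W, lam (τ y, κ (Sum.inr y)))
        (g' := fun κ => ∏ y with ¬y = x ∧ Sum.inr y ∉ W, lam (τ y, κ (Sum.inr y))) fun κ k => ?_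
      -- the factor of the slot `x` leaves the product, as `x` is consumed
      have hx : x ∈ Finset.univ.filter fun y : Inner v => Sum.inr y ∉ W := by simpa using ha
      have he : (Finset.univ.filter fun y : Inner v => ¬y = x ∧ Sum.inr y ∉ W) =
          (Finset.univ.filter fun y : Inner v => Sum.inr y ∉ W).erase x := by
        ext y; simp
      rw [← Finset.mul_prod_erase _ _ hx, he, Function.update_self, mul_comm]
      congr 1
      refine Finset.prod_congr rfl fun y hy => ?_
      rw [Function.update_of_ne (by simpa using Finset.ne_of_mem_erase hy)]

/-- The field number `i` consumes the decay in the slot `i`. -/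
lemma goodOp_fieldAt (i : Fin n) :
    GoodOp (Finset.univ.filter fun x : Fin m => (x : ℕ) < (i.succ : ℕ))
      (Finset.univ.filter fun x : Fin m => (x : ℕ) < (i.castSucc : ℕ)) (fieldAt ω α s i) := by
  unfold fieldAt externalAt
  by_cases h : (i : ℕ) < m
  · have he : (Finset.univ.filter fun x : Fin m => (x : ℕ) < (i.castSucc : ℕ)) =
        (Finset.univ.filter fun x : Fin m => (x : ℕ) < (i.succ : ℕ)).erase ⟨i, h⟩ := by
      ext x
      simp only [Finset.mem_filter, Finset.mem_univ, true_and, Finset.mem_erase, Fin.val_castSucc,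
        Fin.val_succ, ne_eq, Fin.ext_iff]
      omega
    rw [he]
    simp only [dif_pos h, List.foldr_cons, List.foldr_nil]
    exact goodOp_freeField ω _ _ _ _ (by simp)
  · have he : (Finset.univ.filter fun x : Fin m => (x : ℕ) < (i.castSucc : ℕ)) =
        (Finset.univ.filter fun x : Fin m => (x : ℕ) < (i.succ : ℕ)) := by
      ext x
      have := x.2
      simp only [Finset.mem_filter, Finset.mem_univ, true_and, Fin.val_castSucc, Fin.val_succ]
      omega
    rw [he]
    simp only [dif_neg h, List.foldr_nil]
    exact GoodOp.id _

lemma univ_filter_lt_last (hmn : m ≤ n) :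
    (Finset.univ.filter fun x : Fin m => (x : ℕ) < (Fin.last n : ℕ)) = Finset.univ := by
  ext x
  have := x.2
  simp only [Finset.mem_filter, Finset.mem_univ, true_and, Fin.val_last, iff_true]
  omega

/-- The vacuum expectation values of products of evolution operators and free fields are the
coefficient distributions, evaluated on `f ⊗ lam ⊗ ⋯ ⊗ lam`. -/
lemma vacPairing_orderedEvolution (hmn : m ≤ n) (f : 𝓢(Fin m → Mom, ℂ)) (t : Fin n → ℝ) :
    vacPairing (orderedEvolution ω hI lam n v (boundaryTime t) (fun i => fieldAt ω α s i) (vac f)) =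
      partialCoefficient ω hI α s v (tensorTest v f lam) t := by
  classical
  rw [orderedEvolution_eq_integral ω hI lam n v (boundaryTime t) (fun i => fieldAt ω α s i)
    (fun i => Finset.univ.filter fun x : Fin m => (x : ℕ) < (i : ℕ))
    (fun i => goodOp_fieldAt ω α s i) (by
      simp only [univ_filter_lt_last hmn]; exact niceVec_vac f), vacPairing, partialCoefficient]
  refine integral_congr_ae (Eventually.of_forall fun τ => ?_)
  simp only [timeFactor, Complex.ofReal_prod, vacPairing]
  congr 1
  simp only [tensorTest]
  rw [foldr_vertexOperator_tensor ω hI lam α s f τ (partialWord m v)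
    ((pairwise_partialWord v).imp fun {a b} h hab => by rw [hab] at h; exact lt_irrefl _ h)]
  have hempty : (Finset.univ.filter fun y : Inner v => Sum.inr y ∉ partialWord m v) = ∅ := by
    simp [mem_partialWord hmn v]
  simp only
  rw [hempty, Finset.prod_empty, one_mul, partialWord, foldr_word]
  rfl

end TensorTestFunction

/-! ### Formal power series of operators -/

section Series

variable {X : Type}

lemma sum_antidiagonal_assoc {M : Type*} [AddCommMonoid M] (f : ℕ → ℕ → ℕ → M) (V : ℕ) :
    ∑ xy ∈ Finset.HasAntidiagonal.antidiagonal V,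
      ∑ jk ∈ Finset.HasAntidiagonal.antidiagonal xy.2, f xy.1 jk.1 jk.2 =
    ∑ zk ∈ Finset.HasAntidiagonal.antidiagonal V,
      ∑ xj ∈ Finset.HasAntidiagonal.antidiagonal zk.1, f xj.1 xj.2 zk.2 := by
  rw [Finset.sum_sigma', Finset.sum_sigma']
  refine Finset.sum_bij' (fun a _ => ⟨(a.1.1 + a.2.1, a.2.2), (a.1.1, a.2.1)⟩)
    (fun a _ => ⟨(a.2.1, a.2.2 + a.1.2), (a.2.2, a.1.2)⟩) ?_ ?_ ?_ ?_ ?_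
  · rintro ⟨⟨x, y⟩, ⟨j, k⟩⟩ h
    simp only [Finset.mem_sigma, Finset.HasAntidiagonal.mem_antidiagonal, and_true] at h ⊢
    omega
  · rintro ⟨⟨x, y⟩, ⟨j, k⟩⟩ h
    simp only [Finset.mem_sigma, Finset.HasAntidiagonal.mem_antidiagonal, and_true] at h ⊢
    omega
  · rintro ⟨⟨x, y⟩, ⟨j, k⟩⟩ h
    simp only [Finset.mem_sigma, Finset.HasAntidiagonal.mem_antidiagonal] at h ⊢
    obtain ⟨h1, rfl⟩ := h
    rfl
  · rintro ⟨⟨x, y⟩, ⟨j, k⟩⟩ h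
    simp only [Finset.mem_sigma, Finset.HasAntidiagonal.mem_antidiagonal] at h ⊢
    obtain ⟨h1, rfl⟩ := h
    rfl
  · intro a _
    rfl

/-- The action of a series of operators on a series of vectors. -/
def OpSeries.act (A : OpSeries X) (R : ℕ → Fock X) : ℕ → Fock X := fun V =>
  ∑ ab ∈ Finset.HasAntidiagonal.antidiagonal V, A ab.1 (R ab.2)

lemma OpSeries.act_comp {D D' : Finset X} {A B : OpSeries X} {R : ℕ → Fock X}
    (hA : ∀ a, GoodOp D D' (A a)) (hB : ∀ b c, NiceVec D (B b (R c))) :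
    (A.comp B).act R = A.act (B.act R) := by
  ext1 V
  unfold OpSeries.act OpSeries.comp
  have h : ∀ ab : ℕ × ℕ, A ab.1 (∑ jk ∈ Finset.HasAntidiagonal.antidiagonal ab.2, B jk.1 (R jk.2)) =
      ∑ jk ∈ Finset.HasAntidiagonal.antidiagonal ab.2, A ab.1 (B jk.1 (R jk.2)) := fun ab =>
    (hA ab.1).sum _ fun jk _ => hB jk.1 jk.2
  simp only [h]
  exact (sum_antidiagonal_assoc (fun x j k => A x (B j (R k))) V).symm

lemma OpSeries.const_comp (A : Fock X → Fock X) (B : OpSeries X) :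
    (OpSeries.const A).comp B = fun V Ψ => A (B V Ψ) := by
  ext1 V
  ext1 Ψ
  unfold OpSeries.comp OpSeries.const
  rw [Finset.sum_eq_single (0, V)]
  · rw [if_pos rfl]
  · rintro ⟨a, b⟩ h hab
    rw [Finset.HasAntidiagonal.mem_antidiagonal] at h
    rw [if_neg]
    rintro rfl
    exact hab (by simp_all)
  · intro h
    exact absurd (Finset.HasAntidiagonal.mem_antidiagonal.2 (zero_add V)) h

lemma NiceVec.act {D D' : Finset X} {A : OpSeries X} {R : ℕ → Fock X}
    (hA : ∀ a, GoodOp D D' (A a)) (hR : ∀ c, NiceVec D (R c)) (V : ℕ) :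
    NiceVec D' (A.act R V) :=
  NiceVec.sum _ fun ab _ => (hA ab.1).nice (fun _ => zero_le_one) (hR ab.2)

lemma sum_antidiagonalTuple_succ {M : Type*} [AddCommMonoid M] (k V : ℕ)
    (F : (Fin (k + 1) → ℕ) → M) : ∑ v ∈ Finset.Nat.antidiagonalTuple (k + 1) V, F v =
      ∑ ab ∈ Finset.HasAntidiagonal.antidiagonal V,
        ∑ v ∈ Finset.Nat.antidiagonalTuple k ab.2, F (Fin.cons ab.1 v) := by
  rw [Finset.sum_sigma']
  symm
  refine Finset.sum_bij' (fun a _ => Fin.cons a.1.1 a.2)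
    (fun v _ => ⟨(v 0, ∑ i : Fin k, v i.succ), fun i => v i.succ⟩) ?_ ?_ ?_ ?_ ?_
  · rintro ⟨⟨x, y⟩, v⟩ h
    simp only [Finset.mem_sigma, Finset.HasAntidiagonal.mem_antidiagonal, Finset.Nat.mem_antidiagonalTuple] at h ⊢
    rw [Fin.sum_univ_succ]
    simp only [Fin.cons_zero, Fin.cons_succ]
    omega
  · intro v h
    simp only [Finset.mem_sigma, Finset.HasAntidiagonal.mem_antidiagonal, Finset.Nat.mem_antidiagonalTuple] at h ⊢
    rw [Fin.sum_univ_succ] at h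
    exact ⟨h, trivial⟩
  · rintro ⟨⟨x, y⟩, v⟩ h
    simp only [Finset.mem_sigma, Finset.HasAntidiagonal.mem_antidiagonal, Finset.Nat.mem_antidiagonalTuple] at h
    obtain ⟨h1, rfl⟩ := h
    simp
  · intro v _
    exact Fin.cons_self_tail v
  · intro a _
    rfl

end Series

section WightmanSeries

variable {X : Type} [DecidableEq X] (ω : DispersionFunction) (hI : AdmissibleInteraction)
  (lam : 𝓢(ℝ × Mom, ℂ))

/-- The evolution operator as a formal power series. -/
def evolutionSeries (b a : EReal) : OpSeries X := fun V => evolution ω hI lam V b a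

/-- The composition law of the evolution operators, as formal power series. -/
lemma act_evolutionSeries {D : Finset X} (c b a : EReal) {R : ℕ → Fock X}
    (hR : ∀ V, NiceVec D (R V)) :
    (evolutionSeries ω hI lam c b).act ((evolutionSeries ω hI lam b a).act R) =
      (evolutionSeries ω hI lam c a).act R := by
  rw [← OpSeries.act_comp (A := evolutionSeries ω hI lam c b) (B := evolutionSeries ω hI lam b a)
    (R := R) (D := D) (D' := D) (fun k => goodOp_evolution ω hI lam D k c b) fun k j => (goodOp_evolution ω hI lam D k b a).nice (fun _ => zero_le_one) (hR j)]
  ext1 V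
  exact Finset.sum_congr rfl fun jk _ => sum_evolution_evolution ω hI lam jk.1 c b a (hR jk.2)

/-- The coefficients of products of evolution operators between the times `b` and of the
operators `A`. -/
def orderedSeries (n : ℕ) (b : Fin (n + 2) → EReal) (A : Fin n → Fock X → Fock X) (Ψ : Fock X)
    (V : ℕ) : Fock X :=
  ∑ v ∈ Finset.Nat.antidiagonalTuple (n + 1) V, orderedEvolution ω hI lam n v b A Ψ

lemma niceVec_orderedSeries (n : ℕ) (b : Fin (n + 2) → EReal) (A : Fin n → Fock X → Fock X)
    (D : Fin (n + 1) → Finset X) (hA : ∀ i, GoodOp (D i.succ) (D i.castSucc) (A i)) {Ψ : Fock X}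
    (hΨ : NiceVec (D (Fin.last n)) Ψ) (V : ℕ) :
    NiceVec (D 0) (orderedSeries ω hI lam n b A Ψ V) :=
  NiceVec.sum _ fun v _ => niceVec_orderedEvolution ω hI lam n v b A D hA hΨ

/-- The outermost evolution operator and the outermost operator `A 0` split off. -/
lemma orderedSeries_succ (n : ℕ) (b : Fin (n + 3) → EReal) (A : Fin (n + 1) → Fock X → Fock X)
    (D : Fin (n + 2) → Finset X) (hA : ∀ i, GoodOp (D i.succ) (D i.castSucc) (A i)) {Ψ : Fock X}
    (hΨ : NiceVec (D (Fin.last (n + 1))) Ψ) :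
    orderedSeries ω hI lam (n + 1) b A Ψ = (evolutionSeries ω hI lam (b 0) (b 1)).act fun V =>
      A 0 (orderedSeries ω hI lam n (fun i => b i.succ) (fun i => A i.succ) Ψ V) := by
  ext1 V
  have hn := fun v => niceVec_orderedEvolution ω hI lam n v (fun i => b i.succ)
    (fun i => A i.succ) (fun i => D i.succ) (fun i => hA i.succ) hΨ
  unfold orderedSeries OpSeries.act evolutionSeries
  rw [sum_antidiagonalTuple_succ]
  refine Finset.sum_congr rfl fun ab _ => ?_
  dsimp only
  have h1 := (goodOp_evolution ω hI lam (D 0) ab.1 (b 0) (b 1)).sum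
    (Finset.Nat.antidiagonalTuple (n + 1) ab.2) (Ψ := fun v => A 0 (orderedEvolution ω hI lam n v
      (fun i => b i.succ) (fun i => A i.succ) Ψ))
    fun v _ => (hA 0).nice (fun _ => zero_le_one) (hn v)
  rw [(hA 0).sum _ fun v _ => hn v, h1]
  rfl

lemma orderedSeries_zero (b : Fin 2 → EReal) (A : Fin 0 → Fock X → Fock X) (Ψ : Fock X) (V : ℕ) :
    orderedSeries ω hI lam 0 b A Ψ V = evolution ω hI lam V (b 0) (b 1) Ψ := by
  unfold orderedSeries
  rw [Finset.Nat.antidiagonalTuple_one, Finset.sum_singleton]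
  rfl

lemma evolution_apply_zero (k : ℕ) (b a : EReal) : evolution (X := X) ω hI lam k b a 0 = 0 := by
  have := (goodOp_evolution (X := X) ω hI lam ∅ k b a).sum (∅ : Finset ℕ) (Ψ := fun _ => 0)
    (fun i hi => absurd hi (Finset.notMem_empty i))
  simpa using this

/-- The evolution operators between the interacting fields combine by the composition law. -/
lemma act_foldr_interacting (n : ℕ) (A : Fin n → Fock X → Fock X) (t : Fin n → ℝ) (c : EReal)
    (D : Fin (n + 1) → Finset X) (hA : ∀ i, GoodOp (D i.succ) (D i.castSucc) (A i)) {Ψ : Fock X}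
    (hΨ : NiceVec (D (Fin.last n)) Ψ) :
    (evolutionSeries ω hI lam c ⊥).act (fun W => (List.ofFn fun i : Fin n =>
      OpSeries.comp (evolutionSeries ω hI lam ⊥ (t i)) (OpSeries.comp (OpSeries.const (A i))
        (evolutionSeries ω hI lam (t i) ⊥))).foldr OpSeries.comp (OpSeries.const id) W Ψ) =
      orderedSeries ω hI lam n (Fin.cons (α := fun _ => EReal) c
        (Fin.snoc (α := fun _ => EReal) (fun i => (t i : EReal)) ⊥)) A Ψ ∧
    ∀ W, NiceVec (D 0) ((List.ofFn fun i : Fin n =>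
      OpSeries.comp (evolutionSeries ω hI lam ⊥ (t i)) (OpSeries.comp (OpSeries.const (A i))
        (evolutionSeries ω hI lam (t i) ⊥))).foldr OpSeries.comp (OpSeries.const id) W Ψ) := by
  induction n generalizing c with
  | zero =>
    simp only [List.ofFn_zero, List.foldr_nil]
    constructor
    · ext1 V
      rw [orderedSeries_zero]
      unfold OpSeries.act
      rw [Finset.sum_eq_single (V, 0)]
      · simp only [OpSeries.const, if_true, id]
        rfl
      · rintro ⟨a, b⟩ h hab
        rw [Finset.HasAntidiagonal.mem_antidiagonal] at h
        have hb : b ≠ 0 := by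
          rintro rfl
          exact hab (by simp_all)
        simp only [OpSeries.const, if_neg hb]
        exact evolution_apply_zero ω hI lam a c ⊥
      · intro h
        exact absurd (Finset.HasAntidiagonal.mem_antidiagonal.2 (add_zero V)) h
    · intro W
      unfold OpSeries.const
      split_ifs
      · exact hΨ
      · exact (NiceVec.sum (∅ : Finset ℕ) (D := D 0) (Ψ := fun _ => (0 : Fock X))
          fun i hi => absurd hi (Finset.notMem_empty i))
  | succ n ih =>
    have ih' := ih (fun i => A i.succ) (fun i => t i.succ) (t 0) (fun i => D i.succ)
      (fun i => hA i.succ) hΨ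
    rw [List.ofFn_succ]
    simp only [List.foldr_cons]
    set L := (List.ofFn fun i : Fin n =>
      OpSeries.comp (evolutionSeries ω hI lam ⊥ (t i.succ)) (OpSeries.comp
        (OpSeries.const (A i.succ)) (evolutionSeries ω hI lam (t i.succ) ⊥))).foldr
          OpSeries.comp (OpSeries.const id) with hL
    obtain ⟨ih1, ih2⟩ := ih'
    have hE := fun (D : Finset X) (b a : EReal) (k : ℕ) => goodOp_evolution ω hI lam D k b a
    -- the leftmost field, acting on the vectors that the other fields generate
    have h0 : (fun W => OpSeries.comp (OpSeries.comp (evolutionSeries ω hI lam ⊥ (t 0))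
        (OpSeries.comp (OpSeries.const (A 0)) (evolutionSeries ω hI lam (t 0) ⊥))) L W Ψ) =
        (evolutionSeries ω hI lam ⊥ (t 0)).act fun W => A 0 (orderedSeries ω hI lam n
          (Fin.cons (α := fun _ => EReal) (t 0 : EReal) (Fin.snoc (α := fun _ => EReal)
            (fun i => (t i.succ : EReal)) ⊥)) (fun i => A i.succ) Ψ W) := by
      have h1 : (fun W => OpSeries.comp (OpSeries.comp (evolutionSeries ω hI lam ⊥ (t 0))
          (OpSeries.comp (OpSeries.const (A 0)) (evolutionSeries ω hI lam (t 0) ⊥))) L W Ψ) =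
          (OpSeries.comp (evolutionSeries ω hI lam ⊥ (t 0))
          (OpSeries.comp (OpSeries.const (A 0)) (evolutionSeries ω hI lam (t 0) ⊥))).act
            fun W => L W Ψ := rfl
      rw [h1, OpSeries.const_comp, OpSeries.act_comp (A := evolutionSeries ω hI lam ⊥ (t 0))
        (B := fun V Ψ => A 0 (evolutionSeries ω hI lam (t 0) ⊥ V Ψ)) (R := fun W => L W Ψ)
        (D := D 0) (D' := D 0) (hE _ _ _) fun b c => (hA 0).nice (fun _ => zero_le_one)
          ((hE _ _ _ _).nice (fun _ => zero_le_one) (ih2 c))]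
      congr 1
      ext1 W
      rw [← congrFun ih1 W]
      exact ((hA 0).sum _ (Ψ := fun ab : ℕ × ℕ => evolution ω hI lam ab.1 (t 0) ⊥ (L ab.2 Ψ))
        fun ab _ => (hE _ _ _ _).nice (fun _ => zero_le_one) (ih2 ab.2)).symm
    have hnice : ∀ W, NiceVec (D 0) (A 0 (orderedSeries ω hI lam n
          (Fin.cons (α := fun _ => EReal) (t 0 : EReal) (Fin.snoc (α := fun _ => EReal)
            (fun i => (t i.succ : EReal)) ⊥)) (fun i => A i.succ) Ψ W)) := fun W =>
      (hA 0).nice (fun _ => zero_le_one) (niceVec_orderedSeries ω hI lam n _ _ (fun i => D i.succ)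
        (fun i => hA i.succ) hΨ W)
    constructor
    · rw [h0, act_evolutionSeries ω hI lam _ _ _ hnice, orderedSeries_succ ω hI lam n _ A D hA hΨ]
      congr 1
      ext1 V
      congr 2
      ext1 i
      refine Fin.cases rfl (fun i => ?_) i
      simp only [Fin.cons_succ]
      refine Fin.lastCases ?_ (fun j => ?_) i
      · rw [Fin.snoc_last, Fin.succ_last, Fin.snoc_last]
      · rw [Fin.snoc_castSucc, Fin.succ_castSucc, Fin.snoc_castSucc]
    · intro W
      rw [congrFun h0 W]
      exact NiceVec.act (hE _ _ _) hnice W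

/-- The coefficients of the unnormalized Wightman functions. -/
lemma wightmanUnnorm_eq_blockSeries {n : ℕ} (α : Fin n → FieldPart) (f : 𝓢(Fin n → Mom, ℂ))
    (t : Fin n → ℝ) : wightmanUnnorm ω hI lam α f t =
      blockSeries n fun v => coefficient ω hI α v (tensorTest v f lam) t := by
  ext V
  unfold wightmanUnnorm blockSeries
  rw [PowerSeries.coeff_mk, PowerSeries.coeff_mk]
  have h := (act_foldr_interacting ω hI lam n (fun i => fieldAt ω α t i) t ⊤
    (fun i => Finset.univ.filter fun x : Fin n => (x : ℕ) < (i : ℕ))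
    (fun i => goodOp_fieldAt ω α t i) (Ψ := vac f) (by
      simp only [univ_filter_lt_last le_rfl]; exact niceVec_vac f)).1
  have hf : ∀ i : Fin n, fieldAt ω α t i = freeField ω (α i) (t i) i := fun i => by
    ext1 Ψ
    simp [fieldAt, externalAt]
  have h1 := congrArg vacPairing (congrFun h V)
  simp only [hf] at h1
  refine Eq.trans h1 ?_
  unfold orderedSeries
  simp only [vacPairing, Finset.sum_apply]
  refine Finset.sum_congr rfl fun v _ => ?_
  rw [← partialCoefficient_self, ← vacPairing_orderedEvolution ω hI lam α t le_rfl f t]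
  simp only [hf]
  rfl

/-- The coefficients of the vacuum expectation value of the scattering operator, with an arbitrary
subdivision of the time axis. -/
lemma scatteringVac_eq_blockSeries {n : ℕ} (t : Fin n → ℝ) :
    scatteringVac ω hI lam = blockSeries n fun v => partialCoefficient ω hI (m := 0)
      Fin.elim0 Fin.elim0 v (tensorTest v (fun _ => 1) lam) t := by
  ext V
  unfold scatteringVac blockSeries
  rw [PowerSeries.coeff_mk, PowerSeries.coeff_mk]
  have hA : ∀ i, fieldAt ω (m := 0) Fin.elim0 Fin.elim0 i = id := fun i => by
    ext1 Ψ
    simp [fieldAt, externalAt]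
  have hnice : NiceVec (∅ : Finset (Fin 0)) (vac fun _ => 1) := niceVec_vac schwartzOne
  have h1 : vacPairing (scattering ω hI lam V (vac fun _ : Empty → Mom => (1 : ℂ))) =
      vacPairing (evolution ω hI lam V ⊤ ⊥ (vac fun _ : Fin 0 → Mom => (1 : ℂ))) := by
    have h2 : (vac fun _ : Empty → Mom => (1 : ℂ)) = fun l p (_ : Empty → Mom) =>
        (vac fun _ : Fin 0 → Mom => (1 : ℂ)) l p 0 := by
      ext l p κ
      cases l <;> rfl
    rw [scattering, h2, evolution_pullback ω hI lam (fun _ => 0)]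
    rfl
  -- without operators in between, the subdivision of the time axis is immaterial
  have h3 : ∀ (n : ℕ) (b : Fin (n + 2) → EReal) (V : ℕ) (Ψ : Fock (Fin 0)), NiceVec ∅ Ψ →
      orderedSeries ω hI lam n b (fun _ => id) Ψ V =
        evolution ω hI lam V (b 0) (b (Fin.last (n + 1))) Ψ := by
    intro n
    induction n with
    | zero => exact fun b V Ψ _ => orderedSeries_zero ω hI lam b _ Ψ V
    | succ n ih =>
      intro b V Ψ hΨ
      rw [orderedSeries_succ ω hI lam n b _ (fun _ => ∅) (fun _ => GoodOp.id _) hΨ]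
      simp only [id, ih _ _ Ψ hΨ]
      exact sum_evolution_evolution ω hI lam V _ _ _ hΨ
  have h4 := h3 n (boundaryTime t) V _ hnice
  have hlast : boundaryTime t (Fin.last (n + 1)) = ⊥ := by
    rw [← Fin.succ_last, boundaryTime_succ, dif_neg (by simp)]
  rw [h1, show (⊤ : EReal) = boundaryTime t 0 from rfl, ← hlast, ← h4]
  unfold orderedSeries
  simp only [vacPairing, Finset.sum_apply]
  refine Finset.sum_congr rfl fun v _ => ?_
  have h5 := vacPairing_orderedEvolution ω hI lam (v := v) (m := 0) Fin.elim0 Fin.elim0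
    (Nat.zero_le n) schwartzOne t
  simp only [hA] at h5
  exact h5

lemma constantCoeff_scatteringVac : PowerSeries.constantCoeff (scatteringVac ω hI lam) = 1 := by
  rw [← PowerSeries.coeff_zero_eq_constantCoeff_apply, scatteringVac, PowerSeries.coeff_mk]
  rfl

end WightmanSeries

/-! ### Weights of disjoint unions of graphs -/

section Glue

variable {V V₁ V₂ : Type}

/-- The multiplicities of the disjoint union of two graphs, whose vertex sets are put together
by `W`. -/
def glueMult (W : V₁ ⊕ V₂ ≃ V) (μ₁ : V₁ → V₁ → ℕ) (μ₂ : V₂ → V₂ → ℕ) (a b : V) : ℕ :=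
  match W.symm a, W.symm b with
  | .inl x, .inl y => μ₁ x y
  | .inr x, .inr y => μ₂ x y
  | _, _ => 0

variable (W : V₁ ⊕ V₂ ≃ V) (μ₁ : V₁ → V₁ → ℕ) (μ₂ : V₂ → V₂ → ℕ)

@[simp] lemma glueMult_inl_inl (x y : V₁) :
    glueMult W μ₁ μ₂ (W (.inl x)) (W (.inl y)) = μ₁ x y := by simp [glueMult]

@[simp] lemma glueMult_inr_inr (x y : V₂) :
    glueMult W μ₁ μ₂ (W (.inr x)) (W (.inr y)) = μ₂ x y := by simp [glueMult]

@[simp] lemma glueMult_inl_inr (x : V₁) (y : V₂) :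
    glueMult W μ₁ μ₂ (W (.inl x)) (W (.inr y)) = 0 := by simp [glueMult]

@[simp] lemma glueMult_inr_inl (x : V₂) (y : V₁) :
    glueMult W μ₁ μ₂ (W (.inr x)) (W (.inl y)) = 0 := by simp [glueMult]

variable [Fintype V] [Fintype V₁] [Fintype V₂] [DecidableEq V] [DecidableEq V₁] [DecidableEq V₂]

lemma exists_equiv_of_card_fiber {E E' A : Type} [Fintype E] [Fintype E'] [DecidableEq A]
    (f : E → A) (f' : E' → A)
    (h : ∀ a, Fintype.card {e // f e = a} = Fintype.card {e // f' e = a}) :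
    ∃ e : E ≃ E', ∀ x, f' (e x) = f x := by
  have he : ∀ a, Nonempty ({e // f e = a} ≃ {e // f' e = a}) := fun a => Fintype.card_eq.1 (h a)
  exact ⟨(Equiv.sigmaFiberEquiv f).symm.trans ((Equiv.sigmaCongrRight fun a => (he a).some).trans
      (Equiv.sigmaFiberEquiv f')), fun x => ((he (f x)).some ⟨x, rfl⟩).2⟩

lemma card_multLine_eq (μ : V → V → ℕ) (ab : V × V) :
    Fintype.card {e : MultLine μ // e.1 = ab} = μ ab.1 ab.2 := by
  rw [Fintype.card_congr (Equiv.sigmaSubtype ab), Fintype.card_fin]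

/-- The lines of a disjoint union. -/
lemma exists_lineSum : ∃ L : MultLine μ₁ ⊕ MultLine μ₂ ≃ MultLine (glueMult W μ₁ μ₂),
    ∀ e, (L e).1 = Sum.elim (fun e : MultLine μ₁ => (W (.inl e.1.1), W (.inl e.1.2)))
      (fun e : MultLine μ₂ => (W (.inr e.1.1), W (.inr e.1.2))) e := by
  refine exists_equiv_of_card_fiber _ (fun e : MultLine (glueMult W μ₁ μ₂) => e.1) fun ab => ?_
  obtain ⟨a, b⟩ := ab
  obtain ⟨a, rfl⟩ := W.surjective a
  obtain ⟨b, rfl⟩ := W.surjective b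
  rw [card_multLine_eq, Fintype.card_congr Equiv.subtypeSum, Fintype.card_sum]
  simp only [Sum.elim_inl, Sum.elim_inr, Prod.ext_iff, W.injective.eq_iff]
  rcases a with a | a <;> rcases b with b | b <;>
    simp [Sum.inl_injective.eq_iff, Sum.inr_injective.eq_iff, card_multLine]

/-- An injection restricts to a bijection between fibres. -/
lemma exists_fiberEquiv {E E' A A' : Type} {π : E → A} {π' : E' → A'} {i : A → A'} {L : E → E'}
    (hi : Function.Injective i) (hL : Function.Injective L) (h : ∀ e, π' (L e) = i (π e)) (a : A)
    (hs : ∀ e', π' e' = i a → ∃ e, L e = e') :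
    ∃ F : {e // π e = a} ≃ {e' // π' e' = i a}, ∀ e, (F e : E') = L e := by
  refine ⟨Equiv.ofBijective (fun e => ⟨L e, by rw [h, e.2]⟩) ⟨fun e e' he => ?_, fun e' => ?_⟩,
    fun e => rfl⟩
  · exact Subtype.ext (hL (congrArg Subtype.val he))
  · obtain ⟨e, he⟩ := hs e'.1 e'.2
    exact ⟨⟨e, hi (by rw [← h, he, e'.2])⟩, Subtype.ext he⟩

/-- The integral over the line momenta of the graph with multiplicities `μ`, with its symmetry
factor. -/
def lineIntegral (K : V → VertexKernel) (Φ : (V → Mom) → ℂ) (μ : V → V → ℕ) : ℂ :=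
  (∏ b, ∏ a, ((μ b a)! : ℂ))⁻¹ * ∫ p : MultLine μ → Mom,
    (∏ a, (K a).eval (fun e : {e : MultLine μ // e.1.1 = a} => p e)
      (fun e : {e : MultLine μ // e.1.2 = a} => p e)) *
    Φ (fun a => ∑ e : {e : MultLine μ // e.1.1 = a}, p e -
      ∑ e : {e : MultLine μ // e.1.2 = a}, p e)

/-- The symmetry factors of disjoint unions multiply, as no lines join the two parts. -/
lemma prod_factorial_glueMult : (∏ b, ∏ a, ((glueMult W μ₁ μ₂ b a)! : ℂ)) =
    (∏ b, ∏ a, ((μ₁ b a)! : ℂ)) * ∏ b, ∏ a, ((μ₂ b a)! : ℂ) := by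
  rw [← W.prod_comp, Fintype.prod_sum_type]
  simp only [← W.prod_comp (fun a => ((glueMult W μ₁ μ₂ _ a)! : ℂ)), Fintype.prod_sum_type]
  simp

/-- The weight of a disjoint union is the product of the weights. -/
lemma lineIntegral_glueMult (K : V → VertexKernel) (Φ : (V → Mom) → ℂ) (Φ₁ : (V₁ → Mom) → ℂ)
    (Φ₂ : (V₂ → Mom) → ℂ)
    (hΦ : ∀ κ, Φ κ = Φ₁ (fun x => κ (W (.inl x))) * Φ₂ (fun x => κ (W (.inr x)))) :
    lineIntegral K Φ (glueMult W μ₁ μ₂) = lineIntegral (fun x => K (W (.inl x))) Φ₁ μ₁ *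
      lineIntegral (fun x => K (W (.inr x))) Φ₂ μ₂ := by
  obtain ⟨L, hL⟩ := exists_lineSum W μ₁ μ₂
  have hs : ∀ e', ∃ e, L e = e' := L.surjective
  have hWl : Function.Injective fun x => W (.inl x) := W.injective.comp Sum.inl_injective
  have hWr : Function.Injective fun x => W (.inr x) := W.injective.comp Sum.inr_injective
  have hLl : Function.Injective fun x => L (.inl x) := L.injective.comp Sum.inl_injective
  have hLr : Function.Injective fun x => L (.inr x) := L.injective.comp Sum.inr_injective
  -- the lines at a vertex of one part are the lines at that vertex of the union
  have hO₁ := fun a => exists_fiberEquiv (π := fun e : MultLine μ₁ => e.1.1)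
    (π' := fun e : MultLine (glueMult W μ₁ μ₂) => e.1.1) hWl hLl (fun e => by simp [hL]) a
    fun e' h => by
      obtain ⟨e | e, rfl⟩ := hs e'
      · exact ⟨e, rfl⟩
      · simp [hL] at h
  have hI₁ := fun a => exists_fiberEquiv (π := fun e : MultLine μ₁ => e.1.2)
    (π' := fun e : MultLine (glueMult W μ₁ μ₂) => e.1.2) hWl hLl (fun e => by simp [hL]) a
    fun e' h => by
      obtain ⟨e | e, rfl⟩ := hs e'
      · exact ⟨e, rfl⟩
      · simp [hL] at h
  have hO₂ := fun a => exists_fiberEquiv (π := fun e : MultLine μ₂ => e.1.1)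
    (π' := fun e : MultLine (glueMult W μ₁ μ₂) => e.1.1) hWr hLr (fun e => by simp [hL]) a
    fun e' h => by
      obtain ⟨e | e, rfl⟩ := hs e'
      · simp [hL] at h
      · exact ⟨e, rfl⟩
  have hI₂ := fun a => exists_fiberEquiv (π := fun e : MultLine μ₂ => e.1.2)
    (π' := fun e : MultLine (glueMult W μ₁ μ₂) => e.1.2) hWr hLr (fun e => by simp [hL]) a
    fun e' h => by
      obtain ⟨e | e, rfl⟩ := hs e'
      · simp [hL] at h
      · exact ⟨e, rfl⟩
  choose O₁ hO₁ using hO₁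
  choose I₁ hI₁ using hI₁
  choose O₂ hO₂ using hO₂
  choose I₂ hI₂ using hI₂
  unfold lineIntegral
  rw [prod_factorial_glueMult, mul_inv, mul_mul_mul_comm]
  congr 1
  rw [integral_pi_sum L, ← integral_prod_mul]
  refine integral_congr_ae (Eventually.of_forall fun z => ?_)
  simp only
  rw [mul_mul_mul_comm, hΦ, ← W.prod_comp, Fintype.prod_sum_type]
  have hl : ∀ x : MultLine μ₁, Sum.elim z.1 z.2 (L.symm (L (.inl x))) = z.1 x := fun x => by simp
  have hr : ∀ x : MultLine μ₂, Sum.elim z.1 z.2 (L.symm (L (.inr x))) = z.2 x := fun x => by simp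
  have eO₁ : ∀ a e, Sum.elim z.1 z.2 (L.symm (O₁ a e)) = z.1 e := fun a e => by rw [hO₁, hl]
  have eI₁ : ∀ a e, Sum.elim z.1 z.2 (L.symm (I₁ a e)) = z.1 e := fun a e => by rw [hI₁, hl]
  have eO₂ : ∀ a e, Sum.elim z.1 z.2 (L.symm (O₂ a e)) = z.2 e := fun a e => by rw [hO₂, hr]
  have eI₂ : ∀ a e, Sum.elim z.1 z.2 (L.symm (I₂ a e)) = z.2 e := fun a e => by rw [hI₂, hr]
  congr 1
  · congr 1
    · refine Finset.prod_congr rfl fun a _ => ?_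
      rw [← (K (W (.inl a))).eval_equiv (O₁ a) (I₁ a)]
      simp only [eO₁, eI₁]
    · refine Finset.prod_congr rfl fun a _ => ?_
      rw [← (K (W (.inr a))).eval_equiv (O₂ a) (I₂ a)]
      simp only [eO₂, eI₂]
  · congr 1
    · congr 1
      ext1 a
      rw [← (O₁ a).sum_comp, ← (I₁ a).sum_comp]
      simp only [eO₁, eI₁]
    · congr 1
      ext1 a
      rw [← (O₂ a).sum_comp, ← (I₂ a).sum_comp]
      simp only [eO₂, eI₂]

end Glue

section GlueVertex

variable (ω : DispersionFunction) (hI : AdmissibleInteraction) {m n : ℕ}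
  {v v₁ v₂ : Fin (n + 1) → ℕ}

/-- The vertices of a disjoint union of graphs, the second of which has no external vertices, for
given positions of the internal vertices. -/
def vertexSum (m : ℕ) (e : Inner v₁ ⊕ Inner v₂ ≃ Inner v) :
    Vertex m v₁ ⊕ Vertex 0 v₂ ≃ Vertex m v where
  toFun
    | .inl (.inl i) => .inl i
    | .inl (.inr x) => .inr (e (.inl x))
    | .inr (.inl i) => i.elim0
    | .inr (.inr x) => .inr (e (.inr x))
  invFun
    | .inl i => .inl (.inl i)
    | .inr y => Sum.map .inr .inr (e.symm y)
  left_inv := by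
    rintro ((i | x) | (i | x))
    · rfl
    · simp
    · exact i.elim0
    · simp
  right_inv := by
    rintro (i | y)
    · rfl
    · obtain ⟨y | y, rfl⟩ := e.surjective y <;> simp

/-- The integral over the line momenta at fixed times. -/
def graphAmplitude (α : Fin m → FieldPart) (s : Fin m → ℝ) (Φ : Args m v → ℂ)
    (μ : Vertex m v → Vertex m v → ℕ) (τ : Inner v → ℝ) : ℂ :=
  (∏ b, ∏ a, ((μ b a)! : ℂ))⁻¹ * ∫ p, wickTerm ω hI α s Φ μ τ p

/-- For test functions `f ⊗ lam ⊗ ⋯ ⊗ lam`, the amplitudes of disjoint unions factorize at fixed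
times. -/
lemma graphAmplitude_glueMult (α : Fin m → FieldPart) (s : Fin m → ℝ) (f : (Fin m → Mom) → ℂ)
    (lam : 𝓢(ℝ × Mom, ℂ)) (e : Inner v₁ ⊕ Inner v₂ ≃ Inner v)
    (μ₁ : Vertex m v₁ → Vertex m v₁ → ℕ) (μ₂ : Vertex 0 v₂ → Vertex 0 v₂ → ℕ) (τ : Inner v → ℝ) :
    graphAmplitude ω hI α s (tensorTest v f lam) (glueMult (vertexSum m e) μ₁ μ₂) τ =
      graphAmplitude ω hI α s (tensorTest v₁ f lam) μ₁ (fun x => τ (e (.inl x))) *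
        graphAmplitude ω hI Fin.elim0 Fin.elim0 (tensorTest v₂ (fun _ => 1) lam) μ₂
          (fun x => τ (e (.inr x))) := by
  have h := lineIntegral_glueMult (vertexSum m e) μ₁ μ₂ (feynmanKernel ω hI α s τ)
    (fun κ => tensorTest v f lam (fun i => κ (.inl i), fun x => (τ x, κ (.inr x))))
    (fun κ => tensorTest v₁ f lam (fun i => κ (.inl i), fun x => (τ (e (.inl x)), κ (.inr x))))
    (fun κ => tensorTest v₂ (fun _ => 1) lam
      (fun i => κ (.inl i), fun x => (τ (e (.inr x)), κ (.inr x)))) fun κ => by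
      simp only [tensorTest]
      rw [← e.prod_comp, Fintype.prod_sum_type, one_mul, mul_assoc]
      rfl
  have h₁ : (fun x => feynmanKernel ω hI α s τ (vertexSum m e (.inl x))) =
      feynmanKernel ω hI α s fun x => τ (e (.inl x)) := by
    ext1 x; cases x <;> rfl
  have h₂ : (fun x => feynmanKernel ω hI α s τ (vertexSum m e (.inr x))) =
      feynmanKernel ω hI Fin.elim0 Fin.elim0 fun x => τ (e (.inr x)) := by
    ext1 x
    rcases x with i | x
    · exact i.elim0
    · rfl
  rw [h₁, h₂] at h
  exact h

/-- A contribution is an integral over the times of the time factor and the integral over the line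
momenta. -/
lemma FeynmanGraph.contribution_eq_integral (Γ : FeynmanGraph m v) (α : Fin m → FieldPart)
    (s : Fin m → ℝ) (t : Fin n → ℝ) (Φ : 𝓢(Args m v, ℂ)) :
    Γ.contribution ω hI α s t Φ =
      ∫ τ : Inner v → ℝ, (timeFactor t τ : ℂ) * graphAmplitude ω hI α s Φ Γ.mult τ := by
  rw [contribution_eq, Measure.volume_eq_prod, integral_prod _
    (integrable_timeFactor_mul_wickTerm ω hI α s t Φ Γ.mult), ← integral_const_mul]
  refine integral_congr_ae (Eventually.of_forall fun τ => ?_)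
  simp only [graphAmplitude]
  rw [integral_const_mul]
  ring

lemma integrable_timeFactor_mul_graphAmplitude (α : Fin m → FieldPart) (s : Fin m → ℝ)
    (t : Fin n → ℝ) (Φ : 𝓢(Args m v, ℂ)) (μ : Vertex m v → Vertex m v → ℕ) :
    Integrable fun τ : Inner v → ℝ => (timeFactor t τ : ℂ) * graphAmplitude ω hI α s Φ μ τ := by
  have h := ((integrable_timeFactor_mul_wickTerm ω hI α s t Φ μ).integral_prod_left).const_mul
    (∏ b, ∏ a, ((μ b a)! : ℂ))⁻¹
  refine h.congr (Eventually.of_forall fun τ => ?_)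
  simp only [graphAmplitude]
  rw [integral_const_mul]
  ring

end GlueVertex

/-! ### Shuffles of times -/

/-- The shuffles of two blocks of `a` and `b` ordered points into a block of `c` ordered points. -/
abbrev BlockShuffle (a b c : ℕ) : Type :=
  {s : Fin a ⊕ Fin b ≃ Fin c // StrictMono (fun i => s (.inl i)) ∧ StrictMono fun i => s (.inr i)}

instance (a b c : ℕ) : Fintype (BlockShuffle a b c) := by
  classical infer_instance

/-- The enumeration of finitely many distinct real numbers in increasing order. -/
lemma exists_strictMono_enum {X : Type} [Fintype X] {c : ℕ} (hc : Fintype.card X = c) {σ : X → ℝ}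
    (hσ : Function.Injective σ) :
    ∃ u : X ≃ Fin c, StrictMono (σ ∘ u.symm) ∧ ∀ w : X ≃ Fin c, StrictMono (σ ∘ w.symm) → w = u := by
  let e : Fin c ≃ X := (Fintype.equivFinOfCardEq hc).symm
  let r : Fin c ≃ X := (Tuple.sort (σ ∘ e)).trans e
  have hr : StrictMono (σ ∘ r) :=
    (Tuple.monotone_sort (σ ∘ e)).strictMono_of_injective (hσ.comp r.injective)
  refine ⟨r.symm, hr, fun w hw => ?_⟩
  have h := (hw.range_inj hr).1 (by
    rw [Set.range_comp, Set.range_comp, w.symm.range_eq_univ, r.range_eq_univ])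
  have h2 : w.symm = r := Equiv.ext fun j => hσ (congrFun h j)
  rw [← h2]
  rfl

lemma orderIndicator_lt_eq_ite {c : ℕ} {η : ℝ} (τ : Fin c → ℝ) :
    orderIndicator (fun i j : Fin c => i < j) η τ =
      open Classical in if StrictMono (fun i => η * τ i) then 1 else 0 := by
  unfold orderIndicator
  have h : (∀ i j : Fin c, i < j → η * (τ i - τ j) < 0) ↔ StrictMono (fun i => η * τ i) := by
    refine forall_congr' fun i => forall_congr' fun j => imp_congr_right fun _ => ?_
    rw [mul_sub, sub_neg]
  simp only [h]

/-- Two ordered families of pairwise distinct times are ordered jointly by exactly one shuffle. -/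
lemma orderIndicator_shuffle {a b c : ℕ} (hc : a + b = c) {η : ℝ} (hη : η ≠ 0)
    (τ : Fin a ⊕ Fin b → ℝ) (hτ : Function.Injective τ) :
    orderIndicator (fun i j : Fin a => i < j) η (fun i => τ (.inl i)) *
      orderIndicator (fun i j : Fin b => i < j) η (fun i => τ (.inr i)) =
    ∑ s : BlockShuffle a b c,
      orderIndicator (fun i j : Fin c => i < j) η (fun j => τ (s.1.symm j)) := by
  classical
  have hσ : Function.Injective fun x => η * τ x := (mul_right_injective₀ hη).comp hτ
  -- the joint enumeration of the times
  obtain ⟨u, hu, huniq⟩ := exists_strictMono_enum (c := c) (by simp [hc]) hσ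
  have hlt : ∀ x y, u x < u y ↔ η * τ x < η * τ y := fun x y => by
    rw [← hu.lt_iff_lt]; simp
  have hl : StrictMono (fun i => η * τ (.inl i)) ↔ StrictMono fun i => u (.inl i) :=
    forall_congr' fun i => forall_congr' fun j => imp_congr_right fun _ => (hlt _ _).symm
  have hr : StrictMono (fun i => η * τ (.inr i)) ↔ StrictMono fun i => u (.inr i) :=
    forall_congr' fun i => forall_congr' fun j => imp_congr_right fun _ => (hlt _ _).symm
  have hs : ∀ s : BlockShuffle a b c, StrictMono (fun j => η * τ (s.1.symm j)) ↔ s.1 = u :=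
    fun s => ⟨huniq s.1, fun h => h ▸ hu⟩
  simp only [orderIndicator_lt_eq_ite, hl, hr, hs]
  rw [ite_zero_mul_ite_zero, one_mul]
  split_ifs with h
  · rw [Finset.sum_eq_single ⟨u, h⟩ (fun s _ hs => if_neg fun h' => hs (Subtype.ext h'))
      (fun h' => absurd (Finset.mem_univ _) h')]
    simp
  · exact (Finset.sum_eq_zero fun (s : BlockShuffle a b c) _ => if_neg fun h' : s.1 = u => h (h' ▸ s.2)).symm

/-- The product of two time simplices is the union of the simplices of the shuffles. -/
lemma simplexKernel_shuffle {a b c : ℕ} (hc : a + b = c) (A B : EReal)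
    (τ : Fin a ⊕ Fin b → ℝ) (hτ : Function.Injective τ) :
    simplexKernel A B (fun i => τ (.inl i)) * simplexKernel A B (fun i => τ (.inr i)) =
    ∑ s : BlockShuffle a b c, simplexKernel A B (fun j => τ (s.1.symm j)) := by
  unfold simplexKernel
  have hstep : ∀ s : BlockShuffle a b c, ∏ j, stepKernel (τ (s.1.symm j)) A B =
      (∏ i, stepKernel (τ (.inl i)) A B) * ∏ i, stepKernel (τ (.inr i)) A B := fun s => by
    rw [s.1.symm.prod_comp fun x => stepKernel (τ x) A B, Fintype.prod_sum_type]
  simp only [hstep]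
  rw [← Finset.mul_sum, mul_mul_mul_comm]
  -- for coinciding end points both sides vanish, unless there are no times at all
  rcases eq_or_ne A B with rfl | hAB
  · rcases Nat.eq_zero_or_pos (a + b) with h0 | h0
    · obtain ⟨rfl, rfl⟩ : a = 0 ∧ b = 0 := by omega
      obtain rfl : c = 0 := by omega
      have hu : ∀ s s' : BlockShuffle 0 0 0, s = s' := fun s s' =>
        Subtype.ext (Equiv.ext fun x => by rcases x with x | x <;> exact x.elim0)
      let s₀ : BlockShuffle 0 0 0 := ⟨Equiv.sumEmpty (Fin 0) (Fin 0), fun i => i.elim0,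
        fun i => i.elim0⟩
      rw [Finset.sum_eq_single s₀ (fun s _ hs => absurd (hu s s₀) hs)
        (fun h' => absurd (Finset.mem_univ _) h')]
      simp [orderIndicator]
    · have : (∏ i : Fin a, stepKernel (τ (.inl i)) A A) *
          ∏ i : Fin b, stepKernel (τ (.inr i)) A A = 0 := by
        simp only [stepKernel_self, Finset.prod_const, Finset.card_univ, Fintype.card_fin,
          ← pow_add]
        exact zero_pow h0.ne'
      rw [this, zero_mul, zero_mul]
  · rw [orderIndicator_shuffle hc _ τ hτ]
    unfold orientation
    rcases lt_or_gt_of_ne hAB with h | h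
    · simp [h]
    · simp [h, h.not_gt]

section TimeShuffle

variable {m n : ℕ} {v v₁ v₂ : Fin (n + 1) → ℕ}

/-- Shuffles of the internal vertices within each block. -/
abbrev Shuffle (v₁ v₂ v : Fin (n + 1) → ℕ) : Type := ∀ i, BlockShuffle (v₁ i) (v₂ i) (v i)

/-- The identification of internal vertices given by a shuffle. -/
def Shuffle.equiv (s : Shuffle v₁ v₂ v) : Inner v₁ ⊕ Inner v₂ ≃ Inner v :=
  (Equiv.sigmaSumDistrib (fun i => Fin (v₁ i)) (fun i => Fin (v₂ i))).symm.trans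
    (Equiv.sigmaCongrRight fun i => (s i).1)

lemma Shuffle.equiv_inl (s : Shuffle v₁ v₂ v) (x : Inner v₁) :
    s.equiv (.inl x) = ⟨x.1, (s x.1).1 (.inl x.2)⟩ := rfl

lemma Shuffle.equiv_inr (s : Shuffle v₁ v₂ v) (x : Inner v₂) :
    s.equiv (.inr x) = ⟨x.1, (s x.1).1 (.inr x.2)⟩ := rfl

/-- The product of the time factors of two graphs is the sum over the relative orders, block by
block. -/
lemma timeFactor_shuffle (hv : v₁ + v₂ = v) (t : Fin n → ℝ) (τ : Inner v₁ ⊕ Inner v₂ → ℝ)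
    (hτ : Function.Injective τ) :
    timeFactor t (fun x => τ (.inl x)) * timeFactor t (fun x => τ (.inr x)) =
      ∑ s : Shuffle v₁ v₂ v, timeFactor t fun y => τ (s.equiv.symm y) := by
  unfold timeFactor
  rw [← Finset.prod_mul_distrib]
  have h : ∀ i, _ := fun i => simplexKernel_shuffle (congrFun hv i) (boundaryTime t i.succ)
    (boundaryTime t i.castSucc) (fun x : Fin (v₁ i) ⊕ Fin (v₂ i) => τ (Sum.map (fun j => ⟨i, j⟩)
      (fun j => ⟨i, j⟩) x)) (hτ.comp (Sum.map_injective.2 ⟨fun j j' h => by simpa using h,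
        fun j j' h => by simpa using h⟩))
  refine (Finset.prod_congr rfl fun i _ => h i).trans ?_
  rw [Fintype.prod_sum]
  refine Finset.sum_congr rfl fun s _ => Finset.prod_congr rfl fun i _ => ?_
  congr 1

/-- Almost all families of times are pairwise distinct. -/
lemma ae_injective {X : Type} [Fintype X] : ∀ᵐ τ : X → ℝ, Function.Injective τ := by
  have h : ∀ x y : X, x ≠ y → ∀ᵐ τ : X → ℝ, τ x ≠ τ y := fun x y hxy => by
    let L : (X → ℝ) →ₗ[ℝ] ℝ := (LinearMap.proj x : (X → ℝ) →ₗ[ℝ] ℝ) - LinearMap.proj y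
    have hL : LinearMap.ker L ≠ ⊤ := fun h => by
      classical
      have h1 : L (Pi.single x 1) = 0 := by
        rw [← LinearMap.mem_ker, h]; trivial
      simp [L, hxy.symm] at h1
    have h2 := Measure.addHaar_submodule (volume : Measure (X → ℝ)) _ hL
    refine measure_mono_null (fun τ hτ => ?_) h2
    have : τ x = τ y := not_not.1 hτ
    simp [L, this]
  have h' : ∀ᵐ τ : X → ℝ, ∀ x y : X, x ≠ y → τ x ≠ τ y :=
    ae_all_iff.2 fun x => ae_all_iff.2 fun y => by
      by_cases hxy : x = y
      · exact Eventually.of_forall fun τ h => absurd hxy h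
      · exact (h x y hxy).mono fun τ h _ => h
  exact h'.mono fun τ hτ x y hxy => by_contra fun hne => hτ x y hne hxy

lemma measurePreserving_sumElim {ι ι' Y : Type} [Fintype ι] [Fintype ι'] [Fintype Y]
    (e : ι ⊕ ι' ≃ Y) : MeasurePreserving
      (fun (z : (ι → ℝ) × (ι' → ℝ)) (y : Y) => Sum.elim z.1 z.2 (e.symm y)) := by
  have h := (volume_measurePreserving_piCongrLeft (fun _ : Y => ℝ) e).comp
    (volume_measurePreserving_sumPiEquivProdPi_symm (fun _ : ι ⊕ ι' => ℝ))
  refine (congrArg (MeasurePreserving · volume volume) (funext fun z => funext fun y => ?_)).mpr h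
  obtain ⟨x, rfl⟩ := e.surjective y
  simp only [Function.comp_apply, MeasurableEquiv.coe_piCongrLeft, Equiv.piCongrLeft_apply_apply,
    Equiv.symm_apply_apply]
  cases x <;> rfl

section Contribution

variable (ω : DispersionFunction) (hI : AdmissibleInteraction)

/-- The product of the contributions of a graph and a vacuum graph is the sum of the contributions
of their disjoint unions, over all relative orders of the internal vertices. -/
lemma contribution_mul_eq_sum (hv : v₁ + v₂ = v) (α : Fin m → FieldPart) (s : Fin m → ℝ)
    (t : Fin n → ℝ) (f : 𝓢(Fin m → Mom, ℂ)) (lam : 𝓢(ℝ × Mom, ℂ)) (Γ₁ : FeynmanGraph m v₁)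
    (Γ₂ : FeynmanGraph 0 v₂) :
    Γ₁.contribution ω hI α s t (tensorTest v₁ f lam) *
      Γ₂.contribution ω hI Fin.elim0 Fin.elim0 t (tensorTest v₂ (fun _ => 1) lam) =
    ∑ σ : Shuffle v₁ v₂ v, ∫ τ : Inner v → ℝ, (timeFactor t τ : ℂ) *
      graphAmplitude ω hI α s (tensorTest v f lam)
        (glueMult (vertexSum m σ.equiv) Γ₁.mult Γ₂.mult) τ := by
  obtain ⟨Φ₁, hΦ₁⟩ := exists_schwartz_tensorTest v₁ f lam
  obtain ⟨Φ₂, hΦ₂⟩ := exists_schwartz_tensorTest v₂ schwartzOne lam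
  obtain ⟨Φ, hΦ⟩ := exists_schwartz_tensorTest v f lam
  have hone : tensorTest v₂ (fun _ => 1) lam = tensorTest v₂ schwartzOne lam := rfl
  rw [hone, ← hΦ₁, ← hΦ₂, Γ₁.contribution_eq_integral ω hI, Γ₂.contribution_eq_integral ω hI,
    ← integral_prod_mul]
  have hglue : ∀ (σ : Shuffle v₁ v₂ v) (z : (Inner v₁ → ℝ) × (Inner v₂ → ℝ)),
      graphAmplitude ω hI α s (tensorTest v f lam)
        (glueMult (vertexSum m σ.equiv) Γ₁.mult Γ₂.mult)
        (fun y => Sum.elim z.1 z.2 (σ.equiv.symm y)) =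
      graphAmplitude ω hI α s Φ₁ Γ₁.mult z.1 *
        graphAmplitude ω hI Fin.elim0 Fin.elim0 Φ₂ Γ₂.mult z.2 := fun σ z => by
    rw [graphAmplitude_glueMult, hΦ₁, hΦ₂]
    simp only [Equiv.symm_apply_apply, Sum.elim_inl, Sum.elim_inr]
    rfl
  have hint : ∀ σ : Shuffle v₁ v₂ v, _ := fun σ =>
    (measurePreserving_sumElim σ.equiv).integrable_comp_of_integrable
      (integrable_timeFactor_mul_graphAmplitude ω hI α s t Φ
        (glueMult (vertexSum m σ.equiv) Γ₁.mult Γ₂.mult))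
  rw [Finset.sum_congr rfl fun σ _ => integral_pi_sum (Shuffle.equiv σ) _]
  rw [← integral_finsetSum _ fun σ _ => by
    have := hint σ
    rw [hΦ] at this
    exact this]
  -- coinciding times form a null set
  have hinj : ∀ᵐ z : (Inner v₁ → ℝ) × (Inner v₂ → ℝ),
      Function.Injective (Sum.elim z.1 z.2 : Inner v₁ ⊕ Inner v₂ → ℝ) := by
    have h := (measurePreserving_sumElim (Equiv.refl (Inner v₁ ⊕ Inner v₂))).quasiMeasurePreserving.ae
      (ae_injective (X := Inner v₁ ⊕ Inner v₂))
    exact h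
  refine integral_congr_ae (hinj.mono fun z hz => ?_)
  simp only [hglue]
  have h := timeFactor_shuffle hv t _ hz
  simp only [Sum.elim_inl, Sum.elim_inr] at h
  rw [← Finset.sum_mul, ← Complex.ofReal_sum, ← h, Complex.ofReal_mul]
  ring

end Contribution

end TimeShuffle

/-! ### Splitting off the vacuum components -/

section Splitting

variable {m n : ℕ} {v v₁ v₂ : Fin (n + 1) → ℕ}

/-- Shuffles preserve the order of the vertices within each of the two parts. -/
lemma precedes_vertexSum_inl (s : Shuffle v₁ v₂ v) (x y : Vertex m v₁) :
    Vertex.Precedes (vertexSum m s.equiv (.inl x)) (vertexSum m s.equiv (.inl y)) ↔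
      Vertex.Precedes x y := by
  rcases x with i | ⟨i, j⟩ <;> rcases y with i' | ⟨i', j'⟩
  · exact Iff.rfl
  · change toLex (_, _) < toLex (_, _) ↔ toLex (_, _) < toLex (_, _)
    simp [Prod.Lex.toLex_lt_toLex, Shuffle.equiv_inl]
  · change toLex (_, _) < toLex (_, _) ↔ toLex (_, _) < toLex (_, _)
    simp [Prod.Lex.toLex_lt_toLex, Shuffle.equiv_inl]
  · change toLex (_, _) < toLex (_, _) ↔ toLex (_, _) < toLex (_, _)
    by_cases h : i = i'
    · subst h
      simpa [Prod.Lex.toLex_lt_toLex, Shuffle.equiv_inl] using (s i).2.1.lt_iff_lt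
    · have h' : (i' : ℕ) ≠ i := fun h' => h (Fin.ext h'.symm)
      simp [Prod.Lex.toLex_lt_toLex, Shuffle.equiv_inl, h']

lemma precedes_vertexSum_inr (s : Shuffle v₁ v₂ v) (x y : Vertex 0 v₂) :
    Vertex.Precedes (vertexSum m s.equiv (.inr x)) (vertexSum m s.equiv (.inr y)) ↔
      Vertex.Precedes x y := by
  rcases x with i | ⟨i, j⟩
  · exact i.elim0
  rcases y with i' | ⟨i', j'⟩
  · exact i'.elim0
  change toLex (_, _) < toLex (_, _) ↔ toLex (_, _) < toLex (_, _)
  by_cases h : i = i'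
  · subst h
    simpa [Prod.Lex.toLex_lt_toLex, Shuffle.equiv_inr] using (s i).2.2.lt_iff_lt
  · have h' : (i' : ℕ) ≠ i := fun h' => h (Fin.ext h'.symm)
    simp [Prod.Lex.toLex_lt_toLex, Shuffle.equiv_inr, h']

namespace FeynmanGraph

/-- The disjoint union of a graph and a graph without external vertices, with the relative order of
their internal vertices given by a shuffle. -/
def glue (s : Shuffle v₁ v₂ v) (Γ₁ : FeynmanGraph m v₁) (Γ₂ : FeynmanGraph 0 v₂) :
    FeynmanGraph m v where
  mult := glueMult (vertexSum m s.equiv) Γ₁.mult Γ₂.mult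
  ordered a b := by
    obtain ⟨x, rfl⟩ := (vertexSum m s.equiv).surjective a
    obtain ⟨y, rfl⟩ := (vertexSum m s.equiv).surjective b
    rcases x with x | x <;> rcases y with y | y
    · rw [glueMult_inl_inl, precedes_vertexSum_inl]
      exact Γ₁.ordered x y
    · simp
    · simp
    · rw [glueMult_inr_inr, precedes_vertexSum_inr]
      exact Γ₂.ordered x y
  external i := by
    have hi : (Sum.inl i : Vertex m v) = vertexSum m s.equiv (.inl (.inl i)) := rfl
    rw [hi, ← (vertexSum m s.equiv).sum_comp, Fintype.sum_sum_type]
    simpa using Γ₁.external i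

/-- The vertices that are not connected to any external vertex. -/
def vacuumSet (Γ : FeynmanGraph m v) : Set (Vertex m v) :=
  {a | ∀ i : Fin m, ¬ Γ.graph.Reachable (Sum.inl i) a}

lemma noVacuum_iff (Γ : FeynmanGraph m v) : Γ.NoVacuum ↔ ∀ a, a ∉ Γ.vacuumSet := by
  unfold NoVacuum IsVacuumComponent vacuumSet
  refine ⟨fun h a ha => h (Γ.graph.connectedComponentMk a) fun i hi => ha i ?_, fun h c => ?_⟩
  · exact SimpleGraph.ConnectedComponent.exact hi
  · induction c using SimpleGraph.ConnectedComponent.ind with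
    | h a => exact fun hc => h a fun i hi => hc i (SimpleGraph.ConnectedComponent.sound hi)

lemma graph_adj_of_mult_ne_zero (Γ : FeynmanGraph m v) {a b : Vertex m v} (h : Γ.mult a b ≠ 0) :
    Γ.graph.Adj a b := by
  refine (SimpleGraph.fromRel_adj _ a b).2 ⟨?_, Or.inl h⟩
  rintro rfl
  exact lt_irrefl _ (Γ.ordered a a h)

lemma mem_vacuumSet_iff_of_adj (Γ : FeynmanGraph m v) {a b : Vertex m v} (h : Γ.graph.Adj a b) :
    a ∈ Γ.vacuumSet ↔ b ∈ Γ.vacuumSet :=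
  ⟨fun ha i hi => ha i (hi.trans h.symm.reachable), fun hb i hi => hb i (hi.trans h.reachable)⟩

lemma glue_graph_adj_inl (s : Shuffle v₁ v₂ v) (Γ₁ : FeynmanGraph m v₁) (Γ₂ : FeynmanGraph 0 v₂)
    (x y : Vertex m v₁) :
    (glue s Γ₁ Γ₂).graph.Adj (vertexSum m s.equiv (.inl x)) (vertexSum m s.equiv (.inl y)) ↔
      Γ₁.graph.Adj x y := by
  simp [graph, glue, SimpleGraph.fromRel_adj]

/-- The vacuum components of a disjoint union with a graph without vacuum components. -/
lemma vertexSum_mem_vacuumSet_glue (s : Shuffle v₁ v₂ v) (Γ₁ : FeynmanGraph m v₁)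
    (Γ₂ : FeynmanGraph 0 v₂) (h₁ : Γ₁.NoVacuum) (x : Vertex m v₁ ⊕ Vertex 0 v₂) :
    vertexSum m s.equiv x ∈ (glue s Γ₁ Γ₂).vacuumSet ↔ x.isRight := by
  rcases x with x | x
  · simp only [Sum.isRight_inl, Bool.false_eq_true, iff_false]
    intro hx
    refine (noVacuum_iff Γ₁).1 h₁ x fun i hi => hx i ?_
    exact hi.map (G' := (glue s Γ₁ Γ₂).graph)
      ⟨fun x => vertexSum m s.equiv (.inl x), fun {a b} h => (glue_graph_adj_inl s Γ₁ Γ₂ a b).2 h⟩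
  · simp only [Sum.isRight_inr, iff_true]
    intro i hi
    -- paths that start at an external vertex stay in the first part
    have hstay : ∀ b, (glue s Γ₁ Γ₂).graph.Reachable (Sum.inl i) b →
        ∃ y, b = vertexSum m s.equiv (.inl y) := fun b hb => by
      rw [SimpleGraph.reachable_iff_reflTransGen] at hb
      induction hb with
      | refl => exact ⟨.inl i, rfl⟩
      | tail _ hbc ih =>
        obtain ⟨y, rfl⟩ := ih
        rename_i c _
        obtain ⟨z | z, rfl⟩ := (vertexSum m s.equiv).surjective c
        · exact ⟨z, rfl⟩
        · simp [graph, glue, SimpleGraph.fromRel_adj] at hbc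
    obtain ⟨y, hy⟩ := hstay _ hi
    simpa using (vertexSum m s.equiv).injective hy

/-- The vacuum components of a graph can be split off. -/
lemma exists_glue_eq (Γ : FeynmanGraph m v) : ∃ (v₁ v₂ : Fin (n + 1) → ℕ) (_ : v₁ + v₂ = v)
    (s : Shuffle v₁ v₂ v) (Γ₁ : FeynmanGraph m v₁) (Γ₂ : FeynmanGraph 0 v₂),
    Γ₁.NoVacuum ∧ glue s Γ₁ Γ₂ = Γ := by
  classical
  -- the positions in each block of the vertices connected to external ones
  let T : ∀ i, Finset (Fin (v i)) := fun i =>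
    Finset.univ.filter fun j => (Sum.inr ⟨i, j⟩ : Vertex m v) ∉ Γ.vacuumSet
  let s : Shuffle (fun i => (T i).card) (fun i => (T i)ᶜ.card) v := fun i =>
    ⟨finSumEquivOfFinset rfl rfl, fun j j' h => by
      simpa using ((T i).orderEmbOfFin rfl).strictMono h, fun j j' h => by
      simpa using ((T i)ᶜ.orderEmbOfFin rfl).strictMono h⟩
  have hW : ∀ x, vertexSum m s.equiv x ∈ Γ.vacuumSet ↔ x.isRight := by
    rintro ((i | ⟨i, j⟩) | (i | ⟨i, j⟩))
    · simp only [Sum.isRight_inl, Bool.false_eq_true, iff_false]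
      exact fun h => h i (SimpleGraph.Reachable.refl _)
    · simp only [Sum.isRight_inl, Bool.false_eq_true, iff_false]
      have h := (T i).orderEmbOfFin_mem rfl j
      exact (Finset.mem_filter.1 h).2
    · exact i.elim0
    · simp only [Sum.isRight_inr, iff_true]
      have h := (T i)ᶜ.orderEmbOfFin_mem rfl j
      rw [Finset.mem_compl, Finset.mem_filter] at h
      have h' := not_and.1 h (Finset.mem_univ _)
      exact not_not.1 h'
  -- no lines join the two parts
  have hcross : ∀ x y, x.isRight ≠ y.isRight →
      Γ.mult (vertexSum m s.equiv x) (vertexSum m s.equiv y) = 0 := fun x y hxy => by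
    by_contra h
    have := Γ.mem_vacuumSet_iff_of_adj (Γ.graph_adj_of_mult_ne_zero h)
    rw [hW, hW] at this
    exact hxy (Bool.eq_iff_iff.2 this)
  let Γ₁ : FeynmanGraph m fun i => (T i).card :=
    { mult := fun x y => Γ.mult (vertexSum m s.equiv (.inl x)) (vertexSum m s.equiv (.inl y))
      ordered := fun x y h => (precedes_vertexSum_inl s x y).1 (Γ.ordered _ _ h)
      external := fun i => by
        have h := Γ.external i
        have hi : (Sum.inl i : Vertex m v) = vertexSum m s.equiv (.inl (.inl i)) := rfl
        rw [hi, ← (vertexSum m s.equiv).sum_comp, Fintype.sum_sum_type] at h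
        refine (left_eq_add.2 (Finset.sum_eq_zero fun x _ => ?_)).trans h
        rw [hcross _ _ (by simp), hcross _ _ (by simp), add_zero] }
  let Γ₂ : FeynmanGraph 0 fun i => (T i)ᶜ.card :=
    { mult := fun x y => Γ.mult (vertexSum m s.equiv (.inr x)) (vertexSum m s.equiv (.inr y))
      ordered := fun x y h => (precedes_vertexSum_inr (m := m) s x y).1 (Γ.ordered _ _ h)
      external := fun i => i.elim0 }
  refine ⟨_, _, funext fun i => by simp [Finset.card_add_card_compl], s, Γ₁, Γ₂, ?_, ?_⟩
  · refine (noVacuum_iff _).2 fun x hx => ?_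
    have hx' : vertexSum m s.equiv (.inl x) ∉ Γ.vacuumSet := by simp [hW]
    refine hx' fun i hi => ?_
    have hstay : ∀ b, Γ.graph.Reachable (Sum.inl i) b →
        ∃ y, b = vertexSum m s.equiv (.inl y) ∧ Γ₁.graph.Reachable (Sum.inl i) y := fun b hb => by
      rw [SimpleGraph.reachable_iff_reflTransGen] at hb
      induction hb with
      | refl => exact ⟨.inl i, rfl, SimpleGraph.Reachable.refl _⟩
      | tail _ hbc ih =>
        obtain ⟨y, rfl, hy⟩ := ih
        rename_i c _
        obtain ⟨z | z, rfl⟩ := (vertexSum m s.equiv).surjective c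
        · refine ⟨z, rfl, hy.trans (SimpleGraph.Adj.reachable ?_)⟩
          simpa [graph, Γ₁, SimpleGraph.fromRel_adj] using hbc
        · have := Γ.mem_vacuumSet_iff_of_adj hbc
          simp [hW] at this
    obtain ⟨y, hy, hr⟩ := hstay _ hi
    obtain rfl : x = y := by simpa using (vertexSum m s.equiv).injective hy
    exact hx i hr
  · refine FeynmanGraph.ext (funext fun a => funext fun b => ?_)
    obtain ⟨x, rfl⟩ := (vertexSum m s.equiv).surjective a
    obtain ⟨y, rfl⟩ := (vertexSum m s.equiv).surjective b
    rcases x with x | x <;> rcases y with y | y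
    · exact glueMult_inl_inl ..
    · exact (glueMult_inl_inr ..).trans (hcross _ _ (by simp)).symm
    · exact (glueMult_inr_inl ..).trans (hcross _ _ (by simp)).symm
    · exact glueMult_inr_inr ..

end FeynmanGraph

/-- A graph without vacuum components, a graph without external vertices, and a relative order of
their internal vertices. -/
abbrev VacuumSplitting (m : ℕ) (v : Fin (n + 1) → ℕ) : Type :=
  Σ q : {q : (Fin (n + 1) → ℕ) × (Fin (n + 1) → ℕ) // q.1 + q.2 = v},
    Shuffle q.1.1 q.1.2 v × {Γ : FeynmanGraph m q.1.1 // Γ.NoVacuum} × FeynmanGraph 0 q.1.2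

/-- Every graph is, in a unique way, the disjoint union of a graph without vacuum components and a
graph without external vertices. -/
lemma bijective_glue : Function.Bijective fun q : VacuumSplitting m v =>
    FeynmanGraph.glue q.2.1 q.2.2.1.1 q.2.2.2 := by
  constructor
  · rintro ⟨⟨⟨v₁, v₂⟩, h⟩, s, ⟨Γ₁, h₁⟩, Γ₂⟩ ⟨⟨⟨v₁', v₂'⟩, h'⟩, s', ⟨Γ₁', h₁'⟩, Γ₂'⟩ he
    simp only at he h h'
    -- the positions of both parts can be read off from the vacuum set of the union
    have hr : ∀ {u₁ u₂ : Fin (n + 1) → ℕ} (σ : Shuffle u₁ u₂ v) (Δ₁ : FeynmanGraph m u₁)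
        (Δ₂ : FeynmanGraph 0 u₂) (_ : Δ₁.NoVacuum) (i : Fin (n + 1)),
        Set.range (fun j => (σ i).1 (.inl j)) =
          {j | (Sum.inr ⟨i, j⟩ : Vertex m v) ∉ (FeynmanGraph.glue σ Δ₁ Δ₂).vacuumSet} ∧
        Set.range (fun j => (σ i).1 (.inr j)) =
          {j | (Sum.inr ⟨i, j⟩ : Vertex m v) ∈ (FeynmanGraph.glue σ Δ₁ Δ₂).vacuumSet} := by
      intro u₁ u₂ σ Δ₁ Δ₂ hΔ i
      have hl : ∀ j, (Sum.inr ⟨i, (σ i).1 (.inl j)⟩ : Vertex m v) ∉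
          (FeynmanGraph.glue σ Δ₁ Δ₂).vacuumSet := fun j h => by
        simpa using (FeynmanGraph.vertexSum_mem_vacuumSet_glue σ Δ₁ Δ₂ hΔ (.inl (.inr ⟨i, j⟩))).1 h
      have hr : ∀ j, (Sum.inr ⟨i, (σ i).1 (.inr j)⟩ : Vertex m v) ∈
          (FeynmanGraph.glue σ Δ₁ Δ₂).vacuumSet := fun j =>
        (FeynmanGraph.vertexSum_mem_vacuumSet_glue σ Δ₁ Δ₂ hΔ (.inr (.inr ⟨i, j⟩))).2 rfl
      constructor <;> ext j <;> obtain ⟨x | x, rfl⟩ := (σ i).1.surjective j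
      · simpa using hl x
      · simpa using hr x
      · simpa using hl x
      · simpa using hr x
    have hL : ∀ i, Set.range (fun j => (s i).1 (.inl j)) = Set.range fun j => (s' i).1 (.inl j) :=
      fun i => by rw [(hr s Γ₁ Γ₂ h₁ i).1, (hr s' Γ₁' Γ₂' h₁' i).1, he]
    have hR : ∀ i, Set.range (fun j => (s i).1 (.inr j)) = Set.range fun j => (s' i).1 (.inr j) :=
      fun i => by rw [(hr s Γ₁ Γ₂ h₁ i).2, (hr s' Γ₁' Γ₂' h₁' i).2, he]
    have hcard : ∀ {a b c : ℕ} (f : Fin a → Fin c) (g : Fin b → Fin c), StrictMono f →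
        StrictMono g → Set.range f = Set.range g → a = b := fun {a b c} f g hf hg hfg => by
      have h1 := Set.card_range_of_injective hf.injective
      have h2 := Set.card_range_of_injective hg.injective
      simp only [Fintype.card_fin] at h1 h2
      rw [← h1, ← h2]
      exact Fintype.card_congr (Equiv.setCongr hfg)
    obtain rfl : v₁ = v₁' := funext fun i => hcard _ _ (s i).2.1 (s' i).2.1 (hL i)
    obtain rfl : v₂ = v₂' := funext fun i => hcard _ _ (s i).2.2 (s' i).2.2 (hR i)
    obtain rfl : s = s' := by
      refine funext fun i => Subtype.ext (Equiv.ext fun x => ?_)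
      rcases x with x | x
      · exact congrFun (((s i).2.1.range_inj (s' i).2.1).1 (hL i)) x
      · exact congrFun (((s i).2.2.range_inj (s' i).2.2).1 (hR i)) x
    have hm := congrArg FeynmanGraph.mult he
    obtain rfl : Γ₁ = Γ₁' := FeynmanGraph.ext (funext fun x => funext fun y => by
      have := congrFun (congrFun hm (vertexSum m s.equiv (.inl x))) (vertexSum m s.equiv (.inl y))
      simpa [FeynmanGraph.glue] using this)
    obtain rfl : Γ₂ = Γ₂' := FeynmanGraph.ext (funext fun x => funext fun y => by
      have := congrFun (congrFun hm (vertexSum m s.equiv (.inr x))) (vertexSum m s.equiv (.inr y))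
      simpa [FeynmanGraph.glue] using this)
    rfl
  · intro Γ
    obtain ⟨v₁, v₂, hv, s, Γ₁, Γ₂, h₁, h⟩ := Γ.exists_glue_eq
    exact ⟨⟨⟨(v₁, v₂), hv⟩, s, ⟨Γ₁, h₁⟩, Γ₂⟩, h⟩

end Splitting

/-! ### Factorization of the vacuum contributions -/

section Factorization

variable (ω : DispersionFunction) (hI : AdmissibleInteraction) {m n : ℕ} {v : Fin (n + 1) → ℕ}

lemma hasFiniteSupport_contribution (α : Fin m → FieldPart) (s : Fin m → ℝ) (t : Fin n → ℝ)
    (Φ : Args m v → ℂ) : (fun Γ : FeynmanGraph m v => Γ.contribution ω hI α s t Φ).HasFiniteSupport :=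
  (finite_contribution_ne_zero ω hI m v α).subset fun _ h => ⟨_, _, _, h⟩

/-- The pairs of block sizes with sum `v`. -/
def blockPairs (v : Fin (n + 1) → ℕ) : Finset ((Fin (n + 1) → ℕ) × (Fin (n + 1) → ℕ)) :=
  (Finset.Iic v ×ˢ Finset.Iic v).filter fun q => q.1 + q.2 = v

lemma mem_blockPairs {q : (Fin (n + 1) → ℕ) × (Fin (n + 1) → ℕ)} :
    q ∈ blockPairs v ↔ q.1 + q.2 = v := by
  simp only [blockPairs, Finset.mem_filter, Finset.mem_product, Finset.mem_Iic,
    and_iff_right_iff_imp]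
  rintro rfl
  exact ⟨fun i => Nat.le_add_right _ _, fun i => Nat.le_add_left _ _⟩

/-- The sum over all graphs is the sum over the pairs of a graph without vacuum components and a
graph without external vertices. -/
lemma finsum_contribution_eq_sum_blockPairs (α : Fin m → FieldPart) (s : Fin m → ℝ)
    (t : Fin n → ℝ) (f : 𝓢(Fin m → Mom, ℂ)) (lam : 𝓢(ℝ × Mom, ℂ)) :
    ∑ᶠ Γ : FeynmanGraph m v, Γ.contribution ω hI α s t (tensorTest v f lam) =
    ∑ q ∈ blockPairs v,
      (∑ᶠ Γ : {Γ : FeynmanGraph m q.1 // Γ.NoVacuum},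
        Γ.1.contribution ω hI α s t (tensorTest q.1 f lam)) *
      ∑ᶠ Γ : FeynmanGraph 0 q.2, Γ.contribution ω hI Fin.elim0 Fin.elim0 t
        (tensorTest q.2 (fun _ => 1) lam) := by
  have hfin := hasFiniteSupport_contribution ω hI (v := v) α s t (tensorTest v f lam)
  have hfin₁ : ∀ v₁ : Fin (n + 1) → ℕ, (fun Γ : {Γ : FeynmanGraph m v₁ // Γ.NoVacuum} =>
      Γ.1.contribution ω hI α s t (tensorTest v₁ f lam)).HasFiniteSupport := fun v₁ =>
    (hasFiniteSupport_contribution ω hI α s t _).preimage Subtype.val_injective.injOn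
  have hfin₂ : ∀ v₂ : Fin (n + 1) → ℕ, (fun Γ : FeynmanGraph 0 v₂ =>
      Γ.contribution ω hI Fin.elim0 Fin.elim0 t (tensorTest v₂ (fun _ => 1) lam)).HasFiniteSupport :=
    fun v₂ => hasFiniteSupport_contribution ω hI _ _ t _
  rw [← tsum_eq_finsum (L := .unconditional _) hfin]
  -- the sum is reorganized along the unique splitting of the graphs
  let e := Equiv.ofBijective _ (bijective_glue (m := m) (v := v))
  have hsum : Summable fun q : VacuumSplitting m v =>
      (e q).contribution ω hI α s t (tensorTest v f lam) := e.summable_iff.2 (summable_of_hasFiniteSupport hfin)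
  rw [← e.tsum_eq, Summable.tsum_sigma hsum]
  let _ : Fintype {q : (Fin (n + 1) → ℕ) × (Fin (n + 1) → ℕ) // q.1 + q.2 = v} :=
    Fintype.subtype (blockPairs v) fun q => mem_blockPairs
  rw [tsum_fintype, Finset.sum_subtype (blockPairs v) (fun q => mem_blockPairs)]
  refine Finset.sum_congr rfl fun q _ => ?_
  obtain ⟨⟨v₁, v₂⟩, hv⟩ := q
  have hq := hsum.sigma_factor ⟨(v₁, v₂), hv⟩
  rw [hq.tsum_prod, tsum_fintype, ← Summable.tsum_finsetSum fun σ _ => hq.prod_factor σ]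
  rw [← tsum_eq_finsum (L := .unconditional _) (hfin₁ v₁),
    ← tsum_eq_finsum (L := .unconditional _) (hfin₂ v₂),
    tsum_mul_tsum_of_summable_norm (summable_of_hasFiniteSupport (hfin₁ v₁)).norm
      (summable_of_hasFiniteSupport (hfin₂ v₂)).norm]
  refine tsum_congr fun Γ => ?_
  rw [contribution_mul_eq_sum ω hI hv]
  refine Finset.sum_congr rfl fun σ _ => ?_
  obtain ⟨Φ, hΦ⟩ := exists_schwartz_tensorTest v f lam
  rw [← hΦ, FeynmanGraph.contribution_eq_integral]
  rfl

/-- Products of series over block sizes. -/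
lemma blockSeries_mul (a b : (Fin (n + 1) → ℕ) → ℂ) : blockSeries n a * blockSeries n b =
    blockSeries n fun v => ∑ q ∈ blockPairs v, a q.1 * b q.2 := by
  ext V
  unfold blockSeries
  simp only [PowerSeries.coeff_mul, PowerSeries.coeff_mk, Finset.sum_mul_sum]
  simp only [← Finset.sum_product']
  rw [Finset.sum_sigma', Finset.sum_sigma']
  refine Finset.sum_bij' (fun x _ => ⟨x.2.1 + x.2.2, x.2⟩)
    (fun x _ => ⟨(∑ i, x.2.1 i, ∑ i, x.2.2 i), x.2⟩) ?_ ?_ ?_ ?_ ?_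
  · rintro ⟨⟨A, B⟩, v₁, v₂⟩ h
    simp only [Finset.mem_sigma, Finset.mem_product, Finset.HasAntidiagonal.mem_antidiagonal,
      Finset.Nat.mem_antidiagonalTuple, mem_blockPairs] at h ⊢
    obtain ⟨rfl, rfl, rfl⟩ := h
    exact ⟨by simp [Finset.sum_add_distrib], trivial⟩
  · rintro ⟨v, v₁, v₂⟩ h
    simp only [Finset.mem_sigma, Finset.mem_product, Finset.HasAntidiagonal.mem_antidiagonal,
      Finset.Nat.mem_antidiagonalTuple, mem_blockPairs] at h ⊢
    obtain ⟨rfl, rfl⟩ := h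
    exact ⟨by simp [Finset.sum_add_distrib], trivial, trivial⟩
  · rintro ⟨⟨A, B⟩, v₁, v₂⟩ h
    simp only [Finset.mem_sigma, Finset.mem_product, Finset.HasAntidiagonal.mem_antidiagonal,
      Finset.Nat.mem_antidiagonalTuple] at h ⊢
    obtain ⟨rfl, rfl, rfl⟩ := h
    rfl
  · rintro ⟨v, v₁, v₂⟩ h
    simp only [Finset.mem_sigma, mem_blockPairs] at h ⊢
    obtain ⟨_, rfl⟩ := h
    rfl
  · intro x _
    rfl

lemma coefficient_eq_feynmanSum (α : Fin n → FieldPart) (Φ : 𝓢(Args n v, ℂ)) (t : Fin n → ℝ) :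
    coefficient ω hI α v Φ t = feynmanSum ω hI α v Φ t := by
  rw [← partialCoefficient_self]
  exact partialCoefficient_eq_finsum ω hI le_rfl α t Φ t

/-- Vacuum contributions factor out of the coefficients, block by block. -/
lemma coefficient_tensorTest (α : Fin n → FieldPart) (f : 𝓢(Fin n → Mom, ℂ))
    (lam : 𝓢(ℝ × Mom, ℂ)) (t : Fin n → ℝ) :
    coefficient ω hI α v (tensorTest v f lam) t = ∑ q ∈ blockPairs v,
      feynmanSumNoVacuum ω hI α q.1 (tensorTest q.1 f lam) t *
        feynmanSumVacuum ω hI q.2 (tensorTest q.2 (fun _ => 1) lam) t := by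
  obtain ⟨Φ, hΦ⟩ := exists_schwartz_tensorTest v f lam
  rw [← hΦ, coefficient_eq_feynmanSum, hΦ]
  exact finsum_contribution_eq_sum_blockPairs ω hI α t t f lam

/-- The vacuum expectation value of the scattering operator is the sum over vacuum graphs, with an
arbitrary subdivision `t` of the time axis. -/
lemma scatteringVac_eq_feynmanSumVacuum (lam : 𝓢(ℝ × Mom, ℂ)) (t : Fin n → ℝ) :
    scatteringVac ω hI lam =
      blockSeries n fun v => feynmanSumVacuum ω hI v (tensorTest v (fun _ => 1) lam) t := by
  rw [scatteringVac_eq_blockSeries ω hI lam t]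
  congr 1
  ext1 v
  obtain ⟨Φ, hΦ⟩ := exists_schwartz_tensorTest v schwartzOne lam
  have hone : tensorTest v (fun _ => 1) lam = tensorTest v schwartzOne lam := rfl
  rw [hone, ← hΦ]
  exact partialCoefficient_eq_finsum ω hI (Nat.zero_le n) Fin.elim0 Fin.elim0 Φ t

lemma IsParamDistribution.congr {D : Type} [NormedAddCommGroup D] [NormedSpace ℝ D]
    {A B : (D → ℂ) → (Fin n → ℝ) → ℂ} (hA : IsParamDistribution A)
    (h : ∀ (Φ : 𝓢(D, ℂ)) t, B Φ t = A Φ t) : IsParamDistribution B := by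
  refine ⟨fun t => ?_, fun Φ => ?_⟩
  · obtain ⟨T, hT⟩ := hA.1 t
    exact ⟨T, fun Φ => (hT Φ).trans (h Φ t).symm⟩
  · have : B Φ = A Φ := funext fun t => h Φ t
    rw [this]
    exact hA.2 Φ

lemma isParamDistribution_finsum_all (α : Fin m → FieldPart) {s : (Fin n → ℝ) → Fin m → ℝ}
    (hs : s.HasTemperateGrowth) : IsParamDistribution fun (Φ : Args m v → ℂ) (t : Fin n → ℝ) =>
      ∑ᶠ Γ : FeynmanGraph m v, Γ.contribution ω hI α (s t) t Φ :=
  (isParamDistribution_finsum ω hI α hs fun _ => True).congr fun Φ t =>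
    (finsum_comp_equiv (Equiv.subtypeUnivEquiv fun _ => trivial)
      (f := fun Γ : FeynmanGraph m v => Γ.contribution ω hI α (s t) t Φ)).symm

lemma isParamDistribution_coefficient (α : Fin n → FieldPart) (v : Fin (n + 1) → ℕ) :
    IsParamDistribution (coefficient ω hI α v) :=
  (isParamDistribution_finsum_all ω hI α (s := fun t => t) (by fun_prop)).congr fun Φ t =>
    coefficient_eq_feynmanSum ω hI α Φ t

lemma isParamDistribution_feynmanSumVacuum (v : Fin (n + 1) → ℕ) :
    IsParamDistribution (feynmanSumVacuum ω hI v) :=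
  isParamDistribution_finsum_all ω hI Fin.elim0 (s := fun _ => Fin.elim0) (by fun_prop)

lemma isParamDistribution_feynmanSumNoVacuum (α : Fin n → FieldPart) (v : Fin (n + 1) → ℕ) :
    IsParamDistribution (feynmanSumNoVacuum ω hI α v) :=
  isParamDistribution_finsum ω hI α (s := fun t => t) (by fun_prop) FeynmanGraph.NoVacuum

lemma blockSeries_noVacuum_mul (α : Fin n → FieldPart) (lam : 𝓢(ℝ × Mom, ℂ))
    (f : 𝓢(Fin n → Mom, ℂ)) (t : Fin n → ℝ) :
    (blockSeries n fun v => feynmanSumNoVacuum ω hI α v (tensorTest v f lam) t) *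
        (blockSeries n fun v => feynmanSumVacuum ω hI v (tensorTest v (fun _ => 1) lam) t) =
      blockSeries n fun v => coefficient ω hI α v (tensorTest v f lam) t := by
  rw [blockSeries_mul]
  congr 1
  ext1 v
  exact (coefficient_tensorTest ω hI α f lam t).symm

/-- The normalization has constant term `1`, hence is invertible as a formal power series, and
cancels against the factor of the vacuum graphs. -/
lemma wightman_eq_blockSeries (α : Fin n → FieldPart) (lam : 𝓢(ℝ × Mom, ℂ))
    (f : 𝓢(Fin n → Mom, ℂ)) (t : Fin n → ℝ) : wightman ω hI lam α f t =
      blockSeries n fun v => feynmanSumNoVacuum ω hI α v (tensorTest v f lam) t := by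
  rw [wightman, wightmanUnnorm_eq_blockSeries, ← blockSeries_noVacuum_mul,
    ← scatteringVac_eq_feynmanSumVacuum, mul_assoc, PowerSeries.mul_inv_cancel, mul_one]
  rw [constantCoeff_scatteringVac]
  exact one_ne_zero

end Factorization

end HpQFT

end

open HpQFT in
theorem proposition4 (ω : DispersionFunction) (hI : AdmissibleInteraction) (n : ℕ)
    (α : Fin n → FieldPart) :
    -- Feynman rules for the coefficient distributions
    (∀ v : Fin (n + 1) → ℕ,
      {Γ : FeynmanGraph n v | ∃ Φ t, Γ.contribution ω hI α t t Φ ≠ 0}.Finite ∧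
      (∀ (Γ : FeynmanGraph n v) (Φ : 𝓢(Args n v, ℂ)) (t : Fin n → ℝ),
        MeasureTheory.Integrable (Γ.integrand ω hI α t t Φ)) ∧
      IsParamDistribution (coefficient ω hI α v) ∧
      (∀ (Φ : 𝓢(Args n v, ℂ)) (t : Fin n → ℝ),
        coefficient ω hI α v Φ t = feynmanSum ω hI α v Φ t)) ∧
    -- they give the coefficients of the unnormalized Wightman functions
    (∀ (lam : 𝓢(ℝ × Mom, ℂ)) (f : 𝓢(Fin n → Mom, ℂ)) (t : Fin n → ℝ),
      wightmanUnnorm ω hI lam α f t =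
        blockSeries n fun v => coefficient ω hI α v (tensorTest v f lam) t) ∧
    -- the vacuum expectation value of the scattering operator
    (∀ v : Fin (n + 1) → ℕ,
      {Γ : FeynmanGraph 0 v | ∃ Φ, ∃ t : Fin n → ℝ,
        Γ.contribution ω hI Fin.elim0 Fin.elim0 t Φ ≠ 0}.Finite ∧
      (∀ (Γ : FeynmanGraph 0 v) (Φ : 𝓢(Args 0 v, ℂ)) (t : Fin n → ℝ),
        MeasureTheory.Integrable (Γ.integrand ω hI Fin.elim0 Fin.elim0 t Φ)) ∧
      IsParamDistribution (feynmanSumVacuum ω hI v)) ∧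
    (∀ (lam : 𝓢(ℝ × Mom, ℂ)) (t : Fin n → ℝ),
      scatteringVac ω hI lam =
        blockSeries n fun v => feynmanSumVacuum ω hI v (tensorTest v (fun _ => 1) lam) t) ∧
    (∀ lam : 𝓢(ℝ × Mom, ℂ), PowerSeries.constantCoeff (scatteringVac ω hI lam) = 1) ∧
    -- dropping the graphs with vacuum components
    (∀ v : Fin (n + 1) → ℕ, IsParamDistribution (feynmanSumNoVacuum ω hI α v)) ∧
    (∀ (lam : 𝓢(ℝ × Mom, ℂ)) (f : 𝓢(Fin n → Mom, ℂ)) (t : Fin n → ℝ),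
      (blockSeries n fun v => feynmanSumNoVacuum ω hI α v (tensorTest v f lam) t) *
          (blockSeries n fun v => feynmanSumVacuum ω hI v (tensorTest v (fun _ => 1) lam) t) =
        blockSeries n fun v => coefficient ω hI α v (tensorTest v f lam) t) ∧
    (∀ (lam : 𝓢(ℝ × Mom, ℂ)) (f : 𝓢(Fin n → Mom, ℂ)) (t : Fin n → ℝ),
      wightman ω hI lam α f t =
        blockSeries n fun v => feynmanSumNoVacuum ω hI α v (tensorTest v f lam) t) :=
  ⟨fun v => ⟨(finite_contribution_ne_zero ω hI n v α).subset fun _ ⟨Φ, t, h⟩ => ⟨t, t, Φ, h⟩,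
      fun Γ Φ t => Γ.integrable_integrand ω hI α t t Φ, isParamDistribution_coefficient ω hI α v,
      coefficient_eq_feynmanSum ω hI α⟩,
    fun lam f t => wightmanUnnorm_eq_blockSeries ω hI lam α f t,
    fun v => ⟨(finite_contribution_ne_zero ω hI 0 v Fin.elim0).subset
        fun _ ⟨Φ, t, h⟩ => ⟨Fin.elim0, t, Φ, h⟩,
      fun Γ Φ t => Γ.integrable_integrand ω hI Fin.elim0 Fin.elim0 t Φ,
      isParamDistribution_feynmanSumVacuum ω hI v⟩,
    scatteringVac_eq_feynmanSumVacuum ω hI,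
    constantCoeff_scatteringVac ω hI,
    isParamDistribution_feynmanSumNoVacuum ω hI α,
    blockSeries_noVacuum_mul ω hI α,
    wightman_eq_blockSeries ω hI α⟩
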